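/- Let $\Omega$ be one of $\mathbb C$, $\mathbb S^2=\mathbb C\cup\{\infty\}$, $\mathbb D=\{|z|<1\}$, with Lebesgue measure $m$ on $\mathbb C$, and let $G$ be the corresponding group of isometries: $z\mapsto \lambda z+\beta$ with $|\lambda|=1$ for $\mathbb C$; $z\mapsto \frac{az+b}{-\bar b z+\bar a}$ with $|a|^2+|b|^2=1$ for $\mathbb S^2$; $z\mapsto \frac{az+b}{\bar b z+\bar a}$ with $|a|^2-|b|^2=1$ for $\mathbb D$. A point process on $\Omega$ is a random integer-valued Radon measure $\mathcal X$; it is determinantal with kernel $\mathbb K$ with respect to $\mu$ if it is almost surely simple and its correlation functions with respect to $\mu$ are $\rho_n(x_1,\dots,x_n)=\det(\mathbb K(x_i,x_j))_{i,j\le n}$. It is invariant if $g(\mathcal X)$ has the same law as $\mathcal X$ for every $g\in G$. Consider the following families. * Det-$\mathbb C$-$\alpha$, $\alpha\in(0,\infty)$: $d\mu_\alpha(z)=e^{-\alpha|z|^2}dm(z)$, kernel $\mathbb K_\alpha(z,w)=\frac{\alpha}{\pi}e^{\alpha z\bar w}$, $\phi_{\alpha,k}(z)=\sqrt{\frac{\alpha}{\pi}\frac{\alpha^k}{k!}}\,z^k$,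 $k\ge 0$. * Det-$\mathbb S^2$-$\alpha$, $\alpha\in\{1,2,3,\dots\}$: $d\mu_\alpha(z)=\frac{dm(z)}{(1+|z|^2)^{\alpha+1}}$, kernel $\mathbb K_\alpha(z,w)=\frac{\alpha}{\pi}(1+z\bar w)^{\alpha-1}$, $\phi_{\alpha,k}(z)=\sqrt{\frac{\alpha}{\pi}\binom{\alpha-1}{k}}\,z^k$, $0\le k\le\alpha-1$. * Det-$\mathbb D$-$\alpha$, $\alpha\in(0,\infty)$: $d\mu_\alpha(z)=(1-|z|^2)^{\alpha-1}dm(z)$, kernel $\mathbb K_\alpha(z,w)=\frac{\alpha}{\pi}(1-z\bar w)^{-(\alpha+1)}$, $\phi_{\alpha,k}(z)=\sqrt{\frac{\alpha}{\pi}\frac{(\alpha+1)(\alpha+2)\cdots(\alpha+k)}{k!}}\,z^k$, $k\ge 0$. **Theorem.** (a) In each family the $\phi_{\alpha,k}$ are orthonormal in $L^2(\mu_\alpha)$, $\mathbb K_\alpha(z,w)=\sum_k\phi_{\alpha,k}(z)\overline{\phi_{\alpha,k}(w)}$, and every analytic function in $L^2(\mu_\alpha)$ that is orthogonal to all the $\phi_{\alpha,k}$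 vanishes; so $\mathbb K_\alpha$ is the projection kernel of the space of analytic functions in $L^2(\mu_\alpha)$. (On the sphere "analytic" means analytic on $\mathbb C=\mathbb S^2\setminus\{\infty\}$.) (b) Let $\mu$ be a Radon measure on $\Omega$ that is invariant under the rotations $z\mapsto uz$, $|u|=1$. Let $(\phi_k)_{k=1}^N$, $1\le N\le\infty$, be functions on $\Omega$ that are orthonormal in $L^2(\mu)$ and analytic on $\Omega$ (on $\Omega\setminus\{\infty\}$ with an arbitrary value at $\infty$ if $\Omega=\mathbb S^2$), with $\sum_k|\phi_k(z)|^2<\infty$ for every $z\in\Omega$, and put $\mathbb K(z,w)=\sum_{k=1}^N\phi_k(z)\overline{\phi_k(w)}$. Let $\mathcal X$ be a determinantal process on $\Omega$ with kernel $\mathbb K$ with respect to $\mu$. Then $\mathcal X$ is invariant if and only if, for some admissible $\alpha$, $\mathcal X$ is the process Det-$\Omega$-$\alpha$, i.e. determinantal with kernel $\mathbb K_\alpha$ with respect to $\mu_\alpha$. Moreover, whenever $\mathcal X$ is Det-$\Omega$-$\alpha$, one has $N=\infty$ for $\Omega=\mathbb C,\mathbb D$ and $N=\alpha$ for $\Omega=\mathbb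 S^2$, and there is a constant $c>0$ with $\mathbb K=c\,\mathbb K_\alpha$ and $\mu=c^{-1}\mu_\alpha$ (on $\mathbb C=\mathbb S^2\setminus\{\infty\}$ if $\Omega=\mathbb S^2$). -/

import Mathlib

open MeasureTheory
open scoped ENNReal NNReal ComplexConjugate

/-! ## Point processes, correlation functions, determinantal processes -/

section PointProcess

variable {S Ω ι : Type*} [MeasurableSpace S] [MeasurableSpace Ω]

/-- A point process on `Ω`: a random Borel measure which is almost surely integer-valued
(values in `{0, 1, 2, …, ∞}`) and finite on compact sets. -/
structure IsPointProcess [TopologicalSpace Ω] (P : Measure S) (X : S → Measure Ω) : Prop where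
  measurable : Measurable X
  integer_valued : ∀ᵐ ω ∂P, ∀ B : Set Ω, MeasurableSet B → ∃ n : ℕ∞, X ω B = (n : ℝ≥0∞)
  radon : ∀ᵐ ω ∂P, IsFiniteMeasureOnCompacts (X ω)

/-- A simple point process: almost surely there are no coincident points. -/
def IsSimple (P : Measure S) (X : S → Measure Ω) : Prop :=
  ∀ᵐ ω ∂P, ∀ x : Ω, X ω {x} ≤ 1

/-- The falling factorial `x (x - 1) ⋯ (x - n + 1)` (that is, `n! * (x choose n)`), for
`x ∈ {0, 1, 2, …, ∞}`. The subtraction of `ℝ≥0∞` is truncated, which is harmless: if `x < n` is a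
natural number then one of the factors is `x - x = 0`. -/
noncomputable def fallingFactorial (x : ℝ≥0∞) (n : ℕ) : ℝ≥0∞ :=
  ∏ j ∈ Finset.range n, (x - (j : ℝ≥0∞))

/-- `ρ n`, `n ≥ 1`, are the correlation functions (joint intensities) of `X` with respect to `μ`:
for pairwise disjoint Borel sets `D 0, …, D (m - 1)` and natural numbers `n 0, …, n (m - 1)`,
`E [∏ i, (X (D i) choose n i) * (n i)!]` is the integral of `ρ (∑ i, n i)` over
`∏ i, (D i) ^ (n i)`. -/
def HasCorrelationFunctions (P : Measure S) (X : S → Measure Ω) (μ : Measure Ω)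
    (ρ : (n : ℕ) → (Fin n → Ω) → ℝ≥0) : Prop :=
  ∀ (m : ℕ) (D : Fin m → Set Ω) (n : Fin m → ℕ),
    (∀ i, MeasurableSet (D i)) → Pairwise (fun i j => Disjoint (D i) (D j)) →
    1 ≤ ∑ i, n i →
    ∫⁻ ω, ∏ i, fallingFactorial (X ω (D i)) (n i) ∂P =
      ∫⁻ x in {x : Fin (∑ i, n i) → Ω |
          ∀ (i : Fin m) (j : Fin (n i)), x (finSigmaFinEquiv ⟨i, j⟩) ∈ D i},
        (ρ (∑ i, n i) x : ℝ≥0∞) ∂(Measure.pi fun _ => μ)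

/-- `X` is a determinantal process with kernel `K` with respect to `μ`: a simple point process
whose correlation functions with respect to `μ` are `det (K (x i) (x j))`. -/
structure IsDeterminantal [TopologicalSpace Ω] (P : Measure S) (X : S → Measure Ω)
    (μ : Measure Ω) (K : Ω → Ω → ℂ) : Prop where
  pointProcess : IsPointProcess P X
  simple : IsSimple P X
  correlation : ∃ ρ : (n : ℕ) → (Fin n → Ω) → ℝ≥0, HasCorrelationFunctions P X μ ρ ∧
    ∀ (n : ℕ) (x : Fin n → Ω),
      (((ρ n x : ℝ≥0) : ℝ) : ℂ) = (Matrix.of fun i j => K (x i) (x j)).det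

/-- The distribution of `X` is invariant under the transformations in `G`: moving every point of
the process by `g ∈ G` does not change its law. -/
def IsInvariantInLaw (P : Measure S) (X : S → Measure Ω) (G : Set (Ω → Ω)) : Prop :=
  ∀ g ∈ G, P.map (fun ω => (X ω).map g) = P.map X

/-- The functions `φ k` belong to `L²(μ)` and are orthonormal there. -/
structure IsOrthonormalL2 (μ : Measure Ω) (φ : ι → Ω → ℂ) : Prop where
  memLp : ∀ k, MemLp (φ k) 2 μ
  norm_one : ∀ k, ∫ z, φ k z * conj (φ k z) ∂μ = 1
  orthogonal : ∀ j k, j ≠ k → ∫ z, φ j z * conj (φ k z) ∂μ = 0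

/-- The kernel `∑ k, φ k z * conj (φ k w)`. -/
noncomputable def seriesKernel (φ : ι → Ω → ℂ) (z w : Ω) : ℂ :=
  ∑' k, φ k z * conj (φ k w)

end PointProcess

/-! ## The plane -/

/-- The maps `z ↦ λ z + β` with `|λ| = 1`. -/
def planeIsometries : Set (ℂ → ℂ) :=
  {g | ∃ a b : ℂ, ‖a‖ = 1 ∧ g = fun z => a * z + b}

/-- The measure `e^{-α|z|²} dm(z)` on `ℂ`, `m` being Lebesgue measure. -/
noncomputable def planeMeasure (α : ℝ) : Measure ℂ :=
  volume.withDensity fun z => ENNReal.ofReal (Real.exp (-α * ‖z‖ ^ 2))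

/-- The kernel `(α/π) e^{α z w̄}`. -/
noncomputable def planeKernel (α : ℝ) (z w : ℂ) : ℂ :=
  ((α / Real.pi : ℝ) : ℂ) * Complex.exp (α * (z * conj w))

/-- The functions `√(α/π) √(α^k/k!) z^k`. -/
noncomputable def planeBasis (α : ℝ) (k : ℕ) (z : ℂ) : ℂ :=
  (Real.sqrt (α / Real.pi * (α ^ k / k.factorial)) : ℂ) * z ^ k

/-! ## The sphere, as the one-point compactification `ℂ ∪ {∞}` -/

/-- The sphere `ℂ ∪ {∞}`. -/
abbrev Sphere2 : Type := OnePoint ℂ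

noncomputable instance instMeasurableSpaceSphere2 : MeasurableSpace (OnePoint ℂ) := borel (OnePoint ℂ)

noncomputable instance instBorelSpaceSphere2 : BorelSpace (OnePoint ℂ) := ⟨rfl⟩

open Classical in
/-- The linear fractional map `z ↦ (a z + b) / (-b̄ z + ā)` of `ℂ ∪ {∞}`. -/
noncomputable def sphereMap (a b : ℂ) (z : Sphere2) : Sphere2 :=
  OnePoint.elim z
    (if b = 0 then OnePoint.infty else ((a / (-conj b) : ℂ) : Sphere2))
    (fun z : ℂ =>
      if -conj b * z + conj a = 0 then OnePoint.infty
      else (((a * z + b) / (-conj b * z + conj a) : ℂ) : Sphere2))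

/-- The rotations of the sphere: the maps `sphereMap a b` with `|a|² + |b|² = 1`. -/
def sphereIsometries : Set (Sphere2 → Sphere2) :=
  {g | ∃ a b : ℂ, ‖a‖ ^ 2 + ‖b‖ ^ 2 = 1 ∧ g = sphereMap a b}

/-- The measure `dm(z) / (1 + |z|²)^{α+1}` on the sphere (without mass at `∞`). -/
noncomputable def sphereMeasure (α : ℕ) : Measure Sphere2 :=
  ((volume : Measure ℂ).withDensity
    fun z => ENNReal.ofReal (1 / (1 + ‖z‖ ^ 2) ^ (α + 1))).map (fun z : ℂ => (z : Sphere2))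

/-- The kernel `(α/π) (1 + z w̄)^{α-1}`, for `α ≥ 1`; it is set to `0` if `z` or `w` is `∞`, a point
to which `sphereMeasure α` gives no mass. -/
noncomputable def sphereKernel (α : ℕ) (z w : Sphere2) : ℂ :=
  OnePoint.elim z 0 fun z : ℂ => OnePoint.elim w 0 fun w : ℂ =>
    ((α / Real.pi : ℝ) : ℂ) * (1 + z * conj w) ^ (α - 1)

/-- The functions `√(α/π) √((α-1) choose k) z^k`, `k = 0, …, α - 1` (set to `0` at `∞`). -/
noncomputable def sphereBasis (α : ℕ) (k : Fin α) (z : Sphere2) : ℂ :=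
  OnePoint.elim z 0 fun z : ℂ =>
    (Real.sqrt (α / Real.pi * ((α - 1).choose k : ℝ)) : ℂ) * z ^ (k : ℕ)

/-! ## The hyperbolic disk -/

/-- The open unit disk. -/
abbrev Disk : Type := Metric.ball (0 : ℂ) 1

theorem diskMap_mem {a b : ℂ} (h : ‖a‖ ^ 2 - ‖b‖ ^ 2 = 1) (z : Disk) :
    (a * z + b) / (conj b * z + conj a) ∈ Metric.ball (0 : ℂ) 1 := by
  have hz : ‖(z : ℂ)‖ < 1 := mem_ball_zero_iff.1 z.2
  have hz2 : ‖(z : ℂ)‖ ^ 2 < 1 := by nlinarith [norm_nonneg (z : ℂ)]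
  have key : ‖conj b * (z : ℂ) + conj a‖ ^ 2 - ‖a * (z : ℂ) + b‖ ^ 2 =
      (‖a‖ ^ 2 - ‖b‖ ^ 2) * (1 - ‖(z : ℂ)‖ ^ 2) := by
    simp only [← Complex.normSq_eq_norm_sq, Complex.normSq_apply, Complex.add_re, Complex.add_im,
      Complex.mul_re, Complex.mul_im, Complex.conj_re, Complex.conj_im]
    ring
  rw [h, one_mul] at key
  have hlt : ‖a * (z : ℂ) + b‖ < ‖conj b * (z : ℂ) + conj a‖ :=
    lt_of_pow_lt_pow_left₀ 2 (norm_nonneg _) (by linarith)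
  rw [mem_ball_zero_iff, norm_div, div_lt_one (lt_of_le_of_lt (norm_nonneg _) hlt)]
  exact hlt

/-- The linear fractional map `z ↦ (a z + b) / (b̄ z + ā)` of the unit disk, `|a|² - |b|² = 1`. -/
noncomputable def diskMap (a b : ℂ) (h : ‖a‖ ^ 2 - ‖b‖ ^ 2 = 1) (z : Disk) : Disk :=
  ⟨(a * z + b) / (conj b * z + conj a), diskMap_mem h z⟩

/-- The isometries of the hyperbolic disk. -/
def diskIsometries : Set (Disk → Disk) :=
  {g | ∃ (a b : ℂ) (h : ‖a‖ ^ 2 - ‖b‖ ^ 2 = 1), g = diskMap a b h}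

/-- The rotation `z ↦ u z` of the disk, `|u| = 1`. -/
noncomputable def diskRotation (u : Circle) (z : Disk) : Disk :=
  ⟨u * z, by
    have hz : ‖(z : ℂ)‖ < 1 := mem_ball_zero_iff.1 z.2
    rw [mem_ball_zero_iff, norm_mul, Circle.norm_coe, one_mul]
    exact hz⟩

/-- The measure `(1 - |z|²)^{α-1} dm(z)` on the disk. -/
noncomputable def diskMeasure (α : ℝ) : Measure Disk :=
  ((volume : Measure ℂ).comap (Subtype.val : Disk → ℂ)).withDensity
    fun z => ENNReal.ofReal ((1 - ‖(z : ℂ)‖ ^ 2) ^ (α - 1))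

/-- The kernel `(α/π) (1 - z w̄)^{-(α+1)}`; the power is the principal branch, and `1 - z w̄` has
positive real part. -/
noncomputable def diskKernel (α : ℝ) (z w : Disk) : ℂ :=
  ((α / Real.pi : ℝ) : ℂ) * (1 - (z : ℂ) * conj (w : ℂ)) ^ (-((α : ℂ) + 1))

/-- The functions `√(α/π) √((α+1)(α+2)⋯(α+k)/k!) z^k`. -/
noncomputable def diskBasis (α : ℝ) (k : ℕ) (z : Disk) : ℂ :=
  (Real.sqrt (α / Real.pi * ((∏ j ∈ Finset.range k, (α + 1 + j)) / k.factorial)) : ℂ) *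
    (z : ℂ) ^ k

/-! The three spaces are treated at once, as the geometry of curvature ε ∈ {0, 1, -1} on the part of
ℂ where 1 + ε|z|² > 0, with isometries `mobius ε a b` and invariant measure σ = dm / (1 + ε|z|²)²
(`geomMeasure`).

Invariance gives a model. If X is invariant, so are its one- and two-point intensities. A rotation
and translation invariant measure is unique up to a factor (`eq_smul_geomMeasure`), so K(z,z) dμ = C
σ. Since μ and K(z,z) dμ are both rotation invariant, so is K(z,z), and Fourier analysis on circles
yields K(z,w) = ∑ Aₙ (z w̄)ⁿ with Aₙ ≥ 0 (`exists_radial_expansion`). The ratio |K(z,w)|² / (K(z,z)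
K(w,w)) is invariant too; moving one of two real points to 0 gives a functional equation for k(t) =
∑ Aₙ tⁿ, whose derivative in that point at the origin is A₀ (1 + εt) k' = A₁ k. Hence (n + 1) Aₙ₊₁ =
(β - εn) Aₙ with β = A₁ / A₀ (`coeff_recursion`), and up to a factor k is e^{βt}, (1 + t)^β or (1 -
t)^{-β}. It remains to find the admissible β. The function K(·,0) is the constant A₀, so the
reproducing identity reads A₀ μ(Ω) = 1 (`coeff_mul_measure_univ`). This excludes β = 0 in the plane
and β ≤ 1 in the disk, and it determines C. On the sphere Aₙ ≥ 0 forces β to be an integer. The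
parameter is α = β + ε, and C = α / π (`eq_model`).

A model gives invariance. The model kernels satisfy K(x,y) = u(x) K(gx,gy) conj u(y), and g maps
|u|² μ to μ. The determinants acquire the factor ∏ |u(xᵢ)|², so all factorial moments agree for X
and g(X) (`map_eq_of_gauge`). They determine the law, because a positive semidefinite n × n matrix
with diagonal at most M has determinant at most Mⁿ, which makes the expansion of the generating
function in factorial moments absolutely convergent (`law_eq_of_factorial_moments`).

For the last assertion, a process Det-α is invariant by the converse, hence of the form found in the
direct part for some β; the intensity (plane, disk) or the expected number of points (sphere) shows
α = β. The number of functions is the expected number of points, so it depends on the process only.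

The statements about orthonormal bases use rotations: distinct monomials are orthogonal for any
radial weight, integration by parts gives a recursion for the moments, and a Taylor coefficient of
an analytic function in L² is a multiple of its product with zᵏ when zᵏ is in L², and is zero when
zᵏ is not. -/

open scoped ComplexOrder

/-! ## The law of a point process is determined by its factorial moments -/

section Law

theorem fallingFactorial_natCast (a n : ℕ) :
    fallingFactorial (a : ℝ≥0∞) n = (a.descFactorial n : ℝ≥0∞) := by
  rw [fallingFactorial, Nat.descFactorial_eq_prod_range]
  push_cast
  simp

/-- The binomial theorem, read as a factorial moment expansion: averaged over a random `a` it
expresses the probability generating function at `1 + s` by factorial moments. -/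
theorem hasSum_descFactorial (a : ℕ) (s : ℂ) :
    HasSum (fun n : ℕ => s ^ n / n.factorial * (a.descFactorial n : ℂ)) ((1 + s) ^ a) := by
  rw [add_comm, add_pow]
  simp only [one_pow, mul_one]
  have h : ∀ n : ℕ, s ^ n / n.factorial * (a.descFactorial n : ℂ) = s ^ n * (a.choose n : ℂ) := by
    intro n
    rw [Nat.descFactorial_eq_factorial_mul_choose]
    have : (n.factorial : ℂ) ≠ 0 := by exact_mod_cast n.factorial_ne_zero
    push_cast
    field_simp
  simp only [h]
  apply hasSum_sum_of_ne_finset_zero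
  intro n hn
  have : a < n := by simpa using hn
  simp [Nat.choose_eq_zero_of_lt this]

/-- The series is written as an integral against counting measure, so that products of such series
and their expectations fall under Fubini's theorem. -/
theorem integral_count_descFactorial (a : ℕ) (s : ℂ) :
    ∫ n : ℕ, s ^ n / n.factorial * (a.descFactorial n : ℂ) ∂Measure.count = (1 + s) ^ a := by
  have hs := hasSum_descFactorial a s
  rw [integral_countable (integrable_count_iff.2 hs.summable.norm)]
  simpa using hs.tsum_eq

theorem enorm_finsetProd {ι : Type*} (s : Finset ι) (f : ι → ℂ) :
    ‖∏ j ∈ s, f j‖ₑ = ∏ j ∈ s, ‖f j‖ₑ := by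
  simp only [enorm_eq_nnnorm, nnnorm_prod, ENNReal.ofNNReal_finsetProd]

theorem enorm_natCast_complex (n : ℕ) : ‖(n : ℂ)‖ₑ = (n : ℝ≥0∞) := by
  rw [enorm_eq_nnnorm, Complex.nnnorm_natCast]
  simp

variable {S Ω : Type*} [MeasurableSpace S] [MeasurableSpace Ω]

/-- The dominating series for that application of Fubini's theorem; its sum is `∏ exp (C j)`. -/
theorem lintegral_pi_count_prod_pow {m : ℕ} (C : Fin m → ℝ≥0) :
    ∫⁻ n : Fin m → ℕ, ∏ j, (C j : ℝ≥0∞) ^ n j / ((n j).factorial : ℝ≥0∞)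
      ∂(Measure.pi fun _ => Measure.count) < ∞ := by
  have hint : Integrable (fun n : Fin m → ℕ => ∏ j, ((C j : ℝ) ^ n j / (n j).factorial))
      (Measure.pi fun _ => Measure.count) := by
    refine Integrable.fintype_prod (f := fun j (k : ℕ) => (C j : ℝ) ^ k / k.factorial) fun j => ?_
    exact integrable_count_iff.2 (Real.summable_pow_div_factorial (C j : ℝ)).norm
  have := hint.lintegral_lt_top
  refine lt_of_le_of_lt (lintegral_mono fun n => ?_) this
  rw [ENNReal.ofReal_prod_of_nonneg (fun i _ => by positivity)]
  refine Finset.prod_le_prod' fun j _ => ?_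
  rw [ENNReal.ofReal_div_of_pos (by positivity), ENNReal.ofReal_pow (by positivity)]
  simp

/-- Fubini's theorem for `P` and counting measure on `ℕ^m`. The bound `hb` dominates the terms by `∏
(‖s j‖ C)^(n j) / (n j)!`, so the expansion holds for every complex `s`, and its right side involves
`N` only through its factorial moments. -/
theorem integral_prod_one_add_pow (P : Measure S) [IsProbabilityMeasure P] {m : ℕ}
    (N : S → Fin m → ℕ) (hN : ∀ j, Measurable fun ω => N ω j) (C : ℝ≥0)
    (hb : ∀ n : Fin m → ℕ,
      ∫⁻ ω, ∏ j, ((N ω j).descFactorial (n j) : ℝ≥0∞) ∂P ≤ ∏ j, (C : ℝ≥0∞) ^ n j)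
    (s : Fin m → ℂ) :
    ∫ ω, ∏ j, (1 + s j) ^ N ω j ∂P =
      ∫ n : Fin m → ℕ, (∏ j, s j ^ n j / (n j).factorial) *
        ((∫⁻ ω, ∏ j, ((N ω j).descFactorial (n j) : ℝ≥0∞) ∂P).toReal : ℂ)
        ∂(Measure.pi fun _ => Measure.count) := by
  set F : S → (Fin m → ℕ) → ℂ := fun ω n =>
    ∏ j, (s j ^ n j / (n j).factorial * ((N ω j).descFactorial (n j) : ℂ)) with hF
  have hNm : Measurable N := measurable_pi_lambda _ hN
  have hFm : Measurable (Function.uncurry F) := by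
    have : Function.uncurry F = (fun p : (Fin m → ℕ) × (Fin m → ℕ) =>
      ∏ j, (s j ^ p.2 j / (p.2 j).factorial * ((p.1 j).descFactorial (p.2 j) : ℂ))) ∘
        (fun p : S × (Fin m → ℕ) => (N p.1, p.2)) := rfl
    rw [this]
    exact (measurable_of_countable _).comp
      ((hNm.comp measurable_fst).prodMk measurable_snd)
  have hfact : ∀ n : Fin m → ℕ, ∀ ω, F ω n = (∏ j, s j ^ n j / (n j).factorial) *
      (∏ j, ((N ω j).descFactorial (n j) : ℂ)) := fun n ω => by
    simp only [hF, Finset.prod_mul_distrib]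
  have hint : Integrable (Function.uncurry F)
      (P.prod (Measure.pi fun _ => Measure.count)) := by
    refine ⟨hFm.aestronglyMeasurable, ?_⟩
    rw [hasFiniteIntegral_iff_enorm, lintegral_prod_symm _ hFm.enorm.aemeasurable]
    refine lt_of_le_of_lt (lintegral_mono fun n => ?_)
      (lintegral_pi_count_prod_pow fun j => ‖s j‖₊ * C)
    simp only [Function.uncurry]
    calc ∫⁻ ω, ‖F ω n‖ₑ ∂P = ∫⁻ ω, (∏ j, (‖s j‖₊ : ℝ≥0∞) ^ n j / (n j).factorial) *
          ∏ j, ((N ω j).descFactorial (n j) : ℝ≥0∞) ∂P := by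
          refine lintegral_congr fun ω => ?_
          rw [hfact, enorm_mul, enorm_finsetProd, enorm_finsetProd]
          congr 1
          · refine Finset.prod_congr rfl fun j _ => ?_
            rw [div_eq_mul_inv, enorm_mul, enorm_pow, enorm_inv
              (by exact_mod_cast (n j).factorial_ne_zero), enorm_eq_nnnorm, div_eq_mul_inv]
            congr 2
            exact enorm_natCast_complex _
          · exact Finset.prod_congr rfl fun j _ => enorm_natCast_complex _
      _ = (∏ j, (‖s j‖₊ : ℝ≥0∞) ^ n j / (n j).factorial) *
          ∫⁻ ω, ∏ j, ((N ω j).descFactorial (n j) : ℝ≥0∞) ∂P := by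
          rw [lintegral_const_mul]
          exact Finset.measurable_prod _ fun j _ => (measurable_of_countable
            (fun a : ℕ => (a.descFactorial (n j) : ℝ≥0∞))).comp (hN j)
      _ ≤ (∏ j, (‖s j‖₊ : ℝ≥0∞) ^ n j / (n j).factorial) * ∏ j, (C : ℝ≥0∞) ^ n j := by
          gcongr
          exact hb n
      _ = _ := by
          rw [← Finset.prod_mul_distrib]
          refine Finset.prod_congr rfl fun j _ => ?_
          rw [ENNReal.coe_mul, mul_pow, div_eq_mul_inv, div_eq_mul_inv]
          ring
  have h1 : ∀ ω, ∏ j, (1 + s j) ^ N ω j =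
      ∫ n : Fin m → ℕ, F ω n ∂(Measure.pi fun _ => Measure.count) := fun ω => by
    rw [integral_fintype_prod_eq_prod
      (f := fun j (k : ℕ) => s j ^ k / k.factorial * ((N ω j).descFactorial k : ℂ))]
    exact Finset.prod_congr rfl fun j _ => (integral_count_descFactorial _ _).symm
  simp only [h1]
  rw [integral_integral_swap hint]
  refine integral_congr_ae (Filter.Eventually.of_forall fun n => ?_)
  simp only [hfact]
  rw [integral_const_mul]
  congr 1
  have : ∀ ω, (∏ j, ((N ω j).descFactorial (n j) : ℂ)) =
      (((∏ j, ((N ω j).descFactorial (n j) : ℝ≥0∞)).toReal : ℝ) : ℂ) := fun ω => by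
    simp [ENNReal.toReal_prod]
  simp only [this]
  rw [integral_complex_ofReal, integral_toReal]
  · exact (Finset.measurable_prod _ fun j _ => (measurable_of_countable
      (fun a : ℕ => (a.descFactorial (n j) : ℝ≥0∞))).comp (hN j)).aemeasurable
  · exact Filter.Eventually.of_forall fun ω => ENNReal.prod_lt_top fun j _ => by simp

/-- Random vectors of natural numbers with the same, geometrically bounded, joint factorial moments
have the same distribution. -/
theorem map_eq_of_factorial_moments (P : Measure S) [IsProbabilityMeasure P] {m : ℕ}
    (N N' : S → Fin m → ℕ) (hN : ∀ j, Measurable fun ω => N ω j)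
    (hN' : ∀ j, Measurable fun ω => N' ω j) (C : ℝ≥0)
    (hb : ∀ n : Fin m → ℕ,
      ∫⁻ ω, ∏ j, ((N ω j).descFactorial (n j) : ℝ≥0∞) ∂P ≤ ∏ j, (C : ℝ≥0∞) ^ n j)
    (he : ∀ n : Fin m → ℕ,
      ∫⁻ ω, ∏ j, ((N' ω j).descFactorial (n j) : ℝ≥0∞) ∂P =
        ∫⁻ ω, ∏ j, ((N ω j).descFactorial (n j) : ℝ≥0∞) ∂P) :
    P.map (fun ω j => (N ω j : ℝ)) = P.map (fun ω j => (N' ω j : ℝ)) := by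
  have hm : Measurable (fun ω j => (N ω j : ℝ)) :=
    measurable_pi_lambda _ fun j => (measurable_of_countable fun a : ℕ => (a : ℝ)).comp (hN j)
  have hm' : Measurable (fun ω j => (N' ω j : ℝ)) :=
    measurable_pi_lambda _ fun j => (measurable_of_countable fun a : ℕ => (a : ℝ)).comp (hN' j)
  have := Measure.isProbabilityMeasure_map (μ := P) hm.aemeasurable
  have := Measure.isProbabilityMeasure_map (μ := P) hm'.aemeasurable
  refine Measure.ext_of_charFunDual ?_
  ext L
  -- The characteristic function at `L` is the generating function at `1 + s j = exp (i L (e j))`.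
  have key : ∀ x : Fin m → ℕ, Complex.exp (L (fun j => (x j : ℝ)) * Complex.I) =
      ∏ j, (1 + (Complex.exp (L (Pi.single j 1) * Complex.I) - 1)) ^ x j := fun x => by
    have : L (fun j => (x j : ℝ)) = ∑ j, (x j : ℝ) * L (Pi.single j 1) := by
      have := LinearMap.pi_apply_eq_sum_univ (L : (Fin m → ℝ) →ₗ[ℝ] ℝ) (fun j => (x j : ℝ))
      simp only [ContinuousLinearMap.coe_coe, smul_eq_mul] at this
      rw [this]
      refine Finset.sum_congr rfl fun j _ => ?_
      congr 2
      ext i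
      simp [Pi.single_apply, eq_comm]
    rw [this]
    push_cast
    rw [Finset.sum_mul, Complex.exp_sum]
    refine Finset.prod_congr rfl fun j _ => ?_
    rw [add_sub_cancel, ← Complex.exp_nat_mul]
    ring_nf
  rw [charFunDual_apply, charFunDual_apply, integral_map hm.aemeasurable
    (by fun_prop), integral_map hm'.aemeasurable (by fun_prop)]
  simp only [key]
  rw [integral_prod_one_add_pow P N hN C hb,
    integral_prod_one_add_pow P N' hN' C (fun n => (he n).trans_le (hb n))]
  simp only [he]

/-- Evaluations on sets inside some `E k` already generate the σ-algebra, because `ν s` is the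
supremum of `ν (s ∩ E k)`. Moment bounds are only available inside the sets `E k`. -/
theorem comap_eval_eq_measurableSpace (E : ℕ → Set Ω) (hEm : ∀ k, MeasurableSet (E k))
    (hmono : Monotone E) (hU : ⋃ k, E k = Set.univ) :
    MeasurableSpace.comap
      (fun (ν : Measure Ω) (B : {B : Set Ω // MeasurableSet B ∧ ∃ k, B ⊆ E k}) => ν B.1)
      MeasurableSpace.pi = (inferInstance : MeasurableSpace (Measure Ω)) := by
  apply le_antisymm
  · rw [← measurable_iff_comap_le]
    exact measurable_pi_lambda _ fun B => Measure.measurable_coe B.2.1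
  · refine iSup₂_le fun s hs => ?_
    rw [← measurable_iff_comap_le]
    set ev := fun (ν : Measure Ω) (B : {B : Set Ω // MeasurableSet B ∧ ∃ k, B ⊆ E k}) => ν B.1
    have : (fun ν : Measure Ω => ν s) =
        (fun f : {B : Set Ω // MeasurableSet B ∧ ∃ k, B ⊆ E k} → ℝ≥0∞ =>
          ⨆ k, f ⟨s ∩ E k, hs.inter (hEm k), k, Set.inter_subset_right⟩) ∘ ev := by
      funext ν
      have h1 : s = ⋃ k, s ∩ E k := by rw [← Set.inter_iUnion, hU, Set.inter_univ]
      conv_lhs => rw [h1]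
      rw [Monotone.measure_iUnion]
      · rfl
      · exact fun i j hij => Set.inter_subset_inter_right _ (hmono hij)
    rw [this]
    exact Measurable.comp (Measurable.iSup fun k => measurable_pi_apply _)
      (comap_measurable ev)

/-- The sets `B i` may overlap, whereas factorial moments are given for disjoint sets. One therefore
passes to the atoms of the finite algebra generated by the `B i` inside `E`, and recovers each count
as a sum over atoms. -/
theorem map_eval_eq_of_factorial_moments (P : Measure S) [IsProbabilityMeasure P]
    (X Y : S → Measure Ω) (hX : Measurable X) (hY : Measurable Y) (E : Set Ω)
    (hEm : MeasurableSet E) (C : ℝ≥0)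
    (hXi : ∀ᵐ ω ∂P, ∀ B : Set Ω, MeasurableSet B → ∃ n : ℕ∞, X ω B = (n : ℝ≥0∞))
    (hYi : ∀ᵐ ω ∂P, ∀ B : Set Ω, MeasurableSet B → ∃ n : ℕ∞, Y ω B = (n : ℝ≥0∞))
    (hb : ∀ (m : ℕ) (D : Fin m → Set Ω) (n : Fin m → ℕ), (∀ i, MeasurableSet (D i)) →
      (∀ i, D i ⊆ E) → Pairwise (fun i j => Disjoint (D i) (D j)) →
      ∫⁻ ω, ∏ i, fallingFactorial (X ω (D i)) (n i) ∂P ≤ ∏ i, (C : ℝ≥0∞) ^ n i)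
    (he : ∀ (m : ℕ) (D : Fin m → Set Ω) (n : Fin m → ℕ), (∀ i, MeasurableSet (D i)) →
      (∀ i, D i ⊆ E) → Pairwise (fun i j => Disjoint (D i) (D j)) →
      ∫⁻ ω, ∏ i, fallingFactorial (Y ω (D i)) (n i) ∂P =
        ∫⁻ ω, ∏ i, fallingFactorial (X ω (D i)) (n i) ∂P)
    {I : Type*} [Fintype I] (B : I → Set Ω) (hBm : ∀ i, MeasurableSet (B i))
    (hBE : ∀ i, B i ⊆ E) :
    P.map (fun ω i => X ω (B i)) = P.map (fun ω i => Y ω (B i)) := by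
  classical
  have hfin : ∀ Z : S → Measure Ω, Measurable Z →
      ∫⁻ ω, ∏ i : Fin 1, fallingFactorial (Z ω E) 1 ∂P ≤ ∏ i : Fin 1, (C : ℝ≥0∞) ^ 1 →
      ∀ᵐ ω ∂P, Z ω E < ∞ := by
    intro Z hZ h
    simp only [fallingFactorial, Finset.range_one, Finset.prod_singleton, Nat.cast_zero, tsub_zero,
      Finset.univ_unique, Finset.prod_const, Finset.card_singleton, pow_one] at h
    exact ae_lt_top ((Measure.measurable_coe hEm).comp hZ) (h.trans_lt ENNReal.coe_lt_top).ne
  have h1 := hb 1 (fun _ => E) (fun _ => 1) (fun _ => hEm) (fun _ => subset_rfl)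
    (Subsingleton.pairwise)
  have hXf := hfin X hX h1
  have hYf := hfin Y hY
    ((he 1 (fun _ => E) (fun _ => 1) (fun _ => hEm) (fun _ => subset_rfl)
      (Subsingleton.pairwise)).trans_le h1)
  -- An atom consists of the points of `E` that lie in exactly the same sets `B i`.
  let typ : Ω → Finset I := fun x => Finset.univ.filter fun i => x ∈ B i
  let e := Fintype.equivFin (Finset I)
  let D : Fin (Fintype.card (Finset I)) → Set Ω := fun j => {x ∈ E | typ x = e.symm j}
  have hDE : ∀ j, D j ⊆ E := fun j x hx => hx.1
  have hDm : ∀ j, MeasurableSet (D j) := by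
    intro j
    have : D j = E ∩ ⋂ i, (if i ∈ e.symm j then B i else (B i)ᶜ) := by
      ext x
      simp only [D, typ, Set.mem_ofPred_eq, Set.mem_inter_iff, Set.mem_iInter, Finset.ext_iff,
        Finset.mem_filter, Finset.mem_univ, true_and]
      refine and_congr_right fun _ => forall_congr' fun i => ?_
      split_ifs with h <;> simp [h]
    rw [this]
    refine hEm.inter (MeasurableSet.iInter fun i => ?_)
    split_ifs
    exacts [hBm i, (hBm i).compl]
  have hDd : Pairwise (fun i j => Disjoint (D i) (D j)) := by
    intro i j hij
    refine Set.disjoint_left.2 fun x hx hx' => hij ?_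
    exact e.symm.injective (hx.2.symm.trans hx'.2)
  have hBD : ∀ i, B i = ⋃ j ∈ (Finset.univ.filter fun j => i ∈ e.symm j), D j := by
    intro i
    ext x
    simp only [Set.mem_iUnion, Finset.mem_filter, Finset.mem_univ, true_and, exists_prop]
    constructor
    · intro hx
      refine ⟨e (typ x), ?_, hBE i hx, by simp⟩
      simp [typ, hx]
    · rintro ⟨j, hj, hx⟩
      rw [← hx.2] at hj
      simpa [typ] using hj
  have hsum : ∀ (ν : Measure Ω) (i : I),
      ν (B i) = ∑ j ∈ (Finset.univ.filter fun j => i ∈ e.symm j), ν (D j) := by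
    intro ν i
    conv_lhs => rw [hBD i]
    exact measure_biUnion_finset (fun a _ b _ hab => hDd hab) fun j _ => hDm j
  -- A version of the counts with values in `ℕ` everywhere; it agrees with the true counts almost
  -- surely, where these are integers and finite.
  let cnt : (S → Measure Ω) → S → Fin (Fintype.card (Finset I)) → ℕ :=
    fun Z ω j => ⌊(Z ω (D j)).toReal⌋₊
  have hcm : ∀ Z : S → Measure Ω, Measurable Z → ∀ j, Measurable fun ω => cnt Z ω j :=
    fun Z hZ j => Nat.measurable_floor.comp
      (((Measure.measurable_coe (hDm j)).comp hZ).ennreal_toReal)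
  have hcnt : ∀ Z : S → Measure Ω,
      (∀ᵐ ω ∂P, ∀ B : Set Ω, MeasurableSet B → ∃ n : ℕ∞, Z ω B = (n : ℝ≥0∞)) →
      (∀ᵐ ω ∂P, Z ω E < ∞) → ∀ᵐ ω ∂P, ∀ j, Z ω (D j) = (cnt Z ω j : ℝ≥0∞) := by
    intro Z hZi hZf
    filter_upwards [hZi, hZf] with ω h1 h2 j
    obtain ⟨n, hn⟩ := h1 (D j) (hDm j)
    have hlt : Z ω (D j) < ∞ := (measure_mono (hDE j)).trans_lt h2
    obtain ⟨k, rfl⟩ : ∃ k : ℕ, n = k := by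
      refine ENat.ne_top_iff_exists.1 ?_ |>.imp fun _ h => h.symm
      rintro rfl
      simp [hn] at hlt
    simp [cnt, hn]
  have hXc := hcnt X hXi hXf
  have hYc := hcnt Y hYi hYf
  have hmom : ∀ Z : S → Measure Ω, (∀ᵐ ω ∂P, ∀ j, Z ω (D j) = (cnt Z ω j : ℝ≥0∞)) →
      ∀ n : Fin (Fintype.card (Finset I)) → ℕ,
      ∫⁻ ω, ∏ j, ((cnt Z ω j).descFactorial (n j) : ℝ≥0∞) ∂P =
        ∫⁻ ω, ∏ i, fallingFactorial (Z ω (D i)) (n i) ∂P := by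
    intro Z hZ n
    refine lintegral_congr_ae ?_
    filter_upwards [hZ] with ω h
    exact Finset.prod_congr rfl fun j _ => by rw [h j, fallingFactorial_natCast]
  have hlaw := map_eq_of_factorial_moments P (cnt X) (cnt Y) (hcm X hX) (hcm Y hY) C
    (fun n => by rw [hmom X hXc]; exact hb _ D n hDm hDE hDd)
    (fun n => by rw [hmom X hXc, hmom Y hYc]; exact he _ D n hDm hDE hDd)
  let G : (Fin (Fintype.card (Finset I)) → ℝ) → I → ℝ≥0∞ := fun x i =>
    ∑ j ∈ (Finset.univ.filter fun j => i ∈ e.symm j), ENNReal.ofReal (x j)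
  have hG : Measurable G := by fun_prop
  have hrepr : ∀ Z : S → Measure Ω, Measurable Z →
      (∀ᵐ ω ∂P, ∀ j, Z ω (D j) = (cnt Z ω j : ℝ≥0∞)) →
      P.map (fun ω i => Z ω (B i)) = (P.map fun ω j => (cnt Z ω j : ℝ)).map G := by
    intro Z hZ hZc
    have hcr : Measurable fun ω j => (cnt Z ω j : ℝ) := measurable_pi_lambda _ fun j =>
      (measurable_of_countable fun a : ℕ => (a : ℝ)).comp (hcm Z hZ j)
    rw [Measure.map_map hG hcr]
    refine Measure.map_congr ?_
    filter_upwards [hZc] with ω h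
    funext i
    rw [hsum]
    refine Finset.sum_congr rfl fun j _ => ?_
    rw [h j]
    simp
  rw [hrepr X hX hXc, hrepr Y hY hYc, hlaw]

/-- Two point processes with the same factorial moments on the subsets of an exhausting sequence,
these moments being geometrically bounded, have the same law. -/
theorem law_eq_of_factorial_moments (P : Measure S) [IsProbabilityMeasure P]
    (X Y : S → Measure Ω) (hX : Measurable X) (hY : Measurable Y)
    (E : ℕ → Set Ω) (hEm : ∀ k, MeasurableSet (E k))
    (hmono : Monotone E) (hU : ⋃ k, E k = Set.univ) (C : ℕ → ℝ≥0)
    (hXi : ∀ᵐ ω ∂P, ∀ B : Set Ω, MeasurableSet B → ∃ n : ℕ∞, X ω B = (n : ℝ≥0∞))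
    (hYi : ∀ᵐ ω ∂P, ∀ B : Set Ω, MeasurableSet B → ∃ n : ℕ∞, Y ω B = (n : ℝ≥0∞))
    (hb : ∀ (k m : ℕ) (D : Fin m → Set Ω) (n : Fin m → ℕ), (∀ i, MeasurableSet (D i)) →
      (∀ i, D i ⊆ E k) → Pairwise (fun i j => Disjoint (D i) (D j)) →
      ∫⁻ ω, ∏ i, fallingFactorial (X ω (D i)) (n i) ∂P ≤ ∏ i, (C k : ℝ≥0∞) ^ n i)
    (he : ∀ (m : ℕ) (D : Fin m → Set Ω) (n : Fin m → ℕ), (∀ i, MeasurableSet (D i)) →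
      Pairwise (fun i j => Disjoint (D i) (D j)) →
      ∫⁻ ω, ∏ i, fallingFactorial (Y ω (D i)) (n i) ∂P =
        ∫⁻ ω, ∏ i, fallingFactorial (X ω (D i)) (n i) ∂P) :
    P.map X = P.map Y := by
  let ev := fun (ν : Measure Ω) (B : {B : Set Ω // MeasurableSet B ∧ ∃ k, B ⊆ E k}) => ν B.1
  have hev : Measurable ev := measurable_pi_lambda _ fun B => Measure.measurable_coe B.2.1
  -- A finite measure on a product is determined by its finite-dimensional marginals, and finitely
  -- many of the sets lie in one common `E k`.
  have key : P.map (ev ∘ X) = P.map (ev ∘ Y) := by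
    have := Measure.isProbabilityMeasure_map (μ := P) (hev.comp hX).aemeasurable
    refine IsProjectiveLimit.unique (P := fun I => (P.map (ev ∘ X)).map I.restrict)
      (fun I => rfl) (fun I => ?_)
    have hr : Measurable (I.restrict (π := fun
      _ : {B : Set Ω // MeasurableSet B ∧ ∃ k, B ⊆ E k} => ℝ≥0∞)) := Finset.measurable_restrict I
    change _ = (P.map (ev ∘ X)).map I.restrict
    rw [Measure.map_map hr (hev.comp hY), Measure.map_map hr (hev.comp hX)]
    obtain ⟨k, hk⟩ : ∃ k, ∀ B ∈ I, B.1 ⊆ E k := by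
      refine ⟨I.sup fun B => B.2.2.choose, fun B hB => ?_⟩
      exact B.2.2.choose_spec.trans (hmono (Finset.le_sup (f := fun
        B : {B : Set Ω // MeasurableSet B ∧ ∃ k, B ⊆ E k} => B.2.2.choose) hB))
    exact (map_eval_eq_of_factorial_moments P X Y hX hY (E k) (hEm k) (C k) hXi hYi (hb k)
      (fun m D n h1 _ h3 => he m D n h1 h3) (fun i : I => i.1.1) (fun i => i.1.2.1)
      (fun i => hk _ i.2)).symm
  ext T hT
  obtain ⟨T', hT', rfl⟩ : MeasurableSet[MeasurableSpace.comap ev MeasurableSpace.pi] T := by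
    rw [comap_eval_eq_measurableSpace E hEm hmono hU]
    exact hT
  rw [← Measure.map_apply hev hT', ← Measure.map_apply hev hT', Measure.map_map hev hX,
    Measure.map_map hev hY, key]

end Law

/-! ## Correlation functions of determinantal processes -/

section PiMeasure

variable {Ω : Type*} [MeasurableSpace Ω]

theorem lintegral_fin_prod_eq_prod (μ : Measure Ω) [SigmaFinite μ] (n : ℕ)
    (f : Fin n → Ω → ℝ≥0∞) (hf : ∀ i, Measurable (f i)) :
    ∫⁻ x : Fin n → Ω, ∏ i, f i (x i) ∂(Measure.pi fun _ => μ) = ∏ i, ∫⁻ x, f i x ∂μ := by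
  induction n with
  | zero => simp
  | succ n ih =>
    rw [← ((measurePreserving_piFinSuccAbove (fun _ : Fin (n + 1) => μ) 0).symm).lintegral_comp_emb
      (MeasurableEquiv.measurableEmbedding _)]
    simp only [Fin.prod_univ_succ]
    rw [lintegral_prod]
    · simp only [MeasurableEquiv.piFinSuccAbove_symm_apply, Fin.insertNthEquiv, Equiv.coe_fn_mk,
        Fin.insertNth_zero', Fin.cons_zero, Fin.cons_succ]
      have : ∀ x, ∫⁻ y : Fin n → Ω, f 0 x * ∏ i : Fin n, f i.succ (y i) ∂(Measure.pi fun _ => μ) =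
          f 0 x * ∏ i : Fin n, ∫⁻ x, f i.succ x ∂μ := fun x => by
        rw [lintegral_const_mul, ih _ fun i => hf i.succ]
        exact Finset.measurable_prod _ fun i _ => (hf i.succ).comp (measurable_pi_apply i)
      erw [lintegral_congr this, lintegral_mul_const _ (hf 0)]
    · refine AEMeasurable.mul ?_ ?_
      · exact ((hf 0).comp ((measurable_pi_apply _).comp
          (MeasurableEquiv.measurable _))).aemeasurable
      · exact (Finset.measurable_prod _ fun i _ => (hf i.succ).comp ((measurable_pi_apply _).comp
          (MeasurableEquiv.measurable _))).aemeasurable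

theorem pi_withDensity (μ : Measure Ω) [SigmaFinite μ] (n : ℕ) (f : Ω → ℝ≥0∞)
    (hf : Measurable f) [SigmaFinite (μ.withDensity f)] :
    Measure.pi (fun _ : Fin n => μ.withDensity f) =
      (Measure.pi fun _ : Fin n => μ).withDensity fun x => ∏ i, f (x i) := by
  refine Measure.pi_eq fun s hs => ?_
  rw [withDensity_apply _ (MeasurableSet.univ_pi hs), ← lintegral_indicator
    (MeasurableSet.univ_pi hs)]
  have : ∀ x : Fin n → Ω, (Set.univ.pi s).indicator (fun x => ∏ i, f (x i)) x =
      ∏ i, (s i).indicator f (x i) := by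
    intro x
    by_cases hx : x ∈ Set.univ.pi s
    · rw [Set.indicator_of_mem hx]
      exact Finset.prod_congr rfl fun i _ => (Set.indicator_of_mem (hx i trivial) _).symm
    · rw [Set.indicator_of_notMem hx]
      obtain ⟨i, hi⟩ : ∃ i, x i ∉ s i := by simpa [Set.mem_pi] using hx
      exact (Finset.prod_eq_zero (Finset.mem_univ i) (Set.indicator_of_notMem hi _)).symm
  simp only [this]
  rw [lintegral_fin_prod_eq_prod μ n _ fun i => hf.indicator (hs i)]
  refine Finset.prod_congr rfl fun i _ => ?_
  rw [withDensity_apply _ (hs i), lintegral_indicator (hs i)]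

/-- Used with `k` the diagonal of the kernel, to rewrite second moments as integrals against the
intensity measure. -/
theorem lintegral_lintegral_withDensity (μ : Measure Ω) [SFinite μ] {D₀ D₁ : Set Ω}
    (hD₀ : MeasurableSet D₀) (hD₁ : MeasurableSet D₁) {k : Ω → ℝ≥0∞} (hk : Measurable k)
    {h : Ω → Ω → ℝ≥0∞} (hh : Measurable (Function.uncurry h)) :
    ∫⁻ x in D₀, ∫⁻ y in D₁, k x * (k y * h x y) ∂μ ∂μ =
      ∫⁻ x in D₀, ∫⁻ y in D₁, h x y ∂(μ.withDensity k) ∂(μ.withDensity k) := by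
  rw [restrict_withDensity hD₀, restrict_withDensity hD₁]
  have hx : ∀ x, Measurable (h x) := fun x => hh.comp measurable_prodMk_left
  have hin : ∀ x, ∫⁻ y in D₁, k x * (k y * h x y) ∂μ =
      k x * ∫⁻ y, h x y ∂((μ.restrict D₁).withDensity k) := by
    intro x
    rw [lintegral_withDensity_eq_lintegral_mul _ hk (hx x)]
    exact lintegral_const_mul (f := fun y => k y * h x y) _ (hk.mul (hx x))
  simp only [hin]
  have hout : Measurable fun x => ∫⁻ y, h x y ∂((μ.restrict D₁).withDensity k) :=
    Measurable.lintegral_prod_right' (f := fun p : Ω × Ω => h p.1 p.2) hh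
  rw [lintegral_withDensity_eq_lintegral_mul _ hk hout]
  simp only [Pi.mul_apply]

end PiMeasure

/-! ### Positive semidefinite kernels, and the moments of a determinantal process -/

section Kernel

/-- All the matrices `K (x i) (x j)` are positive semidefinite. -/
def IsPSDKernel {Ω : Type*} (K : Ω → Ω → ℂ) : Prop :=
  ∀ (n : ℕ) (x : Fin n → Ω), (Matrix.of fun i j => K (x i) (x j)).PosSemidef

/-- The quadratic form at `v` is `∑ k, |∑ i, conj (v i) φ k (x i)|²`. -/
theorem IsPSDKernel.of_hasSum {Ω ι : Type*} {K : Ω → Ω → ℂ} (φ : ι → Ω → ℂ)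
    (h : ∀ x y, HasSum (fun k => φ k x * conj (φ k y)) (K x y)) : IsPSDKernel K := by
  intro n x
  refine Matrix.PosSemidef.of_dotProduct_mulVec_nonneg ?_ ?_
  · ext i j
    simp only [Matrix.conjTranspose_apply, Matrix.of_apply]
    have h1 := (h (x j) (x i)).star
    refine h1.unique ?_
    simpa [mul_comm] using h (x i) (x j)
  · intro v
    have h1 : HasSum (fun k => ((Complex.normSq (∑ i, conj (v i) * φ k (x i)) : ℝ) : ℂ))
        (star v ⬝ᵥ (Matrix.of fun i j => K (x i) (x j)).mulVec v) := by
      have h2 : HasSum (fun k => ∑ i, conj (v i) * ∑ j, (φ k (x i) * conj (φ k (x j))) * v j)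
          (∑ i, conj (v i) * ∑ j, K (x i) (x j) * v j) :=
        hasSum_sum fun i _ => (hasSum_sum fun j _ => (h (x i) (x j)).mul_right _).mul_left _
      have h3 : star v ⬝ᵥ (Matrix.of fun i j => K (x i) (x j)).mulVec v =
          ∑ i, conj (v i) * ∑ j, K (x i) (x j) * v j := by
        simp [dotProduct, Matrix.mulVec]
      rw [h3]
      convert h2 using 2 with k
      rw [← Complex.mul_conj, map_sum, Finset.sum_mul]
      refine Finset.sum_congr rfl fun i _ => ?_
      rw [Finset.mul_sum, Finset.mul_sum]
      refine Finset.sum_congr rfl fun j _ => ?_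
      simp only [map_mul, Complex.conj_conj]
      ring
    rw [Complex.nonneg_iff]
    constructor
    · have := h1.mapL Complex.reCLM
      refine this.nonneg fun k => ?_
      simp [Complex.normSq_nonneg]
    · have := h1.mapL Complex.imCLM
      simp only [Complex.imCLM_apply, Complex.ofReal_im] at this
      exact hasSum_zero.unique this

theorem IsPSDKernel.diag_nonneg {Ω : Type*} {K : Ω → Ω → ℂ} (hK : IsPSDKernel K) (x : Ω) :
    0 ≤ (K x x).re := by
  have := (hK 1 fun _ => x).diag_nonneg (i := 0)
  exact (Complex.nonneg_iff.1 this).1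

theorem IsPSDKernel.diag_im {Ω : Type*} {K : Ω → Ω → ℂ} (hK : IsPSDKernel K) (x : Ω) :
    (K x x).im = 0 := by
  have := (hK 1 fun _ => x).diag_nonneg (i := 0)
  exact (Complex.nonneg_iff.1 this).2.symm

theorem IsPSDKernel.symm {Ω : Type*} {K : Ω → Ω → ℂ} (hK : IsPSDKernel K) (x y : Ω) :
    K y x = conj (K x y) := by
  have := (hK 2 ![x, y]).isHermitian.apply 1 0
  simpa using this.symm

theorem IsPSDKernel.det_two {Ω : Type*} {K : Ω → Ω → ℂ} (hK : IsPSDKernel K) (x y : Ω) :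
    (Matrix.of fun i j => K (![x, y] i) (![x, y] j)).det =
      (((K x x).re * (K y y).re - ‖K x y‖ ^ 2 : ℝ) : ℂ) := by
  rw [Matrix.det_fin_two]
  simp only [Matrix.of_apply, Matrix.cons_val_zero, Matrix.cons_val_one]
  rw [hK.symm x y, Complex.mul_conj, Complex.normSq_eq_norm_sq]
  have h1 : K x x = ((K x x).re : ℂ) := Complex.ext rfl (hK.diag_im x)
  have h2 : K y y = ((K y y).re : ℂ) := Complex.ext rfl (hK.diag_im y)
  rw [h1, h2]
  push_cast
  simp

/-- Cauchy–Schwarz, as nonnegativity of a 2 × 2 determinant. -/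
theorem IsPSDKernel.norm_sq_le {Ω : Type*} {K : Ω → Ω → ℂ} (hK : IsPSDKernel K) (x y : Ω) :
    ‖K x y‖ ^ 2 ≤ (K x x).re * (K y y).re := by
  have h := (hK 2 ![x, y]).det_nonneg
  rw [hK.det_two, Complex.zero_le_real] at h
  linarith

/-- The inequality of arithmetic and geometric means for the eigenvalues, whose sum is the trace and
so at most `n M`. It makes factorial moments geometrically bounded wherever the diagonal is bounded.
-/
theorem IsPSDKernel.det_le {Ω : Type*} {K : Ω → Ω → ℂ} (hK : IsPSDKernel K) {n : ℕ}
    (x : Fin n → Ω) {M : ℝ} (hM : ∀ i, (K (x i) (x i)).re ≤ M) :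
    ((Matrix.of fun i j => K (x i) (x j)).det).re ≤ M ^ n := by
  rcases Nat.eq_zero_or_pos n with rfl | hn
  · simp
  have hn' : (0 : ℝ) < n := by exact_mod_cast hn
  have hA := hK n x
  set A := Matrix.of fun i j => K (x i) (x j)
  have hH := hA.isHermitian
  rw [hH.det_eq_prod_eigenvalues]
  have h0 := hA.eigenvalues_nonneg
  have htr : ∑ i, hH.eigenvalues i ≤ n * M := by
    have h1 := congrArg Complex.re hH.trace_eq_sum_eigenvalues
    have h2 : (∑ i, (hH.eigenvalues i : ℂ)).re = ∑ i, hH.eigenvalues i := by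
      rw [← Complex.ofReal_sum, Complex.ofReal_re]
    have h3 : A.trace.re ≤ n * M := by
      simp only [Matrix.trace, Matrix.diag, A, Matrix.of_apply, Complex.re_sum]
      calc _ ≤ ∑ _i : Fin n, M := Finset.sum_le_sum fun i _ => hM i
        _ = n * M := by simp
    rw [← h2]
    exact h1 ▸ h3
  have hprod : (∏ i, ((hH.eigenvalues i : ℝ) : ℂ)).re = ∏ i, hH.eigenvalues i := by
    rw [← Complex.ofReal_prod, Complex.ofReal_re]
  refine (le_of_eq hprod).trans ?_
  have hgm := Real.geom_mean_le_arith_mean Finset.univ (fun _ : Fin n => (1 : ℝ))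
    hH.eigenvalues (fun _ _ => zero_le_one) (by simpa using hn) (fun i _ => h0 i)
  simp only [Real.rpow_one, Finset.sum_const, Finset.card_univ, Fintype.card_fin, nsmul_eq_mul,
    mul_one, one_mul] at hgm
  have hp0 : 0 ≤ ∏ i, hH.eigenvalues i := Finset.prod_nonneg fun i _ => h0 i
  have h4 : (∏ i, hH.eigenvalues i) ^ ((n : ℝ)⁻¹) ≤ M :=
    hgm.trans ((div_le_iff₀ hn').2 (by linarith))
  calc ∏ i, hH.eigenvalues i = ((∏ i, hH.eigenvalues i) ^ ((n : ℝ)⁻¹)) ^ n :=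
        (Real.rpow_inv_natCast_pow hp0 hn.ne').symm
    _ ≤ M ^ n := by gcongr

variable {S Ω : Type*} [MeasurableSpace S] [MeasurableSpace Ω]

/-- The intensity measure of the determinantal process with kernel `K`. -/
noncomputable def kernelIntensity (μ : Measure Ω) (K : Ω → Ω → ℂ) : Measure Ω :=
  μ.withDensity fun x => ENNReal.ofReal (K x x).re

/-- The squared kernel, normalized to be `1` on the diagonal. -/
noncomputable def normalizedKernel {Ω : Type*} (K : Ω → Ω → ℂ) (x y : Ω) : ℝ :=
  ‖K x y‖ ^ 2 / ((K x x).re * (K y y).re)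

variable [TopologicalSpace Ω] {P : Measure S} {X : S → Measure Ω} {μ : Measure Ω}
  {K : Ω → Ω → ℂ}

theorem IsDeterminantal.lintegral_factorial (h : IsDeterminantal P X μ K)
    {m : ℕ} (D : Fin m → Set Ω) (n : Fin m → ℕ) (hD : ∀ i, MeasurableSet (D i))
    (hd : Pairwise (fun i j => Disjoint (D i) (D j))) (hn : 1 ≤ ∑ i, n i) :
    ∫⁻ ω, ∏ i, fallingFactorial (X ω (D i)) (n i) ∂P =
      ∫⁻ x in {x : Fin (∑ i, n i) → Ω |
          ∀ (i : Fin m) (j : Fin (n i)), x (finSigmaFinEquiv ⟨i, j⟩) ∈ D i},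
        ENNReal.ofReal (Matrix.of fun i j => K (x i) (x j)).det.re ∂(Measure.pi fun _ => μ) := by
  obtain ⟨ρ, h1, h2⟩ := h.correlation
  rw [h1 m D n hD hd hn]
  refine lintegral_congr fun x => ?_
  rw [← h2, Complex.ofReal_re, ENNReal.ofReal_coe_nnreal]

theorem IsDeterminantal.lintegral_prod_eq [SigmaFinite μ] (h : IsDeterminantal P X μ K)
    {m : ℕ} (hm : 1 ≤ m) (D : Fin m → Set Ω) (hD : ∀ i, MeasurableSet (D i))
    (hd : Pairwise (fun i j => Disjoint (D i) (D j))) :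
    ∫⁻ ω, ∏ i, X ω (D i) ∂P =
      ∫⁻ x in Set.univ.pi D,
        ENNReal.ofReal (Matrix.of fun i j => K (x i) (x j)).det.re ∂(Measure.pi fun _ => μ) := by
  have h1 := h.lintegral_factorial D (fun _ => 1) hD hd (by simpa using hm)
  simp only [fallingFactorial, Finset.range_one, Finset.prod_singleton, Nat.cast_zero,
    tsub_zero] at h1
  rw [h1]
  -- With all multiplicities one, only the index type has to be changed; permuting rows and columns
  -- simultaneously keeps the determinant.
  let e : Fin m ≃ Fin (∑ _i : Fin m, 1) :=
    (Equiv.sigmaUnique (Fin m) fun _ => Fin 1).symm.trans finSigmaFinEquiv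
  have he : ∀ (i : Fin m) (j : Fin 1), finSigmaFinEquiv (n := fun _ : Fin m => 1) ⟨i, j⟩ = e i := by
    intro i j
    rw [Subsingleton.elim j default]
    rfl
  have hmp := measurePreserving_piCongrLeft (fun _ : Fin (∑ _i : Fin m, 1) => μ) e
  have happ : ∀ (y : Fin m → Ω) (i : Fin m),
      MeasurableEquiv.piCongrLeft (fun _ : Fin (∑ _i : Fin m, 1) => Ω) e y (e i) = y i :=
    fun y i => by
      rw [MeasurableEquiv.coe_piCongrLeft]
      exact Equiv.piCongrLeft_apply_apply (fun _ => Ω) e y i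
  rw [← hmp.setLIntegral_comp_preimage_emb (MeasurableEquiv.measurableEmbedding _)]
  have hset : (MeasurableEquiv.piCongrLeft (fun _ : Fin (∑ _i : Fin m, 1) => Ω) e) ⁻¹'
      {x | ∀ (i : Fin m) (j : Fin 1), x (finSigmaFinEquiv ⟨i, j⟩) ∈ D i} = Set.univ.pi D := by
    ext y
    simp only [Set.mem_preimage, Set.mem_ofPred_eq, he, happ, Set.mem_pi, Set.mem_univ,
      true_imp_iff]
    exact forall_congr' fun i => ⟨fun h => h 0, fun h _ => h⟩
  rw [hset]
  refine lintegral_congr fun y => ?_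
  congr 2
  rw [← Matrix.det_submatrix_equiv_self e]
  congr 1
  ext i j
  simp [happ]

theorem IsDeterminantal.lintegral_apply [SigmaFinite μ] (h : IsDeterminantal P X μ K)
    {D : Set Ω} (hD : MeasurableSet D) :
    ∫⁻ ω, X ω D ∂P = kernelIntensity μ K D := by
  have h1 := h.lintegral_prod_eq le_rfl (fun _ : Fin 1 => D) (fun _ => hD) Subsingleton.pairwise
  simp only [Finset.univ_unique, Finset.prod_const, Finset.card_singleton, pow_one] at h1
  rw [h1, kernelIntensity, withDensity_apply _ hD,
    ← (measurePreserving_funUnique μ (Fin 1)).setLIntegral_comp_preimage_emb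
      (MeasurableEquiv.measurableEmbedding _)]
  congr 1
  · congr 1
    ext x
    simp [Set.mem_pi, MeasurableEquiv.funUnique]
  · funext x
    simp [MeasurableEquiv.funUnique]

/-- The 2 × 2 determinant is `K x x * K y y * (1 - normalizedKernel K x y)`, and the diagonal
factors are the density of the intensity. Normalized in this way the kernel no longer depends on the
choice of reference measure. -/
theorem IsDeterminantal.lintegral_mul [SigmaFinite μ] (h : IsDeterminantal P X μ K)
    (hK : IsPSDKernel K) (hKm : Measurable (Function.uncurry K)) {D₀ D₁ : Set Ω}
    (hD₀ : MeasurableSet D₀) (hD₁ : MeasurableSet D₁) (hd : Disjoint D₀ D₁) :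
    ∫⁻ ω, X ω D₀ * X ω D₁ ∂P =
      ∫⁻ x in D₀, ∫⁻ y in D₁, ENNReal.ofReal (1 - normalizedKernel K x y)
        ∂(kernelIntensity μ K) ∂(kernelIntensity μ K) := by
  have hdiag : Measurable fun x => ENNReal.ofReal (K x x).re :=
    (Complex.measurable_re.comp (hKm.comp (measurable_id.prodMk measurable_id))).ennreal_ofReal
  have hnk : Measurable (Function.uncurry fun x y =>
      ENNReal.ofReal (1 - normalizedKernel K x y)) := by
    have h1 : Measurable fun p : Ω × Ω => (K p.1 p.1).re := Complex.measurable_re.comp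
      (hKm.comp (measurable_fst.prodMk measurable_fst))
    have h2 : Measurable fun p : Ω × Ω => (K p.2 p.2).re := Complex.measurable_re.comp
      (hKm.comp (measurable_snd.prodMk measurable_snd))
    have h3 : Measurable fun p : Ω × Ω => ‖K p.1 p.2‖ := hKm.norm
    unfold normalizedKernel
    simp only [Function.uncurry_def]
    exact (measurable_const.sub ((h3.pow_const 2).div (h1.mul h2))).ennreal_ofReal
  have h1 := h.lintegral_prod_eq (by norm_num) ![D₀, D₁] (by
      intro i; fin_cases i <;> simpa) (by
      intro i j hij
      fin_cases i <;> fin_cases j <;> simp_all [disjoint_comm])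
  simp only [Fin.prod_univ_two, Matrix.cons_val_zero, Matrix.cons_val_one] at h1
  rw [h1, ← (measurePreserving_finTwoArrow μ).symm.setLIntegral_comp_preimage_emb
      (MeasurableEquiv.measurableEmbedding _)]
  have hset : (MeasurableEquiv.finTwoArrow (α := Ω)).symm ⁻¹' (Set.univ.pi ![D₀, D₁]) =
      D₀ ×ˢ D₁ := by
    ext x
    simp [MeasurableEquiv.finTwoArrow, Set.mem_pi, Fin.forall_fin_two]
  rw [hset, ← Measure.prod_restrict]
  have hval : ∀ p : Ω × Ω, ENNReal.ofReal (Matrix.of fun i j =>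
      K ((MeasurableEquiv.finTwoArrow (α := Ω)).symm p i)
        ((MeasurableEquiv.finTwoArrow (α := Ω)).symm p j)).det.re =
      ENNReal.ofReal (K p.1 p.1).re * (ENNReal.ofReal (K p.2 p.2).re *
        ENNReal.ofReal (1 - normalizedKernel K p.1 p.2)) := by
    rintro ⟨x, y⟩
    have h2 : ((MeasurableEquiv.finTwoArrow (α := Ω)).symm (x, y)) = ![x, y] := by
      ext i; fin_cases i <;> simp [MeasurableEquiv.finTwoArrow]
    rw [h2, hK.det_two, Complex.ofReal_re, ← ENNReal.ofReal_mul (hK.diag_nonneg _),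
      ← ENNReal.ofReal_mul (hK.diag_nonneg _)]
    congr 1
    have h3 := hK.norm_sq_le x y
    have h4 := sq_nonneg ‖K x y‖
    simp only [normalizedKernel]
    -- Where the diagonal product vanishes, Cauchy–Schwarz gives `K x y = 0`, so the convention for
    -- division by zero does no harm.
    by_cases h5 : (K x x).re * (K y y).re = 0
    · rw [h5] at h3
      rcases mul_eq_zero.1 h5 with h6 | h6 <;> rw [h6] <;> ring_nf <;> nlinarith
    · rw [← mul_assoc, mul_sub, mul_one, mul_div_cancel₀ _ h5]
  simp only [hval]
  have hmeas : Measurable fun p : Ω × Ω => ENNReal.ofReal (K p.1 p.1).re *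
      (ENNReal.ofReal (K p.2 p.2).re * ENNReal.ofReal (1 - normalizedKernel K p.1 p.2)) :=
    (hdiag.comp measurable_fst).mul ((hdiag.comp measurable_snd).mul hnk)
  rw [lintegral_prod _ hmeas.aemeasurable]
  exact lintegral_lintegral_withDensity μ hD₀ hD₁ hdiag hnk

/-- The first two intensities of an invariant process are invariant. -/
theorem IsDeterminantal.intensity_invariant [SigmaFinite μ] (h : IsDeterminantal P X μ K)
    {g : Ω → Ω} (hg : Measurable g) (hinv : P.map (fun ω => (X ω).map g) = P.map X) :
    (kernelIntensity μ K).map g = kernelIntensity μ K := by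
  ext D hD
  have hXm := h.1.measurable
  have hXg : Measurable fun ω => (X ω).map g := (Measure.measurable_map g hg).comp hXm
  rw [Measure.map_apply hg hD, ← h.lintegral_apply hD, ← h.lintegral_apply (hg hD)]
  have h1 : ∀ ω, X ω (g ⁻¹' D) = (X ω).map g D := fun ω => (Measure.map_apply hg hD).symm
  simp only [h1]
  rw [← lintegral_map (f := fun ν : Measure Ω => ν D) (Measure.measurable_coe hD)
    hXg,
    ← lintegral_map (f := fun ν : Measure Ω => ν D) (Measure.measurable_coe hD) hXm, hinv]

theorem IsDeterminantal.two_point_invariant [SigmaFinite μ] (h : IsDeterminantal P X μ K)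
    (hK : IsPSDKernel K) (hKm : Measurable (Function.uncurry K))
    {g : Ω → Ω} (hg : Measurable g) (hinv : P.map (fun ω => (X ω).map g) = P.map X)
    {D₀ D₁ : Set Ω} (hD₀ : MeasurableSet D₀) (hD₁ : MeasurableSet D₁) (hd : Disjoint D₀ D₁) :
    ∫⁻ x in g ⁻¹' D₀, ∫⁻ y in g ⁻¹' D₁, ENNReal.ofReal (1 - normalizedKernel K x y)
        ∂(kernelIntensity μ K) ∂(kernelIntensity μ K) =
      ∫⁻ x in D₀, ∫⁻ y in D₁, ENNReal.ofReal (1 - normalizedKernel K x y)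
        ∂(kernelIntensity μ K) ∂(kernelIntensity μ K) := by
  have hXm := h.1.measurable
  have hXg : Measurable fun ω => (X ω).map g := (Measure.measurable_map g hg).comp hXm
  rw [← h.lintegral_mul hK hKm hD₀ hD₁ hd,
    ← h.lintegral_mul hK hKm (hg hD₀) (hg hD₁) (hd.preimage g)]
  have h1 : ∀ ω, X ω (g ⁻¹' D₀) * X ω (g ⁻¹' D₁) = (X ω).map g D₀ * (X ω).map g D₁ :=
    fun ω => by rw [Measure.map_apply hg hD₀, Measure.map_apply hg hD₁]
  simp only [h1]
  have hmeas : Measurable fun ν : Measure Ω => ν D₀ * ν D₁ :=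
    (Measure.measurable_coe hD₀).mul (Measure.measurable_coe hD₁)
  rw [← lintegral_map (f := fun ν : Measure Ω => ν D₀ * ν D₁) hmeas
    hXg,
    ← lintegral_map (f := fun ν : Measure Ω => ν D₀ * ν D₁) hmeas hXm, hinv]

/-- A determinantal process is invariant under `g` if the kernel and the measure are invariant up to
a change of gauge `u`. -/
theorem IsDeterminantal.map_eq_of_gauge [IsProbabilityMeasure P] [IsFiniteMeasure μ]
    (h : IsDeterminantal P X μ K)
    (hK : IsPSDKernel K) (hKm : Measurable (Function.uncurry K))
    {g : Ω → Ω} (hg : Measurable g) (u : Ω → ℂ) (hu : Measurable u)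
    (hμ : (μ.withDensity fun x => ENNReal.ofReal (‖u x‖ ^ 2)).map g = μ)
    (N : Set Ω) (hN : μ N = 0)
    (hgauge : ∀ x ∉ N, ∀ y ∉ N, K x y = u x * K (g x) (g y) * conj (u y)) :
    P.map (fun ω => (X ω).map g) = P.map X := by
  have hXm := h.1.measurable
  have hdens : Measurable fun x => ENNReal.ofReal (‖u x‖ ^ 2) :=
    (hu.norm.pow_const 2).ennreal_ofReal
  have hfin : IsFiniteMeasure (μ.withDensity fun x => ENNReal.ofReal (‖u x‖ ^ 2)) := by
    constructor
    rw [← Set.preimage_univ (f := g), ← Measure.map_apply hg MeasurableSet.univ, hμ]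
    exact measure_lt_top _ _
  have hdet : ∀ n : ℕ, Measurable fun x : Fin n → Ω =>
      ENNReal.ofReal (Matrix.of fun i j => K (x i) (x j)).det.re := by
    intro n
    refine (Complex.measurable_re.comp ?_).ennreal_ofReal
    simp only [Matrix.det_apply, Matrix.of_apply]
    refine Finset.measurable_sum _ fun σ _ => Measurable.const_smul ?_ _
    refine Finset.measurable_prod _ fun i _ => ?_
    exact hKm.comp (f := fun x : Fin n → Ω => (x (σ i), x i))
      ((measurable_pi_apply _).prodMk (measurable_pi_apply _))
  -- The change of gauge multiplies the determinant by `∏ ‖u (x i)‖²`, exactly the density of the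
  -- product measure that `g`, acting on each coordinate, maps to the `n`-fold power of `μ`.
  have hpi : ∀ n : ℕ, ∀ T : Set (Fin n → Ω), MeasurableSet T →
      ∫⁻ x in (fun x i => g (x i)) ⁻¹' T,
          ENNReal.ofReal (Matrix.of fun i j => K (x i) (x j)).det.re ∂(Measure.pi fun _ => μ) =
        ∫⁻ x in T, ENNReal.ofReal (Matrix.of fun i j => K (x i) (x j)).det.re
          ∂(Measure.pi fun _ => μ) := by
    intro n T hT
    have hG : Measurable fun (x : Fin n → Ω) i => g (x i) :=
      measurable_pi_lambda _ fun i => hg.comp (measurable_pi_apply i)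
    have hmap : (Measure.pi fun _ : Fin n => μ.withDensity fun x =>
        ENNReal.ofReal (‖u x‖ ^ 2)).map (fun (x : Fin n → Ω) i => g (x i)) =
        Measure.pi fun _ : Fin n => μ := by
      have : SigmaFinite ((μ.withDensity fun x => ENNReal.ofReal (‖u x‖ ^ 2)).map g) := by
        rw [hμ]; infer_instance
      rw [Measure.pi_map_pi fun _ => hg.aemeasurable]
      simp only [hμ]
    have hdensn : Measurable fun x : Fin n → Ω => ∏ i, ENNReal.ofReal (‖u (x i)‖ ^ 2) :=
      Finset.measurable_prod _ fun i _ => hdens.comp (measurable_pi_apply i)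
    have hdetG : Measurable fun x : Fin n → Ω =>
        ENNReal.ofReal (Matrix.of fun i j => K (g (x i)) (g (x j))).det.re := (hdet n).comp hG
    conv_rhs => rw [← hmap]
    rw [Measure.restrict_map hG hT, lintegral_map (hdet n) hG, pi_withDensity μ n _ hdens,
      restrict_withDensity (hG hT), lintegral_withDensity_eq_lintegral_mul _ hdensn hdetG]
    refine lintegral_congr_ae (ae_restrict_of_ae ?_)
    have hNae : ∀ᵐ x : Fin n → Ω ∂(Measure.pi fun _ => μ), ∀ i, x i ∉ N := by
      rw [ae_all_iff]
      intro i
      exact Measure.tendsto_eval_ae_ae.eventually (measure_eq_zero_iff_ae_notMem.1 hN)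
    filter_upwards [hNae] with x hx
    simp only [Pi.mul_apply]
    have h1 : (Matrix.of fun i j => K (x i) (x j)).det =
        ((∏ i, ‖u (x i)‖ ^ 2 : ℝ) : ℂ) *
          (Matrix.of fun i j => K (g (x i)) (g (x j))).det := by
      have h2 : (Matrix.of fun i j => K (x i) (x j)) = Matrix.of fun i j =>
          conj (u (x j)) * (Matrix.of fun i j => u (x i) *
            (Matrix.of fun i j => K (g (x i)) (g (x j))) i j) i j := by
        ext i j
        simp only [Matrix.of_apply]
        rw [hgauge _ (hx i) _ (hx j)]
        ring
      rw [h2, Matrix.det_mul_row, Matrix.det_mul_column, ← mul_assoc, ← Finset.prod_mul_distrib]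
      congr 1
      push_cast
      refine Finset.prod_congr rfl fun i _ => ?_
      rw [mul_comm, Complex.mul_conj, Complex.normSq_eq_norm_sq]
      push_cast
      rfl
    rw [h1, Complex.re_ofReal_mul, ENNReal.ofReal_mul (by positivity),
      ENNReal.ofReal_prod_of_nonneg fun i _ => by positivity]
  -- Correlation functions say nothing about total order zero, but there all the products are empty
  -- and equal to one.
  have hm0 : ∀ {m : ℕ} (n : Fin m → ℕ), ¬ 1 ≤ ∑ i, n i → ∀ i, n i = 0 := by
    intro m n hn i
    have : ∑ i, n i = 0 := by omega
    exact (Finset.sum_eq_zero_iff.1 this) i (Finset.mem_univ i)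
  have hTm : ∀ {m : ℕ} (D : Fin m → Set Ω) (n : Fin m → ℕ) (_ : ∀ i, MeasurableSet (D i)),
      MeasurableSet {x : Fin (∑ i, n i) → Ω |
          ∀ (i : Fin m) (j : Fin (n i)), x (finSigmaFinEquiv ⟨i, j⟩) ∈ D i} := by
    intro m D n hD
    have : {x : Fin (∑ i, n i) → Ω | ∀ (i : Fin m) (j : Fin (n i)),
        x (finSigmaFinEquiv ⟨i, j⟩) ∈ D i} = ⋂ (i : Fin m), ⋂ (j : Fin (n i)),
        (fun x : Fin (∑ i, n i) → Ω => x (finSigmaFinEquiv ⟨i, j⟩)) ⁻¹' D i := by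
      ext x
      simp
    rw [this]
    exact MeasurableSet.iInter fun i => MeasurableSet.iInter fun j => measurable_pi_apply _ (hD i)
  have hdiag : Measurable fun x => (K x x).re :=
    Complex.measurable_re.comp (hKm.comp (measurable_id.prodMk measurable_id))
  -- The space is exhausted by the sets where the diagonal is at most `k`. There a determinant of
  -- order `n` is at most `k ^ n`, and its integral at most `(k μ(Ω)) ^ n`, which is where
  -- finiteness of `μ` enters.
  refine (law_eq_of_factorial_moments P X (fun ω => (X ω).map g) hXm
    ((Measure.measurable_map g hg).comp hXm) (fun k : ℕ => {x | (K x x).re ≤ k})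
    (fun k => measurableSet_le hdiag measurable_const) ?_ ?_
    (fun k => k * (μ Set.univ).toNNReal) h.1.integer_valued ?_ ?_ ?_).symm
  · intro i j hij x hx
    have h1 : (K x x).re ≤ i := hx
    exact h1.trans (by exact_mod_cast hij)
  · refine Set.eq_univ_of_forall fun x => Set.mem_iUnion.2 ?_
    exact exists_nat_ge (K x x).re
  · filter_upwards [h.1.integer_valued] with ω hω B hB
    rw [Measure.map_apply hg hB]
    exact hω _ (hg hB)
  · intro k m D n hD hDE hd
    by_cases hn : 1 ≤ ∑ i, n i
    · rw [h.lintegral_factorial D n hD hd hn]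
      calc _ ≤ ∫⁻ x in {x : Fin (∑ i, n i) → Ω |
              ∀ (i : Fin m) (j : Fin (n i)), x (finSigmaFinEquiv ⟨i, j⟩) ∈ D i},
              (k : ℝ≥0∞) ^ (∑ i, n i) ∂(Measure.pi fun _ => μ) := by
            refine setLIntegral_mono measurable_const fun x hx => ?_
            have h1 : ∀ l, (K (x l) (x l)).re ≤ k := by
              intro l
              obtain ⟨⟨i, j⟩, rfl⟩ := finSigmaFinEquiv.surjective l
              exact hDE i (hx i j)
            refine (ENNReal.ofReal_le_ofReal (hK.det_le x h1)).trans_eq ?_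
            rw [ENNReal.ofReal_pow (by positivity), ENNReal.ofReal_natCast]
        _ ≤ (k : ℝ≥0∞) ^ (∑ i, n i) * (Measure.pi fun _ : Fin (∑ i, n i) => μ) Set.univ := by
            rw [setLIntegral_const]
            gcongr
            exact Set.subset_univ _
        _ = _ := by
            rw [Measure.pi_univ, Finset.prod_const, Finset.card_univ, Fintype.card_fin,
              ← mul_pow, Finset.prod_pow_eq_pow_sum, ENNReal.coe_mul,
              ENNReal.coe_toNNReal (measure_ne_top _ _), ENNReal.coe_natCast]
    · have h0 := hm0 n hn
      simp [fallingFactorial, h0]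
  · intro m D n hD hd
    by_cases hn : 1 ≤ ∑ i, n i
    · have h1 : ∀ ω i, (X ω).map g (D i) = X ω (g ⁻¹' D i) :=
        fun ω i => Measure.map_apply hg (hD i)
      simp only [h1]
      rw [h.lintegral_factorial (fun i => g ⁻¹' D i) n (fun i => hg (hD i))
        (fun i j hij => (hd hij).preimage g) hn, h.lintegral_factorial D n hD hd hn]
      exact hpi _ _ (hTm D n hD)
    · have h0 := hm0 n hn
      simp [fallingFactorial, h0]

end Kernel

/-! ## The plane, the sphere and the hyperbolic disk as geometries of curvature `ε` on `ℂ` -/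

section Geometry

/-- The points `z` with `1 + ε |z|² > 0`. -/
def geomDomain (ε : ℝ) : Set ℂ := {z | 0 < 1 + ε * ‖z‖ ^ 2}

/-- The invariant measure `dm(z) / (1 + ε |z|²)²`. -/
noncomputable def geomMeasure (ε : ℝ) : Measure ℂ :=
  (volume.restrict (geomDomain ε)).withDensity fun z =>
    ENNReal.ofReal (1 / (1 + ε * ‖z‖ ^ 2) ^ 2)

/-- The linear fractional map `z ↦ (a z + b) / (-ε b̄ z + ā)`. -/
noncomputable def mobius (ε : ℝ) (a b z : ℂ) : ℂ := (a * z + b) / (-(ε * conj b) * z + conj a)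

/-- The translation of `0` to `w`. -/
noncomputable def geomTranslation (ε : ℝ) (w z : ℂ) : ℂ := (z + w) / (1 - ε * conj w * z)

variable {ε : ℝ} {a b z w : ℂ}

theorem isOpen_geomDomain (ε : ℝ) : IsOpen (geomDomain ε) :=
  isOpen_lt continuous_const (by fun_prop)

theorem measurableSet_geomDomain (ε : ℝ) : MeasurableSet (geomDomain ε) :=
  (isOpen_geomDomain ε).measurableSet

theorem measurable_geomDensity (ε : ℝ) :
    Measurable fun z : ℂ => ENNReal.ofReal (1 / (1 + ε * ‖z‖ ^ 2) ^ 2) := by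
  fun_prop

instance sigmaFinite_geomMeasure (ε : ℝ) : SigmaFinite (geomMeasure ε) :=
  SigmaFinite.withDensity_of_ne_top
    (Filter.Eventually.of_forall fun _ => ENNReal.ofReal_ne_top)

theorem zero_mem_geomDomain (ε : ℝ) : (0 : ℂ) ∈ geomDomain ε := by simp [geomDomain]

theorem mem_geomDomain_of_norm_le (hz : z ∈ geomDomain ε) (h : ‖w‖ ≤ ‖z‖) : w ∈ geomDomain ε := by
  simp only [geomDomain, Set.mem_ofPred_eq] at *
  have h1 : ‖w‖ ^ 2 ≤ ‖z‖ ^ 2 := by gcongr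
  rcases le_total 0 ε with h2 | h2
  · nlinarith [sq_nonneg ‖w‖]
  · nlinarith

theorem geomMeasure_apply {D : Set ℂ} (hD : MeasurableSet D) :
    geomMeasure ε D = ∫⁻ z in D ∩ geomDomain ε, ENNReal.ofReal (1 / (1 + ε * ‖z‖ ^ 2) ^ 2) := by
  rw [geomMeasure, withDensity_apply _ hD, Measure.restrict_restrict hD]

theorem geomMeasure_absolutelyContinuous (ε : ℝ) : geomMeasure ε ≪ volume :=
  (withDensity_absolutelyContinuous _ _).trans Measure.absolutelyContinuous_restrict

theorem absolutelyContinuous_geomMeasure (ε : ℝ) :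
    volume.restrict (geomDomain ε) ≪ geomMeasure ε := by
  refine withDensity_absolutelyContinuous' (measurable_geomDensity ε).aemeasurable ?_
  filter_upwards [ae_restrict_mem (measurableSet_geomDomain ε)] with z hz
  have : 0 < 1 + ε * ‖z‖ ^ 2 := hz
  simp only [ne_eq, ENNReal.ofReal_eq_zero, not_le]
  positivity

theorem ae_mem_geomDomain (ε : ℝ) : ∀ᵐ z ∂(geomMeasure ε), z ∈ geomDomain ε :=
  (withDensity_absolutelyContinuous _ _).ae_le (ae_restrict_mem (measurableSet_geomDomain ε))

theorem geomMeasure_pos {V : Set ℂ} (hV : IsOpen V) (hVd : V ⊆ geomDomain ε) (hne : V.Nonempty) :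
    0 < geomMeasure ε V := by
  refine pos_iff_ne_zero.2 fun h => ?_
  have h1 := absolutelyContinuous_geomMeasure ε h
  rw [Measure.restrict_apply hV.measurableSet, Set.inter_eq_left.2 hVd] at h1
  exact (hV.measure_pos volume hne).ne' h1

theorem geomMeasure_lt_top {R : ℝ} (hR : (R : ℂ) ∈ geomDomain ε) :
    geomMeasure ε (Metric.closedBall 0 |R|) < ∞ := by
  rw [geomMeasure_apply Metric.isClosed_closedBall.measurableSet]
  have hR' : 0 < 1 + ε * |R| ^ 2 := by
    have : 0 < 1 + ε * ‖(R : ℂ)‖ ^ 2 := hR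
    simpa using this
  set c := min 1 (1 + ε * |R| ^ 2) with hc
  have hc0 : 0 < c := lt_min one_pos hR'
  calc _ ≤ ∫⁻ z in Metric.closedBall 0 |R| ∩ geomDomain ε, ENNReal.ofReal (1 / c ^ 2) := by
        refine setLIntegral_mono measurable_const fun z hz => ?_
        have h1 : ‖z‖ ≤ |R| := by simpa using hz.1
        have h2 : ‖z‖ ^ 2 ≤ |R| ^ 2 := by gcongr
        have h3 : c ≤ 1 + ε * ‖z‖ ^ 2 := by
          rcases le_total 0 ε with h | h
          · exact (min_le_left _ _).trans (by nlinarith [sq_nonneg ‖z‖])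
          · exact (min_le_right _ _).trans (by nlinarith)
        gcongr
    _ < ∞ := by
        rw [setLIntegral_const]
        refine ENNReal.mul_lt_top ENNReal.ofReal_lt_top ?_
        exact (measure_mono Set.inter_subset_left).trans_lt
          (isCompact_closedBall _ _).measure_lt_top

/-- In homogeneous coordinates `(z, 1)` the matrix of `mobius ε a b` multiplies the Hermitian form
`|w|² + ε|z|²` by `‖a‖² + ε‖b‖²`. All invariance statements rest on this. -/
theorem mobius_key (ε : ℝ) (a b z : ℂ) :
    ‖-(ε * conj b) * z + conj a‖ ^ 2 + ε * ‖a * z + b‖ ^ 2 =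
      (‖a‖ ^ 2 + ε * ‖b‖ ^ 2) * (1 + ε * ‖z‖ ^ 2) := by
  simp only [← Complex.normSq_eq_norm_sq, Complex.normSq_apply, Complex.add_re, Complex.add_im,
      Complex.mul_re, Complex.mul_im, Complex.conj_re, Complex.conj_im, Complex.neg_re,
      Complex.neg_im, Complex.ofReal_re, Complex.ofReal_im]
  ring

theorem one_add_norm_mobius (h : ‖a‖ ^ 2 + ε * ‖b‖ ^ 2 = 1)
    (hz : -(ε * conj b) * z + conj a ≠ 0) :
    1 + ε * ‖mobius ε a b z‖ ^ 2 =
      (1 + ε * ‖z‖ ^ 2) / ‖-(ε * conj b) * z + conj a‖ ^ 2 := by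
  have h1 := mobius_key ε a b z
  rw [h, one_mul] at h1
  have h2 : ‖-(ε * conj b) * z + conj a‖ ≠ 0 := norm_ne_zero_iff.2 hz
  rw [mobius, norm_div, div_pow, ← h1, add_div, div_self (pow_ne_zero 2 h2), mul_div_assoc]

/-- Here `mobius ε (conj a) (-b)` is the inverse map. Its denominator at the image is reciprocal to
the original one, so the image avoids its pole. -/
theorem mobius_denom_conj (h : ‖a‖ ^ 2 + ε * ‖b‖ ^ 2 = 1)
    (hz : -(ε * conj b) * z + conj a ≠ 0) :
    -(ε * conj (-b)) * mobius ε a b z + conj (conj a) = 1 / (-(ε * conj b) * z + conj a) := by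
  have h1 : a * conj a + ε * (b * conj b) = 1 := by
    rw [Complex.mul_conj, Complex.mul_conj, Complex.normSq_eq_norm_sq, Complex.normSq_eq_norm_sq]
    exact_mod_cast h
  rw [mobius, eq_div_iff hz, add_mul, mul_assoc, div_mul_cancel₀ _ hz]
  simp only [map_neg, Complex.conj_conj]
  linear_combination h1

theorem mobius_conj_mobius (h : ‖a‖ ^ 2 + ε * ‖b‖ ^ 2 = 1)
    (hz : -(ε * conj b) * z + conj a ≠ 0) :
    mobius ε (conj a) (-b) (mobius ε a b z) = z := by
  have h1 : a * conj a + ε * (b * conj b) = 1 := by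
    rw [Complex.mul_conj, Complex.mul_conj, Complex.normSq_eq_norm_sq, Complex.normSq_eq_norm_sq]
    exact_mod_cast h
  rw [mobius, mobius_denom_conj h hz, div_div_eq_mul_div, div_one, add_mul, mobius, mul_assoc,
    div_mul_cancel₀ _ hz]
  linear_combination z * h1

theorem measurable_mobius (ε : ℝ) (a b : ℂ) : Measurable (mobius ε a b) := by
  unfold mobius
  fun_prop

/-- The denominator is affine and, by the normalization, not identically zero; there is at most one
pole. -/
theorem volume_mobius_pole (h : ‖a‖ ^ 2 + ε * ‖b‖ ^ 2 = 1) :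
    volume {z : ℂ | -(ε * conj b) * z + conj a = 0} = 0 := by
  refine Set.Subsingleton.measure_zero ?_ _
  intro z hz w hw
  simp only [Set.mem_ofPred_eq] at hz hw
  by_cases hb : (ε : ℂ) * conj b = 0
  · exfalso
    have ha : a = 0 := by simpa [hb] using hz
    rcases mul_eq_zero.1 hb with h1 | h1
    · have : ε = 0 := by exact_mod_cast h1
      simp [this, ha] at h
    · have : b = 0 := by simpa using h1
      simp [this, ha] at h
  · have : -((ε : ℂ) * conj b) * (z - w) = 0 := by linear_combination hz - hw
    have h2 := (mul_eq_zero.1 this).resolve_left (neg_ne_zero.2 hb)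
    exact sub_eq_zero.1 h2

theorem hasDerivAt_mobius (h : ‖a‖ ^ 2 + ε * ‖b‖ ^ 2 = 1)
    (hz : -(ε * conj b) * z + conj a ≠ 0) :
    HasDerivAt (mobius ε a b) (1 / (-(ε * conj b) * z + conj a) ^ 2) z := by
  have h1 : a * conj a + ε * (b * conj b) = 1 := by
    rw [Complex.mul_conj, Complex.mul_conj, Complex.normSq_eq_norm_sq, Complex.normSq_eq_norm_sq]
    exact_mod_cast h
  have hn : HasDerivAt (fun z => a * z + b) a z := by
    simpa using ((hasDerivAt_id z).const_mul a).add_const b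
  have hd : HasDerivAt (fun z => -(ε * conj b) * z + conj a) (-(ε * conj b)) z := by
    simpa using ((hasDerivAt_id z).const_mul (-(ε * conj b))).add_const (conj a)
  refine (hn.div hd hz).congr_deriv ?_
  congr 1
  linear_combination h1

theorem det_smul_one (c : ℂ) : (c • (1 : ℂ →L[ℝ] ℂ)).det = ‖c‖ ^ 2 := by
  have h : ((c • (1 : ℂ →L[ℝ] ℂ) : ℂ →L[ℝ] ℂ) : ℂ →ₗ[ℝ] ℂ) =
      LinearMap.restrictScalars ℝ (LinearMap.lsmul ℂ ℂ c) := by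
    ext
    simp
  rw [ContinuousLinearMap.det, h, LinearMap.det_restrictScalars]
  simp [Algebra.norm_complex_eq, Complex.normSq_eq_norm_sq]

/-- The invariant measure is invariant under the isometries. -/
theorem map_mobius_geomMeasure (h : ‖a‖ ^ 2 + ε * ‖b‖ ^ 2 = 1) :
    (geomMeasure ε).map (mobius ε a b) = geomMeasure ε := by
  have h' : ‖conj a‖ ^ 2 + ε * ‖-b‖ ^ 2 = 1 := by simpa using h
  have hden : MeasurableSet {z : ℂ | -(ε * conj b) * z + conj a ≠ 0} :=
    (isOpen_ne_fun (by fun_prop) continuous_const).measurableSet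
  have hden0 : ∀ᵐ z : ℂ, -(ε * conj b) * z + conj a ≠ 0 :=
    measure_eq_zero_iff_ae_notMem.1 (volume_mobius_pole h)
  have hden1 : ∀ᵐ z : ℂ, -(ε * conj (-b)) * z + conj (conj a) ≠ 0 :=
    measure_eq_zero_iff_ae_notMem.1 (volume_mobius_pole h')
  ext D hD
  rw [Measure.map_apply (measurable_mobius ε a b) hD,
    geomMeasure_apply (measurable_mobius ε a b hD), geomMeasure_apply hD]
  -- The pole, where division by zero returns a meaningless value, is discarded; the map is then a
  -- bijection onto the target minus the pole of the inverse map.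
  set T := (mobius ε a b ⁻¹' D ∩ geomDomain ε) ∩ {z : ℂ | -(ε * conj b) * z + conj a ≠ 0} with hT
  have hTm : MeasurableSet T :=
    ((measurable_mobius ε a b hD).inter (measurableSet_geomDomain ε)).inter hden
  have himg : mobius ε a b '' T =
      (D ∩ geomDomain ε) ∩ {z : ℂ | -(ε * conj (-b)) * z + conj (conj a) ≠ 0} := by
    ext w
    constructor
    · rintro ⟨z, ⟨⟨hz1, hz2⟩, hz3⟩, rfl⟩
      refine ⟨⟨hz1, ?_⟩, ?_⟩
      · change 0 < 1 + ε * ‖mobius ε a b z‖ ^ 2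
        rw [one_add_norm_mobius h hz3]
        have : 0 < 1 + ε * ‖z‖ ^ 2 := hz2
        have h2 : 0 < ‖-(ε * conj b) * z + conj a‖ := norm_pos_iff.2 hz3
        positivity
      · change _ ≠ _
        rw [mobius_denom_conj h hz3]
        exact one_div_ne_zero hz3
    · rintro ⟨⟨hw1, hw2⟩, hw3⟩
      have h1 : mobius ε a b (mobius ε (conj a) (-b) w) = w := by
        simpa using mobius_conj_mobius h' hw3
      refine ⟨mobius ε (conj a) (-b) w, ⟨⟨?_, ?_⟩, ?_⟩, h1⟩
      · change mobius ε a b _ ∈ D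
        rwa [h1]
      · change 0 < 1 + ε * ‖mobius ε (conj a) (-b) w‖ ^ 2
        rw [one_add_norm_mobius h' hw3]
        have : 0 < 1 + ε * ‖w‖ ^ 2 := hw2
        have h2 : 0 < ‖-(ε * conj (-b)) * w + conj (conj a)‖ := norm_pos_iff.2 hw3
        positivity
      · have := mobius_denom_conj h' hw3
        simp only [neg_neg, Complex.conj_conj] at this
        change _ ≠ _
        rw [this]
        refine one_div_ne_zero ?_
        simpa using hw3
  have hinj : Set.InjOn (mobius ε a b) T := by
    intro z hz w hw hzw
    rw [← mobius_conj_mobius h hz.2, ← mobius_conj_mobius h hw.2, hzw]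
  have hcv := lintegral_image_eq_lintegral_abs_det_fderiv_mul volume hTm
    (fun z hz => ((hasDerivAt_mobius h hz.2).complexToReal_fderiv.hasFDerivWithinAt)) hinj
    (fun z => ENNReal.ofReal (1 / (1 + ε * ‖z‖ ^ 2) ^ 2))
  rw [himg] at hcv
  have hA : ∀ (U V : Set ℂ), (∀ᵐ z : ℂ, z ∈ V) → (U ∩ V : Set ℂ) =ᵐ[volume] U := by
    intro U V hV
    filter_upwards [hV] with z hz
    exact propext ⟨fun h => h.1, fun h => ⟨h, hz⟩⟩
  rw [setLIntegral_congr (hA _ {z : ℂ | -(ε * conj (-b)) * z + conj (conj a) ≠ 0} hden1)] at hcv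
  rw [hcv, ← setLIntegral_congr (hA _ {z : ℂ | -(ε * conj b) * z + conj a ≠ 0} hden0)]
  refine setLIntegral_congr_fun hTm fun z hz => ?_
  have hz3 : -(ε * conj b) * z + conj a ≠ 0 := hz.2
  have hpos : 0 < ‖-(ε * conj b) * z + conj a‖ := norm_pos_iff.2 hz3
  have hz2 : 0 < 1 + ε * ‖z‖ ^ 2 := hz.1.2
  rw [one_add_norm_mobius h hz3]
  -- The real Jacobian is the squared modulus of the complex derivative. It cancels the fourth power
  -- of the denominator that `one_add_norm_mobius` contributes to the density.
  have hdet : ((1 / (-(ε * conj b) * z + conj a) ^ 2) • (1 : ℂ →L[ℝ] ℂ)).det =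
      1 / ‖-(ε * conj b) * z + conj a‖ ^ 4 := by
    rw [det_smul_one]
    simp [← pow_mul]
  rw [hdet, ← ENNReal.ofReal_mul (by positivity), abs_of_pos (by positivity)]
  congr 1
  generalize ‖-(ε * conj b) * z + conj a‖ = t at hpos
  field_simp

theorem ae_mobius_denom (h : ‖a‖ ^ 2 + ε * ‖b‖ ^ 2 = 1) :
    ∀ᵐ z ∂(geomMeasure ε), -(ε * conj b) * z + conj a ≠ 0 :=
  (geomMeasure_absolutelyContinuous ε).ae_le
    (measure_eq_zero_iff_ae_notMem.1 (volume_mobius_pole h))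

theorem geomTranslation_eq_mobius (hw : w ∈ geomDomain ε) :
    ∃ a b : ℂ, ‖a‖ ^ 2 + ε * ‖b‖ ^ 2 = 1 ∧ (a ≠ 0 ∧ conj a = a ∧ b = a * w) ∧
      mobius ε a b = geomTranslation ε w := by
  have hw' : 0 < 1 + ε * ‖w‖ ^ 2 := hw
  -- The normalization for which `a = r` and `b = r w` satisfy `‖a‖² + ε‖b‖² = 1`.
  set r : ℝ := (Real.sqrt (1 + ε * ‖w‖ ^ 2))⁻¹ with hr
  have hr0 : 0 < r := by positivity
  have hr2 : r ^ 2 * (1 + ε * ‖w‖ ^ 2) = 1 := by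
    rw [hr, inv_pow, Real.sq_sqrt hw'.le, inv_mul_cancel₀ hw'.ne']
  refine ⟨r, r * w, ?_, ⟨by exact_mod_cast hr0.ne', Complex.conj_ofReal r, rfl⟩, ?_⟩
  · rw [norm_mul, Complex.norm_real, Real.norm_eq_abs, abs_of_pos hr0, mul_pow]
    linarith
  · funext z
    have hrc : (r : ℂ) ≠ 0 := by exact_mod_cast hr0.ne'
    rw [mobius, geomTranslation, map_mul, Complex.conj_ofReal,
      ← mul_div_mul_left (z + w) (1 - ε * conj w * z) hrc]
    congr 1 <;> ring

theorem measurable_geomTranslation (ε : ℝ) (w : ℂ) : Measurable (geomTranslation ε w) := by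
  unfold geomTranslation
  fun_prop

theorem map_geomTranslation (hw : w ∈ geomDomain ε) :
    (geomMeasure ε).map (geomTranslation ε w) = geomMeasure ε := by
  obtain ⟨a, b, h, -, h2⟩ := geomTranslation_eq_mobius hw
  rw [← h2, map_mobius_geomMeasure h]

theorem neg_mem_geomDomain (hw : w ∈ geomDomain ε) : -w ∈ geomDomain ε :=
  mem_geomDomain_of_norm_le hw (by simp)

theorem geomTranslation_neg (hw : w ∈ geomDomain ε) (h : 1 - ε * conj w * z ≠ 0) :
    geomTranslation ε (-w) (geomTranslation ε w z) = z := by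
  have hw' : (1 + ε * (w * conj w) : ℂ) ≠ 0 := by
    have h1 : 0 < 1 + ε * ‖w‖ ^ 2 := hw
    rw [Complex.mul_conj, Complex.normSq_eq_norm_sq]
    exact_mod_cast h1.ne'
  have h2 : 1 + ε * conj w * ((z + w) / (1 - ε * conj w * z)) =
      (1 + ε * (w * conj w)) / (1 - ε * conj w * z) := by
    field_simp
    ring
  simp only [geomTranslation, map_neg]
  rw [show 1 - ε * -conj w * ((z + w) / (1 - ε * conj w * z)) =
    1 + ε * conj w * ((z + w) / (1 - ε * conj w * z)) by ring, h2,
    div_add' _ _ _ h, div_div_div_cancel_right₀ h, div_eq_iff hw']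
  ring

/-- The numerators agree and the denominators are complex conjugate. For radial functions this lets
the point and the translation exchange roles, although translations do not commute when `ε ≠ 0`. -/
theorem norm_geomTranslation_comm (ε : ℝ) (z w : ℂ) :
    ‖geomTranslation ε w z‖ = ‖geomTranslation ε z w‖ := by
  have h : (1 - ε * conj w * z : ℂ) = conj (1 - ε * conj z * w) := by
    simp
    ring
  rw [geomTranslation, geomTranslation, norm_div, norm_div, add_comm z w, h, Complex.norm_conj]

theorem norm_geomTranslation_neg (ε : ℝ) (z w : ℂ) :
    ‖geomTranslation ε (-w) z‖ = ‖geomTranslation ε (-z) w‖ := by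
  have h : (1 - ε * conj (-w) * z : ℂ) = conj (1 - ε * conj (-z) * w) := by
    simp
    ring
  rw [geomTranslation, geomTranslation, norm_div, norm_div, ← sub_eq_add_neg, ← sub_eq_add_neg,
    norm_sub_rev, h, Complex.norm_conj]

theorem ae_geomTranslation_denom (hw : w ∈ geomDomain ε) :
    ∀ᵐ z ∂(geomMeasure ε), 1 - ε * conj w * z ≠ 0 := by
  obtain ⟨a, b, h, ⟨h1, h2, rfl⟩, -⟩ := geomTranslation_eq_mobius hw
  filter_upwards [ae_mobius_denom h] with z hz h3
  refine hz ?_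
  rw [map_mul, h2]
  linear_combination a * h3

end Geometry

/-! ## Averages over rotations and Taylor coefficients -/

section Rotation

theorem HasSum.of_eq {α M : Type*} [AddCommMonoid M] [TopologicalSpace M] {f g : α → M} {a : M}
    (h : HasSum g a) (e : ∀ n, f n = g n) : HasSum f a := by
  rwa [funext e]

/-- The normalized Haar measure of `ℝ / ℤ`. -/
noncomputable abbrev circleMeasure : Measure UnitAddCircle := AddCircle.haarAddCircle

/-- The point `e^{2 π i t}` of the unit circle. -/
noncomputable def rot (t : UnitAddCircle) : ℂ := (AddCircle.toCircle t : ℂ)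

theorem continuous_rot : Continuous rot :=
  continuous_subtype_val.comp AddCircle.continuous_toCircle

@[fun_prop]
theorem measurable_rot : Measurable rot := continuous_rot.measurable

@[simp]
theorem norm_rot (t : UnitAddCircle) : ‖rot t‖ = 1 := Circle.norm_coe _

theorem rot_add (s t : UnitAddCircle) : rot (s + t) = rot s * rot t := by
  simp [rot, AddCircle.toCircle_add]

theorem exists_rot (z : ℂ) : ∃ t, z = rot t * ‖z‖ := by
  by_cases hz : z = 0
  · exact ⟨0, by simp [hz]⟩
  have h : ‖z / ‖z‖‖ = 1 := by simp [hz]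
  obtain ⟨t, ht⟩ := (AddCircle.homeomorphCircle (T := 1) one_ne_zero).surjective
    ⟨z / ‖z‖, by simpa [Submonoid.unitSphere] using h⟩
  refine ⟨t, ?_⟩
  have h1 : rot t = z / ‖z‖ := by
    rw [AddCircle.homeomorphCircle_apply] at ht
    exact congrArg Subtype.val ht
  rw [h1, div_mul_cancel₀]
  exact_mod_cast norm_ne_zero_iff.2 hz

theorem rot_pow_mul_conj_pow (t : UnitAddCircle) (n m : ℕ) :
    rot t ^ n * conj (rot t) ^ m = fourier ((n : ℤ) - m) t := by
  rw [fourier_apply, AddCircle.toCircle_zsmul, Circle.coe_zpow]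
  have h : conj (rot t) = (rot t)⁻¹ := by
    rw [rot, ← Circle.coe_inv_eq_conj, Circle.coe_inv]
  have h0 : (AddCircle.toCircle t : ℂ) ≠ 0 := Circle.coe_ne_zero _
  rw [h, rot, zpow_sub₀ h0, inv_pow, div_eq_mul_inv]
  simp

theorem integral_rot_pow_mul_conj_pow (n m : ℕ) :
    ∫ t, rot t ^ n * conj (rot t) ^ m ∂circleMeasure = if n = m then 1 else 0 := by
  simp only [rot_pow_mul_conj_pow]
  split_ifs with h
  · simp [h]
  · have h1 : (n : ℤ) - m ≠ 0 := sub_ne_zero.2 (by exact_mod_cast h)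
    exact integral_eq_zero_of_add_right_eq_neg (fourier_add_half_inv_index h1 one_pos)

variable {μ : Measure ℂ}

/-- Tonelli's theorem: a rotation invariant measure may be integrated circle by circle, where
Fourier analysis applies. -/
theorem lintegral_eq_lintegral_rot [SFinite μ] (hμ : ∀ u : Circle, μ.map (fun z : ℂ => u * z) = μ)
    {F : ℂ → ℝ≥0∞} (hF : Measurable F) :
    ∫⁻ z, F z ∂μ = ∫⁻ z, ∫⁻ t, F (rot t * z) ∂circleMeasure ∂μ := by
  rw [lintegral_lintegral_swap]
  · have h : ∀ t, ∫⁻ z, F (rot t * z) ∂μ = ∫⁻ z, F z ∂μ := fun t => by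
      conv_rhs => rw [← hμ (AddCircle.toCircle t)]
      rw [lintegral_map hF (by fun_prop)]
      rfl
    simp [h]
  · exact (hF.comp (by fun_prop : Measurable fun p : ℂ × UnitAddCircle =>
      rot p.2 * p.1)).aemeasurable

theorem integral_eq_integral_rot [SFinite μ] (hμ : ∀ u : Circle, μ.map (fun z : ℂ => u * z) = μ)
    {F : ℂ → ℂ} (hF : Measurable F) (hi : Integrable F μ) :
    ∫ z, F z ∂μ = ∫ z, ∫ t, F (rot t * z) ∂circleMeasure ∂μ := by
  rw [integral_integral_swap]
  · have h : ∀ t, ∫ z, F (rot t * z) ∂μ = ∫ z, F z ∂μ := fun t => by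
      conv_rhs => rw [← hμ (AddCircle.toCircle t)]
      rw [integral_map (by fun_prop) hF.aestronglyMeasurable]
      rfl
    simp [h]
  · have hm : Measurable (Function.uncurry fun (z : ℂ) (t : UnitAddCircle) => F (rot t * z)) :=
      hF.comp (by fun_prop : Measurable fun p : ℂ × UnitAddCircle => rot p.2 * p.1)
    refine ⟨hm.aestronglyMeasurable, ?_⟩
    rw [hasFiniteIntegral_iff_enorm, lintegral_prod _ hm.enorm.aemeasurable]
    have := lintegral_eq_lintegral_rot hμ hF.enorm
    simp only [Function.uncurry_apply_pair]
    rw [← this]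
    exact hi.2

/-- A power series is determined by its sum on an interval `(0, δ)`. -/
theorem eq_zero_of_hasSum_pow {b : ℕ → ℂ} {δ : ℝ} (hδ : 0 < δ)
    (h : ∀ r : ℝ, 0 < r → r < δ → HasSum (fun m => b m * (r : ℂ) ^ m) 0) (m : ℕ) : b m = 0 := by
  induction m using Nat.strong_induction_on with
  | _ m ih =>
    have h1 : ∀ r : ℝ, 0 < r → r < δ → HasSum (fun j => b (j + m) * (r : ℂ) ^ j) 0 := by
      intro r hr hr'
      have h2 := (hasSum_nat_add_iff' m).2 (h r hr hr')
      rw [Finset.sum_eq_zero (fun j hj => by rw [ih j (Finset.mem_range.1 hj), zero_mul]),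
        sub_zero] at h2
      have h3 := h2.mul_right ((r : ℂ) ^ m)⁻¹
      rw [zero_mul] at h3
      refine h3.of_eq fun j => ?_
      have : (r : ℂ) ^ m ≠ 0 := pow_ne_zero _ (by exact_mod_cast hr.ne')
      rw [pow_add]
      field_simp
    have hs : Summable fun j => ‖b (j + m)‖ * (δ / 2) ^ j := by
      have := (h1 (δ / 2) (by linarith) (by linarith)).summable.norm
      simpa [abs_of_pos hδ] using this
    -- After removal of the lower coefficients and division by `r ^ m` the sum is still zero for `r
    -- > 0`. It is continuous up to `r = 0`, where its value is `b m`.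
    have hc : ContinuousOn (fun r : ℝ => ∑' j, b (j + m) * (r : ℂ) ^ j) (Set.Icc 0 (δ / 2)) := by
      refine continuousOn_tsum (fun j => by fun_prop) hs fun j r hr => ?_
      rw [norm_mul, norm_pow, Complex.norm_real, Real.norm_eq_abs, abs_of_nonneg hr.1]
      gcongr
      exacts [hr.1, hr.2]
    have h0 : (∑' j, b (j + m) * ((0 : ℝ) : ℂ) ^ j) = b m := by
      rw [tsum_eq_single 0 fun j hj => by simp [hj]]
      simp
    have ht := (hc 0 ⟨le_rfl, by linarith⟩).tendsto
    simp only [h0] at ht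
    have ht' : Filter.Tendsto (fun r : ℝ => ∑' j, b (j + m) * (r : ℂ) ^ j)
        (nhdsWithin 0 (Set.Ioo 0 (δ / 2))) (nhds (b m)) :=
      ht.mono_left (nhdsWithin_mono _ Set.Ioo_subset_Icc_self)
    have hz : Filter.Tendsto (fun r : ℝ => ∑' j, b (j + m) * (r : ℂ) ^ j)
        (nhdsWithin 0 (Set.Ioo 0 (δ / 2))) (nhds 0) := by
      refine tendsto_const_nhds.congr' ?_
      filter_upwards [self_mem_nhdsWithin] with r hr
      exact (h1 r hr.1 (by linarith [hr.2])).tsum_eq.symm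
    have : (nhdsWithin (0 : ℝ) (Set.Ioo 0 (δ / 2))).NeBot :=
      left_nhdsWithin_Ioo_neBot (by linarith)
    exact tendsto_nhds_unique ht' hz

/-- The Taylor coefficients at `0`. -/
noncomputable def taylorCoeff (f : ℂ → ℂ) (n : ℕ) : ℂ := (n.factorial : ℂ)⁻¹ * iteratedDeriv n f 0

theorem exists_norm_lt_mem_geomDomain {ε : ℝ} {z : ℂ} (hz : z ∈ geomDomain ε) :
    ∃ r : ℝ, ‖z‖ < r ∧ (r : ℂ) ∈ geomDomain ε := by
  have ho : IsOpen {x : ℝ | 0 < 1 + ε * x ^ 2} := isOpen_lt continuous_const (by fun_prop)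
  have hm : ∀ᶠ x in nhdsWithin ‖z‖ (Set.Ioi ‖z‖), x ∈ {x : ℝ | 0 < 1 + ε * x ^ 2} :=
    nhdsWithin_le_nhds (ho.mem_nhds hz)
  obtain ⟨r, hr, hr'⟩ := (hm.and self_mem_nhdsWithin).exists
  exact ⟨r, hr', by simpa [geomDomain] using hr⟩

theorem hasSum_taylorCoeff {ε : ℝ} {f : ℂ → ℂ} (hf : DifferentiableOn ℂ f (geomDomain ε)) {z : ℂ}
    (hz : z ∈ geomDomain ε) : HasSum (fun n => taylorCoeff f n * z ^ n) (f z) := by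
  obtain ⟨r, hr, hr'⟩ := exists_norm_lt_mem_geomDomain hz
  have hr0 : 0 ≤ r := (norm_nonneg z).trans hr.le
  have h := Complex.hasSum_taylorSeries_on_ball (c := 0) (r := r) (hf.mono fun w hw =>
    mem_geomDomain_of_norm_le hr' (by
      rw [Complex.norm_real, Real.norm_eq_abs, abs_of_nonneg hr0]
      exact (mem_ball_zero_iff.1 hw).le)) (mem_ball_zero_iff.2 hr)
  refine h.of_eq fun n => ?_
  simp only [taylorCoeff, sub_zero, smul_eq_mul]
  ring

theorem rot_mul_mem_geomDomain {ε : ℝ} {z : ℂ} (hz : z ∈ geomDomain ε) (t : UnitAddCircle) :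
    rot t * z ∈ geomDomain ε := mem_geomDomain_of_norm_le hz (by simp)

/-- Cauchy's formula for the coefficients, on circles around `0`. -/
theorem integral_rot_mul_conj_pow {ε : ℝ} {f : ℂ → ℂ} (hf : DifferentiableOn ℂ f (geomDomain ε))
    {z : ℂ} (hz : z ∈ geomDomain ε) (n : ℕ) :
    ∫ t, f (rot t * z) * conj (rot t * z) ^ n ∂circleMeasure =
      taylorCoeff f n * (‖z‖ : ℂ) ^ (2 * n) := by
  have hs : ∀ t, HasSum (fun m => taylorCoeff f m * z ^ m * conj z ^ n *
      (rot t ^ m * conj (rot t) ^ n)) (f (rot t * z) * conj (rot t * z) ^ n) := fun t => by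
    have := (hasSum_taylorCoeff hf (rot_mul_mem_geomDomain hz t)).mul_right
      (conj (rot t * z) ^ n)
    refine this.of_eq fun m => ?_
    rw [map_mul, mul_pow, mul_pow]
    ring
  have hnorm : ∀ m t, ‖taylorCoeff f m * z ^ m * conj z ^ n * (rot t ^ m * conj (rot t) ^ n)‖ =
      ‖taylorCoeff f m * z ^ m‖ * ‖z‖ ^ n := fun m t => by simp
  have hi : ∀ m, Integrable (fun t => taylorCoeff f m * z ^ m * conj z ^ n *
      (rot t ^ m * conj (rot t) ^ n)) circleMeasure := fun m => by
    refine Integrable.of_bound ?_ (‖taylorCoeff f m * z ^ m‖ * ‖z‖ ^ n)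
      (Filter.Eventually.of_forall fun t => (hnorm m t).le)
    exact Measurable.aestronglyMeasurable (by fun_prop)
  have h := hasSum_integral_of_summable_integral_norm hi (by
    simp only [hnorm]
    simpa using (hasSum_taylorCoeff hf hz).summable.norm.mul_right (‖z‖ ^ n))
  have h2 : ∫ t, f (rot t * z) * conj (rot t * z) ^ n ∂circleMeasure =
      ∫ t, ∑' m, taylorCoeff f m * z ^ m * conj z ^ n * (rot t ^ m * conj (rot t) ^ n)
        ∂circleMeasure := integral_congr_ae (Filter.Eventually.of_forall fun t => (hs t).tsum_eq.symm)
  rw [h2, ← h.tsum_eq]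
  simp only [integral_const_mul, integral_rot_pow_mul_conj_pow]
  rw [tsum_eq_single n fun m hm => by simp [hm]]
  simp only [if_true, mul_one]
  rw [mul_assoc, ← mul_pow, Complex.mul_conj, Complex.normSq_eq_norm_sq, pow_mul]
  push_cast
  rfl

/-- Bessel's inequality for the coefficients, on circles around `0`. -/
theorem enorm_taylorCoeff_sq_le {ε : ℝ} {f : ℂ → ℂ} (hf : DifferentiableOn ℂ f (geomDomain ε))
    {z : ℂ} (hz : z ∈ geomDomain ε) (n : ℕ) :
    ‖taylorCoeff f n‖ₑ ^ 2 * ‖z‖ₑ ^ (2 * n) ≤ ∫⁻ t, ‖f (rot t * z)‖ₑ ^ 2 ∂circleMeasure := by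
  by_cases h0 : ‖z‖ₑ ^ n = 0
  · have : ‖z‖ₑ ^ (2 * n) = 0 := by rw [mul_comm, pow_mul, h0]; simp
    simp [this]
  have hcont : Continuous fun t => f (rot t * z) :=
    hf.continuousOn.comp_continuous (continuous_rot.mul continuous_const)
      fun t => rot_mul_mem_geomDomain hz t
  have h1 : ‖taylorCoeff f n‖ₑ * ‖z‖ₑ ^ n ≤ ∫⁻ t, ‖f (rot t * z)‖ₑ ∂circleMeasure := by
    have h2 := enorm_integral_le_lintegral_enorm (μ := circleMeasure)
      fun t => f (rot t * z) * conj (rot t * z) ^ n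
    rw [integral_rot_mul_conj_pow hf hz n] at h2
    have h3 : ∀ t, ‖f (rot t * z) * conj (rot t * z) ^ n‖ₑ = ‖f (rot t * z)‖ₑ * ‖z‖ₑ ^ n :=
      fun t => by
        have : ‖conj (rot t * z)‖ₑ = ‖z‖ₑ := by
          rw [enorm_eq_nnnorm, enorm_eq_nnnorm]
          congr 1
          ext
          simp
        rw [enorm_mul, enorm_pow, this]
    simp only [h3] at h2
    rw [lintegral_mul_const _ hcont.measurable.enorm, enorm_mul, enorm_pow, two_mul, pow_add,
      ← mul_assoc] at h2
    have h4 : ‖(‖z‖ : ℂ)‖ₑ = ‖z‖ₑ := by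
      rw [enorm_eq_nnnorm, enorm_eq_nnnorm]
      congr 1
      ext
      simp
    rw [h4] at h2
    exact (ENNReal.mul_le_mul_iff_left h0 (by simp)).1 h2
  -- Cauchy's formula bounds the coefficient by an L¹ mean over the circle; Haar measure is a
  -- probability measure, so the L² mean is at least as large.
  have h5 : eLpNorm (fun t => f (rot t * z)) 1 circleMeasure ≤
      eLpNorm (fun t => f (rot t * z)) 2 circleMeasure :=
    eLpNorm_le_eLpNorm_of_exponent_le (by norm_num) hcont.aestronglyMeasurable
  rw [eLpNorm_one_eq_lintegral_enorm] at h5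
  have h6 : eLpNorm (fun t => f (rot t * z)) 2 circleMeasure ^ 2 =
      ∫⁻ t, ‖f (rot t * z)‖ₑ ^ 2 ∂circleMeasure := by
    have := eLpNorm_nnreal_pow_eq_lintegral (μ := circleMeasure) (f := fun t => f (rot t * z))
      (p := 2) (by norm_num)
    simpa using this
  rw [← h6]
  calc _ = (‖taylorCoeff f n‖ₑ * ‖z‖ₑ ^ n) ^ 2 := by rw [mul_pow, ← pow_mul, mul_comm 2 n]
    _ ≤ _ := by gcongr; exact h1.trans h5

end Rotation

/-! ## Rotation invariant kernels are power series in `z w̄` -/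

section Radial

/-- The diagonal `∑ k, |φ k z|²` of `seriesKernel φ`, with values in `[0, ∞]`. -/
noncomputable def kernelDiag {Ω ι : Type*} (φ : ι → Ω → ℂ) (z : Ω) : ℝ≥0∞ := ∑' k, ‖φ k z‖ₑ ^ 2

theorem ofReal_norm_sq (z : ℂ) : ENNReal.ofReal (‖z‖ ^ 2) = ‖z‖ₑ ^ 2 := by
  rw [ENNReal.ofReal_pow (norm_nonneg _), ofReal_norm]

theorem kernelDiag_eq_ofReal {Ω ι : Type*} {φ : ι → Ω → ℂ} {z : Ω}
    (h : Summable fun k => ‖φ k z‖ ^ 2) : kernelDiag φ z = ENNReal.ofReal (∑' k, ‖φ k z‖ ^ 2) := by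
  rw [ENNReal.ofReal_tsum_of_nonneg (fun k => by positivity) h]
  simp only [kernelDiag, ofReal_norm_sq]

theorem hasSum_seriesKernel {Ω ι : Type*} {φ : ι → Ω → ℂ}
    (h : ∀ z, Summable fun k => ‖φ k z‖ ^ 2) (z w : Ω) :
    HasSum (fun k => φ k z * conj (φ k w)) (seriesKernel φ z w) := by
  refine Summable.hasSum (Summable.of_norm_bounded ((h z).add (h w)) fun k => ?_)
  rw [norm_mul, Complex.norm_conj]
  nlinarith [sq_nonneg (‖φ k z‖ - ‖φ k w‖), sq_nonneg ‖φ k z‖, sq_nonneg ‖φ k w‖]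

theorem isPSDKernel_seriesKernel {Ω ι : Type*} {φ : ι → Ω → ℂ}
    (h : ∀ z, Summable fun k => ‖φ k z‖ ^ 2) : IsPSDKernel (seriesKernel φ) :=
  IsPSDKernel.of_hasSum φ (hasSum_seriesKernel h)

theorem seriesKernel_self {Ω ι : Type*} {φ : ι → Ω → ℂ}
    (h : ∀ z, Summable fun k => ‖φ k z‖ ^ 2) (z : Ω) :
    seriesKernel φ z z = ((∑' k, ‖φ k z‖ ^ 2 : ℝ) : ℂ) := by
  refine (hasSum_seriesKernel h z z).unique ?_
  refine ((h z).hasSum.mapL Complex.ofRealCLM).of_eq fun k => ?_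
  rw [Complex.mul_conj, Complex.normSq_eq_norm_sq]
  rfl

theorem ofReal_seriesKernel_self {Ω ι : Type*} {φ : ι → Ω → ℂ}
    (h : ∀ z, Summable fun k => ‖φ k z‖ ^ 2) (z : Ω) :
    ENNReal.ofReal (seriesKernel φ z z).re = kernelDiag φ z := by
  rw [seriesKernel_self h, kernelDiag_eq_ofReal (h z), Complex.ofReal_re]

theorem measurable_kernelDiag {Ω ι : Type*} [MeasurableSpace Ω] [Countable ι] {φ : ι → Ω → ℂ}
    (hm : ∀ k, Measurable (φ k)) : Measurable (kernelDiag φ) :=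
  Measurable.tsum fun k => (hm k).enorm.pow_const 2

theorem measurable_seriesKernel {Ω ι : Type*} [MeasurableSpace Ω] [Countable ι] {φ : ι → Ω → ℂ}
    (hm : ∀ k, Measurable (φ k)) (h : ∀ z, Summable fun k => ‖φ k z‖ ^ 2) :
    Measurable (Function.uncurry (seriesKernel φ)) := by
  refine measurable_of_tendsto_metrizable' (Filter.atTop : Filter (Finset ι))
    (f := fun s p => ∑ k ∈ s, φ k p.1 * conj (φ k p.2)) (fun s => ?_) ?_
  · have : Measurable (conj : ℂ → ℂ) := Complex.continuous_conj.measurable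
    exact Finset.measurable_sum _ fun k _ => ((hm k).comp measurable_fst).mul
      (this.comp ((hm k).comp measurable_snd))
  · rw [tendsto_pi_nhds]
    exact fun p => hasSum_seriesKernel h p.1 p.2

/-- Since `μ` and `κ μ` are both invariant, `κ` and its rotation are densities of the same measure
with respect to `μ`, and densities are unique almost everywhere. -/
theorem kernelDiag_rot_ae_eq {μ : Measure ℂ} [SigmaFinite μ]
    (hμ : ∀ u : Circle, μ.map (fun z : ℂ => u * z) = μ) {κ : ℂ → ℝ≥0∞} (hκ : Measurable κ)
    (hν : ∀ u : Circle, (μ.withDensity κ).map (fun z : ℂ => u * z) = μ.withDensity κ)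
    (u : Circle) : (fun z : ℂ => κ (u * z)) =ᵐ[μ] κ := by
  have hu : Measurable fun z : ℂ => (u : ℂ) * z := by fun_prop
  refine (withDensity_eq_iff_of_sigmaFinite (hκ.comp hu).aemeasurable hκ.aemeasurable).1 ?_
  ext A hA
  have hB : MeasurableSet ((fun z : ℂ => ((u⁻¹ : Circle) : ℂ) * z) ⁻¹' A) :=
    (by fun_prop : Measurable fun z : ℂ => ((u⁻¹ : Circle) : ℂ) * z) hA
  set B := (fun z : ℂ => ((u⁻¹ : Circle) : ℂ) * z) ⁻¹' A with hBdef
  have hAB : A = (fun z : ℂ => (u : ℂ) * z) ⁻¹' B := by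
    ext z
    have : ((u⁻¹ : Circle) : ℂ) * ((u : ℂ) * z) = z := by
      rw [← mul_assoc, ← Circle.coe_mul]
      simp
    simp only [hBdef, Set.mem_preimage, this]
  rw [withDensity_apply _ hA]
  conv_lhs => rw [hAB]
  have h1 := setLIntegral_map (μ := μ) hB hκ hu
  simp only [Function.comp_apply]
  rw [← h1, hμ u, ← withDensity_apply _ hB, ← hν u, Measure.map_apply hu hB, ← hAB, hν u]

variable {ι : Type*} [Countable ι] {ε : ℝ} {φ : ι → ℂ → ℂ} {μ : Measure ℂ}

/-- A Cauchy estimate for the whole sequence `φ k` at once. The diagonal is constant on circles only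
almost everywhere, so Fubini's theorem selects a point `z` farther out than `z₀` with an almost
constant circle; there Bessel's inequality is summed over `k`. -/
theorem exists_taylorCoeff_bound [SigmaFinite μ]
    (hφ : ∀ k, DifferentiableOn ℂ (φ k) (geomDomain ε)) (hm : ∀ k, Measurable (φ k))
    (hrot : ∀ u : Circle, (fun z : ℂ => kernelDiag φ (u * z)) =ᵐ[μ] kernelDiag φ)
    (habs : volume.restrict (geomDomain ε) ≪ μ) {z₀ : ℂ} (hz₀ : z₀ ∈ geomDomain ε) :
    ∃ z ∈ geomDomain ε, ‖z₀‖ < ‖z‖ ∧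
      ∀ n, (∑' k, ‖taylorCoeff (φ k) n‖ₑ ^ 2) * ‖z‖ₑ ^ (2 * n) ≤ kernelDiag φ z := by
  have hκ := measurable_kernelDiag hm
  have hae : ∀ᵐ z ∂μ, ∀ᵐ t ∂circleMeasure, kernelDiag φ (rot t * z) = kernelDiag φ z := by
    have hset : MeasurableSet {p : ℂ × UnitAddCircle |
        kernelDiag φ (rot p.2 * p.1) = kernelDiag φ p.1} :=
      measurableSet_eq_fun (hκ.comp (by fun_prop)) (hκ.comp measurable_fst)
    have := (Measure.ae_ae_comm (μ := μ) (ν := circleMeasure)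
      (p := fun z t => kernelDiag φ (rot t * z) = kernelDiag φ z) hset).2
      (Filter.Eventually.of_forall fun t => hrot (AddCircle.toCircle t))
    exact this
  set V := geomDomain ε ∩ {z | ‖z₀‖ < ‖z‖} with hV
  have hVo : IsOpen V := (isOpen_geomDomain ε).inter (isOpen_lt continuous_const continuous_norm)
  have hVne : V.Nonempty := by
    obtain ⟨r, hr, hr'⟩ := exists_norm_lt_mem_geomDomain hz₀
    refine ⟨r, hr', ?_⟩
    change ‖z₀‖ < ‖(r : ℂ)‖
    rwa [Complex.norm_real, Real.norm_eq_abs, abs_of_nonneg ((norm_nonneg z₀).trans hr.le)]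
  have hVpos : μ V ≠ 0 := fun h => by
    have h1 := habs h
    rw [Measure.restrict_apply hVo.measurableSet, Set.inter_eq_left.2 Set.inter_subset_left] at h1
    exact (hVo.measure_pos volume hVne).ne' h1
  obtain ⟨z, hzV, hz⟩ : ∃ z ∈ V, ∀ᵐ t ∂circleMeasure, kernelDiag φ (rot t * z) = kernelDiag φ z := by
    by_contra! hcon
    refine hVpos (measure_mono_null (fun z hz => ?_) hae)
    simpa using hcon z hz
  refine ⟨z, hzV.1, hzV.2, fun n => ?_⟩
  calc (∑' k, ‖taylorCoeff (φ k) n‖ₑ ^ 2) * ‖z‖ₑ ^ (2 * n)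
      = ∑' k, ‖taylorCoeff (φ k) n‖ₑ ^ 2 * ‖z‖ₑ ^ (2 * n) := ENNReal.tsum_mul_right.symm
    _ ≤ ∑' k, ∫⁻ t, ‖φ k (rot t * z)‖ₑ ^ 2 ∂circleMeasure :=
        ENNReal.tsum_le_tsum fun k => enorm_taylorCoeff_sq_le (hφ k) hzV.1 n
    _ = ∫⁻ t, kernelDiag φ (rot t * z) ∂circleMeasure := by
        unfold kernelDiag
        rw [lintegral_tsum]
        intro k
        have : Measurable fun t => φ k (rot t * z) := (hm k).comp (by fun_prop)
        exact (this.enorm.pow_const 2).aemeasurable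
    _ = ∫⁻ t, kernelDiag φ z ∂circleMeasure := lintegral_congr_ae hz
    _ = kernelDiag φ z := by simp

/-- The sequence of the functions `φ k`, as an analytic function with values in `ℓ²`. -/
theorem exists_lp_expansion [SigmaFinite μ]
    (hφ : ∀ k, DifferentiableOn ℂ (φ k) (geomDomain ε)) (hm : ∀ k, Measurable (φ k))
    (hs : ∀ z, Summable fun k => ‖φ k z‖ ^ 2)
    (hrot : ∀ u : Circle, (fun z : ℂ => kernelDiag φ (u * z)) =ᵐ[μ] kernelDiag φ)
    (habs : volume.restrict (geomDomain ε) ≪ μ) :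
    ∃ (a : ℕ → lp (fun _ : ι => ℂ) 2) (Φ : ℂ → lp (fun _ : ι => ℂ) 2),
      (∀ z ∈ geomDomain ε, Summable fun n => ‖a n‖ * ‖z‖ ^ n) ∧
      (∀ z ∈ geomDomain ε, HasSum (fun n => z ^ n • a n) (Φ z)) ∧
      ∀ z ∈ geomDomain ε, ∀ k, Φ z k = φ k z := by
  have hbound := fun z₀ (h : z₀ ∈ geomDomain ε) => exists_taylorCoeff_bound hφ hm hrot habs h
  have hfin : ∀ z, kernelDiag φ z ≠ ∞ := fun z => by
    rw [kernelDiag_eq_ofReal (hs z)]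
    exact ENNReal.ofReal_ne_top
  have hcoef : ∀ n, (∑' k, ‖taylorCoeff (φ k) n‖ₑ ^ 2) ≠ ∞ := fun n h => by
    obtain ⟨z, hz, hz0, hb⟩ := hbound 0 (zero_mem_geomDomain ε)
    have := hb n
    rw [h, ENNReal.top_mul (pow_ne_zero _ (by simpa using hz0)), top_le_iff] at this
    exact hfin z this
  have hmem : ∀ n, Memℓp (fun k => taylorCoeff (φ k) n) 2 := fun n => by
    refine memℓp_gen ?_
    have h1 := hcoef n
    simp only [← ofReal_norm_sq] at h1
    have h2 := ENNReal.summable_toReal h1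
    refine h2.congr fun k => ?_
    rw [ENNReal.toReal_ofReal (by positivity)]
    simp
  let a : ℕ → lp (fun _ : ι => ℂ) 2 := fun n => ⟨fun k => taylorCoeff (φ k) n, hmem n⟩
  have hnorm : ∀ n, ENNReal.ofReal (‖a n‖ ^ 2) = ∑' k, ‖taylorCoeff (φ k) n‖ₑ ^ 2 := fun n => by
    have h1 := lp.norm_rpow_eq_tsum (p := 2) (by norm_num) (a n)
    have h3 := lp.hasSum_norm (p := 2) (by norm_num) (a n)
    simp only [ENNReal.toReal_ofNat, Real.rpow_ofNat] at h1 h3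
    rw [h1, ENNReal.ofReal_tsum_of_nonneg (fun k => by positivity) h3.summable]
    exact tsum_congr fun k => ofReal_norm_sq _
  have hsum : ∀ z ∈ geomDomain ε, Summable fun n => ‖a n‖ * ‖z‖ ^ n := by
    intro z₀ hz₀
    obtain ⟨z, hz, hzz, hb⟩ := hbound z₀ hz₀
    have hz0 : 0 < ‖z‖ := (norm_nonneg _).trans_lt hzz
    -- The estimate `‖a n‖ ≤ M / ‖z‖ ^ n` at a radius larger than `‖z₀‖` gives geometric convergence
    -- at `z₀`.
    set M := Real.sqrt (kernelDiag φ z).toReal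
    have hM : ∀ n, ‖a n‖ * ‖z‖ ^ n ≤ M := fun n => by
      refine Real.le_sqrt_of_sq_le ?_
      have h1 := hb n
      rw [← hnorm, ← ofReal_norm, ← ENNReal.ofReal_pow (norm_nonneg _),
        ← ENNReal.ofReal_mul (by positivity)] at h1
      have h2 := (ENNReal.ofReal_le_iff_le_toReal (hfin z)).1 h1
      rwa [mul_pow, ← pow_mul, mul_comm n 2]
    have hr : ‖z₀‖ / ‖z‖ < 1 := (div_lt_one hz0).2 hzz
    refine Summable.of_nonneg_of_le (fun n => by positivity) (fun n => ?_)
      ((summable_geometric_of_lt_one (by positivity) hr).mul_left M)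
    calc ‖a n‖ * ‖z₀‖ ^ n = (‖a n‖ * ‖z‖ ^ n) * (‖z₀‖ / ‖z‖) ^ n := by
          rw [div_pow]
          field_simp
      _ ≤ _ := by gcongr; exact hM n
  have hsum' : ∀ z ∈ geomDomain ε, Summable fun n => z ^ n • a n := fun z hz => by
    refine Summable.of_norm ((hsum z hz).congr fun n => ?_)
    rw [norm_smul, norm_pow, mul_comm]
  refine ⟨a, fun z => ∑' n, z ^ n • a n, hsum, fun z hz => (hsum' z hz).hasSum, fun z hz k => ?_⟩
  have h1 := (hsum' z hz).hasSum.mapL (lp.evalCLM ℂ (fun _ : ι => ℂ) 2 k)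
  refine h1.unique ?_
  refine (hasSum_taylorCoeff (hφ k) hz).of_eq fun n => ?_
  rw [map_smul]
  exact mul_comm _ _

/-- If the diagonal of the kernel is invariant under rotations, then the kernel is a power series in
`z w̄`. -/
theorem exists_radial_expansion [SigmaFinite μ]
    (hφ : ∀ k, DifferentiableOn ℂ (φ k) (geomDomain ε)) (hm : ∀ k, Measurable (φ k))
    (hs : ∀ z, Summable fun k => ‖φ k z‖ ^ 2)
    (hrot : ∀ u : Circle, (fun z : ℂ => kernelDiag φ (u * z)) =ᵐ[μ] kernelDiag φ)
    (habs : volume.restrict (geomDomain ε) ≪ μ) :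
    ∃ A : ℕ → ℝ, (∀ n, 0 ≤ A n) ∧ ∀ z ∈ geomDomain ε, ∀ w ∈ geomDomain ε,
      HasSum (fun n => (A n : ℂ) * (z * conj w) ^ n) (seriesKernel φ z w) := by
  obtain ⟨a, Φ, hsum, hΦ, hcoord⟩ := exists_lp_expansion hφ hm hs hrot habs
  have hinner : ∀ z ∈ geomDomain ε, ∀ w ∈ geomDomain ε,
      inner ℂ (Φ w) (Φ z) = seriesKernel φ z w := fun z hz w hw => by
    refine (lp.hasSum_inner (𝕜 := ℂ) (Φ w) (Φ z)).unique ?_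
    refine (hasSum_seriesKernel hs z w).of_eq fun k => ?_
    rw [hcoord z hz, hcoord w hw]
    simp
  have hdiag : ∀ z ∈ geomDomain ε, kernelDiag φ z = ENNReal.ofReal (‖Φ z‖ ^ 2) := fun z hz => by
    rw [← ofReal_seriesKernel_self hs, ← hinner z hz z hz, inner_self_eq_norm_sq_to_K]
    norm_cast
  have hcont : ContinuousOn Φ (geomDomain ε) := by
    intro z hz
    obtain ⟨r, hr, hr'⟩ := exists_norm_lt_mem_geomDomain hz
    have hr0 : 0 ≤ r := (norm_nonneg z).trans hr.le
    have hball : ∀ w ∈ Metric.ball (0 : ℂ) r, w ∈ geomDomain ε := fun w hw =>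
      mem_geomDomain_of_norm_le hr' (by
        rw [Complex.norm_real, Real.norm_eq_abs, abs_of_nonneg hr0]
        exact (mem_ball_zero_iff.1 hw).le)
    have h1 : ContinuousOn (fun w => ∑' n, w ^ n • a n) (Metric.ball (0 : ℂ) r) := by
      refine continuousOn_tsum (u := fun n => ‖a n‖ * r ^ n) (fun n => by fun_prop) ?_ ?_
      · have := hsum r hr'
        simpa [abs_of_nonneg hr0] using this
      · intro n w hw
        rw [norm_smul, norm_pow, mul_comm]
        gcongr
        exact (mem_ball_zero_iff.1 hw).le
    have h2 : ContinuousOn Φ (Metric.ball (0 : ℂ) r) :=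
      h1.congr fun w hw => (hΦ w (hball w hw)).tsum_eq.symm
    exact (h2.continuousAt (Metric.isOpen_ball.mem_nhds (mem_ball_zero_iff.2 hr))).continuousWithinAt
  -- Rotation invariance holds almost everywhere for `μ`, hence for Lebesgue measure, hence
  -- everywhere by continuity of `Φ`.
  have hrotΦ : ∀ t, ∀ z ∈ geomDomain ε, ‖Φ (rot t * z)‖ ^ 2 = ‖Φ z‖ ^ 2 := by
    intro t
    have h1 : (fun z : ℂ => kernelDiag φ (rot t * z)) =ᵐ[volume.restrict (geomDomain ε)]
      kernelDiag φ := habs.ae_le (hrot (AddCircle.toCircle t))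
    have h2 : (fun z => ‖Φ (rot t * z)‖ ^ 2) =ᵐ[volume.restrict (geomDomain ε)]
        fun z => ‖Φ z‖ ^ 2 := by
      filter_upwards [h1, ae_restrict_mem (measurableSet_geomDomain ε)] with z hz hzU
      rw [hdiag z hzU, hdiag _ (rot_mul_mem_geomDomain hzU t)] at hz
      exact (ENNReal.ofReal_eq_ofReal_iff (by positivity) (by positivity)).1 hz
    refine Measure.eqOn_open_of_ae_eq h2 (isOpen_geomDomain ε) ?_ (hcont.norm.pow 2)
    refine (hcont.comp (by fun_prop) fun z hz => rot_mul_mem_geomDomain hz t).norm.pow 2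
  -- The Fourier coefficient of order `d > 0` of the constant function `t ↦ ‖Φ (rot t * x)‖²`
  -- vanishes. Expanded, it is `x ^ d` times the power series in `s = x²` with coefficients `⟪a m, a
  -- (m + d)⟫`, which are therefore zero.
  have horth : ∀ m d : ℕ, 0 < d → inner ℂ (a m) (a (m + d)) = 0 := by
    intro m d hd
    obtain ⟨r, hr, hr'⟩ := exists_norm_lt_mem_geomDomain (zero_mem_geomDomain ε)
    have hr0 : 0 < r := by simpa using hr
    refine eq_zero_of_hasSum_pow (b := fun m => inner ℂ (a m) (a (m + d))) (δ := r ^ 2)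
      (by positivity) (fun s hs0 hsr => ?_) m
    set x := Real.sqrt s with hx
    have hx0 : 0 < x := Real.sqrt_pos.2 hs0
    have hxs : x ^ 2 = s := Real.sq_sqrt hs0.le
    have hxr : x < r := by
      rw [hx, Real.sqrt_lt' hr0]
      exact hsr
    have hxU : (x : ℂ) ∈ geomDomain ε := mem_geomDomain_of_norm_le hr' (by
      simp [abs_of_pos hx0, abs_of_pos hr0, hxr.le])
    let F : ℕ × ℕ → ℂ := fun p => inner ℂ (a p.1) (a p.2) * (x : ℂ) ^ (p.1 + p.2)
    have hFs : Summable fun p => ‖F p‖ := by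
      have h1 := hsum x hxU
      have h2 := h1.mul_of_nonneg h1 (fun n => by positivity) (fun n => by positivity)
      refine Summable.of_nonneg_of_le (fun p => norm_nonneg _) (fun p => ?_) h2
      have h3 := norm_inner_le_norm (𝕜 := ℂ) (a p.1) (a p.2)
      simp only [F, norm_mul, norm_pow, Complex.norm_real, Real.norm_eq_abs, pow_add]
      calc _ ≤ (‖a p.1‖ * ‖a p.2‖) * (|x| ^ p.1 * |x| ^ p.2) := by gcongr
        _ = _ := by ring
    have hexp : ∀ t, HasSum (fun p : ℕ × ℕ => F p * (rot t ^ p.2 * conj (rot t) ^ (p.1 + d)))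
        ((‖Φ x‖ ^ 2 : ℝ) * conj (rot t) ^ d) := by
      intro t
      have htU := rot_mul_mem_geomDomain hxU t
      have hn : Summable fun p : ℕ × ℕ => F p * (rot t ^ p.2 * conj (rot t) ^ (p.1 + d)) := by
        refine Summable.of_norm (hFs.congr fun p => ?_)
        simp
      have h1 : HasSum (fun p : ℕ × ℕ => F p * (rot t ^ p.2 * conj (rot t) ^ (p.1 + d)))
          (inner ℂ (Φ (rot t * x)) (Φ (rot t * x)) * conj (rot t) ^ d) := by
        have h2 : ∀ i, HasSum (fun j => F (i, j) * (rot t ^ j * conj (rot t) ^ (i + d)))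
            (inner ℂ ((rot t * x) ^ i • a i) (Φ (rot t * x)) * conj (rot t) ^ d) := fun i => by
          have h3 := ((hΦ _ htU).mapL (innerSL ℂ ((rot t * x) ^ i • a i))).mul_right
            (conj (rot t) ^ d)
          refine h3.of_eq fun j => ?_
          simp only [F, innerSL_apply_apply, inner_smul_left, inner_smul_right, map_pow, map_mul,
            Complex.conj_ofReal]
          ring
        have h4 : HasSum (fun i => inner ℂ ((rot t * x) ^ i • a i) (Φ (rot t * x)))
            (inner ℂ (Φ (rot t * x)) (Φ (rot t * x))) := by
          have h5 := ((hΦ _ htU).mapL (innerSL ℂ (Φ (rot t * x)))).mapL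
            (Complex.conjCLE : ℂ →L[ℝ] ℂ)
          simp only [innerSL_apply_apply, ContinuousLinearEquiv.coe_coe,
            Complex.conjCLE_apply] at h5
          simpa only [inner_conj_symm] using h5
        have h6 := h4.mul_right (conj (rot t) ^ d)
        have h7 := hn.hasSum
        have h8 := h7.prod_fiberwise h2
        rwa [h8.unique h6] at h7
      have h9 : inner ℂ (Φ (rot t * x)) (Φ (rot t * x)) = ((‖Φ x‖ ^ 2 : ℝ) : ℂ) := by
        rw [inner_self_eq_norm_sq_to_K, ← hrotΦ t x hxU]
        norm_cast
      rwa [h9] at h1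
    have hint := hasSum_integral_of_summable_integral_norm (μ := circleMeasure)
      (F := fun (p : ℕ × ℕ) t => F p * (rot t ^ p.2 * conj (rot t) ^ (p.1 + d)))
      (fun p => by
        refine Integrable.of_bound (Measurable.aestronglyMeasurable (by fun_prop)) ‖F p‖
          (Filter.Eventually.of_forall fun t => ?_)
        simp)
      (by simpa using hFs)
    have hzero : ∫ t, ∑' p : ℕ × ℕ, F p * (rot t ^ p.2 * conj (rot t) ^ (p.1 + d))
        ∂circleMeasure = 0 := by
      simp only [fun t => (hexp t).tsum_eq, integral_const_mul]
      have := integral_rot_pow_mul_conj_pow 0 d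
      simp only [pow_zero, one_mul, hd.ne, if_false] at this
      rw [this, mul_zero]
    rw [hzero] at hint
    simp only [integral_const_mul, integral_rot_pow_mul_conj_pow] at hint
    have hinj : Function.Injective fun m : ℕ => (m, m + d) := fun i j h => (Prod.ext_iff.1 h).1
    have hsub := (hinj.hasSum_iff (f := fun p : ℕ × ℕ => F p * if p.2 = p.1 + d then 1 else 0)
      fun p hp => by
        rw [if_neg, mul_zero]
        exact fun h => hp ⟨p.1, Prod.ext rfl h.symm⟩).2 hint
    have hfin := hsub.mul_right ((x : ℂ) ^ d)⁻¹
    rw [zero_mul] at hfin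
    refine hfin.of_eq fun m => ?_
    have hxc : (x : ℂ) ≠ 0 := by exact_mod_cast hx0.ne'
    simp only [F, Function.comp_apply, if_true, mul_one, ← hxs]
    push_cast
    rw [← pow_mul, ← add_assoc, pow_add (x : ℂ) (m + m) d, two_mul]
    field_simp
  have horth' : ∀ m n : ℕ, m ≠ n → inner ℂ (a m) (a n) = 0 := by
    intro m n hmn
    rcases lt_or_gt_of_ne hmn with h | h
    · have := horth m (n - m) (by omega)
      rwa [Nat.add_sub_cancel' h.le] at this
    · have := horth n (m - n) (by omega)
      rw [Nat.add_sub_cancel' h.le] at this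
      rw [← inner_conj_symm, this, map_zero]
  -- Once the coefficient vectors are orthogonal, only the diagonal terms of `⟪Φ w, Φ z⟫` survive.
  refine ⟨fun n => ‖a n‖ ^ 2, fun n => by positivity, fun z hz w hw => ?_⟩
  rw [← hinner z hz w hw]
  refine ((hΦ z hz).mapL (innerSL ℂ (Φ w))).of_eq fun n => ?_
  have h1 : inner ℂ (a n) (Φ w) = w ^ n * (‖a n‖ ^ 2 : ℝ) := by
    refine ((hΦ w hw).mapL (innerSL ℂ (a n))).unique ?_
    have h2 := hasSum_single (f := fun m => innerSL ℂ (a n) (w ^ m • a m)) n fun m hm => by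
      rw [innerSL_apply_apply, inner_smul_right, horth' n m hm.symm, mul_zero]
    have h3 : innerSL ℂ (a n) (w ^ n • a n) = w ^ n * (‖a n‖ ^ 2 : ℝ) := by
      rw [innerSL_apply_apply, inner_smul_right, inner_self_eq_norm_sq_to_K]
      norm_cast
    rwa [h3] at h2
  rw [innerSL_apply_apply, inner_smul_right, ← inner_conj_symm, h1]
  simp
  ring

end Radial

/-! ## Uniqueness of the invariant measure -/

section Uniqueness

theorem map_rot_geomMeasure (ε : ℝ) (u : Circle) :
    (geomMeasure ε).map (fun z : ℂ => u * z) = geomMeasure ε := by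
  -- A square root of `u`: `mobius ε a 0` is multiplication by `a / conj a = a²`.
  set a : ℂ := ((Circle.exp (Complex.arg u / 2) : Circle) : ℂ) with ha
  have ha1 : ‖a‖ = 1 := Circle.norm_coe _
  have ha2 : a * a = u := by
    rw [ha, ← Circle.coe_mul, ← Circle.exp_add, add_halves, Circle.exp_arg]
  have ha3 : a * conj a = 1 := by
    rw [Complex.mul_conj, Complex.normSq_eq_norm_sq, ha1]
    norm_num
  have hc : conj a ≠ 0 := fun h => by simp [h] at ha3
  have h := map_mobius_geomMeasure (ε := ε) (a := a) (b := 0) (by simp [ha1])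
  convert! h using 2
  funext z
  rw [mobius, eq_div_iff (by simpa using hc)]
  simp only [map_zero, mul_zero, neg_zero, zero_mul, zero_add, add_zero]
  linear_combination a * z * ha3 - z * conj a * ha2

variable {ε : ℝ} {ν : Measure ℂ}

/-- Weil's uniqueness argument: the double integral of `H(w) F(T_w z)` over `σ` and `ν` is computed
in two ways. Invariance of `ν` under `T_w` gives the left side; invariance of `σ`, after `z` and `w`
have exchanged roles, gives the right side. Radial `F` and `H` make the exchange possible. -/
theorem lintegral_radial_comm [SFinite ν]
    (hU : ∀ᵐ z ∂ν, z ∈ geomDomain ε)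
    (htr : ∀ w ∈ geomDomain ε, ν.map (geomTranslation ε w) = ν) {F H : ℂ → ℝ≥0∞}
    (hF : Measurable F) (hH : Measurable H) (hFr : ∀ z w, ‖z‖ = ‖w‖ → F z = F w)
    (hHr : ∀ z w, ‖z‖ = ‖w‖ → H z = H w) :
    (∫⁻ w, H w ∂(geomMeasure ε)) * ∫⁻ z, F z ∂ν =
      (∫⁻ w, F w ∂(geomMeasure ε)) * ∫⁻ z, H z ∂ν := by
  have hg : Measurable fun p : ℂ × ℂ => geomTranslation ε p.1 p.2 := by
    unfold geomTranslation
    fun_prop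
  have hg' : Measurable fun p : ℂ × ℂ => geomTranslation ε (-p.1) p.2 :=
    hg.comp (by fun_prop : Measurable fun p : ℂ × ℂ => (-p.1, p.2))
  have hshift : ∀ {G : ℂ → ℝ≥0∞}, Measurable G → ∀ w ∈ geomDomain ε,
      ∫⁻ z, G (geomTranslation ε w z) ∂ν = ∫⁻ z, G z ∂ν := fun {G} hG w hw => by
    conv_rhs => rw [← htr w hw]
    rw [lintegral_map hG (measurable_geomTranslation ε w)]
  have hFg : ∀ w, Measurable fun z => F (geomTranslation ε w z) :=
    fun w => hF.comp (measurable_geomTranslation ε w)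
  have hHg : ∀ w, Measurable fun z => H (geomTranslation ε w z) :=
    fun w => hH.comp (measurable_geomTranslation ε w)
  calc (∫⁻ w, H w ∂(geomMeasure ε)) * ∫⁻ z, F z ∂ν
      = ∫⁻ w, ∫⁻ z, H w * F (geomTranslation ε w z) ∂ν ∂(geomMeasure ε) := by
        rw [← lintegral_mul_const _ hH]
        refine lintegral_congr_ae ?_
        filter_upwards [ae_mem_geomDomain ε] with w hw
        rw [lintegral_const_mul _ (hFg w), hshift hF w hw]
    _ = ∫⁻ z, ∫⁻ w, H w * F (geomTranslation ε w z) ∂(geomMeasure ε) ∂ν := by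
        refine lintegral_lintegral_swap ?_
        exact ((hH.comp measurable_fst).mul (hF.comp hg)).aemeasurable
    -- For fixed `z`, write `w = T_{-z} (T_z w)` and `F (T_w z) = F (T_z w)`, then substitute `w`
    -- for `T_z w` by invariance of `σ`.
    _ = ∫⁻ z, ∫⁻ w, H (geomTranslation ε (-w) z) * F w ∂(geomMeasure ε) ∂ν := by
        refine lintegral_congr_ae ?_
        filter_upwards [hU] with z hz
        calc ∫⁻ w, H w * F (geomTranslation ε w z) ∂(geomMeasure ε)
            = ∫⁻ w, H (geomTranslation ε (-z) (geomTranslation ε z w)) *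
                F (geomTranslation ε z w) ∂(geomMeasure ε) := by
              refine lintegral_congr_ae ?_
              filter_upwards [ae_geomTranslation_denom hz] with w hw
              rw [geomTranslation_neg hz hw, hFr _ _ (norm_geomTranslation_comm ε z w)]
          _ = ∫⁻ w, H (geomTranslation ε (-z) w) * F w ∂(geomMeasure ε) := by
              have hm : Measurable fun w => H (geomTranslation ε (-z) w) * F w := (hHg _).mul hF
              conv_rhs => rw [← map_geomTranslation hz]
              rw [lintegral_map hm (measurable_geomTranslation ε z)]
          _ = _ := by
              refine lintegral_congr fun w => ?_
              rw [hHr _ _ (norm_geomTranslation_neg ε z w)]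
    _ = ∫⁻ w, ∫⁻ z, H (geomTranslation ε (-w) z) * F w ∂ν ∂(geomMeasure ε) := by
        rw [lintegral_lintegral_swap]
        exact ((hH.comp (hg'.comp measurable_swap)).mul (hF.comp measurable_snd)).aemeasurable
    _ = (∫⁻ w, F w ∂(geomMeasure ε)) * ∫⁻ z, H z ∂ν := by
        rw [← lintegral_mul_const _ hF]
        refine lintegral_congr_ae ?_
        filter_upwards [ae_mem_geomDomain ε] with w hw
        rw [lintegral_mul_const _ (hHg _), hshift hH _ (neg_mem_geomDomain hw), mul_comm]

/-- The invariant measure is unique up to a constant. -/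
theorem eq_smul_geomMeasure [SigmaFinite ν] (hU : ∀ᵐ z ∂ν, z ∈ geomDomain ε)
    (hrot : ∀ u : Circle, ν.map (fun z : ℂ => u * z) = ν)
    (htr : ∀ w ∈ geomDomain ε, ν.map (geomTranslation ε w) = ν) :
    ∃ C : ℝ≥0∞, C ≠ ∞ ∧ ν = C • geomMeasure ε := by
  obtain ⟨r, hr, hrU⟩ := exists_norm_lt_mem_geomDomain (zero_mem_geomDomain ε)
  have hr0 : 0 < r := by simpa using hr
  set B : Set ℂ := Metric.closedBall 0 |r| with hB
  have hBm : MeasurableSet B := Metric.isClosed_closedBall.measurableSet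
  have hBlt : geomMeasure ε B ≠ ∞ := (geomMeasure_lt_top hrU).ne
  have hBpos : geomMeasure ε B ≠ 0 := by
    have h1 : 0 < geomMeasure ε (Metric.ball 0 r) := geomMeasure_pos Metric.isOpen_ball
      (fun w hw => mem_geomDomain_of_norm_le hrU (by
        simpa [abs_of_pos hr0] using (mem_ball_zero_iff.1 hw).le)) ⟨0, by simpa using hr0⟩
    refine (h1.trans_le (measure_mono ?_)).ne'
    rw [hB, abs_of_pos hr0]
    exact Metric.ball_subset_closedBall
  have key : ∀ D : Set ℂ, MeasurableSet D →
      geomMeasure ε B * ν D = geomMeasure ε D * ν B := by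
    intro D hD
    -- Averaging the indicator over rotations makes it radial and, both measures being rotation
    -- invariant, keeps its integrals.
    let F : ℂ → ℝ≥0∞ := fun z => ∫⁻ t, D.indicator 1 (rot t * z) ∂circleMeasure
    have hind : Measurable (D.indicator (1 : ℂ → ℝ≥0∞)) := measurable_one.indicator hD
    have hF : Measurable F := by
      refine Measurable.lintegral_prod_right' (f := fun p : ℂ × UnitAddCircle =>
        D.indicator (1 : ℂ → ℝ≥0∞) (rot p.2 * p.1)) ?_
      exact hind.comp (by fun_prop)
    have hFnorm : ∀ z, F z = F ‖z‖ := by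
      intro z
      obtain ⟨s, hs⟩ := exists_rot z
      have h1 : ∀ t, rot t * z = rot (t + s) * ‖z‖ := fun t => by
        rw [rot_add, mul_assoc, ← hs]
      simp only [F, h1]
      exact lintegral_add_right_eq_self (μ := circleMeasure)
        (fun t => D.indicator (1 : ℂ → ℝ≥0∞) (rot t * ‖z‖)) s
    have hFr : ∀ z w, ‖z‖ = ‖w‖ → F z = F w := fun z w h => by
      rw [hFnorm z, hFnorm w, h]
    have h := lintegral_radial_comm hU htr hF
      (measurable_one.indicator hBm : Measurable (B.indicator (1 : ℂ → ℝ≥0∞))) hFr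
      (fun z w h => by simp [Set.indicator, hB, h])
    rw [lintegral_indicator_one hBm, lintegral_indicator_one hBm] at h
    have h2 : ∫⁻ z, F z ∂ν = ν D := by
      rw [← lintegral_eq_lintegral_rot hrot hind, lintegral_indicator_one hD]
    have h3 : ∫⁻ z, F z ∂(geomMeasure ε) = geomMeasure ε D := by
      rw [← lintegral_eq_lintegral_rot (map_rot_geomMeasure ε) hind, lintegral_indicator_one hD]
    rwa [h2, h3] at h
  have hνB : ν B ≠ ∞ := by
    intro hB'
    -- Some set of finite `ν`-measure has positive `σ`-measure; for it `key` would fail if `ν B`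
    -- were infinite.
    obtain ⟨n, hn⟩ : ∃ n, geomMeasure ε (spanningSets ν n) ≠ 0 := by
      by_contra! hcon
      refine hBpos (measure_mono_null (Set.subset_univ _) ?_)
      rw [← iUnion_spanningSets ν]
      exact measure_iUnion_null hcon
    have h1 := key _ (measurableSet_spanningSets ν n)
    rw [hB', ENNReal.mul_top hn] at h1
    exact (ENNReal.mul_lt_top hBlt.lt_top (measure_spanningSets_lt_top ν n)).ne h1
  refine ⟨ν B / geomMeasure ε B, ENNReal.div_ne_top hνB hBpos, ?_⟩
  ext D hD
  rw [Measure.smul_apply, smul_eq_mul, ENNReal.div_eq_inv_mul, mul_assoc, mul_comm (ν B), ← key D hD,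
    ← mul_assoc, ENNReal.inv_mul_cancel hBpos hBlt, one_mul]

end Uniqueness

/-! ## The recursion for the coefficients of an invariant kernel -/

section Recursion

theorem hasDerivAt_tsum_pow {A : ℕ → ℝ} {r t : ℝ} (hr : Summable fun n => |A n| * r ^ n)
    (ht : |t| < r) :
    Summable (fun n => A n * (n * t ^ (n - 1))) ∧
      HasDerivAt (fun s => ∑' n, A n * s ^ n) (∑' n, A n * (n * t ^ (n - 1))) t := by
  -- An intermediate radius: for arguments of modulus below `ρ` the differentiated series is
  -- dominated by a multiple of `n (ρ / r) ^ n`.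
  obtain ⟨ρ, hρt, hρr⟩ := exists_between ht
  have hρ : 0 < ρ := (abs_nonneg t).trans_lt hρt
  have hr0 : 0 < r := hρ.trans hρr
  obtain ⟨M, hM⟩ : ∃ M, ∀ n, |A n| * r ^ n ≤ M := by
    refine ⟨∑' n, |A n| * r ^ n, fun n => ?_⟩
    exact hr.le_tsum n fun m _ => by positivity
  have hq : ‖ρ / r‖ < 1 := by
    rw [Real.norm_of_nonneg (by positivity), div_lt_one hr0]
    exact hρr
  have hu : Summable fun n : ℕ => M / ρ * ((n : ℝ) ^ 1 * (ρ / r) ^ n) :=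
    (summable_pow_mul_geometric_of_norm_lt_one 1 hq).mul_left _
  have hb : ∀ (n : ℕ) (y : ℝ), y ∈ Metric.ball (0 : ℝ) ρ →
      ‖A n * (n * y ^ (n - 1))‖ ≤ M / ρ * ((n : ℝ) ^ 1 * (ρ / r) ^ n) := by
    intro n y hy
    have hy' : |y| ≤ ρ := by simpa using (mem_ball_zero_iff.1 hy).le
    rcases n with _ | n
    · simp
    rw [norm_mul, norm_mul, norm_pow, Real.norm_eq_abs, Real.norm_eq_abs, Real.norm_eq_abs,
      Nat.add_sub_cancel, Nat.abs_cast, pow_one]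
    have h1 : |A (n + 1)| ≤ M / r ^ (n + 1) := (le_div_iff₀ (by positivity)).2 (hM _)
    have hM0 : 0 ≤ M := (by positivity : 0 ≤ |A 0| * r ^ 0).trans (hM 0)
    calc |A (n + 1)| * ((n + 1 : ℕ) * |y| ^ n)
        ≤ M / r ^ (n + 1) * ((n + 1 : ℕ) * ρ ^ n) := by gcongr
      _ = M / ρ * ((n + 1 : ℕ) * (ρ / r) ^ (n + 1)) := by
          rw [div_pow]
          field_simp
          ring
  have hmem : t ∈ Metric.ball (0 : ℝ) ρ := by simpa using hρt
  refine ⟨Summable.of_norm_bounded hu fun n => hb n t hmem, ?_⟩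
  refine hasDerivAt_tsum_of_isPreconnected (t := Metric.ball (0 : ℝ) ρ) (y₀ := 0) hu
    Metric.isOpen_ball (convex_ball _ _).isPreconnected (fun n y _ => ?_) hb
    (by simpa using hρ) ?_ hmem
  · exact (hasDerivAt_pow n y).const_mul (A n)
  · refine summable_of_ne_finset_zero (s := {0}) fun n hn => ?_
    simp [zero_pow (by simpa using hn : n ≠ 0)]

variable {ε : ℝ} {A : ℕ → ℝ} {K : ℂ → ℂ → ℂ}

theorem ofReal_mem_geomDomain {x : ℝ} : (x : ℂ) ∈ geomDomain ε ↔ 0 < 1 + ε * x ^ 2 := by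
  simp [geomDomain]

theorem geomTranslation_mem {z w : ℂ} (hz : z ∈ geomDomain ε) (hw : w ∈ geomDomain ε)
    (h : 1 - ε * conj w * z ≠ 0) : geomTranslation ε w z ∈ geomDomain ε := by
  have h1 := mobius_key ε 1 w z
  have h2 : geomTranslation ε w z = mobius ε 1 w z / 1 := by
    simp only [geomTranslation, mobius, map_one, one_mul, div_one]
    congr 1
    ring
  have h3 : 1 + ε * ‖geomTranslation ε w z‖ ^ 2 =
      (1 + ε * ‖w‖ ^ 2) * (1 + ε * ‖z‖ ^ 2) / ‖1 - ε * conj w * z‖ ^ 2 := by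
    rw [eq_div_iff (by positivity), geomTranslation, norm_div, div_pow]
    have h4 : ‖1 - ε * conj w * z‖ ^ 2 ≠ 0 := by positivity
    have h5 : -(ε * conj w) * z + conj (1 : ℂ) = 1 - ε * conj w * z := by
      rw [map_one]
      ring
    rw [h5] at h1
    simp only [one_mul, norm_one, one_pow] at h1
    rw [← h1, add_mul, one_mul, mul_assoc ε (_ / _), div_mul_cancel₀ _ h4]
  have hz' : 0 < 1 + ε * ‖z‖ ^ 2 := hz
  have hw' : 0 < 1 + ε * ‖w‖ ^ 2 := hw
  change 0 < 1 + ε * ‖geomTranslation ε w z‖ ^ 2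
  rw [h3]
  positivity

theorem kernel_ofReal
    (hA : ∀ z ∈ geomDomain ε, ∀ w ∈ geomDomain ε,
      HasSum (fun n => (A n : ℂ) * (z * conj w) ^ n) (K z w)) {x y : ℝ}
    (hx : (x : ℂ) ∈ geomDomain ε) (hy : (y : ℂ) ∈ geomDomain ε) :
    K x y = ((∑' n, A n * (x * y) ^ n : ℝ) : ℂ) := by
  rw [← (hA x hx y hy).tsum_eq, Complex.ofReal_tsum]
  exact tsum_congr fun n => by simp

theorem hasSum_kernel_ofReal
    (hA : ∀ z ∈ geomDomain ε, ∀ w ∈ geomDomain ε,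
      HasSum (fun n => (A n : ℂ) * (z * conj w) ^ n) (K z w)) {x y : ℝ}
    (hx : (x : ℂ) ∈ geomDomain ε) (hy : (y : ℂ) ∈ geomDomain ε) :
    HasSum (fun n => A n * (x * y) ^ n) (K x y).re :=
  ((hA x hx y hy).mapL Complex.reCLM).of_eq fun n => by
    simp only [Complex.reCLM_apply, Complex.conj_ofReal]
    norm_cast

theorem hasSum_kernel_diag
    (hA : ∀ z ∈ geomDomain ε, ∀ w ∈ geomDomain ε,
      HasSum (fun n => (A n : ℂ) * (z * conj w) ^ n) (K z w)) {z : ℂ} (hz : z ∈ geomDomain ε) :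
    HasSum (fun n => A n * (‖z‖ ^ 2) ^ n) (K z z).re :=
  ((hA z hz z hz).mapL Complex.reCLM).of_eq fun n => by
    rw [Complex.mul_conj, Complex.normSq_eq_norm_sq, Complex.reCLM_apply]
    norm_cast

theorem le_kernel_diag (hA0 : ∀ n, 0 ≤ A n)
    (hA : ∀ z ∈ geomDomain ε, ∀ w ∈ geomDomain ε,
      HasSum (fun n => (A n : ℂ) * (z * conj w) ^ n) (K z w)) {z : ℂ} (hz : z ∈ geomDomain ε) :
    A 0 ≤ (K z z).re := by
  have h := le_hasSum (hasSum_kernel_diag hA hz) 0 fun n _ => by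
    have := hA0 n
    positivity
  simpa using h

/-- If the two-point function depends on the distance only, the coefficients of the kernel satisfy
a first order recursion. -/
theorem coeff_recursion (hA0 : ∀ n, 0 ≤ A n) (hpos : 0 < A 0)
    (hA : ∀ z ∈ geomDomain ε, ∀ w ∈ geomDomain ε,
      HasSum (fun n => (A n : ℂ) * (z * conj w) ^ n) (K z w))
    (hinv : ∀ x y : ℝ, (x : ℂ) ∈ geomDomain ε → (y : ℂ) ∈ geomDomain ε → x ≠ y →
      1 + ε * x * y ≠ 0 → (((x - y) / (1 + ε * x * y) : ℝ) : ℂ) ∈ geomDomain ε ∧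
      normalizedKernel K x y = normalizedKernel K ((x - y) / (1 + ε * x * y) : ℝ) 0) (n : ℕ) :
    A (n + 1) * (n + 1) = A n * (A 1 / A 0 - ε * n) := by
  obtain ⟨r, hr, hrU⟩ := exists_norm_lt_mem_geomDomain (zero_mem_geomDomain ε)
  have hr0 : 0 < r := by simpa using hr
  have hdom : ∀ x : ℝ, |x| ≤ r → (x : ℂ) ∈ geomDomain ε := fun x hx =>
    mem_geomDomain_of_norm_le hrU (by simpa [abs_of_pos hr0] using hx)
  have hsum : Summable fun n => |A n| * (r ^ 2) ^ n := by
    have := (hasSum_kernel_ofReal hA hrU hrU).summable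
    simpa [abs_of_nonneg, hA0, sq] using this
  set k : ℝ → ℝ := fun t => ∑' n, A n * t ^ n with hk
  have hKk : ∀ x y : ℝ, (x : ℂ) ∈ geomDomain ε → (y : ℂ) ∈ geomDomain ε →
      K x y = (k (x * y) : ℂ) := fun x y hx hy => kernel_ofReal hA hx hy
  have hk0 : k 0 = A 0 := by
    rw [hk]
    dsimp only
    rw [tsum_eq_single 0 fun n hn => by simp [hn]]
    simp
  have hkpos : ∀ x : ℝ, (x : ℂ) ∈ geomDomain ε → 0 < k (x * x) := fun x hx => by
    have h1 := le_kernel_diag hA0 hA hx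
    rw [hKk x x hx hx, Complex.ofReal_re] at h1
    exact hpos.trans_le h1
  -- The translation that takes `y` to `0` takes `x` to `ξ = (x - y) / (1 + ε x y)`, and `K ξ 0 = K
  -- 0 0 = A 0`, so invariance of the normalized kernel becomes a functional equation for `k`.
  have hfun : ∀ x y : ℝ, (x : ℂ) ∈ geomDomain ε → (y : ℂ) ∈ geomDomain ε → x ≠ y →
      1 + ε * x * y ≠ 0 → A 0 * k (x * x) * k (y * y) =
        k (x * y) ^ 2 * k ((x - y) / (1 + ε * x * y) * ((x - y) / (1 + ε * x * y))) := by
    intro x y hx hy hxy hd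
    obtain ⟨hξ, h⟩ := hinv x y hx hy hxy hd
    set ξ := (x - y) / (1 + ε * x * y)
    have h0 : ((0 : ℝ) : ℂ) ∈ geomDomain ε := by simpa using zero_mem_geomDomain ε
    rw [← Complex.ofReal_zero] at h
    simp only [normalizedKernel, hKk _ _ hx hy, hKk _ _ hx hx, hKk _ _ hy hy, hKk _ _ hξ hξ,
      hKk _ _ hξ h0, hKk _ _ h0 h0, Complex.ofReal_re, Complex.norm_real, Real.norm_eq_abs,
      sq_abs, mul_zero, hk0] at h
    have h1 := hkpos x hx
    have h2 := hkpos y hy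
    have h3 := hkpos ξ hξ
    rw [div_eq_div_iff (by positivity) (by positivity)] at h
    refine mul_left_cancel₀ hpos.ne' ?_
    linear_combination -h
  set D : ℝ → ℝ := fun t => ∑' n, A n * (n * t ^ (n - 1)) with hD
  have hder : ∀ t, |t| < r ^ 2 → HasDerivAt k (D t) t := fun t ht => (hasDerivAt_tsum_pow hsum ht).2
  have hD0 : D 0 = A 1 := by
    rw [hD]
    dsimp only
    rw [tsum_eq_single 1 fun n hn => ?_]
    · simp
    · rcases n with _ | _ | n <;> simp at hn ⊢
  -- The functional equation is differentiated in `y` at `y = 0`. The left side has derivative zero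
  -- because `k (y²)` is stationary there; on the right `ξ' = -(1 + ε x²)`.
  have hode : ∀ x, 0 < x → x < r → A 0 * (1 + ε * (x * x)) * D (x * x) = A 1 * k (x * x) := by
    intro x hx hxr
    have hxU := hdom x (by rw [abs_of_pos hx]; exact hxr.le)
    have hxx : |x * x| < r ^ 2 := by
      rw [abs_of_pos (by positivity)]
      nlinarith
    have hL : HasDerivAt (fun y : ℝ => A 0 * k (x * x) * k (y * y)) 0 0 := by
      have h1 : HasDerivAt (fun y : ℝ => y * y) 0 0 := by
        exact ((hasDerivAt_id (0 : ℝ)).mul (hasDerivAt_id (0 : ℝ))).congr_deriv (by simp)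
      have h2 : HasDerivAt k (D (0 * 0)) ((0 : ℝ) * 0) := hder _ (by simpa using pow_pos hr0 2)
      have h3 := (HasDerivAt.comp (h := fun y : ℝ => y * y) (0 : ℝ) h2 h1).const_mul (A 0 * k (x * x))
      simpa using h3
    have hR : HasDerivAt (fun y : ℝ => k (x * y) ^ 2 *
        k ((x - y) / (1 + ε * x * y) * ((x - y) / (1 + ε * x * y))))
        (2 * A 0 * (A 1 * x) * k (x * x) +
          A 0 ^ 2 * (D (x * x) * (2 * x * (-1 - ε * x * x)))) 0 := by
      have h1 : HasDerivAt (fun y : ℝ => x * y) x 0 := by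
        simpa using (hasDerivAt_id (0 : ℝ)).const_mul x
      have h2 : HasDerivAt k (D (x * 0)) (x * 0) := hder _ (by simpa using pow_pos hr0 2)
      have h3 := (h2.comp (0 : ℝ) h1).pow 2
      have h4 : HasDerivAt (fun y : ℝ => (x - y) / (1 + ε * x * y)) (-1 - ε * x * x) 0 := by
        have hn : HasDerivAt (fun y : ℝ => x - y) (-1) 0 := by
          simpa using (hasDerivAt_id (0 : ℝ)).const_sub x
        have hd : HasDerivAt (fun y : ℝ => 1 + ε * x * y) (ε * x) 0 := by
          simpa using ((hasDerivAt_id (0 : ℝ)).const_mul (ε * x)).const_add 1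
        refine (hn.div hd (by simp)).congr_deriv ?_
        simp
        ring
      have h5 := h4.mul h4
      have h6 : HasDerivAt k (D (x * x)) ((x - 0) / (1 + ε * x * 0) *
          ((x - 0) / (1 + ε * x * 0))) := by simpa using hder _ hxx
      have h7 := h3.mul (h6.comp (0 : ℝ) h5)
      refine h7.congr_deriv ?_
      simp only [Function.comp_apply, Pi.mul_apply, Pi.pow_apply, mul_zero, sub_zero, add_zero,
        div_one, hk0, hD0]
      push_cast
      ring
    have heq : (fun y : ℝ => A 0 * k (x * x) * k (y * y)) =ᶠ[nhds 0] fun y : ℝ =>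
        k (x * y) ^ 2 * k ((x - y) / (1 + ε * x * y) * ((x - y) / (1 + ε * x * y))) := by
      have h1 : ∀ᶠ y : ℝ in nhds 0, 1 + ε * x * y ≠ 0 :=
        (by fun_prop : Continuous fun y : ℝ => 1 + ε * x * y).continuousAt.eventually_ne (by simp)
      have h2 : ∀ᶠ y : ℝ in nhds 0, x ≠ y :=
        (continuous_id.continuousAt.eventually_ne hx.ne).mono fun y hy => Ne.symm hy
      have h3 : ∀ᶠ y : ℝ in nhds 0, |y| < r :=
        continuous_abs.continuousAt.eventually_lt continuousAt_const (by simpa using hr0)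
      filter_upwards [h1, h2, h3] with y hy1 hy2 hy3
      exact hfun x y hxU (hdom y hy3.le) hy2 hy1
    have h := hL.unique (hR.congr_of_eventuallyEq heq)
    have h8 : 2 * A 0 * x * (A 0 * (1 + ε * (x * x)) * D (x * x) - A 1 * k (x * x)) = 0 := by
      linear_combination h
    have h9 : 2 * A 0 * x ≠ 0 := by positivity
    exact sub_eq_zero.1 ((mul_eq_zero.1 h8).resolve_left h9)
  -- Comparison of coefficients in `(1 + ε t) k'(t) = (A 1 / A 0) k(t)` on an interval `(0, r²)`.
  have hz : ((A (n + 1) * (n + 1) - A n * (A 1 / A 0 - ε * n) : ℝ) : ℂ) = 0 := by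
    refine eq_zero_of_hasSum_pow
      (b := fun n : ℕ => ((A (n + 1) * (n + 1) - A n * (A 1 / A 0 - ε * n) : ℝ) : ℂ))
      (δ := r ^ 2) (by positivity) (fun t ht htr => ?_) n
    have ht2 : |t| < r ^ 2 := by rwa [abs_of_pos ht]
    have hode' : A 0 * (1 + ε * t) * D t = A 1 * k t := by
      have h1 := hode (Real.sqrt t) (Real.sqrt_pos.2 ht) ((Real.sqrt_lt' hr0).2 htr)
      rwa [Real.mul_self_sqrt ht.le] at h1
    have hkt : HasSum (fun n => A n * t ^ n) (k t) := by
      refine Summable.hasSum (Summable.of_norm_bounded hsum fun n => ?_)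
      rw [norm_mul, norm_pow, Real.norm_eq_abs, Real.norm_eq_abs]
      gcongr
    have hDt : HasSum (fun n => A n * (n * t ^ (n - 1))) (D t) :=
      (hasDerivAt_tsum_pow hsum ht2).1.hasSum
    have hshift : HasSum (fun n : ℕ => A (n + 1) * ((n + 1 : ℕ) * t ^ n)) (D t) := by
      have h1 := (hasSum_nat_add_iff' (f := fun n => A n * (n * t ^ (n - 1))) 1).2 hDt
      simpa using h1
    have htD : HasSum (fun n : ℕ => A n * (n * t ^ n)) (t * D t) := by
      refine (hDt.mul_left t).of_eq fun n => ?_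
      rcases n with _ | n
      · simp
      · simp [pow_succ]
        ring
    have h1 := (hshift.add (htD.mul_left ε)).sub (hkt.mul_left (A 1 / A 0))
    have h2 : D t + ε * (t * D t) - A 1 / A 0 * k t = 0 := by
      field_simp
      linear_combination hode'
    rw [h2] at h1
    have h3 := h1.mapL Complex.ofRealCLM
    simp only [map_zero] at h3
    refine h3.of_eq fun n => ?_
    simp only [Complex.ofRealCLM_apply]
    push_cast
    ring
  have := Complex.ofReal_eq_zero.1 hz
  linarith

end Recursion

/-! ## Analytic kernels with invariant one- and two-point functions -/

section TwoPoint

/-- If `F < c < c' < G` at the point, these inequalities persist on a product of small open sets.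
The sets can be taken disjoint because `z ≠ w`, and they have positive finite measure, so their
integrals could not agree. -/
theorem le_of_setLIntegral_eq {ν : Measure ℂ} {U : Set ℂ} (hU : IsOpen U) (hfin : ν U ≠ ∞)
    (hpos : ∀ V : Set ℂ, IsOpen V → V ⊆ U → V.Nonempty → ν V ≠ 0) {F G : ℂ → ℂ → ℝ≥0∞}
    (h : ∀ V₀ V₁ : Set ℂ, IsOpen V₀ → IsOpen V₁ → V₀ ⊆ U → V₁ ⊆ U → Disjoint V₀ V₁ →
      ∫⁻ x in V₀, ∫⁻ y in V₁, F x y ∂ν ∂ν = ∫⁻ x in V₀, ∫⁻ y in V₁, G x y ∂ν ∂ν)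
    {z w : ℂ} (hz : z ∈ U) (hw : w ∈ U) (hzw : z ≠ w)
    (hF : ContinuousAt (Function.uncurry F) (z, w))
    (hG : ContinuousAt (Function.uncurry G) (z, w)) : G z w ≤ F z w := by
  by_contra! hlt
  obtain ⟨c, hc, hcG⟩ := exists_between hlt
  obtain ⟨c', hcc, hcG'⟩ := exists_between hcG
  have h1 : ∀ᶠ p in nhds (z, w), Function.uncurry F p < c := hF.eventually_lt_const hc
  have h2 : ∀ᶠ p in nhds (z, w), c' < Function.uncurry G p := hG.eventually_const_lt hcG'
  obtain ⟨A₀, hA₀, A₁, hA₁, hA⟩ := Filter.mem_prod_iff.1 (nhds_prod_eq (x := z) (y := w) ▸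
    (h1.and h2 : {p | Function.uncurry F p < c ∧ c' < Function.uncurry G p} ∈ nhds (z, w)))
  obtain ⟨B₀, B₁, hB₀, hB₁, hzB, hwB, hB⟩ := t2_separation hzw
  obtain ⟨V₀, hV₀, hV₀o, hzV⟩ := mem_nhds_iff.1
    (Filter.inter_mem hA₀ (Filter.inter_mem (hB₀.mem_nhds hzB) (hU.mem_nhds hz)))
  obtain ⟨V₁, hV₁, hV₁o, hwV⟩ := mem_nhds_iff.1
    (Filter.inter_mem hA₁ (Filter.inter_mem (hB₁.mem_nhds hwB) (hU.mem_nhds hw)))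
  have hU₀ : V₀ ⊆ U := fun x hx => (hV₀ hx).2.2
  have hU₁ : V₁ ⊆ U := fun x hx => (hV₁ hx).2.2
  have hle : ∫⁻ x in V₀, ∫⁻ y in V₁, F x y ∂ν ∂ν ≤ c * ν V₁ * ν V₀ := by
    rw [← setLIntegral_const]
    refine setLIntegral_mono' hV₀o.measurableSet fun x hx => ?_
    rw [← setLIntegral_const]
    exact setLIntegral_mono' hV₁o.measurableSet fun y hy =>
      (hA (Set.mk_mem_prod (hV₀ hx).1 (hV₁ hy).1)).1.le
  have hge : c' * ν V₁ * ν V₀ ≤ ∫⁻ x in V₀, ∫⁻ y in V₁, G x y ∂ν ∂ν := by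
    rw [← setLIntegral_const]
    refine setLIntegral_mono' hV₀o.measurableSet fun x hx => ?_
    rw [← setLIntegral_const]
    exact setLIntegral_mono' hV₁o.measurableSet fun y hy =>
      (hA (Set.mk_mem_prod (hV₀ hx).1 (hV₁ hy).1)).2.le
  rw [← h V₀ V₁ hV₀o hV₁o hU₀ hU₁ (hB.mono (fun x hx => (hV₀ hx).2.1) fun x hx => (hV₁ hx).2.1)]
    at hge
  have h3 := hge.trans hle
  rw [mul_assoc, mul_assoc] at h3
  have hm0 : ν V₁ * ν V₀ ≠ 0 :=
    mul_ne_zero (hpos _ hV₁o hU₁ ⟨w, hwV⟩) (hpos _ hV₀o hU₀ ⟨z, hzV⟩)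
  have hmt : ν V₁ * ν V₀ ≠ ∞ := ENNReal.mul_ne_top
    ((measure_mono hU₁).trans_lt hfin.lt_top).ne ((measure_mono hU₀).trans_lt hfin.lt_top).ne
  exact absurd ((ENNReal.mul_le_mul_iff_left hm0 hmt).1 h3) (not_le.2 hcc)

variable {ε : ℝ} {A : ℕ → ℝ} {K : ℂ → ℂ → ℂ}

theorem continuousAt_kernel (hA0 : ∀ n, 0 ≤ A n)
    (hA : ∀ z ∈ geomDomain ε, ∀ w ∈ geomDomain ε,
      HasSum (fun n => (A n : ℂ) * (z * conj w) ^ n) (K z w)) {z w : ℂ} (hz : z ∈ geomDomain ε)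
    (hw : w ∈ geomDomain ε) : ContinuousAt (Function.uncurry K) (z, w) := by
  obtain ⟨r, hzr, hwr, hr⟩ : ∃ r : ℝ, ‖z‖ < r ∧ ‖w‖ < r ∧ (r : ℂ) ∈ geomDomain ε := by
    obtain ⟨r₁, h1, h1'⟩ := exists_norm_lt_mem_geomDomain hz
    obtain ⟨r₂, h2, h2'⟩ := exists_norm_lt_mem_geomDomain hw
    rcases le_total r₁ r₂ with h | h
    · exact ⟨r₂, h1.trans_le h, h2, h2'⟩
    · exact ⟨r₁, h1, h2.trans_le h, h1'⟩
  have hr0 : 0 < r := (norm_nonneg z).trans_lt hzr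
  have hdom : ∀ v ∈ Metric.ball (0 : ℂ) r, v ∈ geomDomain ε := fun v hv =>
    mem_geomDomain_of_norm_le hr (by simpa [abs_of_pos hr0] using (mem_ball_zero_iff.1 hv).le)
  have hcont : ContinuousOn (fun p : ℂ × ℂ => ∑' n, (A n : ℂ) * (p.1 * conj p.2) ^ n)
      (Metric.ball (0 : ℂ) r ×ˢ Metric.ball (0 : ℂ) r) := by
    refine continuousOn_tsum (u := fun n => A n * (r * r) ^ n) (fun n => ?_)
      (hasSum_kernel_ofReal hA hr hr).summable fun n p hp => ?_
    · exact (by fun_prop : Continuous fun p : ℂ × ℂ =>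
        (A n : ℂ) * (p.1 * conj p.2) ^ n).continuousOn
    · rw [norm_mul, norm_pow, norm_mul, RCLike.norm_conj, Complex.norm_real,
        Real.norm_of_nonneg (hA0 n)]
      have h1 := (mem_ball_zero_iff.1 hp.1).le
      have h2 := (mem_ball_zero_iff.1 hp.2).le
      have := hA0 n
      gcongr
  have hnhds : Metric.ball (0 : ℂ) r ×ˢ Metric.ball (0 : ℂ) r ∈ nhds (z, w) :=
    (Metric.isOpen_ball.prod Metric.isOpen_ball).mem_nhds
      (Set.mk_mem_prod (mem_ball_zero_iff.2 hzr) (mem_ball_zero_iff.2 hwr))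
  refine (hcont.continuousAt hnhds).congr ?_
  filter_upwards [hnhds] with p hp
  exact (hA p.1 (hdom _ hp.1) p.2 (hdom _ hp.2)).tsum_eq

theorem continuousAt_normalizedKernel (hA0 : ∀ n, 0 ≤ A n) (hpos : 0 < A 0)
    (hA : ∀ z ∈ geomDomain ε, ∀ w ∈ geomDomain ε,
      HasSum (fun n => (A n : ℂ) * (z * conj w) ^ n) (K z w)) {z w : ℂ} (hz : z ∈ geomDomain ε)
    (hw : w ∈ geomDomain ε) :
    ContinuousAt (Function.uncurry fun x y => ENNReal.ofReal (1 - normalizedKernel K x y))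
      (z, w) := by
  have h0 := continuousAt_kernel hA0 hA hz hw
  have h1 : ContinuousAt (fun p : ℂ × ℂ => (K p.1 p.1).re) (z, w) :=
    Complex.continuous_re.continuousAt.comp (ContinuousAt.comp (g := Function.uncurry K)
      (f := fun p : ℂ × ℂ => (p.1, p.1)) (continuousAt_kernel hA0 hA hz hz) (by fun_prop))
  have h2 : ContinuousAt (fun p : ℂ × ℂ => (K p.2 p.2).re) (z, w) :=
    Complex.continuous_re.continuousAt.comp (ContinuousAt.comp (g := Function.uncurry K)
      (f := fun p : ℂ × ℂ => (p.2, p.2)) (continuousAt_kernel hA0 hA hw hw) (by fun_prop))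
  have hzp := hpos.trans_le (le_kernel_diag hA0 hA hz)
  have hwp := hpos.trans_le (le_kernel_diag hA0 hA hw)
  refine ENNReal.continuous_ofReal.continuousAt.comp (continuousAt_const.sub ?_)
  exact (h0.norm.pow 2).div (h1.mul h2) (mul_pos hzp hwp).ne'

variable {ν : Measure ℂ}

/-- Invariance compares the same integrand over `D` and over its preimage; here it is turned into
equality of the integrals of `F` and of `F ∘ g` over the same sets. One takes `D = g'⁻¹ V`, whose
preimage under `g` is `V` up to a null set, and changes variables by `g`. -/
theorem setLIntegral_setLIntegral_comp [SFinite ν] {g g' : ℂ → ℂ} (hg : Measurable g)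
    (hg' : Measurable g') (hνg : ν.map g = ν) (hinv : ∀ᵐ z ∂ν, g' (g z) = z)
    {F : ℂ → ℂ → ℝ≥0∞} (hF : Measurable (Function.uncurry F))
    (h : ∀ D₀ D₁ : Set ℂ, MeasurableSet D₀ → MeasurableSet D₁ → Disjoint D₀ D₁ →
      ∫⁻ x in g ⁻¹' D₀, ∫⁻ y in g ⁻¹' D₁, F x y ∂ν ∂ν = ∫⁻ x in D₀, ∫⁻ y in D₁, F x y ∂ν ∂ν)
    {V₀ V₁ : Set ℂ} (hV₀ : MeasurableSet V₀) (hV₁ : MeasurableSet V₁) (hd : Disjoint V₀ V₁) :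
    ∫⁻ x in V₀, ∫⁻ y in V₁, F x y ∂ν ∂ν = ∫⁻ x in V₀, ∫⁻ y in V₁, F (g x) (g y) ∂ν ∂ν := by
  have hFx : ∀ x, Measurable (F x) := fun x => hF.comp measurable_prodMk_left
  have hpre : ∀ V : Set ℂ, (g ⁻¹' (g' ⁻¹' V) : Set ℂ) =ᵐ[ν] V := by
    intro V
    filter_upwards [hinv] with z hz
    change (g' (g z) ∈ V) = (z ∈ V)
    rw [hz]
  have hin : ∀ x, ∫⁻ y in g' ⁻¹' V₁, F x y ∂ν = ∫⁻ y in V₁, F x (g y) ∂ν := fun x => by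
    have h1 := setLIntegral_map (μ := ν) (hg' hV₁) (hFx x) hg
    rwa [hνg, Measure.restrict_congr_set (hpre V₁)] at h1
  have hm2 : Measurable fun x => ∫⁻ y in g' ⁻¹' V₁, F x y ∂ν :=
    Measurable.lintegral_prod_right' (f := fun p : ℂ × ℂ => F p.1 p.2) hF
  have h3 := h _ _ (hg' hV₀) (hg' hV₁) (hd.preimage _)
  rw [Measure.restrict_congr_set (hpre V₀), Measure.restrict_congr_set (hpre V₁)] at h3
  have h4 := setLIntegral_map (μ := ν) (hg' hV₀) hm2 hg
  rw [hνg, Measure.restrict_congr_set (hpre V₀)] at h4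
  rw [h3, h4]
  exact lintegral_congr fun x => hin (g x)

/-- The two-point function of an invariant process is invariant pointwise. -/
theorem normalizedKernel_geomTranslation {C : ℝ≥0∞} (hC0 : C ≠ 0) (hC : C ≠ ∞)
    (hν : ν = C • geomMeasure ε) (hA0 : ∀ n, 0 ≤ A n) (hpos : 0 < A 0)
    (hA : ∀ z ∈ geomDomain ε, ∀ w ∈ geomDomain ε,
      HasSum (fun n => (A n : ℂ) * (z * conj w) ^ n) (K z w))
    (hK : IsPSDKernel K) (hKm : Measurable (Function.uncurry K)) {w : ℂ} (hw : w ∈ geomDomain ε)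
    (h2 : ∀ D₀ D₁ : Set ℂ, MeasurableSet D₀ → MeasurableSet D₁ → Disjoint D₀ D₁ →
      ∫⁻ x in geomTranslation ε w ⁻¹' D₀, ∫⁻ y in geomTranslation ε w ⁻¹' D₁,
          ENNReal.ofReal (1 - normalizedKernel K x y) ∂ν ∂ν =
        ∫⁻ x in D₀, ∫⁻ y in D₁, ENNReal.ofReal (1 - normalizedKernel K x y) ∂ν ∂ν)
    {x y : ℂ} (hx : x ∈ geomDomain ε) (hy : y ∈ geomDomain ε) (hxy : x ≠ y)
    (hxw : 1 - ε * conj w * x ≠ 0) (hyw : 1 - ε * conj w * y ≠ 0) :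
    normalizedKernel K x y =
      normalizedKernel K (geomTranslation ε w x) (geomTranslation ε w y) := by
  set g := geomTranslation ε w with hg
  have hgm : Measurable g := measurable_geomTranslation ε w
  set F : ℂ → ℂ → ℝ≥0∞ := fun x y => ENNReal.ofReal (1 - normalizedKernel K x y) with hF
  have hFm : Measurable (Function.uncurry F) := by
    have h1 : Measurable fun p : ℂ × ℂ => (K p.1 p.1).re := Complex.measurable_re.comp
      (hKm.comp (measurable_fst.prodMk measurable_fst))
    have h2 : Measurable fun p : ℂ × ℂ => (K p.2 p.2).re := Complex.measurable_re.comp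
      (hKm.comp (measurable_snd.prodMk measurable_snd))
    have h3 : Measurable fun p : ℂ × ℂ => ‖K p.1 p.2‖ := hKm.norm
    exact (measurable_const.sub ((h3.pow_const 2).div (h1.mul h2))).ennreal_ofReal
  have hνσ : ν ≪ geomMeasure ε := hν ▸ Measure.smul_absolutelyContinuous
  have : SigmaFinite ν := by
    rw [hν]
    lift C to ℝ≥0 using hC
    exact inferInstanceAs (SigmaFinite (C • geomMeasure ε))
  have hνg : ν.map g = ν := by rw [hν, Measure.map_smul, map_geomTranslation hw]
  have hinv : ∀ᵐ z ∂ν, geomTranslation ε (-w) (g z) = z := by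
    filter_upwards [hνσ.ae_le (ae_geomTranslation_denom hw)] with z hz
    exact geomTranslation_neg hw hz
  have hint : ∀ V₀ V₁ : Set ℂ, IsOpen V₀ → IsOpen V₁ → Disjoint V₀ V₁ →
      ∫⁻ x in V₀, ∫⁻ y in V₁, F x y ∂ν ∂ν =
        ∫⁻ x in V₀, ∫⁻ y in V₁, F (g x) (g y) ∂ν ∂ν := fun V₀ V₁ hV₀ hV₁ hd =>
    setLIntegral_setLIntegral_comp hgm (measurable_geomTranslation ε (-w)) hνg hinv hFm h2
      hV₀.measurableSet hV₁.measurableSet hd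
  obtain ⟨r, hxr, hyr, hr⟩ : ∃ r : ℝ, ‖x‖ < r ∧ ‖y‖ < r ∧ (r : ℂ) ∈ geomDomain ε := by
    obtain ⟨r₁, h1, h1'⟩ := exists_norm_lt_mem_geomDomain hx
    obtain ⟨r₂, h2, h2'⟩ := exists_norm_lt_mem_geomDomain hy
    rcases le_total r₁ r₂ with h | h
    · exact ⟨r₂, h1.trans_le h, h2, h2'⟩
    · exact ⟨r₁, h1, h2.trans_le h, h1'⟩
  have hr0 : 0 < r := (norm_nonneg x).trans_lt hxr
  have hfin : ν (Metric.ball 0 r) ≠ ∞ := by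
    rw [hν, Measure.smul_apply, smul_eq_mul]
    refine ENNReal.mul_ne_top hC ((measure_mono ?_).trans_lt (geomMeasure_lt_top hr)).ne
    rw [abs_of_pos hr0]
    exact Metric.ball_subset_closedBall
  have hsub : Metric.ball (0 : ℂ) r ⊆ geomDomain ε := fun v hv =>
    mem_geomDomain_of_norm_le hr (by simpa [abs_of_pos hr0] using (mem_ball_zero_iff.1 hv).le)
  have hopen : ∀ V : Set ℂ, IsOpen V → V ⊆ Metric.ball 0 r → V.Nonempty → ν V ≠ 0 := by
    intro V hV hVr hne
    rw [hν, Measure.smul_apply, smul_eq_mul]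
    exact mul_ne_zero hC0 (geomMeasure_pos hV (hVr.trans hsub) hne).ne'
  have hgx := geomTranslation_mem hx hw hxw
  have hgy := geomTranslation_mem hy hw hyw
  have hcont : ContinuousAt (Function.uncurry F) (x, y) :=
    continuousAt_normalizedKernel hA0 hpos hA hx hy
  have hgc : ∀ z, 1 - ε * conj w * z ≠ 0 → ContinuousAt g z := fun z hz =>
    ContinuousAt.div (by fun_prop) (by fun_prop) hz
  have hcont' : ContinuousAt (Function.uncurry fun x y => F (g x) (g y)) (x, y) :=
    ContinuousAt.comp (g := Function.uncurry F) (f := fun p : ℂ × ℂ => (g p.1, g p.2))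
      (continuousAt_normalizedKernel hA0 hpos hA hgx hgy)
      ((ContinuousAt.comp (g := g) (x := (x, y)) (hgc x hxw) continuousAt_fst).prodMk
        (ContinuousAt.comp (g := g) (x := (x, y)) (hgc y hyw) continuousAt_snd))
  have hxU : x ∈ Metric.ball (0 : ℂ) r := mem_ball_zero_iff.2 hxr
  have hyU : y ∈ Metric.ball (0 : ℂ) r := mem_ball_zero_iff.2 hyr
  have hEq : F x y = F (g x) (g y) := le_antisymm
    (le_of_setLIntegral_eq Metric.isOpen_ball hfin hopen
      (fun V₀ V₁ h3 h4 _ _ h5 => (hint V₀ V₁ h3 h4 h5).symm) hxU hyU hxy hcont' hcont)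
    (le_of_setLIntegral_eq Metric.isOpen_ball hfin hopen
      (fun V₀ V₁ h3 h4 _ _ h5 => hint V₀ V₁ h3 h4 h5) hxU hyU hxy hcont hcont')
  -- By Cauchy–Schwarz nothing was lost in truncating `1 - normalizedKernel` at zero.
  have hle : ∀ a b, normalizedKernel K a b ≤ 1 := fun a b =>
    div_le_one_of_le₀ (hK.norm_sq_le a b) (mul_nonneg (hK.diag_nonneg a) (hK.diag_nonneg b))
  have h4 := (ENNReal.ofReal_eq_ofReal_iff (sub_nonneg.2 (hle _ _)) (sub_nonneg.2 (hle _ _))).1 hEq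
  linarith

end TwoPoint

/-! ## Invariant analytic ensembles -/

section Ensemble

/-- An orthonormal family of analytic functions on the geometry of curvature `ε` whose kernel
defines invariant one- and two-point functions. -/
structure IsInvariantEnsemble {ι : Type*} (ε : ℝ) (μ : Measure ℂ) (φ : ι → ℂ → ℂ) : Prop where
  ae_mem : ∀ᵐ z ∂μ, z ∈ geomDomain ε
  map_rot : ∀ u : Circle, μ.map (fun z : ℂ => u * z) = μ
  finite_ball : ∃ r > 0, μ (Metric.ball 0 r) ≠ ∞
  differentiableOn : ∀ k, DifferentiableOn ℂ (φ k) (geomDomain ε)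
  measurable : ∀ k, Measurable (φ k)
  summable : ∀ z, Summable fun k => ‖φ k z‖ ^ 2
  orthonormal : IsOrthonormalL2 μ φ
  intensity_rot : ∀ u : Circle, (kernelIntensity μ (seriesKernel φ)).map (fun z : ℂ => u * z) =
    kernelIntensity μ (seriesKernel φ)
  intensity_translation : ∀ w ∈ geomDomain ε,
    (kernelIntensity μ (seriesKernel φ)).map (geomTranslation ε w) =
      kernelIntensity μ (seriesKernel φ)
  two_point : ∀ w ∈ geomDomain ε, ∀ D₀ D₁ : Set ℂ, MeasurableSet D₀ → MeasurableSet D₁ →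
    Disjoint D₀ D₁ →
      ∫⁻ x in geomTranslation ε w ⁻¹' D₀, ∫⁻ y in geomTranslation ε w ⁻¹' D₁,
          ENNReal.ofReal (1 - normalizedKernel (seriesKernel φ) x y)
            ∂(kernelIntensity μ (seriesKernel φ)) ∂(kernelIntensity μ (seriesKernel φ)) =
        ∫⁻ x in D₀, ∫⁻ y in D₁, ENNReal.ofReal (1 - normalizedKernel (seriesKernel φ) x y)
            ∂(kernelIntensity μ (seriesKernel φ)) ∂(kernelIntensity μ (seriesKernel φ))

theorem IsOrthonormalL2.lintegral_enorm_sq {Ω ι : Type*} [MeasurableSpace Ω] {μ : Measure Ω}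
    {φ : ι → Ω → ℂ} (h : IsOrthonormalL2 μ φ) (k : ι) : ∫⁻ z, ‖φ k z‖ₑ ^ 2 ∂μ = 1 := by
  have hi : Integrable (fun z => ‖φ k z‖ ^ 2) μ := (h.memLp k).integrable_norm_pow two_ne_zero
  have h1 : ∫ z, ‖φ k z‖ ^ 2 ∂μ = 1 := by
    have h2 := h.norm_one k
    have h3 : ∀ z, φ k z * conj (φ k z) = ((‖φ k z‖ ^ 2 : ℝ) : ℂ) := fun z => by
      rw [Complex.mul_conj, Complex.normSq_eq_norm_sq]
    simp only [h3] at h2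
    rw [integral_complex_ofReal] at h2
    exact_mod_cast h2
  have h4 := ofReal_integral_eq_lintegral_ofReal hi (Filter.Eventually.of_forall fun z => by positivity)
  rw [h1, ENNReal.ofReal_one] at h4
  rw [h4]
  exact lintegral_congr fun z => (ofReal_norm_sq _).symm

theorem kernelIntensity_seriesKernel {Ω ι : Type*} [MeasurableSpace Ω] (μ : Measure Ω)
    {φ : ι → Ω → ℂ} (h : ∀ z, Summable fun k => ‖φ k z‖ ^ 2) :
    kernelIntensity μ (seriesKernel φ) = μ.withDensity (kernelDiag φ) := by
  rw [kernelIntensity]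
  congr 1
  funext z
  exact ofReal_seriesKernel_self h z

/-- For a determinantal process with this kernel it is the expected total number of points, so the
number of functions is determined by the process. -/
theorem lintegral_kernelDiag {Ω ι : Type*} [MeasurableSpace Ω] [Countable ι] {μ : Measure Ω}
    {φ : ι → Ω → ℂ} (hm : ∀ k, Measurable (φ k)) (h : IsOrthonormalL2 μ φ) :
    ∫⁻ z, kernelDiag φ z ∂μ = ENat.card ι := by
  unfold kernelDiag
  rw [lintegral_tsum fun k => ((hm k).enorm.pow_const 2).aemeasurable]
  simp only [h.lintegral_enorm_sq]
  simp

/-- On these discs `0 < 1 + ε|z|² ≤ 2`, so the density is at least `1/4`. -/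
theorem geomMeasure_ball_ge {ε : ℝ} (hε : |ε| ≤ 1) {δ : ℝ} (hδ : 0 < δ) (hδ1 : δ ≤ 1) :
    ENNReal.ofReal (Real.pi / 4 * δ ^ 2) ≤ geomMeasure ε (Metric.ball 0 δ) := by
  have hsub : Metric.ball (0 : ℂ) δ ⊆ geomDomain ε := fun z hz => by
    have h1 : ‖z‖ < 1 := (mem_ball_zero_iff.1 hz).trans_le hδ1
    have h2 : ‖z‖ ^ 2 < 1 := by nlinarith [norm_nonneg z]
    have h3 := abs_le.1 hε
    change 0 < 1 + ε * ‖z‖ ^ 2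
    nlinarith [sq_nonneg ‖z‖]
  rw [geomMeasure_apply measurableSet_ball, Set.inter_eq_left.2 hsub]
  have h1 : ∀ z ∈ Metric.ball (0 : ℂ) δ, ENNReal.ofReal (1 / 4) ≤
      ENNReal.ofReal (1 / (1 + ε * ‖z‖ ^ 2) ^ 2) := fun z hz => by
    have h4 : 0 < 1 + ε * ‖z‖ ^ 2 := hsub hz
    have h1 : ‖z‖ < 1 := (mem_ball_zero_iff.1 hz).trans_le hδ1
    have h2 : ‖z‖ ^ 2 < 1 := by nlinarith [norm_nonneg z]
    have h3 := abs_le.1 hε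
    have h5 : 1 + ε * ‖z‖ ^ 2 ≤ 2 := by nlinarith [sq_nonneg ‖z‖]
    refine ENNReal.ofReal_le_ofReal (one_div_le_one_div_of_le (by positivity) ?_)
    nlinarith
  refine le_trans ?_ (setLIntegral_mono' measurableSet_ball h1)
  rw [setLIntegral_const, Complex.volume_ball, ← ENNReal.ofReal_pow hδ.le,
    ← ENNReal.ofReal_coe_nnreal, ← ENNReal.ofReal_mul (by positivity),
    ← ENNReal.ofReal_mul (by positivity)]
  refine ENNReal.ofReal_le_ofReal (le_of_eq ?_)
  rw [NNReal.coe_real_pi]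
  ring

variable {ι : Type*} [Countable ι] {ε : ℝ} {μ : Measure ℂ} {φ : ι → ℂ → ℂ}

/-- Uniqueness of the invariant measure; `C = 0` would make every `φ k` vanish almost everywhere,
against its norm being one. -/
theorem IsInvariantEnsemble.exists_intensity_eq [SigmaFinite μ] [Nonempty ι]
    (h : IsInvariantEnsemble ε μ φ) :
    ∃ C : ℝ≥0∞, C ≠ 0 ∧ C ≠ ∞ ∧ kernelIntensity μ (seriesKernel φ) = C • geomMeasure ε := by
  have hν : kernelIntensity μ (seriesKernel φ) ≪ μ := withDensity_absolutelyContinuous _ _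
  have : SigmaFinite (kernelIntensity μ (seriesKernel φ)) :=
    SigmaFinite.withDensity_of_ne_top (Filter.Eventually.of_forall fun _ => ENNReal.ofReal_ne_top)
  obtain ⟨C, hC, hCν⟩ := eq_smul_geomMeasure (hν.ae_le h.ae_mem) h.intensity_rot
    h.intensity_translation
  refine ⟨C, ?_, hC, hCν⟩
  rintro rfl
  rw [zero_smul, kernelIntensity_seriesKernel μ h.summable,
    withDensity_eq_zero_iff (measurable_kernelDiag h.measurable).aemeasurable] at hCν
  obtain ⟨j⟩ := ‹Nonempty ι›
  have h1 := h.orthonormal.lintegral_enorm_sq j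
  have h2 : ∫⁻ z, ‖φ j z‖ₑ ^ 2 ∂μ = 0 := by
    rw [lintegral_eq_zero_iff ((h.measurable j).enorm.pow_const 2)]
    filter_upwards [hCν] with z hz
    exact le_antisymm (hz ▸ ENNReal.le_tsum (f := fun k => ‖φ k z‖ₑ ^ 2) j) zero_le
  exact one_ne_zero (h1.symm.trans h2)

/-- If `A 0 = 0`, then `K z z ≤ M |z|²` near `0`. The intensity of a disc of radius `δ` is of order
at least `δ²`, yet at most `M δ²` times the `μ`-measure of the punctured disc, which tends to zero.
The puncture allows for an atom of `μ` at the origin, where the diagonal vanishes. -/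
theorem coeff_zero_pos [SigmaFinite μ] (hε : |ε| ≤ 1) (hfin : ∃ r > 0, μ (Metric.ball 0 r) ≠ ∞)
    {A : ℕ → ℝ} {K : ℂ → ℂ → ℂ} {C : ℝ≥0∞} (hC0 : C ≠ 0)
    (hν : kernelIntensity μ K = C • geomMeasure ε) (hA0 : ∀ n, 0 ≤ A n)
    (hA : ∀ z ∈ geomDomain ε, ∀ w ∈ geomDomain ε,
      HasSum (fun n => (A n : ℂ) * (z * conj w) ^ n) (K z w)) : 0 < A 0 := by
  refine (hA0 0).lt_of_ne' fun hzero => ?_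
  obtain ⟨r₀, hr₀, hfin⟩ := hfin
  obtain ⟨r, hr, hrU⟩ := exists_norm_lt_mem_geomDomain (zero_mem_geomDomain ε)
  have hr0 : 0 < r := by simpa using hr
  have hdom : ∀ z : ℂ, ‖z‖ ≤ r → z ∈ geomDomain ε := fun z hz =>
    mem_geomDomain_of_norm_le hrU (by simpa [abs_of_pos hr0] using hz)
  -- With no constant term, `|z|^(2n) ≤ r^(2n) |z|² / r²` bounds the diagonal termwise.
  set M : ℝ := (K r r).re / r ^ 2 with hM
  have hKr := hasSum_kernel_ofReal hA hrU hrU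
  have hM0 : 0 ≤ M := div_nonneg (hKr.nonneg fun n => by have := hA0 n; positivity) (by positivity)
  have hKle : ∀ z : ℂ, ‖z‖ ≤ r → (K z z).re ≤ M * ‖z‖ ^ 2 := by
    intro z hz
    have h1 : HasSum (fun n => A n * (r * r) ^ n * (‖z‖ ^ 2 / r ^ 2)) (M * ‖z‖ ^ 2) := by
      have := hKr.mul_right (‖z‖ ^ 2 / r ^ 2)
      rwa [show (K r r).re * (‖z‖ ^ 2 / r ^ 2) = M * ‖z‖ ^ 2 by rw [hM]; ring] at this
    refine hasSum_le (fun n => ?_) (hasSum_kernel_diag hA (hdom z hz)) h1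
    rcases n with _ | n
    · simp [hzero]
    rw [mul_assoc]
    refine mul_le_mul_of_nonneg_left ?_ (hA0 _)
    rw [← sq, pow_succ (r ^ 2), mul_assoc, mul_div_cancel₀ _ (by positivity), pow_succ]
    gcongr
  have hkey : ∀ δ : ℝ, 0 < δ → δ ≤ 1 → δ ≤ r →
      C * ENNReal.ofReal (Real.pi / 4) ≤ ENNReal.ofReal M * μ (Metric.ball 0 δ \ {0}) := by
    intro δ hδ hδ1 hδr
    have hδ2 : ENNReal.ofReal (δ ^ 2) ≠ 0 := by simpa using by positivity
    refine (ENNReal.mul_le_mul_iff_left hδ2 ENNReal.ofReal_ne_top).1 ?_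
    calc C * ENNReal.ofReal (Real.pi / 4) * ENNReal.ofReal (δ ^ 2)
        = C * ENNReal.ofReal (Real.pi / 4 * δ ^ 2) := by
          rw [mul_assoc, ← ENNReal.ofReal_mul (by positivity)]
      _ ≤ C * geomMeasure ε (Metric.ball 0 δ) := by gcongr; exact geomMeasure_ball_ge hε hδ hδ1
      _ = kernelIntensity μ K (Metric.ball 0 δ) := by rw [hν, Measure.smul_apply, smul_eq_mul]
      _ = ∫⁻ z in Metric.ball 0 δ, ENNReal.ofReal (K z z).re ∂μ :=
          withDensity_apply _ measurableSet_ball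
      _ ≤ ∫⁻ z in Metric.ball 0 δ, (Metric.ball 0 δ \ {0}).indicator
            (fun _ => ENNReal.ofReal (M * δ ^ 2)) z ∂μ := by
          refine setLIntegral_mono' measurableSet_ball fun z hz => ?_
          have hz' := mem_ball_zero_iff.1 hz
          have h1 := hKle z (hz'.le.trans hδr)
          by_cases hz0 : z = 0
          · subst hz0
            simp only [norm_zero] at h1
            rw [ENNReal.ofReal_of_nonpos (by simpa using h1)]
            exact zero_le
          · rw [Set.indicator_of_mem (show z ∈ Metric.ball 0 δ \ {0} from ⟨hz, hz0⟩)]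
            refine ENNReal.ofReal_le_ofReal (h1.trans ?_)
            gcongr
      _ ≤ ∫⁻ z, (Metric.ball 0 δ \ {0}).indicator
            (fun _ => ENNReal.ofReal (M * δ ^ 2)) z ∂μ := setLIntegral_le_lintegral _ _
      _ = ENNReal.ofReal M * μ (Metric.ball 0 δ \ {0}) * ENNReal.ofReal (δ ^ 2) := by
          rw [lintegral_indicator (measurableSet_ball.diff (measurableSet_singleton _)),
            setLIntegral_const, ENNReal.ofReal_mul hM0]
          ring
  set δ : ℕ → ℝ := fun n => min (min r r₀) 1 / (n + 1) with hδ
  have hmin : 0 < min (min r r₀) 1 := by positivity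
  have hδ0 : ∀ n, 0 < δ n := fun n => by positivity
  have hδle : ∀ n, δ n ≤ min (min r r₀) 1 := fun n =>
    div_le_self hmin.le (by linarith [Nat.cast_nonneg (α := ℝ) n])
  have hanti : Antitone fun n => Metric.ball (0 : ℂ) (δ n) \ {0} := fun m n hmn => by
    refine Set.sdiff_subset_sdiff_left (Metric.ball_subset_ball ?_)
    simp only [hδ]
    gcongr
  have hlim := tendsto_measure_iInter_atTop (μ := μ)
    (s := fun n => Metric.ball (0 : ℂ) (δ n) \ {0})
    (fun n => (measurableSet_ball.diff (measurableSet_singleton _)).nullMeasurableSet) hanti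
    ⟨0, ((measure_mono (Set.sdiff_subset.trans (Metric.ball_subset_ball
      ((hδle 0).trans ((min_le_left _ _).trans (min_le_right _ _)))))).trans_lt hfin.lt_top).ne⟩
  have hempty : ⋂ n, Metric.ball (0 : ℂ) (δ n) \ {0} = ∅ := by
    rw [Set.eq_empty_iff_forall_notMem]
    intro z hz
    rw [Set.mem_iInter] at hz
    have hz0 : 0 < ‖z‖ := norm_pos_iff.2 (hz 0).2
    have hδlim : Filter.Tendsto δ Filter.atTop (nhds 0) := by
      have := tendsto_one_div_add_atTop_nhds_zero_nat.const_mul (min (min r r₀) 1)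
      simpa [hδ, div_eq_mul_inv] using this
    obtain ⟨n, hn⟩ := (hδlim.eventually_lt_const hz0).exists
    exact absurd (mem_ball_zero_iff.1 (hz n).1) (not_lt.2 hn.le)
  rw [hempty, measure_empty] at hlim
  have hlim2 := ENNReal.Tendsto.const_mul hlim (Or.inr (ENNReal.ofReal_ne_top (r := M)))
  rw [mul_zero] at hlim2
  have h1 := ge_of_tendsto' hlim2 fun n => hkey (δ n) (hδ0 n)
    ((hδle n).trans (min_le_right _ _))
    ((hδle n).trans ((min_le_left _ _).trans (min_le_left _ _)))
  have h2 : C * ENNReal.ofReal (Real.pi / 4) ≠ 0 :=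
    mul_ne_zero hC0 (by simpa using by positivity)
  exact h2 (le_antisymm h1 zero_le)

/-- The kernel of an invariant ensemble is radial, and its coefficients satisfy a first order
recursion. -/
theorem IsInvariantEnsemble.exists_coeff [SigmaFinite μ] (hε : |ε| ≤ 1)
    (h : IsInvariantEnsemble ε μ φ) {C : ℝ≥0∞} (hC0 : C ≠ 0) (hC : C ≠ ∞)
    (hν : kernelIntensity μ (seriesKernel φ) = C • geomMeasure ε) :
    ∃ A : ℕ → ℝ, (∀ n, 0 ≤ A n) ∧ 0 < A 0 ∧
      (∀ z ∈ geomDomain ε, ∀ w ∈ geomDomain ε,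
        HasSum (fun n => (A n : ℂ) * (z * conj w) ^ n) (seriesKernel φ z w)) ∧
      ∀ n : ℕ, A (n + 1) * (n + 1) = A n * (A 1 / A 0 - ε * n) := by
  have hσμ : geomMeasure ε ≪ μ := by
    have h1 : kernelIntensity μ (seriesKernel φ) ≪ μ := withDensity_absolutelyContinuous _ _
    rw [hν] at h1
    exact (Measure.absolutelyContinuous_smul hC0).trans h1
  have hrot : ∀ u : Circle, (fun z : ℂ => kernelDiag φ (u * z)) =ᵐ[μ] kernelDiag φ :=
    kernelDiag_rot_ae_eq h.map_rot (measurable_kernelDiag h.measurable) (by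
      rw [← kernelIntensity_seriesKernel μ h.summable]
      exact h.intensity_rot)
  obtain ⟨A, hA0, hA⟩ := exists_radial_expansion h.differentiableOn h.measurable h.summable hrot
    ((absolutelyContinuous_geomMeasure ε).trans hσμ)
  have hpos := coeff_zero_pos hε h.finite_ball hC0 hν hA0 hA
  refine ⟨A, hA0, hpos, hA, coeff_recursion hA0 hpos hA fun x y hx hy hxy hd => ?_⟩
  -- Translation by `-y` moves the second of two real points to the origin.
  have hw : ((-y : ℝ) : ℂ) ∈ geomDomain ε := by
    rw [Complex.ofReal_neg]
    exact neg_mem_geomDomain hy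
  have hden : ∀ t : ℝ, (1 : ℂ) - ε * conj ((-y : ℝ) : ℂ) * t = ((1 + ε * t * y : ℝ) : ℂ) :=
    fun t => by
      rw [Complex.conj_ofReal]
      push_cast
      ring
  have hxd : (1 : ℂ) - ε * conj ((-y : ℝ) : ℂ) * x ≠ 0 := by
    rw [hden]
    exact_mod_cast hd
  have hyd : (1 : ℂ) - ε * conj ((-y : ℝ) : ℂ) * y ≠ 0 := by
    rw [hden]
    have h1 : 0 < 1 + ε * y ^ 2 := ofReal_mem_geomDomain.1 hy
    exact_mod_cast (by nlinarith : 1 + ε * y * y ≠ 0)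
  have hgx : geomTranslation ε ((-y : ℝ) : ℂ) x = (((x - y) / (1 + ε * x * y) : ℝ) : ℂ) := by
    rw [geomTranslation, hden]
    push_cast
    ring
  have hgy : geomTranslation ε ((-y : ℝ) : ℂ) y = 0 := by
    simp [geomTranslation]
  have h1 := normalizedKernel_geomTranslation hC0 hC hν hA0 hpos hA
    (isPSDKernel_seriesKernel h.summable) (measurable_seriesKernel h.measurable h.summable) hw
    (h.two_point _ hw) hx hy (by exact_mod_cast hxy) hxd hyd
  rw [hgx, hgy] at h1
  exact ⟨hgx ▸ geomTranslation_mem hx hw hxd, h1⟩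

/-- The diagonal is at least `A 0 > 0`, so `μ` is recovered from the intensity by division. -/
theorem IsInvariantEnsemble.measure_eq [SigmaFinite μ] (h : IsInvariantEnsemble ε μ φ)
    {C : ℝ≥0∞} {A : ℕ → ℝ}
    (hν : kernelIntensity μ (seriesKernel φ) = C • geomMeasure ε) (hA0 : ∀ n, 0 ≤ A n)
    (hpos : 0 < A 0) (hA : ∀ z ∈ geomDomain ε, ∀ w ∈ geomDomain ε,
        HasSum (fun n => (A n : ℂ) * (z * conj w) ^ n) (seriesKernel φ z w)) :
    μ = (C • geomMeasure ε).withDensity fun z => (ENNReal.ofReal (seriesKernel φ z z).re)⁻¹ := by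
  have hm : Measurable fun z => ENNReal.ofReal (seriesKernel φ z z).re :=
    (Complex.measurable_re.comp ((measurable_seriesKernel h.measurable h.summable).comp
      (measurable_id.prodMk measurable_id))).ennreal_ofReal
  rw [← hν, kernelIntensity]
  refine (withDensity_inv_same hm ?_ (Filter.Eventually.of_forall fun _ => ENNReal.ofReal_ne_top)).symm
  filter_upwards [h.ae_mem] with z hz
  have := hpos.trans_le (le_kernel_diag hA0 hA hz)
  simpa using this

end Ensemble

/-! ## Total mass of the reference measure of an invariant ensemble -/

section TotalMass

theorem IsOrthonormalL2.orthonormal {Ω ι : Type*} [MeasurableSpace Ω] {μ : Measure Ω}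
    {φ : ι → Ω → ℂ} (h : IsOrthonormalL2 μ φ) :
    Orthonormal ℂ fun k => (h.memLp k).toLp (φ k) := by
  classical
  rw [orthonormal_iff_ite]
  intro j k
  have h1 : inner ℂ ((h.memLp j).toLp (φ j)) ((h.memLp k).toLp (φ k)) =
      ∫ z, φ k z * conj (φ j z) ∂μ := by
    rw [L2.inner_def]
    refine integral_congr_ae ?_
    filter_upwards [(h.memLp j).coeFn_toLp, (h.memLp k).coeFn_toLp] with z hj hk
    rw [hj, hk, RCLike.inner_apply]
  rw [h1]
  split_ifs with hjk
  · subst hjk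
    exact h.norm_one j
  · exact h.orthogonal k j (Ne.symm hjk)

variable {ι : Type*} [Countable ι] {μ : Measure ℂ} {φ : ι → ℂ → ℂ}

/-- If `∑ k, conj (c k) φ k` converges pointwise almost everywhere to a constant `a > 0` with
`∑ k, |c k|² = a`, then `a μ(Ω) = 1`. -/
theorem IsOrthonormalL2.mul_measure_univ (h : IsOrthonormalL2 μ φ) {c : ι → ℂ} {a : ℝ}
    (ha : 0 < a) (hc : HasSum (fun k => ‖c k‖ ^ 2) a)
    (hs : ∀ᵐ z ∂μ, HasSum (fun k => c k * φ k z) (a : ℂ)) :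
    ENNReal.ofReal a * μ Set.univ = 1 := by
  have hon := h.orthonormal
  set e : ι → Lp ℂ 2 μ := fun k => (h.memLp k).toLp (φ k) with he
  have hsum : Summable fun k => c k • e k :=
    (hon.orthogonalFamily.summable_iff_norm_sq_summable c).2 hc.summable
  obtain ⟨G, hG⟩ := hsum
  have hnorm : ‖G‖ ^ 2 = a := by
    have h1 : Filter.Tendsto (fun F : Finset ι => ‖∑ k ∈ F, c k • e k‖ ^ 2) Filter.atTop
        (nhds (‖G‖ ^ 2)) := (Filter.Tendsto.norm hG).pow 2
    have h2 : ∀ F : Finset ι, ‖∑ k ∈ F, c k • e k‖ ^ 2 = ∑ k ∈ F, ‖c k‖ ^ 2 := fun F =>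
      hon.orthogonalFamily.norm_sum c F
    simp only [h2] at h1
    exact tendsto_nhds_unique h1 hc
  have hGae : ⇑G =ᵐ[μ] fun _ => (a : ℂ) := by
    -- L² convergence passes to almost everywhere convergence along a subsequence, which identifies
    -- the L² sum with the pointwise sum.
    have h1 : TendstoInMeasure μ (fun F : Finset ι => ⇑(∑ k ∈ F, c k • e k)) Filter.atTop ⇑G :=
      tendstoInMeasure_of_tendsto_Lp hG
    obtain ⟨ns, hns, hlim⟩ := h1.exists_seq_tendsto_ae'
    have h2 : ∀ᵐ z ∂μ, ∀ F : Finset ι, (∑ k ∈ F, c k • e k : Lp ℂ 2 μ) z =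
        ∑ k ∈ F, c k * φ k z := by
      rw [ae_all_iff]
      intro F
      have h3 : ∀ᵐ z ∂μ, ∀ k, (c k • e k : Lp ℂ 2 μ) z = c k * φ k z := by
        rw [ae_all_iff]
        intro k
        filter_upwards [Lp.coeFn_smul (c k) (e k), (h.memLp k).coeFn_toLp] with z h4 h5
        rw [h4, Pi.smul_apply, h5, smul_eq_mul]
      filter_upwards [h3, Lp.coeFn_finsetSum F fun k => c k • e k] with z h4 h5
      rw [h5, Finset.sum_apply]
      exact Finset.sum_congr rfl fun k _ => h4 k
    filter_upwards [hlim, h2, hs] with z h3 h4 h5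
    simp only [h4] at h3
    have h6 : Filter.Tendsto (fun F : Finset ι => ∑ k ∈ F, c k * φ k z) Filter.atTop
        (nhds (a : ℂ)) := h5
    exact tendsto_nhds_unique h3 (h6.comp hns)
  -- The squared norm of the constant `a` is also `a² μ(Ω)`; comparison with `a` gives the claim.
  have h1 : ‖G‖ₑ ^ 2 = ENNReal.ofReal a := by
    rw [← hnorm, ← ofReal_norm, ENNReal.ofReal_pow (norm_nonneg _)]
  rw [Lp.enorm_def, eLpNorm_congr_ae hGae, eLpNorm_const' _ two_ne_zero ENNReal.ofNat_ne_top,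
    mul_pow, ← ENNReal.rpow_natCast (μ Set.univ ^ _), ← ENNReal.rpow_mul] at h1
  simp only [ENNReal.toReal_ofNat, Nat.cast_ofNat, one_div, inv_mul_cancel₀ (two_ne_zero' ℝ),
    ENNReal.rpow_one] at h1
  have h2 : ‖(a : ℂ)‖ₑ = ENNReal.ofReal a := by
    rw [← ofReal_norm, Complex.norm_real, Real.norm_of_nonneg ha.le]
  have ha0 : ENNReal.ofReal a ≠ 0 := by simpa using ha
  rw [h2, sq, mul_assoc] at h1
  exact (ENNReal.mul_right_inj ha0 ENNReal.ofReal_ne_top).1 (h1.trans (mul_one _).symm)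

/-- The constant `A 0 = K(·, 0)` is the combination `∑ conj (φ k 0) φ k`, whose squared norm is `K 0
0 = A 0`. In particular `μ` is finite. -/
theorem IsInvariantEnsemble.coeff_mul_measure_univ {ε : ℝ} (h : IsInvariantEnsemble ε μ φ)
    {A : ℕ → ℝ} (hpos : 0 < A 0) (hA : ∀ z ∈ geomDomain ε, ∀ w ∈ geomDomain ε,
        HasSum (fun n => (A n : ℂ) * (z * conj w) ^ n) (seriesKernel φ z w)) :
    ENNReal.ofReal (A 0) * μ Set.univ = 1 := by
  have hK : ∀ z ∈ geomDomain ε, seriesKernel φ z 0 = (A 0 : ℂ) := fun z hz => by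
    refine (hA z hz 0 (zero_mem_geomDomain ε)).unique ?_
    simp only [map_zero, mul_zero]
    convert! hasSum_single (f := fun n => (A n : ℂ) * 0 ^ n) 0 fun n hn => by simp [hn] using 1
    simp
  refine h.orthonormal.mul_measure_univ (c := fun k => conj (φ k 0)) hpos ?_ ?_
  · have h1 := (h.summable 0).hasSum
    have h2 := seriesKernel_self h.summable (0 : ℂ)
    rw [hK 0 (zero_mem_geomDomain ε)] at h2
    rw [← Complex.ofReal_injective h2] at h1
    exact h1.of_eq fun k => by rw [RCLike.norm_conj]
  · filter_upwards [h.ae_mem] with z hz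
    rw [← hK z hz]
    exact (hasSum_seriesKernel h.summable z 0).of_eq fun k => mul_comm _ _

end TotalMass

/-! ## Radial measures -/

section Radial

/-- The annulus `a ≤ |z|² < b` with `0 ≤ a` has area `π (b - a)`. -/
theorem map_norm_sq_volume :
    (volume : Measure ℂ).map (fun z => ‖z‖ ^ 2) =
      ENNReal.ofReal Real.pi • volume.restrict (Set.Ici 0) := by
  have hm : Measurable fun z : ℂ => ‖z‖ ^ 2 := by fun_prop
  have hlf : IsLocallyFiniteMeasure
      (ENNReal.ofReal Real.pi • (volume : Measure ℝ).restrict (Set.Ici 0)) := by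
    rw [ENNReal.ofReal]
    exact inferInstanceAs (IsLocallyFiniteMeasure
      (Real.pi.toNNReal • (volume : Measure ℝ).restrict (Set.Ici 0)))
  refine (Measure.ext_of_Ico _ _ fun a b hab => ?_).symm
  have hset : (fun z : ℂ => ‖z‖ ^ 2) ⁻¹' Set.Ico a b =
      Metric.ball 0 (Real.sqrt b) \ Metric.ball 0 (Real.sqrt a) := by
    ext z
    simp [Real.lt_sqrt (norm_nonneg z), and_comm]
  have hvol : ∀ c : ℝ, volume (Metric.ball (0 : ℂ) (Real.sqrt c)) =
      ENNReal.ofReal (max c 0 * Real.pi) := fun c => by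
    rw [Complex.volume_ball, ← ENNReal.ofReal_pow (Real.sqrt_nonneg c), ← ENNReal.ofReal_coe_nnreal,
      ← ENNReal.ofReal_mul (by positivity), NNReal.coe_real_pi]
    congr 2
    rcases le_total c 0 with h | h
    · rw [Real.sqrt_eq_zero_of_nonpos h, max_eq_right h]
      norm_num
    · rw [Real.sq_sqrt h, max_eq_left h]
  rw [Measure.map_apply hm measurableSet_Ico, hset, measure_sdiff
    (Metric.ball_subset_ball (Real.sqrt_le_sqrt hab.le)) measurableSet_ball.nullMeasurableSet
    measure_ball_lt_top.ne, hvol, hvol, ← ENNReal.ofReal_sub _ (by positivity),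
    Measure.smul_apply, Measure.restrict_apply measurableSet_Ico, smul_eq_mul]
  have hinter : Set.Ico a b ∩ Set.Ici 0 = Set.Ico (max a 0) b := by
    ext t
    simp only [Set.mem_inter_iff, Set.mem_Ico, Set.mem_Ici, max_le_iff]
    tauto
  rw [hinter, Real.volume_Ico, ← ENNReal.ofReal_mul Real.pi_pos.le]
  rcases le_total b 0 with h | h
  · rw [max_eq_right h, max_eq_right (hab.le.trans h), ENNReal.ofReal_of_nonpos, sub_self,
      ENNReal.ofReal_zero]
    nlinarith [Real.pi_pos]
  · rw [max_eq_left h]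
    congr 1
    ring

theorem lintegral_norm_sq {F : ℝ → ℝ≥0∞} (hF : Measurable F) :
    ∫⁻ z : ℂ, F (‖z‖ ^ 2) = ENNReal.ofReal Real.pi * ∫⁻ t in Set.Ici 0, F t := by
  rw [← lintegral_map hF (by fun_prop : Measurable fun z : ℂ => ‖z‖ ^ 2), map_norm_sq_volume,
    lintegral_smul_measure, smul_eq_mul]

/-- The measure `w(|z|²) dm(z)` on the geometry of curvature `ε`. -/
noncomputable def radialMeasure (ε : ℝ) (w : ℝ → ℝ) : Measure ℂ :=
  (volume.restrict (geomDomain ε)).withDensity fun z => ENNReal.ofReal (w (‖z‖ ^ 2))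

variable {ε : ℝ} {w : ℝ → ℝ}

instance sigmaFinite_radialMeasure : SigmaFinite (radialMeasure ε w) :=
  SigmaFinite.withDensity_of_ne_top (Filter.Eventually.of_forall fun _ => ENNReal.ofReal_ne_top)

theorem lintegral_radialMeasure (hw : Measurable w) {F : ℝ → ℝ≥0∞} (hF : Measurable F) :
    ∫⁻ z, F (‖z‖ ^ 2) ∂(radialMeasure ε w) = ENNReal.ofReal Real.pi *
      ∫⁻ t in {t | 0 ≤ t ∧ 0 < 1 + ε * t}, ENNReal.ofReal (w t) * F t := by
  have hS : MeasurableSet {t : ℝ | 0 < 1 + ε * t} :=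
    (isOpen_lt continuous_const (by fun_prop)).measurableSet
  have hwm : Measurable fun z : ℂ => ENNReal.ofReal (w (‖z‖ ^ 2)) :=
    (hw.comp (by fun_prop : Measurable fun z : ℂ => ‖z‖ ^ 2)).ennreal_ofReal
  have hFm : Measurable fun z : ℂ => F (‖z‖ ^ 2) := hF.comp (by fun_prop)
  have hprod : Measurable fun t => ENNReal.ofReal (w t) * F t := hw.ennreal_ofReal.mul hF
  rw [radialMeasure, lintegral_withDensity_eq_lintegral_mul _ hwm hFm,
    ← lintegral_indicator (measurableSet_geomDomain ε)]
  have h1 := lintegral_norm_sq (hprod.indicator hS)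
  rw [setLIntegral_indicator hS] at h1
  convert! h1 using 3
  congr 1
  ext t
  simp [and_comm]

theorem map_rot_radialMeasure (hw : Measurable w) (u : Circle) :
    (radialMeasure ε w).map (fun z : ℂ => u * z) = radialMeasure ε w := by
  have hm : Measurable fun z : ℂ => (u : ℂ) * z := by fun_prop
  have hvol : (volume : Measure ℂ).map (fun z : ℂ => u * z) = volume := by
    have := map_rot_geomMeasure 0 u
    have h0 : geomMeasure 0 = volume := by
      have hd : geomDomain 0 = Set.univ := by
        ext z
        simp [geomDomain]
      rw [geomMeasure, hd, Measure.restrict_univ]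
      simp
    rwa [h0] at this
  ext D hD
  rw [Measure.map_apply hm hD, radialMeasure, withDensity_apply _ (hm hD), withDensity_apply _ hD,
    Measure.restrict_restrict (hm hD), Measure.restrict_restrict hD]
  conv_rhs => rw [← hvol]
  have hwm : Measurable fun z : ℂ => ENNReal.ofReal (w (‖z‖ ^ 2)) :=
    (hw.comp (by fun_prop : Measurable fun z : ℂ => ‖z‖ ^ 2)).ennreal_ofReal
  rw [setLIntegral_map (hD.inter (measurableSet_geomDomain ε)) hwm hm]
  simp only [norm_mul, Circle.norm_coe, one_mul]
  congr 2
  ext z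
  have hn : ‖(u : ℂ) * z‖ = ‖z‖ := by rw [norm_mul, Circle.norm_coe, one_mul]
  simp [geomDomain, hn, -norm_mul, -Complex.norm_mul]

theorem ae_mem_radialMeasure : ∀ᵐ z ∂(radialMeasure ε w), z ∈ geomDomain ε :=
  (withDensity_absolutelyContinuous _ _).ae_le (ae_restrict_mem (measurableSet_geomDomain ε))

/-- Moments of a radial weight with `((1 + ε t) w)' = - α w`. -/
theorem tendsto_integral_pow_mul {α : ℝ} {x : ℕ → ℝ} {B : ℕ → ℝ} {N : ℕ} (hα : α ≠ 0)
    (hw1 : w 0 = 1) (hx0 : ∀ n, 0 ≤ x n) (hx : ∀ n, 0 < 1 + ε * x n)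
    (hwc : ContinuousOn w {t | 0 < 1 + ε * t})
    (hder : ∀ t, 0 ≤ t → 0 < 1 + ε * t →
      HasDerivAt (fun s => (1 + ε * s) * w s) (-α * w t) t)
    (hlim : ∀ k ≤ N, Filter.Tendsto (fun n => x n ^ k * ((1 + ε * x n) * w (x n))) Filter.atTop
      (nhds 0))
    (hB0 : B 0 = α / Real.pi) (hB : ∀ k, B (k + 1) * (k + 1) = B k * (α - ε * (k + 1)))
    (hBpos : ∀ k ≤ N, 0 < B k) {k : ℕ} (hk : k ≤ N) :
    Filter.Tendsto (fun n => ∫ t in (0 : ℝ)..x n, t ^ k * w t) Filter.atTop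
      (nhds (1 / (Real.pi * B k))) := by
  have hseg : ∀ n, ∀ t ∈ Set.uIcc 0 (x n), 0 ≤ t ∧ 0 < 1 + ε * t := fun n t ht => by
    rw [Set.uIcc_of_le (hx0 n)] at ht
    refine ⟨ht.1, ?_⟩
    have := hx n
    rcases le_total 0 ε with h | h <;> nlinarith [ht.1, ht.2]
  have hint : ∀ k n, IntervalIntegrable (fun t => t ^ k * w t) volume 0 (x n) := fun k n =>
    ContinuousOn.intervalIntegrable (((continuous_pow k).continuousOn).mul
      (hwc.mono fun t ht => (hseg n t ht).2))
  induction k with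
  | zero =>
    have h1 : ∀ n, ∫ t in (0 : ℝ)..x n, t ^ 0 * w t =
        (1 - x n ^ 0 * ((1 + ε * x n) * w (x n))) / α := by
      intro n
      have h2 := intervalIntegral.integral_eq_sub_of_hasDerivAt
        (fun t ht => hder t (hseg n t ht).1 (hseg n t ht).2)
        (by simpa using (hint 0 n).const_mul (-α))
      rw [intervalIntegral.integral_const_mul] at h2
      simp only [pow_zero, one_mul]
      rw [eq_div_iff hα]
      rw [hw1] at h2
      linarith
    simp only [h1]
    have h3 := ((hlim 0 hk).const_sub 1).div_const α
    have hπ := Real.pi_ne_zero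
    rwa [sub_zero, show (1 : ℝ) / α = 1 / (Real.pi * B 0) by rw [hB0]; field_simp] at h3
  | succ k ih =>
    have ih' := ih (by omega)
    have hBk := hBpos (k + 1) hk
    have hBk' := hBpos k (by omega)
    have hrec := hB k
    -- Positivity of `B (k + 1)` is what permits division; on the sphere this confines the argument
    -- to `k + 1 < α`.
    have hγ : α - ε * (k + 1) ≠ 0 := by
      intro h0
      rw [h0, mul_zero] at hrec
      have : 0 < B (k + 1) * (k + 1) := by positivity
      linarith
    have h1 : ∀ n, ∫ t in (0 : ℝ)..x n, t ^ (k + 1) * w t =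
        ((k + 1) * (∫ t in (0 : ℝ)..x n, t ^ k * w t) -
          x n ^ (k + 1) * ((1 + ε * x n) * w (x n))) / (α - ε * (k + 1)) := by
      intro n
      -- Integration by parts: up to a boundary term, the moments satisfy `(k + 1) mₖ = (α - ε (k +
      -- 1)) mₖ₊₁`, the recursion of `1 / (π B k)`.
      have hd : ∀ t ∈ Set.uIcc 0 (x n), HasDerivAt (fun s => s ^ (k + 1) * ((1 + ε * s) * w s))
          ((k + 1) * (t ^ k * w t) - (α - ε * (k + 1)) * (t ^ (k + 1) * w t)) t := by
        intro t ht
        refine ((hasDerivAt_pow (k + 1) t).mul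
          (hder t (hseg n t ht).1 (hseg n t ht).2)).congr_deriv ?_
        push_cast
        ring
      have h2 := intervalIntegral.integral_eq_sub_of_hasDerivAt hd
        (((hint k n).const_mul _).sub ((hint (k + 1) n).const_mul _))
      rw [intervalIntegral.integral_sub ((hint k n).const_mul _) ((hint (k + 1) n).const_mul _),
        intervalIntegral.integral_const_mul, intervalIntegral.integral_const_mul] at h2
      rw [eq_div_iff hγ]
      simp only [ne_eq, Nat.add_eq_zero_iff, one_ne_zero, and_false, not_false_eq_true, zero_pow,
        zero_mul, sub_zero] at h2
      linarith
    simp only [h1]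
    have h3 := ((ih'.const_mul ((k : ℝ) + 1)).sub (hlim (k + 1) hk)).div_const (α - ε * (k + 1))
    convert! h3 using 2
    rw [sub_zero]
    have hπ := Real.pi_ne_zero
    have hk1 : (k : ℝ) + 1 ≠ 0 := by positivity
    rw [eq_div_iff hγ]
    field_simp
    linear_combination -hrec

/-- Monotone convergence over the intervals `[0, x n]`, which exhaust the range of `|z|²` and treat
bounded and unbounded ranges alike. The cutoff `N` is for the sphere, where only finitely many
moments are finite. -/
theorem lintegral_pow_radialMeasure {α : ℝ} {x : ℕ → ℝ} {B : ℕ → ℝ} {N : ℕ} (hα : α ≠ 0)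
    (hw1 : w 0 = 1) (hx0 : ∀ n, 0 ≤ x n) (hx : ∀ n, 0 < 1 + ε * x n)
    (hwm : Measurable w) (hwc : ContinuousOn w {t | 0 < 1 + ε * t})
    (hwpos : ∀ t, 0 ≤ t → 0 < 1 + ε * t → 0 ≤ w t) (hxm : Monotone x)
    (hxe : ∀ t, 0 ≤ t → 0 < 1 + ε * t → ∃ n, t ≤ x n)
    (hder : ∀ t, 0 ≤ t → 0 < 1 + ε * t →
      HasDerivAt (fun s => (1 + ε * s) * w s) (-α * w t) t)
    (hlim : ∀ k ≤ N, Filter.Tendsto (fun n => x n ^ k * ((1 + ε * x n) * w (x n))) Filter.atTop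
      (nhds 0))
    (hB0 : B 0 = α / Real.pi) (hB : ∀ k, B (k + 1) * (k + 1) = B k * (α - ε * (k + 1)))
    (hBpos : ∀ k ≤ N, 0 < B k) {k : ℕ} (hk : k ≤ N) :
    ∫⁻ z, ‖z‖ₑ ^ (2 * k) ∂(radialMeasure ε w) = ENNReal.ofReal (1 / B k) := by
  have h1 : ∀ z : ℂ, ‖z‖ₑ ^ (2 * k) = ENNReal.ofReal ((‖z‖ ^ 2) ^ k) := fun z => by
    rw [ENNReal.ofReal_pow (by positivity), ofReal_norm_sq, pow_mul]
  simp only [h1]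
  rw [lintegral_radialMeasure hwm
    (by fun_prop : Measurable fun t : ℝ => ENNReal.ofReal (t ^ k))]
  have hseg : ∀ n, ∀ t ∈ Set.Icc 0 (x n), 0 ≤ t ∧ 0 < 1 + ε * t := fun n t ht => by
    refine ⟨ht.1, ?_⟩
    have := hx n
    rcases le_total 0 ε with h | h <;> nlinarith [ht.1, ht.2]
  have hunion : {t : ℝ | 0 ≤ t ∧ 0 < 1 + ε * t} = ⋃ n, Set.Icc 0 (x n) := by
    ext t
    simp only [Set.mem_ofPred_eq, Set.mem_iUnion]
    exact ⟨fun h => (hxe t h.1 h.2).imp fun n hn => ⟨h.1, hn⟩, fun ⟨n, hn⟩ => hseg n t hn⟩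
  have hmono : Monotone fun n => Set.Icc 0 (x n) := fun m n hmn =>
    Set.Icc_subset_Icc_right (hxm hmn)
  have hval : ∀ n, ∫⁻ t in Set.Icc 0 (x n), ENNReal.ofReal (w t) * ENNReal.ofReal (t ^ k) =
      ENNReal.ofReal (∫ t in (0 : ℝ)..x n, t ^ k * w t) := by
    intro n
    have hint : IntegrableOn (fun t => t ^ k * w t) (Set.Icc 0 (x n)) :=
      ContinuousOn.integrableOn_Icc (((continuous_pow k).continuousOn).mul
        (hwc.mono fun t ht => (hseg n t ht).2))
    rw [intervalIntegral.integral_of_le (hx0 n), ← integral_Icc_eq_integral_Ioc,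
      ofReal_integral_eq_lintegral_ofReal hint]
    · refine setLIntegral_congr_fun measurableSet_Icc fun t ht => ?_
      rw [mul_comm, ENNReal.ofReal_mul (pow_nonneg ht.1 k)]
    · filter_upwards [ae_restrict_mem measurableSet_Icc] with t ht
      exact mul_nonneg (pow_nonneg ht.1 k) (hwpos t (hseg n t ht).1 (hseg n t ht).2)
  have hlim1 : Filter.Tendsto (fun n => ∫⁻ t in Set.Icc 0 (x n),
      ENNReal.ofReal (w t) * ENNReal.ofReal (t ^ k)) Filter.atTop
      (nhds (∫⁻ t in ⋃ n, Set.Icc 0 (x n), ENNReal.ofReal (w t) * ENNReal.ofReal (t ^ k))) := by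
    rw [setLIntegral_iUnion_of_directed _ hmono.directed_le]
    exact tendsto_atTop_iSup fun m n hmn => lintegral_mono_set (hmono hmn)
  have hlim2 := ENNReal.tendsto_ofReal
    (tendsto_integral_pow_mul hα hw1 hx0 hx hwc hder hlim hB0 hB hBpos hk)
  simp only [← hval] at hlim2
  rw [hunion, tendsto_nhds_unique hlim1 hlim2, ← ENNReal.ofReal_mul Real.pi_pos.le]
  congr 1
  have := hBpos k hk
  have hπ := Real.pi_ne_zero
  field_simp

end Radial

/-! ## The monomials in the space of analytic functions of a radial weight -/

section Monomials

variable {ε : ℝ} {w : ℝ → ℝ} {B : ℕ → ℝ}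

theorem memLp_two_of_lintegral {Ω : Type*} [MeasurableSpace Ω] {μ : Measure Ω} {f : Ω → ℂ}
    (hf : AEStronglyMeasurable f μ) (h : ∫⁻ z, ‖f z‖ₑ ^ 2 ∂μ ≠ ∞) : MemLp f 2 μ := by
  refine ⟨hf, ?_⟩
  rw [eLpNorm_lt_top_iff_lintegral_rpow_enorm_lt_top two_ne_zero ENNReal.ofNat_ne_top]
  simpa using h.lt_top

theorem MemLp.lintegral_enorm_sq_ne_top {Ω : Type*} [MeasurableSpace Ω] {μ : Measure Ω}
    {f : Ω → ℂ} (h : MemLp f 2 μ) : ∫⁻ z, ‖f z‖ₑ ^ 2 ∂μ ≠ ∞ := by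
  have h1 := h.2
  rw [eLpNorm_lt_top_iff_lintegral_rpow_enorm_lt_top two_ne_zero ENNReal.ofNat_ne_top] at h1
  simpa using h1.ne

theorem enorm_mul_pow_sq (b : ℝ) (hb : 0 ≤ b) (z : ℂ) (k : ℕ) :
    ‖(Real.sqrt b : ℂ) * z ^ k‖ₑ ^ 2 = ENNReal.ofReal b * ‖z‖ₑ ^ (2 * k) := by
  rw [enorm_mul, mul_pow, enorm_pow, ← pow_mul, mul_comm k 2]
  congr 1
  rw [← ofReal_norm_sq, Complex.norm_real, Real.norm_of_nonneg (Real.sqrt_nonneg b), Real.sq_sqrt hb]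

theorem lintegral_enorm_sqrt_mul_pow {k : ℕ} (hB : 0 < B k)
    (hm : ∫⁻ z, ‖z‖ₑ ^ (2 * k) ∂(radialMeasure ε w) = ENNReal.ofReal (1 / B k)) :
    ∫⁻ z, ‖(Real.sqrt (B k) : ℂ) * z ^ k‖ₑ ^ 2 ∂(radialMeasure ε w) = 1 := by
  simp only [enorm_mul_pow_sq _ hB.le]
  rw [lintegral_const_mul' _ _ ENNReal.ofReal_ne_top, hm, ← ENNReal.ofReal_mul hB.le,
    mul_one_div_cancel hB.ne', ENNReal.ofReal_one]

theorem memLp_sqrt_mul_pow {k : ℕ} (hB : 0 < B k)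
    (hm : ∫⁻ z, ‖z‖ₑ ^ (2 * k) ∂(radialMeasure ε w) = ENNReal.ofReal (1 / B k)) :
    MemLp (fun z : ℂ => (Real.sqrt (B k) : ℂ) * z ^ k) 2 (radialMeasure ε w) :=
  memLp_two_of_lintegral (by fun_prop : Continuous fun z : ℂ =>
    (Real.sqrt (B k) : ℂ) * z ^ k).aestronglyMeasurable (by
      rw [lintegral_enorm_sqrt_mul_pow hB hm]
      exact ENNReal.one_ne_top)

/-- The normalized monomials are orthonormal for a radial weight. -/
theorem isOrthonormalL2_monomials (hw : Measurable w) {ι : Type*} (e : ι → ℕ)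
    (he : Function.Injective e) (hB : ∀ i, 0 < B (e i))
    (hm : ∀ i, ∫⁻ z, ‖z‖ₑ ^ (2 * e i) ∂(radialMeasure ε w) = ENNReal.ofReal (1 / B (e i))) :
    IsOrthonormalL2 (radialMeasure ε w)
      fun i (z : ℂ) => (Real.sqrt (B (e i)) : ℂ) * z ^ (e i) := by
  have hLp := fun i => memLp_sqrt_mul_pow (hB i) (hm i)
  refine ⟨hLp, fun i => ?_, fun i j hij => ?_⟩
  · have h1 : ∀ z : ℂ, (Real.sqrt (B (e i)) : ℂ) * z ^ (e i) *
        conj ((Real.sqrt (B (e i)) : ℂ) * z ^ (e i)) =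
        ((‖(Real.sqrt (B (e i)) : ℂ) * z ^ (e i)‖ ^ 2 : ℝ) : ℂ) := fun z => by
      rw [Complex.mul_conj, Complex.normSq_eq_norm_sq]
    simp only [h1]
    rw [integral_complex_ofReal, integral_eq_lintegral_of_nonneg_ae
      (Filter.Eventually.of_forall fun z => by positivity)
      (by fun_prop : Continuous fun z : ℂ =>
        ‖(Real.sqrt (B (e i)) : ℂ) * z ^ (e i)‖ ^ 2).aestronglyMeasurable]
    simp only [ofReal_norm_sq]
    rw [lintegral_enorm_sqrt_mul_pow (hB i) (hm i)]
    simp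
  · have hi : Integrable (fun z : ℂ => (Real.sqrt (B (e i)) : ℂ) * z ^ (e i) *
        conj ((Real.sqrt (B (e j)) : ℂ) * z ^ (e j))) (radialMeasure ε w) := by
      have h2 := (hLp j).star
      exact MemLp.integrable_mul (p := 2) (q := 2) (hLp i) h2
    -- On each circle distinct powers are orthogonal, whatever the radial weight.
    rw [integral_eq_integral_rot (map_rot_radialMeasure hw) (by fun_prop) hi]
    have h3 : ∀ z : ℂ, ∫ t, (Real.sqrt (B (e i)) : ℂ) * (rot t * z) ^ (e i) *
        conj ((Real.sqrt (B (e j)) : ℂ) * (rot t * z) ^ (e j)) ∂circleMeasure = 0 := by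
      intro z
      have h4 : ∀ t, (Real.sqrt (B (e i)) : ℂ) * (rot t * z) ^ (e i) *
          conj ((Real.sqrt (B (e j)) : ℂ) * (rot t * z) ^ (e j)) =
          (Real.sqrt (B (e i)) : ℂ) * z ^ (e i) * conj ((Real.sqrt (B (e j)) : ℂ) * z ^ (e j)) *
            (rot t ^ (e i) * conj (rot t) ^ (e j)) := fun t => by
        simp only [map_mul, map_pow]
        ring
      simp only [h4]
      rw [integral_const_mul, integral_rot_pow_mul_conj_pow, if_neg (he.ne hij), mul_zero]
    simp only [h3, integral_zero]

/-- An analytic function in `L²` of a radial weight which is orthogonal to all monomials in `L²`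
vanishes. -/
theorem eq_zero_of_orthogonal_monomials (hw : Measurable w) {f : ℂ → ℂ}
    (hf : DifferentiableOn ℂ f (geomDomain ε)) (hfm : Measurable f)
    (hf2 : MemLp f 2 (radialMeasure ε w))
    (hB : ∀ k, (0 < B k ∧
        ∫⁻ z, ‖z‖ₑ ^ (2 * k) ∂(radialMeasure ε w) = ENNReal.ofReal (1 / B k) ∧
        ∫ z, f z * conj ((Real.sqrt (B k) : ℂ) * z ^ k) ∂(radialMeasure ε w) = 0) ∨
      ∫⁻ z, ‖z‖ₑ ^ (2 * k) ∂(radialMeasure ε w) = ∞) :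
    ∀ z ∈ geomDomain ε, f z = 0 := by
  have hc : ∀ k, taylorCoeff f k = 0 := by
    intro k
    rcases hB k with ⟨hBk, hmk, hk⟩ | hk
    -- By Cauchy's formula on circles, the product of `f` with the normalized monomial is a nonzero
    -- multiple of the coefficient.
    · have hLp := memLp_sqrt_mul_pow hBk hmk
      have hi : Integrable (fun z : ℂ => f z * conj ((Real.sqrt (B k) : ℂ) * z ^ k))
          (radialMeasure ε w) := MemLp.integrable_mul (p := 2) (q := 2) hf2 hLp.star
      rw [integral_eq_integral_rot (map_rot_radialMeasure hw) (by fun_prop) hi] at hk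
      have h1 : ∀ᵐ z ∂(radialMeasure ε w), ∫ t, f (rot t * z) *
          conj ((Real.sqrt (B k) : ℂ) * (rot t * z) ^ k) ∂circleMeasure =
          (Real.sqrt (B k) : ℂ) * taylorCoeff f k * ((‖z‖ ^ (2 * k) : ℝ) : ℂ) := by
        filter_upwards [ae_mem_radialMeasure] with z hz
        have h2 : ∀ t, f (rot t * z) * conj ((Real.sqrt (B k) : ℂ) * (rot t * z) ^ k) =
            (Real.sqrt (B k) : ℂ) * (f (rot t * z) * conj (rot t * z) ^ k) := fun t => by
          rw [map_mul, Complex.conj_ofReal, map_pow]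
          ring
        simp only [h2]
        rw [integral_const_mul, integral_rot_mul_conj_pow hf hz k]
        push_cast
        ring
      rw [integral_congr_ae h1, integral_const_mul, integral_complex_ofReal,
        integral_eq_lintegral_of_nonneg_ae (Filter.Eventually.of_forall fun z => by positivity)
          (by fun_prop : Continuous fun z : ℂ => ‖z‖ ^ (2 * k)).aestronglyMeasurable] at hk
      have h3 : ∀ z : ℂ, ENNReal.ofReal (‖z‖ ^ (2 * k)) = ‖z‖ₑ ^ (2 * k) := fun z => by
        rw [pow_mul, pow_mul, ENNReal.ofReal_pow (by positivity), ofReal_norm_sq]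
      simp only [h3, hmk] at hk
      rw [ENNReal.toReal_ofReal (by positivity)] at hk
      have h4 : (Real.sqrt (B k) : ℂ) ≠ 0 := by
        exact_mod_cast (Real.sqrt_pos.2 hBk).ne'
      have h5 : ((1 / B k : ℝ) : ℂ) ≠ 0 := by
        exact_mod_cast (by positivity : 1 / B k ≠ 0)
      simpa [h4, hBk.ne'] using hk
    -- By Bessel's inequality on circles `‖f‖²` is at least `|c k|² ∫ |z|^(2k)`, which is infinite
    -- unless `c k = 0`.
    · by_contra hne
      have h1 := lintegral_eq_lintegral_rot (map_rot_radialMeasure (ε := ε) hw)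
        (F := fun z => ‖f z‖ₑ ^ 2) (hfm.enorm.pow_const 2)
      refine MemLp.lintegral_enorm_sq_ne_top hf2 (top_le_iff.1 ?_)
      calc (∞ : ℝ≥0∞) = ‖taylorCoeff f k‖ₑ ^ 2 * ∫⁻ z, ‖z‖ₑ ^ (2 * k) ∂(radialMeasure ε w) := by
            rw [hk, ENNReal.mul_top (by simpa using hne)]
        _ = ∫⁻ z, ‖taylorCoeff f k‖ₑ ^ 2 * ‖z‖ₑ ^ (2 * k) ∂(radialMeasure ε w) :=
            (lintegral_const_mul' _ _ (by simp)).symm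
        _ ≤ ∫⁻ z, ∫⁻ t, ‖f (rot t * z)‖ₑ ^ 2 ∂circleMeasure ∂(radialMeasure ε w) := by
            refine lintegral_mono_ae ?_
            filter_upwards [ae_mem_radialMeasure] with z hz
            exact enorm_taylorCoeff_sq_le hf hz k
        _ = ∫⁻ z, ‖f z‖ₑ ^ 2 ∂(radialMeasure ε w) := h1.symm
  intro z hz
  have h1 := hasSum_taylorCoeff hf hz
  simp only [hc, zero_mul] at h1
  exact h1.unique hasSum_zero

end Monomials

/-! ## The three families as weighted spaces of analytic functions -/

section Models

/-- The weight `w` on the geometry of curvature `ε`, with the reproducing kernel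
`∑ n, B n (z w̄)^n`. -/
structure IsWeightedModel (ε α : ℝ) (w : ℝ → ℝ) (B : ℕ → ℝ) (K : ℂ → ℂ → ℂ) : Prop where
  pos : 0 < α
  measurable : Measurable w
  coeff_zero : B 0 = α / Real.pi
  coeff_succ : ∀ k : ℕ, B (k + 1) * (k + 1) = B k * (α - ε * (k + 1))
  moment : ∀ k, (0 < B k ∧
      ∫⁻ z, ‖z‖ₑ ^ (2 * k) ∂(radialMeasure ε w) = ENNReal.ofReal (1 / B k)) ∨
    (B k = 0 ∧ ∫⁻ z, ‖z‖ₑ ^ (2 * k) ∂(radialMeasure ε w) = ∞)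
  hasSum : ∀ z ∈ geomDomain ε, ∀ v ∈ geomDomain ε,
    HasSum (fun n => (B n : ℂ) * (z * conj v) ^ n) (K z v)
  weight_pos : ∀ z ∈ geomDomain ε, 0 < w (‖z‖ ^ 2)
  diag : ∀ z ∈ geomDomain ε,
    (K z z).re * w (‖z‖ ^ 2) = α / Real.pi * (1 / (1 + ε * ‖z‖ ^ 2) ^ 2)

theorem geomDomain_zero : geomDomain 0 = Set.univ := by
  ext z
  simp [geomDomain]

theorem geomDomain_one : geomDomain 1 = Set.univ := by
  ext z
  simp only [geomDomain, Set.mem_ofPred_eq, Set.mem_univ, iff_true]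
  positivity

theorem geomDomain_neg_one : geomDomain (-1) = Metric.ball 0 1 := by
  ext z
  simp only [geomDomain, Set.mem_ofPred_eq, mem_ball_zero_iff]
  rw [← sq_lt_one_iff₀ (norm_nonneg z)]
  constructor <;> intro h <;> linarith

/-! ### The plane -/

/-- The weight of the plane family. -/
noncomputable def planeWeight (α t : ℝ) : ℝ := Real.exp (-α * t)

/-- The coefficients of the kernels of the plane family. -/
noncomputable def planeCoeff (α : ℝ) (k : ℕ) : ℝ := α / Real.pi * (α ^ k / k.factorial)

theorem planeMeasure_eq (α : ℝ) : planeMeasure α = radialMeasure 0 (planeWeight α) := by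
  rw [radialMeasure, geomDomain_zero, Measure.restrict_univ]
  rfl

theorem planeCoeff_pos {α : ℝ} (hα : 0 < α) (k : ℕ) : 0 < planeCoeff α k := by
  unfold planeCoeff
  positivity

theorem planeCoeff_succ (α : ℝ) (k : ℕ) :
    planeCoeff α (k + 1) * (k + 1) = planeCoeff α k * (α - 0 * (k + 1)) := by
  simp only [planeCoeff, Nat.factorial_succ]
  push_cast
  field_simp
  ring

theorem isWeightedModel_plane {α : ℝ} (hα : 0 < α) :
    IsWeightedModel 0 α (planeWeight α) (planeCoeff α) (planeKernel α) where
  pos := hα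
  measurable := by
    unfold planeWeight
    fun_prop
  coeff_zero := by simp [planeCoeff]
  coeff_succ := planeCoeff_succ α
  moment k := Or.inl ⟨planeCoeff_pos hα k, by
    refine lintegral_pow_radialMeasure (w := planeWeight α) (x := fun n => n) (α := α) (N := k) hα.ne'
      (by simp [planeWeight]) (fun n => Nat.cast_nonneg n) (by simp)
      (by unfold planeWeight; fun_prop) (by unfold planeWeight; fun_prop)
      (fun t _ _ => (Real.exp_pos _).le) Nat.mono_cast (fun t _ _ => exists_nat_ge t) ?_ ?_
      (by simp [planeCoeff]) (planeCoeff_succ α) (fun j _ => planeCoeff_pos hα j) le_rfl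
    · intro t _ _
      have h1 : HasDerivAt (planeWeight α) (-α * planeWeight α t) t := by
        have h2 := ((hasDerivAt_id t).const_mul (-α)).exp
        refine h2.congr_deriv ?_
        simp [planeWeight, mul_comm]
      simpa using h1
    · intro j _
      have h1 := (tendsto_rpow_mul_exp_neg_mul_atTop_nhds_zero j α hα).comp
        tendsto_natCast_atTop_atTop
      refine h1.congr fun n => ?_
      simp [planeWeight]⟩
  hasSum z _ v _ := by
    have h1 := (NormedSpace.expSeries_div_hasSum_exp ((α : ℂ) * (z * conj v))).mul_left
      ((α / Real.pi : ℝ) : ℂ)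
    rw [← Complex.exp_eq_exp_ℂ] at h1
    refine h1.of_eq fun n => ?_
    simp only [planeCoeff]
    push_cast
    ring
  weight_pos z _ := Real.exp_pos _
  diag z _ := by
    simp only [planeKernel, planeWeight]
    rw [Complex.mul_conj, Complex.normSq_eq_norm_sq, ← Complex.ofReal_mul, ← Complex.ofReal_exp,
      ← Complex.ofReal_mul, Complex.ofReal_re, mul_assoc, ← Real.exp_add]
    simp

/-! ### The sphere -/

/-- The weight of the sphere family. -/
noncomputable def sphereWeight (α : ℕ) (t : ℝ) : ℝ := 1 / (1 + t) ^ (α + 1)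

/-- The coefficients of the kernels of the sphere family. -/
noncomputable def sphereCoeff (α : ℕ) (k : ℕ) : ℝ := α / Real.pi * ((α - 1).choose k : ℝ)

theorem sphereMeasure_eq (α : ℕ) :
    sphereMeasure α = (radialMeasure 1 (sphereWeight α)).map (fun z : ℂ => (z : Sphere2)) := by
  rw [radialMeasure, geomDomain_one, Measure.restrict_univ]
  rfl

theorem sphereCoeff_pos {α k : ℕ} (hk : k < α) : 0 < sphereCoeff α k := by
  have h1 : 0 < (α - 1).choose k := Nat.choose_pos (by omega)
  have h2 : 0 < α := by omega
  unfold sphereCoeff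
  positivity

theorem sphereCoeff_succ {α : ℕ} (hα : 1 ≤ α) (k : ℕ) :
    sphereCoeff α (k + 1) * (k + 1) = sphereCoeff α k * (α - 1 * (k + 1)) := by
  obtain ⟨m, rfl⟩ : ∃ m, α = m + 1 := ⟨α - 1, by omega⟩
  simp only [sphereCoeff, Nat.add_sub_cancel]
  have h1 : ((m.choose (k + 1) : ℕ) : ℝ) * (k + 1) = (m.choose k : ℝ) * ((m : ℝ) - k) := by
    rcases le_or_gt k m with h | h
    · have := Nat.choose_succ_right_eq m k
      rw [← Nat.cast_sub h]
      exact_mod_cast this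
    · rw [Nat.choose_eq_zero_of_lt h, Nat.choose_eq_zero_of_lt (by omega)]
      simp
  push_cast
  linear_combination ((m : ℝ) + 1) / Real.pi * h1

/-- On `t > 1` the integrand `t ^ k / (1 + t) ^ (α + 1)` is at least `2 ^ (-(α + 1)) / t`. So `z ^
k` is not in L², which is why the basis on the sphere stops at `α - 1`. -/
theorem lintegral_sphereWeight_eq_top {α k : ℕ} (hk : α ≤ k) :
    ∫⁻ z, ‖z‖ₑ ^ (2 * k) ∂(radialMeasure 1 (sphereWeight α)) = ∞ := by
  have h1 : ∀ z : ℂ, ‖z‖ₑ ^ (2 * k) = ENNReal.ofReal ((‖z‖ ^ 2) ^ k) := fun z => by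
    rw [ENNReal.ofReal_pow (by positivity), ofReal_norm_sq, pow_mul]
  simp only [h1]
  rw [lintegral_radialMeasure (by unfold sphereWeight; fun_prop)
    (by fun_prop : Measurable fun t : ℝ => ENNReal.ofReal (t ^ k))]
  have hlow : ∫⁻ t in Set.Ioi (1 : ℝ), ENNReal.ofReal (1 / 2 ^ (α + 1)) * ENNReal.ofReal t⁻¹ ≤
      ∫⁻ t in {t : ℝ | 0 ≤ t ∧ 0 < 1 + 1 * t}, ENNReal.ofReal (sphereWeight α t) *
        ENNReal.ofReal (t ^ k) := by
    refine (setLIntegral_mono' measurableSet_Ioi fun t ht => ?_).trans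
      (lintegral_mono_set fun t ht => ?_)
    · have ht1 : (1 : ℝ) < t := ht
      have ht0 : 0 < t := one_pos.trans ht1
      rw [← ENNReal.ofReal_mul (by positivity), sphereWeight, ← ENNReal.ofReal_mul (by positivity)]
      refine ENNReal.ofReal_le_ofReal ?_
      rw [one_div_mul_eq_div, one_div_mul_eq_div, div_le_div_iff₀ (by positivity) (by positivity)]
      have h2 : (1 + t) ^ (α + 1) ≤ (2 * t) ^ (α + 1) := by gcongr; linarith
      have h3 : t ^ α ≤ t ^ k := pow_le_pow_right₀ ht1.le hk
      calc t⁻¹ * (1 + t) ^ (α + 1) ≤ t⁻¹ * (2 * t) ^ (α + 1) := by gcongr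
        _ = t ^ α * 2 ^ (α + 1) := by
            rw [mul_pow]
            field_simp
            ring
        _ ≤ t ^ k * 2 ^ (α + 1) := by gcongr
    · have ht1 : (1 : ℝ) < t := ht
      exact ⟨by linarith, by linarith⟩
  have htop : ∫⁻ t in Set.Ioi (1 : ℝ), ENNReal.ofReal t⁻¹ = ∞ := by
    by_contra hne
    refine not_integrableOn_Ioi_inv (a := (1 : ℝ)) ?_
    refine ⟨measurable_inv.aestronglyMeasurable, ?_⟩
    rw [hasFiniteIntegral_iff_ofReal]
    · exact lt_top_iff_ne_top.2 hne
    · filter_upwards [ae_restrict_mem measurableSet_Ioi] with t ht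
      exact inv_nonneg.2 (zero_le_one.trans (le_of_lt ht))
  rw [lintegral_const_mul' _ _ ENNReal.ofReal_ne_top, htop,
    ENNReal.mul_top (by simp)] at hlow
  rw [top_le_iff.1 hlow, ENNReal.mul_top (by simpa using Real.pi_pos)]

theorem isWeightedModel_sphere {α : ℕ} (hα : 1 ≤ α) :
    IsWeightedModel 1 α (sphereWeight α) (sphereCoeff α)
      fun z w => sphereKernel α (z : Sphere2) (w : Sphere2) where
  pos := by exact_mod_cast hα
  measurable := by
    unfold sphereWeight
    fun_prop
  coeff_zero := by simp [sphereCoeff]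
  coeff_succ := sphereCoeff_succ hα
  moment k := by
    rcases lt_or_ge k α with hk | hk
    · refine Or.inl ⟨sphereCoeff_pos hk, ?_⟩
      refine lintegral_pow_radialMeasure (w := sphereWeight α) (x := fun n => n) (α := α) (N := k)
        (by exact_mod_cast (by omega : α ≠ 0))
        (by simp [sphereWeight]) (fun n => Nat.cast_nonneg n)
        (fun n => by positivity)
        (by unfold sphereWeight; fun_prop) ?_
        (fun t _ _ => by unfold sphereWeight; positivity) Nat.mono_cast
        (fun t _ _ => exists_nat_ge t) ?_ ?_
        (by simp [sphereCoeff]) (sphereCoeff_succ hα) (fun j hj => sphereCoeff_pos (by omega)) le_rfl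
      · unfold sphereWeight
        refine ContinuousOn.div (by fun_prop) (by fun_prop) fun t ht => ?_
        have ht' : 0 < 1 + 1 * t := ht
        rw [one_mul] at ht'
        positivity
      · intro t ht _
        have h0 : (1 + t) ≠ 0 := by positivity
        have h1 : HasDerivAt (fun s : ℝ => 1 + 1 * s) 1 t := by
          simpa using ((hasDerivAt_id t).const_mul (1 : ℝ)).const_add 1
        have h2 : HasDerivAt (fun s : ℝ => 1 + s) 1 t := (hasDerivAt_id t).const_add 1
        have h3 : HasDerivAt (sphereWeight α)
            (-((α + 1 : ℕ) * (1 + t) ^ α) / ((1 + t) ^ (α + 1)) ^ 2) t := by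
          have h4 := (hasDerivAt_const t (1 : ℝ)).div (h2.pow (α + 1)) (pow_ne_zero _ h0)
          refine h4.congr_deriv ?_
          simp
        refine (h1.mul h3).congr_deriv ?_
        simp only [sphereWeight]
        push_cast
        field_simp
        ring
      -- The boundary term `n ^ j (1 + n) / (1 + n) ^ (α + 1)` is at most `1 / (n + 1)`, since `j +
      -- 1 ≤ α`.
      · intro j hj
        have h1 := tendsto_one_div_add_atTop_nhds_zero_nat (𝕜 := ℝ)
        refine squeeze_zero (fun n => by unfold sphereWeight; positivity) (fun n => ?_) h1
        simp only [sphereWeight]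
        rw [one_mul, mul_one_div, mul_div_assoc', div_le_div_iff₀ (by positivity) (by positivity)]
        have h2 : (n : ℝ) ^ j ≤ (1 + n) ^ j := by gcongr; linarith
        have h3 : (1 + (n : ℝ)) ^ (j + 2) ≤ (1 + n) ^ (α + 1) :=
          pow_le_pow_right₀ (by linarith [Nat.cast_nonneg (α := ℝ) n]) (by omega)
        calc (n : ℝ) ^ j * (1 + n) * (n + 1) ≤ (1 + n) ^ j * (1 + n) * (n + 1) := by gcongr
          _ = (1 + (n : ℝ)) ^ (j + 2) := by ring
          _ ≤ 1 * (1 + n) ^ (α + 1) := by rw [one_mul]; exact h3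
    · refine Or.inr ⟨?_, lintegral_sphereWeight_eq_top hk⟩
      rw [sphereCoeff, Nat.choose_eq_zero_of_lt (by omega)]
      simp
  hasSum z _ v _ := by
    have h1 : (1 + z * conj v) ^ (α - 1) = ∑ n ∈ Finset.range (α - 1 + 1),
        (z * conj v) ^ n * ((α - 1).choose n : ℂ) := by
      rw [add_comm, add_pow]
      simp
    have h2 : HasSum (fun n => ((α / Real.pi : ℝ) : ℂ) *
        ((z * conj v) ^ n * ((α - 1).choose n : ℂ)))
        (((α / Real.pi : ℝ) : ℂ) * (1 + z * conj v) ^ (α - 1)) := by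
      refine HasSum.mul_left _ ?_
      rw [h1]
      refine hasSum_sum_of_ne_finset_zero fun n hn => ?_
      rw [Nat.choose_eq_zero_of_lt (by simpa using hn)]
      simp
    refine h2.of_eq fun n => ?_
    simp only [sphereCoeff]
    push_cast
    ring
  weight_pos z _ := by
    unfold sphereWeight
    positivity
  diag z _ := by
    obtain ⟨m, rfl⟩ : ∃ m, α = m + 1 := ⟨α - 1, by omega⟩
    change (((((m + 1 : ℕ) : ℝ) / Real.pi : ℝ) : ℂ) * (1 + z * conj z) ^ (m + 1 - 1)).re * _ = _
    have h1 : (1 : ℂ) + z * conj z = ((1 + ‖z‖ ^ 2 : ℝ) : ℂ) := by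
      rw [Complex.mul_conj, Complex.normSq_eq_norm_sq]
      push_cast
      rfl
    rw [h1, ← Complex.ofReal_pow, ← Complex.ofReal_mul, Complex.ofReal_re, sphereWeight,
      Nat.add_sub_cancel, one_mul]
    field_simp
    ring

/-! ### The disk -/

/-- The weight of the disk family. -/
noncomputable def diskWeight (α t : ℝ) : ℝ := (1 - t) ^ (α - 1)

/-- The coefficients of the kernels of the disk family. -/
noncomputable def diskCoeff (α : ℝ) (k : ℕ) : ℝ :=
  α / Real.pi * ((∏ j ∈ Finset.range k, (α + 1 + j)) / k.factorial)

theorem diskCoeff_pos {α : ℝ} (hα : 0 < α) (k : ℕ) : 0 < diskCoeff α k := by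
  have h1 : 0 < ∏ j ∈ Finset.range k, (α + 1 + j) := Finset.prod_pos fun j _ => by positivity
  unfold diskCoeff
  positivity

theorem diskCoeff_succ (α : ℝ) (k : ℕ) :
    diskCoeff α (k + 1) * (k + 1) = diskCoeff α k * (α - -1 * (k + 1)) := by
  simp only [diskCoeff, Nat.factorial_succ, Finset.prod_range_succ]
  push_cast
  field_simp
  ring

/-- The binomial series, its generalized binomial coefficients rewritten as rising factorials over
`n!`. -/
theorem hasSum_one_sub_cpow (a : ℝ) {x : ℂ} (hx : ‖x‖ < 1) :
    HasSum (fun n : ℕ => (((∏ j ∈ Finset.range n, (a + j)) / n.factorial : ℝ) : ℂ) * x ^ n)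
      ((1 - x) ^ (-(a : ℂ))) := by
  have h1 := Complex.one_div_one_sub_cpow_hasFPowerSeriesOnBall_zero (a : ℂ)
  have h2 := h1.hasSum (y := x) (by
    rwa [Metric.mem_eball, edist_zero_right, ← ofReal_norm, ENNReal.ofReal_lt_one])
  rw [zero_add, one_div, ← Complex.cpow_neg] at h2
  refine h2.of_eq fun n => ?_
  rw [FormalMultilinearSeries.ofScalars_apply_eq, smul_eq_mul, ← Ring.multichoose_eq]
  congr 1
  have h3 := Ring.factorial_nsmul_multichoose_eq_ascPochhammer (a : ℂ) n
  have h5 : ∀ m : ℕ, (ascPochhammer ℂ m).eval (a : ℂ) = ∏ j ∈ Finset.range m, ((a : ℂ) + j) := by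
    intro m
    induction m with
    | zero => simp
    | succ m ih => rw [ascPochhammer_succ_eval, ih, Finset.prod_range_succ]
  rw [Polynomial.ascPochhammer_smeval_eq_eval, h5, nsmul_eq_mul] at h3
  have h4 : (n.factorial : ℂ) ≠ 0 := by exact_mod_cast n.factorial_ne_zero
  push_cast
  rw [div_eq_iff h4, ← h3, mul_comm]

theorem isWeightedModel_disk {α : ℝ} (hα : 0 < α) :
    IsWeightedModel (-1) α (diskWeight α) (diskCoeff α)
      fun z w => ((α / Real.pi : ℝ) : ℂ) * (1 - z * conj w) ^ (-((α : ℂ) + 1)) where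
  pos := hα
  measurable := by
    unfold diskWeight
    fun_prop
  coeff_zero := by simp [diskCoeff]
  coeff_succ := diskCoeff_succ α
  moment k := Or.inl ⟨diskCoeff_pos hα k, by
    refine lintegral_pow_radialMeasure (w := diskWeight α)
      (x := fun n : ℕ => 1 - 1 / ((n : ℝ) + 1)) (α := α) (N := k) hα.ne' (by simp [diskWeight]) (fun n => ?_) (fun n => ?_)
      (by unfold diskWeight; fun_prop) ?_
      (fun t _ ht => Real.rpow_nonneg (by linarith) _) ?_ (fun t _ ht => ?_) ?_ ?_
      (by simp [diskCoeff]) (diskCoeff_succ α) (fun j _ => diskCoeff_pos hα j) le_rfl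
    · have : 1 / ((n : ℝ) + 1) ≤ 1 :=
        div_le_one_of_le₀ (by linarith [Nat.cast_nonneg (α := ℝ) n]) (by positivity)
      linarith
    · have : 0 < 1 / ((n : ℝ) + 1) := by positivity
      linarith
    · unfold diskWeight
      refine ContinuousOn.rpow_const (by fun_prop) fun t ht => Or.inl ?_
      have ht' : 0 < 1 + -1 * t := ht
      linarith
    · intro m n hmn
      have : 1 / ((n : ℝ) + 1) ≤ 1 / ((m : ℝ) + 1) := Nat.one_div_le_one_div hmn
      dsimp only
      linarith
    · obtain ⟨n, hn⟩ := exists_nat_one_div_lt (show 0 < 1 - t by linarith)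
      exact ⟨n, by linarith⟩
    · intro t _ ht
      have ht' : 0 < 1 - t := by linarith
      have h1 : HasDerivAt (fun s : ℝ => 1 + -1 * s) (-1) t := by
        simpa using ((hasDerivAt_id t).const_mul (-1 : ℝ)).const_add 1
      have h2 : HasDerivAt (fun s : ℝ => 1 - s) (-1) t := (hasDerivAt_id t).const_sub 1
      have h3 : HasDerivAt (diskWeight α) (-1 * (α - 1) * (1 - t) ^ (α - 1 - 1)) t :=
        h2.rpow_const (Or.inl ht'.ne')
      refine (h1.mul h3).congr_deriv ?_
      simp only [diskWeight]
      rw [Real.rpow_sub_one ht'.ne' (α - 1)]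
      field_simp
      ring
    -- At `t = 1 - 1 / (n + 1)` the boundary term is at most `(1 - t) ^ α`, which tends to zero
    -- because `α > 0`.
    · intro j _
      have h1 : Filter.Tendsto (fun n : ℕ => (1 / ((n : ℝ) + 1)) ^ α) Filter.atTop (nhds 0) := by
        have := (tendsto_one_div_add_atTop_nhds_zero_nat (𝕜 := ℝ)).rpow_const (Or.inr hα.le)
        rwa [Real.zero_rpow hα.ne'] at this
      have h2 : ∀ n : ℕ, 0 ≤ 1 - 1 / ((n : ℝ) + 1) := fun n => by
        have : 1 / ((n : ℝ) + 1) ≤ 1 :=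
          div_le_one_of_le₀ (by linarith [Nat.cast_nonneg (α := ℝ) n]) (by positivity)
        linarith
      have h3 : ∀ n : ℕ, (1 + -1 * (1 - 1 / ((n : ℝ) + 1))) *
          diskWeight α (1 - 1 / ((n : ℝ) + 1)) = (1 / ((n : ℝ) + 1)) ^ α := fun n => by
        have h4 : 0 < 1 / ((n : ℝ) + 1) := by positivity
        rw [diskWeight, show 1 + -1 * (1 - 1 / ((n : ℝ) + 1)) = 1 / ((n : ℝ) + 1) by ring,
          sub_sub_cancel, Real.rpow_sub_one h4.ne', mul_div_cancel₀ _ h4.ne']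
      refine squeeze_zero (fun n => ?_) (fun n => ?_) h1
      · rw [h3]
        exact mul_nonneg (pow_nonneg (h2 n) j) (by positivity)
      · rw [h3]
        refine mul_le_of_le_one_left (by positivity) (pow_le_one₀ (h2 n) ?_)
        have : 0 < 1 / ((n : ℝ) + 1) := by positivity
        linarith⟩
  hasSum z hz v hv := by
    rw [geomDomain_neg_one, mem_ball_zero_iff] at hz hv
    have hx : ‖z * conj v‖ < 1 := by
      rw [norm_mul, RCLike.norm_conj]
      nlinarith [norm_nonneg z, norm_nonneg v]
    have h1 := (hasSum_one_sub_cpow (α + 1) hx).mul_left ((α / Real.pi : ℝ) : ℂ)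
    rw [Complex.ofReal_add, Complex.ofReal_one] at h1
    refine h1.of_eq fun n => ?_
    simp only [diskCoeff]
    push_cast
    ring
  weight_pos z hz := by
    have hz' : 0 < 1 + -1 * ‖z‖ ^ 2 := hz
    exact Real.rpow_pos_of_pos (by linarith) _
  diag z hz := by
    have hz' : 0 < 1 + -1 * ‖z‖ ^ 2 := hz
    have hz'' : 0 < 1 - ‖z‖ ^ 2 := by linarith
    have h1 : (1 : ℂ) - z * conj z = ((1 - ‖z‖ ^ 2 : ℝ) : ℂ) := by
      rw [Complex.mul_conj, Complex.normSq_eq_norm_sq]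
      push_cast
      rfl
    have h2 : -((α : ℂ) + 1) = ((-(α + 1) : ℝ) : ℂ) := by push_cast; rfl
    rw [h1, h2, ← Complex.ofReal_cpow hz''.le, ← Complex.ofReal_mul, Complex.ofReal_re, diskWeight,
      mul_assoc, ← Real.rpow_add hz'', show -(α + 1) + (α - 1) = -(2 : ℕ) by push_cast; ring,
      Real.rpow_neg hz''.le, Real.rpow_natCast, one_div, neg_one_mul, ← sub_eq_add_neg]

end Models

/-! ## Classification of the invariant analytic ensembles -/

section Classification

theorem IsWeightedModel.kernelIntensity_eq {ε α : ℝ} {w : ℝ → ℝ} {B : ℕ → ℝ} {K : ℂ → ℂ → ℂ}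
    (hM : IsWeightedModel ε α w B K) (hK : Measurable fun z => (K z z).re) :
    kernelIntensity (radialMeasure ε w) K = ENNReal.ofReal (α / Real.pi) • geomMeasure ε := by
  have hα := hM.pos
  have hwm : Measurable fun z : ℂ => ENNReal.ofReal (w (‖z‖ ^ 2)) :=
    (hM.measurable.comp (by fun_prop : Measurable fun z : ℂ => ‖z‖ ^ 2)).ennreal_ofReal
  rw [kernelIntensity, radialMeasure, ← withDensity_mul _ hwm hK.ennreal_ofReal, geomMeasure,
    ← withDensity_smul _ (measurable_geomDensity ε)]
  refine withDensity_congr_ae ?_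
  filter_upwards [ae_restrict_mem (measurableSet_geomDomain ε)] with z hz
  rw [Pi.mul_apply, Pi.smul_apply, smul_eq_mul, ← ENNReal.ofReal_mul (hM.weight_pos z hz).le,
    ← ENNReal.ofReal_mul (by positivity), mul_comm, hM.diag z hz]

theorem IsWeightedModel.radialMeasure_eq {ε α : ℝ} {w : ℝ → ℝ} {B : ℕ → ℝ} {K : ℂ → ℂ → ℂ}
    (hM : IsWeightedModel ε α w B K) (hK : Measurable fun z => (K z z).re) :
    radialMeasure ε w = (ENNReal.ofReal (α / Real.pi) • geomMeasure ε).withDensity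
      fun z => (ENNReal.ofReal (K z z).re)⁻¹ := by
  have hα := hM.pos
  rw [← hM.kernelIntensity_eq hK, kernelIntensity]
  refine (withDensity_inv_same hK.ennreal_ofReal ?_
    (Filter.Eventually.of_forall fun _ => ENNReal.ofReal_ne_top)).symm
  filter_upwards [ae_mem_radialMeasure] with z hz
  have h1 : 0 < (K z z).re * w (‖z‖ ^ 2) := by
    have hz' : 0 < 1 + ε * ‖z‖ ^ 2 := hz
    rw [hM.diag z hz]
    positivity
  have h2 := pos_of_mul_pos_left h1 (hM.weight_pos z hz).le
  simpa using h2

variable {ι : Type*} [Countable ι] {ε : ℝ} {μ : Measure ℂ} {φ : ι → ℂ → ℂ}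

/-- An invariant ensemble whose coefficients satisfy the recursion of a weighted model is that
model, up to a constant. -/
theorem IsInvariantEnsemble.eq_model [SigmaFinite μ] (h : IsInvariantEnsemble ε μ φ) {α : ℝ}
    {w : ℝ → ℝ} {B : ℕ → ℝ} {K : ℂ → ℂ → ℂ} (hM : IsWeightedModel ε α w B K)
    (hK : Measurable fun z => (K z z).re) {C : ℝ≥0∞} {A : ℕ → ℝ}
    (hν : kernelIntensity μ (seriesKernel φ) = C • geomMeasure ε) (hA0 : ∀ n, 0 ≤ A n)
    (hpos : 0 < A 0) (hA : ∀ z ∈ geomDomain ε, ∀ v ∈ geomDomain ε,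
        HasSum (fun n => (A n : ℂ) * (z * conj v) ^ n) (seriesKernel φ z v))
    (hrec : ∀ n : ℕ, A (n + 1) * (n + 1) = A n * (A 1 / A 0 - ε * n))
    (hα : A 1 / A 0 = α - ε) :
    ∃ c : ℝ, 0 < c ∧ (∀ z ∈ geomDomain ε, ∀ v ∈ geomDomain ε, seriesKernel φ z v = c * K z v) ∧
      μ = ENNReal.ofReal c⁻¹ • radialMeasure ε w ∧ C = ENNReal.ofReal (α / Real.pi) := by
  have hα0 := hM.pos
  have hB0 : 0 < B 0 := by
    rw [hM.coeff_zero]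
    positivity
  have hmass : radialMeasure ε w Set.univ = ENNReal.ofReal (1 / B 0) := by
    rcases hM.moment 0 with h1 | h1
    · simpa using h1.2
    · exact absurd h1.1 hB0.ne'
  -- The hypothesis `hα` makes the recursions of `A` and `B` identical, so the sequences are
  -- proportional.
  set c := A 0 / B 0 with hc
  have hc0 : 0 < c := by positivity
  have hAB : ∀ n, A n = c * B n := by
    intro n
    induction n with
    | zero => rw [hc, div_mul_cancel₀ _ hB0.ne']
    | succ n ih =>
      have h1 := hrec n
      have h2 := hM.coeff_succ n
      have h3 : (n : ℝ) + 1 ≠ 0 := by positivity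
      refine mul_right_cancel₀ h3 ?_
      rw [h1, mul_assoc, h2, ih, hα]
      ring
  have hKK : ∀ z ∈ geomDomain ε, ∀ v ∈ geomDomain ε, seriesKernel φ z v = c * K z v :=
    fun z hz v hv => (hA z hz v hv).unique (((hM.hasSum z hz v hv).mul_left (c : ℂ)).of_eq
      fun n => by
        rw [hAB]
        push_cast
        ring)
  have hμ := h.measure_eq hν hA0 hpos hA
  have hinv : Measurable fun z => (ENNReal.ofReal (K z z).re)⁻¹ := hK.ennreal_ofReal.inv
  have hμ' : μ = (C * ENNReal.ofReal c⁻¹) • (geomMeasure ε).withDensity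
      fun z => (ENNReal.ofReal (K z z).re)⁻¹ := by
    rw [withDensity_smul_measure] at hμ
    rw [hμ, mul_smul, ← withDensity_smul _ hinv]
    congr 1
    refine withDensity_congr_ae ?_
    filter_upwards [ae_mem_geomDomain ε] with z hz
    rw [hKK z hz z hz, Complex.re_ofReal_mul, ENNReal.ofReal_mul hc0.le, Pi.smul_apply, smul_eq_mul,
      ENNReal.ofReal_inv_of_pos hc0, ENNReal.mul_inv (Or.inr ENNReal.ofReal_ne_top)
        (Or.inl ENNReal.ofReal_ne_top)]
  have hr := hM.radialMeasure_eq hK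
  rw [withDensity_smul_measure] at hr
  set τ := (geomMeasure ε).withDensity fun z => (ENNReal.ofReal (K z z).re)⁻¹ with hτ
  have hαπ : ENNReal.ofReal (α / Real.pi) ≠ 0 := by
    simpa using by positivity
  -- The total masses are known on both sides, `A 0 μ(Ω) = 1` and `1 / B 0` for the weight; their
  -- comparison leaves one value for `C`.
  have hC : C = ENNReal.ofReal (α / Real.pi) := by
    have h1 := h.coeff_mul_measure_univ hpos hA
    rw [hr, Measure.smul_apply, smul_eq_mul] at hmass
    rw [hμ', Measure.smul_apply, smul_eq_mul] at h1
    have h2 : τ Set.univ = ENNReal.ofReal (α / Real.pi)⁻¹ * ENNReal.ofReal (1 / B 0) := by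
      rw [← hmass, ← mul_assoc, ← ENNReal.ofReal_mul (by positivity),
        inv_mul_cancel₀ (by positivity), ENNReal.ofReal_one, one_mul]
    have h3 : ENNReal.ofReal (A 0) * (C * ENNReal.ofReal c⁻¹ *
        (ENNReal.ofReal (α / Real.pi)⁻¹ * ENNReal.ofReal (1 / B 0))) =
        C * ENNReal.ofReal (α / Real.pi)⁻¹ := by
      have h4 : ENNReal.ofReal (A 0) * ENNReal.ofReal c⁻¹ * ENNReal.ofReal (1 / B 0) = 1 := by
        rw [← ENNReal.ofReal_mul hpos.le, ← ENNReal.ofReal_mul (by positivity), hc,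
          ENNReal.ofReal_eq_one]
        field_simp
      calc _ = C * ENNReal.ofReal (α / Real.pi)⁻¹ *
            (ENNReal.ofReal (A 0) * ENNReal.ofReal c⁻¹ * ENNReal.ofReal (1 / B 0)) := by ring
        _ = _ := by rw [h4, mul_one]
    rw [h2, h3] at h1
    calc C = C * (ENNReal.ofReal (α / Real.pi)⁻¹ * ENNReal.ofReal (α / Real.pi)) := by
          rw [← ENNReal.ofReal_mul (by positivity), inv_mul_cancel₀ (by positivity),
            ENNReal.ofReal_one, mul_one]
      _ = _ := by rw [← mul_assoc, h1, one_mul]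
  refine ⟨c, hc0, hKK, ?_, hC⟩
  conv_lhs => rw [hμ']
  rw [hr, smul_smul, hC, mul_comm]

theorem eq_zero_of_recursion {A : ℕ → ℝ} {β : ℝ}
    (hrec : ∀ n : ℕ, A (n + 1) * (n + 1) = A n * (β - 0 * n)) (hβ : β = 0) (n : ℕ) :
    A (n + 1) = 0 := by
  have h1 := hrec n
  rw [hβ, zero_mul, sub_zero, mul_zero] at h1
  exact (mul_eq_zero.1 h1).resolve_right (by positivity)

/-- Only `β = A 1 / A 0 = 0` has to be excluded. There the kernel is the constant `A 0`, so the
intensity has total mass `A 0 μ(ℂ) = 1`, whereas the invariant measure of the plane is infinite. -/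
theorem IsInvariantEnsemble.plane [Nonempty ι] [SigmaFinite μ] (h : IsInvariantEnsemble 0 μ φ) :
    ∃ α : ℝ, 0 < α ∧ ∃ c : ℝ, 0 < c ∧ (∀ z v, seriesKernel φ z v = c * planeKernel α z v) ∧
      μ = ENNReal.ofReal c⁻¹ • planeMeasure α ∧
      kernelIntensity μ (seriesKernel φ) = ENNReal.ofReal (α / Real.pi) • geomMeasure 0 := by
  obtain ⟨C, hC0, hC, hν⟩ := h.exists_intensity_eq
  obtain ⟨A, hA0, hpos, hA, hrec⟩ := h.exists_coeff (by simp) hC0 hC hν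
  have hdom : ∀ z : ℂ, z ∈ geomDomain 0 := fun z => by simp [geomDomain_zero]
  have hβ : 0 < A 1 / A 0 := by
    refine (div_nonneg (hA0 1) (hA0 0)).lt_of_ne' fun hβ => ?_
    have hAn := eq_zero_of_recursion hrec hβ
    have hKA : ∀ z, seriesKernel φ z z = (A 0 : ℂ) := fun z => by
      refine (hA z (hdom z) z (hdom z)).unique ?_
      have h1 : HasSum (fun n => (A n : ℂ) * (z * conj z) ^ n) ((A 0 : ℂ) * (z * conj z) ^ 0) :=
        hasSum_single 0 fun n hn => by
          obtain ⟨m, rfl⟩ := Nat.exists_eq_succ_of_ne_zero hn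
          simp [hAn]
      simpa using h1
    have hσ : geomMeasure 0 Set.univ = ∞ := by
      rw [geomMeasure, geomDomain_zero, Measure.restrict_univ]
      simp
    have hμ : kernelIntensity μ (seriesKernel φ) Set.univ = 1 := by
      rw [kernelIntensity]
      simp only [hKA, Complex.ofReal_re]
      rw [withDensity_const, Measure.smul_apply, smul_eq_mul]
      exact h.coeff_mul_measure_univ hpos hA
    rw [hν, Measure.smul_apply, hσ, smul_eq_mul, ENNReal.mul_top hC0] at hμ
    exact ENNReal.top_ne_one hμ
  have hKm : Measurable fun z => (planeKernel (A 1 / A 0) z z).re := by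
    unfold planeKernel
    fun_prop
  obtain ⟨c, hc, hK, hμ, hCα⟩ := h.eq_model (isWeightedModel_plane hβ) hKm hν hA0 hpos hA hrec
    (by rw [sub_zero])
  refine ⟨A 1 / A 0, hβ, c, hc, fun z v => hK z (hdom z) v (hdom v), ?_, hCα ▸ hν⟩
  rwa [planeMeasure_eq]

/-- The coefficients stay positive as long as `n < β`. If `n` jumped over `β` without meeting it,
the next coefficient would be negative. -/
theorem exists_nat_of_recursion {A : ℕ → ℝ} (hA0 : ∀ n, 0 ≤ A n) (hpos : 0 < A 0) {β : ℝ}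
    (hβ : 0 ≤ β) (hrec : ∀ n : ℕ, A (n + 1) * (n + 1) = A n * (β - 1 * n)) :
    ∃ m : ℕ, β = m := by
  by_contra! hne
  have hlt : ∀ n : ℕ, 0 < A n ∧ (n : ℝ) < β := by
    intro n
    induction n with
    | zero => exact ⟨hpos, by simpa using hβ.lt_of_ne' (by simpa using hne 0)⟩
    | succ n ih =>
      have h1 : 0 < A (n + 1) := by
        have h2 : 0 < A (n + 1) * (n + 1) := by
          rw [hrec n]
          exact mul_pos ih.1 (by linarith [ih.2])
        exact pos_of_mul_pos_left h2 (by positivity)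
      refine ⟨h1, lt_of_le_of_ne ?_ (hne (n + 1)).symm⟩
      by_contra! hlt
      have h3 := hrec (n + 1)
      have h4 : 0 ≤ A (n + 1 + 1) * ((n + 1 : ℕ) + 1) := mul_nonneg (hA0 _) (by positivity)
      rw [h3] at h4
      nlinarith
  obtain ⟨n, hn⟩ := exists_nat_gt β
  exact absurd (hlt n).2 (not_lt.2 hn.le)

theorem IsInvariantEnsemble.sphere [Nonempty ι] [SigmaFinite μ] (h : IsInvariantEnsemble 1 μ φ) :
    ∃ α : ℕ, 1 ≤ α ∧ ∃ c : ℝ, 0 < c ∧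
      (∀ z v : ℂ, seriesKernel φ z v = c * sphereKernel α (z : Sphere2) (v : Sphere2)) ∧
      μ = ENNReal.ofReal c⁻¹ • radialMeasure 1 (sphereWeight α) ∧
      kernelIntensity μ (seriesKernel φ) = ENNReal.ofReal (α / Real.pi) • geomMeasure 1 := by
  obtain ⟨C, hC0, hC, hν⟩ := h.exists_intensity_eq
  obtain ⟨A, hA0, hpos, hA, hrec⟩ := h.exists_coeff (by simp) hC0 hC hν
  have hdom : ∀ z : ℂ, z ∈ geomDomain 1 := fun z => by simp [geomDomain_one]
  obtain ⟨m, hm⟩ := exists_nat_of_recursion hA0 hpos (div_nonneg (hA0 1) (hA0 0)) hrec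
  have hKm : Measurable fun z : ℂ =>
      (sphereKernel (m + 1) (z : Sphere2) (z : Sphere2)).re := by
    change Measurable fun z : ℂ =>
      (((((m + 1 : ℕ) : ℝ) / Real.pi : ℝ) : ℂ) * (1 + z * conj z) ^ (m + 1 - 1)).re
    fun_prop
  obtain ⟨c, hc, hK, hμ, hCα⟩ := h.eq_model (isWeightedModel_sphere (by omega : 1 ≤ m + 1)) hKm hν
    hA0 hpos hA hrec (by rw [hm]; push_cast; ring)
  exact ⟨m + 1, by omega, c, hc, fun z v => hK z (hdom z) v (hdom v), hμ, hCα ▸ hν⟩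

theorem measurable_diskKernel_diag (α : ℝ) : Measurable fun z : ℂ =>
    (((α / Real.pi : ℝ) : ℂ) * (1 - z * conj z) ^ (-((α : ℂ) + 1))).re := by
  fun_prop

theorem lintegral_one_sub_inv_eq_top :
    ∫⁻ t in {t : ℝ | 0 ≤ t ∧ 0 < 1 + -1 * t}, ENNReal.ofReal (1 - t)⁻¹ = ∞ := by
  by_contra hne
  have h1 : ¬ IntervalIntegrable (fun t : ℝ => (t - 1)⁻¹) volume 0 1 := by
    rw [intervalIntegrable_sub_inv_iff]
    simp
  refine h1 ?_
  rw [intervalIntegrable_iff_integrableOn_Ico_of_le zero_le_one]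
  have hset : {t : ℝ | 0 ≤ t ∧ 0 < 1 + -1 * t} = Set.Ico 0 1 := by
    ext t
    simp only [Set.mem_ofPred_eq, Set.mem_Ico]
    constructor <;> rintro ⟨h2, h3⟩ <;> exact ⟨h2, by linarith⟩
  rw [hset] at hne
  have h2 : IntegrableOn (fun t : ℝ => (1 - t)⁻¹) (Set.Ico 0 1) := by
    refine ⟨(by fun_prop : Measurable fun t : ℝ => (1 - t)⁻¹).aestronglyMeasurable, ?_⟩
    rw [hasFiniteIntegral_iff_ofReal]
    · exact lt_top_iff_ne_top.2 hne
    · filter_upwards [ae_restrict_mem measurableSet_Ico] with t ht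
      exact inv_nonneg.2 (by linarith [ht.2])
  refine h2.neg.congr_fun (fun t _ => ?_) measurableSet_Ico
  rw [Pi.neg_apply, ← inv_neg, neg_sub]

/-- If `β = A 1 / A 0 ≤ 1`, the coefficients do not increase and `K z z ≤ A 0 / (1 - |z|²)`. Then
`μ` is at least a multiple of `dm / (1 - |z|²)`, whose mass diverges logarithmically at the
boundary, against `A 0 μ(Ω) = 1`. -/
theorem IsInvariantEnsemble.disk [Nonempty ι] [SigmaFinite μ]
    (h : IsInvariantEnsemble (-1) μ φ) :
    ∃ α : ℝ, 0 < α ∧ ∃ c : ℝ, 0 < c ∧ (∀ z ∈ geomDomain (-1), ∀ v ∈ geomDomain (-1),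
        seriesKernel φ z v =
          c * (((α / Real.pi : ℝ) : ℂ) * (1 - z * conj v) ^ (-((α : ℂ) + 1)))) ∧
      μ = ENNReal.ofReal c⁻¹ • radialMeasure (-1) (diskWeight α) ∧
      kernelIntensity μ (seriesKernel φ) = ENNReal.ofReal (α / Real.pi) • geomMeasure (-1) := by
  obtain ⟨C, hC0, hC, hν⟩ := h.exists_intensity_eq
  obtain ⟨A, hA0, hpos, hA, hrec⟩ := h.exists_coeff (by simp) hC0 hC hν
  have hβ : 1 < A 1 / A 0 := by
    by_contra! hβ
    have hle : ∀ n, A n ≤ A 0 := by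
      intro n
      induction n with
      | zero => exact le_rfl
      | succ n ih =>
        have h1 := hrec n
        have h2 : A (n + 1) * (n + 1) ≤ A n * (n + 1) := by
          rw [h1]
          exact mul_le_mul_of_nonneg_left (by linarith) (hA0 n)
        exact (le_of_mul_le_mul_right h2 (by positivity)).trans ih
    have hK : ∀ z ∈ geomDomain (-1), (seriesKernel φ z z).re ≤ A 0 * (1 - ‖z‖ ^ 2)⁻¹ := by
      intro z hz
      have hz1 : 0 < 1 + -1 * ‖z‖ ^ 2 := hz
      refine hasSum_le (fun n => ?_) (hasSum_kernel_diag hA hz)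
        ((hasSum_geometric_of_lt_one (by positivity) (by linarith : ‖z‖ ^ 2 < 1)).mul_left (A 0))
      exact mul_le_mul_of_nonneg_right (hle n) (by positivity)
    have hμ := h.measure_eq hν hA0 hpos hA
    have hmass := h.coeff_mul_measure_univ hpos hA
    have hA0' : ENNReal.ofReal (A 0) ≠ 0 := by simpa using hpos
    have hm1 : Measurable fun z => (ENNReal.ofReal (seriesKernel φ z z).re)⁻¹ :=
      ((Complex.measurable_re.comp ((measurable_seriesKernel h.measurable h.summable).comp
        (measurable_id.prodMk measurable_id))).ennreal_ofReal).inv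
    have hw : Measurable fun t : ℝ => (1 - t)⁻¹ := by fun_prop
    have hlow : ENNReal.ofReal (A 0)⁻¹ * radialMeasure (-1) (fun t => (1 - t)⁻¹) Set.univ ≤
        ∫⁻ z, (ENNReal.ofReal (seriesKernel φ z z).re)⁻¹ ∂(geomMeasure (-1)) := by
      rw [geomMeasure, lintegral_withDensity_eq_lintegral_mul _ (measurable_geomDensity _) hm1,
        radialMeasure, withDensity_apply _ MeasurableSet.univ, Measure.restrict_univ,
        ← lintegral_const_mul' _ _ ENNReal.ofReal_ne_top]
      refine lintegral_mono_ae ?_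
      filter_upwards [ae_restrict_mem (measurableSet_geomDomain (-1))] with z hz
      have hz1 : 0 < 1 + -1 * ‖z‖ ^ 2 := hz
      have hz2 : 0 < 1 - ‖z‖ ^ 2 := by linarith
      have hKpos := hpos.trans_le (le_kernel_diag hA0 hA hz)
      rw [Pi.mul_apply, ← ENNReal.ofReal_inv_of_pos hKpos, ← ENNReal.ofReal_mul (by positivity),
        ← ENNReal.ofReal_mul (by positivity)]
      refine ENNReal.ofReal_le_ofReal ?_
      rw [show 1 + -1 * ‖z‖ ^ 2 = 1 - ‖z‖ ^ 2 by ring]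
      calc (A 0)⁻¹ * (1 - ‖z‖ ^ 2)⁻¹ = 1 / (1 - ‖z‖ ^ 2) ^ 2 * (A 0 * (1 - ‖z‖ ^ 2)⁻¹)⁻¹ := by
            field_simp
        _ ≤ 1 / (1 - ‖z‖ ^ 2) ^ 2 * ((seriesKernel φ z z).re)⁻¹ := by
            gcongr
            exact hK z hz
    have htop : radialMeasure (-1) (fun t => (1 - t)⁻¹) Set.univ = ∞ := by
      have h1 := lintegral_radialMeasure (ε := -1) hw (F := fun _ => 1) measurable_const
      simp only [lintegral_one, mul_one] at h1
      rw [h1, lintegral_one_sub_inv_eq_top, ENNReal.mul_top (by simpa using Real.pi_pos)]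
    rw [htop, ENNReal.mul_top (by simpa using hpos)] at hlow
    rw [hμ, withDensity_apply _ MeasurableSet.univ, Measure.restrict_univ, lintegral_smul_measure,
      top_le_iff.1 hlow, smul_eq_mul, ENNReal.mul_top hC0, ENNReal.mul_top hA0'] at hmass
    exact ENNReal.top_ne_one hmass
  obtain ⟨c, hc, hK, hμ, hCα⟩ := h.eq_model (α := A 1 / A 0 - 1)
    (isWeightedModel_disk (by linarith)) (measurable_diskKernel_diag _) hν hA0 hpos hA hrec
    (by ring)
  exact ⟨A 1 / A 0 - 1, by linarith, c, hc, hK, hμ, hCα ▸ hν⟩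

end Classification

/-! ## Projection kernels of the three families -/

section Projection

theorem isOrthonormalL2_map {Ω Ω' ι : Type*} [MeasurableSpace Ω] [MeasurableSpace Ω']
    {μ : Measure Ω} {e : Ω → Ω'} (he : MeasurableEmbedding e) {φ : ι → Ω' → ℂ} :
    IsOrthonormalL2 (μ.map e) φ ↔ IsOrthonormalL2 μ fun k z => φ k (e z) := by
  constructor <;> intro h
  · refine ⟨fun k => he.memLp_map_measure_iff.1 (h.memLp k), fun k => ?_, fun j k hjk => ?_⟩
    · rw [← h.norm_one k, he.integral_map]
    · rw [← h.orthogonal j k hjk, he.integral_map]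
  · refine ⟨fun k => he.memLp_map_measure_iff.2 (h.memLp k), fun k => ?_, fun j k hjk => ?_⟩
    · rw [← h.norm_one k, he.integral_map]
    · rw [← h.orthogonal j k hjk, he.integral_map]

theorem sqrt_mul_pow_mul_conj {b : ℝ} (hb : 0 ≤ b) (z w : ℂ) (k : ℕ) :
    (Real.sqrt b : ℂ) * z ^ k * conj ((Real.sqrt b : ℂ) * w ^ k) = (b : ℂ) * (z * conj w) ^ k := by
  have h1 : (Real.sqrt b : ℂ) * Real.sqrt b = b := by
    rw [← Complex.ofReal_mul, Real.mul_self_sqrt hb]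
  rw [map_mul, Complex.conj_ofReal, map_pow, mul_pow]
  linear_combination z ^ k * conj w ^ k * h1

theorem IsWeightedModel.moment_eq {ε α : ℝ} {w : ℝ → ℝ} {B : ℕ → ℝ} {K : ℂ → ℂ → ℂ}
    (hM : IsWeightedModel ε α w B K) {k : ℕ} (hk : 0 < B k) :
    ∫⁻ z, ‖z‖ₑ ^ (2 * k) ∂(radialMeasure ε w) = ENNReal.ofReal (1 / B k) := by
  rcases hM.moment k with h | h
  · exact h.2
  · exact absurd h.1 hk.ne'

/-! ### The plane -/

theorem isOrthonormalL2_planeBasis {α : ℝ} (hα : 0 < α) :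
    IsOrthonormalL2 (planeMeasure α) (planeBasis α) := by
  rw [planeMeasure_eq]
  exact isOrthonormalL2_monomials (isWeightedModel_plane hα).measurable id Function.injective_id
    (fun k => planeCoeff_pos hα k) fun k => (isWeightedModel_plane hα).moment_eq (planeCoeff_pos hα k)

theorem hasSum_planeBasis {α : ℝ} (hα : 0 < α) (z w : ℂ) :
    HasSum (fun k => planeBasis α k z * conj (planeBasis α k w)) (planeKernel α z w) :=
  ((isWeightedModel_plane hα).hasSum z (by simp [geomDomain_zero]) w
    (by simp [geomDomain_zero])).of_eq fun k => sqrt_mul_pow_mul_conj (planeCoeff_pos hα k).le z w k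

theorem eq_zero_of_orthogonal_planeBasis {α : ℝ} (hα : 0 < α) {f : ℂ → ℂ}
    (hf : Differentiable ℂ f) (hf2 : MemLp f 2 (planeMeasure α))
    (h : ∀ k, ∫ z, f z * conj (planeBasis α k z) ∂(planeMeasure α) = 0) (z : ℂ) : f z = 0 := by
  rw [planeMeasure_eq] at hf2
  refine eq_zero_of_orthogonal_monomials (isWeightedModel_plane hα).measurable
    hf.differentiableOn hf.continuous.measurable hf2 (B := planeCoeff α) (fun k => Or.inl
      ⟨planeCoeff_pos hα k, (isWeightedModel_plane hα).moment_eq (planeCoeff_pos hα k), ?_⟩) z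
    (by simp [geomDomain_zero])
  have := h k
  rwa [planeMeasure_eq] at this

/-! ### The sphere -/

theorem measurableEmbedding_coe_sphere : MeasurableEmbedding fun z : ℂ => (z : Sphere2) :=
  OnePoint.isOpenEmbedding_coe.measurableEmbedding

theorem isOrthonormalL2_sphereBasis {α : ℕ} (hα : 1 ≤ α) :
    IsOrthonormalL2 (sphereMeasure α) (sphereBasis α) := by
  rw [sphereMeasure_eq, isOrthonormalL2_map measurableEmbedding_coe_sphere]
  exact isOrthonormalL2_monomials (isWeightedModel_sphere hα).measurable (fun k : Fin α => (k : ℕ))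
    Fin.val_injective (fun k => sphereCoeff_pos k.2)
    fun k => (isWeightedModel_sphere hα).moment_eq (sphereCoeff_pos k.2)

theorem sum_sphereBasis {α : ℕ} (hα : 1 ≤ α) (z w : Sphere2) :
    ∑ k, sphereBasis α k z * conj (sphereBasis α k w) = sphereKernel α z w := by
  induction z using OnePoint.rec with
  | infty => simp [sphereBasis, sphereKernel]
  | coe z =>
    induction w using OnePoint.rec with
    | infty => simp [sphereBasis, sphereKernel]
    | coe w =>
      have h1 : ∀ k : Fin α, sphereBasis α k (z : Sphere2) * conj (sphereBasis α k (w : Sphere2)) =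
          (sphereCoeff α k : ℂ) * (z * conj w) ^ (k : ℕ) := fun k =>
        sqrt_mul_pow_mul_conj (sphereCoeff_pos k.2).le z w k
      have h2 := (isWeightedModel_sphere hα).hasSum z (by simp [geomDomain_one]) w
        (by simp [geomDomain_one])
      simp only [h1]
      rw [Fin.sum_univ_eq_sum_range (fun k => (sphereCoeff α k : ℂ) * (z * conj w) ^ k)]
      refine HasSum.unique (hasSum_sum_of_ne_finset_zero fun k hk => ?_) h2
      have hk' : α ≤ k := by simpa using hk
      rw [sphereCoeff, Nat.choose_eq_zero_of_lt (by omega)]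
      simp

theorem eq_zero_of_orthogonal_sphereBasis {α : ℕ} (hα : 1 ≤ α) {f : Sphere2 → ℂ}
    (hf : Differentiable ℂ fun z : ℂ => f z) (hf2 : MemLp f 2 (sphereMeasure α))
    (h : ∀ k, ∫ z, f z * conj (sphereBasis α k z) ∂(sphereMeasure α) = 0) (z : ℂ) : f z = 0 := by
  rw [sphereMeasure_eq, measurableEmbedding_coe_sphere.memLp_map_measure_iff] at hf2
  refine eq_zero_of_orthogonal_monomials (f := fun z : ℂ => f z)
    (isWeightedModel_sphere hα).measurable
    hf.differentiableOn hf.continuous.measurable hf2 (B := sphereCoeff α) (fun k => ?_) z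
    (by simp [geomDomain_one])
  rcases lt_or_ge k α with hk | hk
  · refine Or.inl ⟨sphereCoeff_pos hk, (isWeightedModel_sphere hα).moment_eq (sphereCoeff_pos hk), ?_⟩
    have := h ⟨k, hk⟩
    rwa [sphereMeasure_eq, measurableEmbedding_coe_sphere.integral_map] at this
  · exact Or.inr (lintegral_sphereWeight_eq_top hk)

/-! ### The disk -/

theorem measurableEmbedding_coe_disk : MeasurableEmbedding (Subtype.val : Disk → ℂ) :=
  MeasurableEmbedding.subtype_coe measurableSet_ball

theorem map_diskMeasure (α : ℝ) :
    (diskMeasure α).map (Subtype.val : Disk → ℂ) = radialMeasure (-1) (diskWeight α) := by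
  have he := measurableEmbedding_coe_disk
  ext D hD
  have hf : Measurable fun z : ℂ => ENNReal.ofReal (diskWeight α (‖z‖ ^ 2)) := by
    unfold diskWeight
    fun_prop
  rw [Measure.map_apply he.measurable hD, diskMeasure, withDensity_apply _ (he.measurable hD),
    radialMeasure, withDensity_apply _ hD, geomDomain_neg_one]
  have h1 := he.lintegral_map (μ := ((volume : Measure ℂ).comap (Subtype.val : Disk → ℂ)).restrict
    (Subtype.val ⁻¹' D)) fun z : ℂ => ENNReal.ofReal (diskWeight α (‖z‖ ^ 2))
  rw [← he.restrict_map, he.map_comap, Subtype.range_coe] at h1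
  exact h1.symm

theorem isOrthonormalL2_diskBasis {α : ℝ} (hα : 0 < α) :
    IsOrthonormalL2 (diskMeasure α) (diskBasis α) := by
  refine (isOrthonormalL2_map measurableEmbedding_coe_disk
    (φ := fun k (z : ℂ) => (Real.sqrt (diskCoeff α k) : ℂ) * z ^ k)).1 ?_
  rw [map_diskMeasure]
  exact isOrthonormalL2_monomials (isWeightedModel_disk hα).measurable id Function.injective_id
    (fun k => diskCoeff_pos hα k) fun k => (isWeightedModel_disk hα).moment_eq (diskCoeff_pos hα k)

theorem Disk.mem_geomDomain (z : Disk) : (z : ℂ) ∈ geomDomain (-1) := by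
  rw [geomDomain_neg_one]
  exact z.2

theorem hasSum_diskBasis {α : ℝ} (hα : 0 < α) (z w : Disk) :
    HasSum (fun k => diskBasis α k z * conj (diskBasis α k w)) (diskKernel α z w) :=
  ((isWeightedModel_disk hα).hasSum z z.mem_geomDomain w w.mem_geomDomain).of_eq fun k =>
    sqrt_mul_pow_mul_conj (diskCoeff_pos hα k).le (z : ℂ) w k

theorem measurable_indicator_of_differentiableOn {U : Set ℂ} (hU : IsOpen U) {f : ℂ → ℂ}
    (hf : DifferentiableOn ℂ f U) : Measurable (U.indicator f) := by
  classical
  exact Measurable.of_union_range_cover (MeasurableEmbedding.subtype_coe hU.measurableSet)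
    (MeasurableEmbedding.subtype_coe hU.measurableSet.compl) (fun x _ => by
      by_cases hx : x ∈ U <;> simp [hx])
    (by
      have h1 : (U.indicator f ∘ (Subtype.val : U → ℂ)) = U.domRestrict f := by
        funext z
        exact Set.indicator_of_mem z.2 f
      rw [h1]
      exact hf.continuousOn.domRestrict.measurable)
    (by
      have h1 : (U.indicator f ∘ (Subtype.val : ↥Uᶜ → ℂ)) = fun _ => 0 := by
        funext z
        exact Set.indicator_of_notMem z.2 f
      rw [h1]
      exact measurable_const)

theorem eq_zero_of_orthogonal_diskBasis {α : ℝ} (hα : 0 < α) {f : ℂ → ℂ}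
    (hf : DifferentiableOn ℂ f (Metric.ball 0 1))
    (hf2 : MemLp (fun z : Disk => f z) 2 (diskMeasure α))
    (h : ∀ k, ∫ z : Disk, f z * conj (diskBasis α k z) ∂(diskMeasure α) = 0) (z : Disk) :
    f z = 0 := by
  have he := measurableEmbedding_coe_disk
  set F : ℂ → ℂ := (Metric.ball (0 : ℂ) 1).indicator f with hF
  have hFz : ∀ z : Disk, F z = f z := fun z => Set.indicator_of_mem z.2 f
  have hFd : DifferentiableOn ℂ F (geomDomain (-1)) := by
    rw [geomDomain_neg_one]
    exact hf.congr fun z hz => Set.indicator_of_mem hz f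
  rw [← hFz]
  refine eq_zero_of_orthogonal_monomials (isWeightedModel_disk hα).measurable
    hFd (measurable_indicator_of_differentiableOn Metric.isOpen_ball hf) ?_
    (B := diskCoeff α) (fun k => Or.inl
      ⟨diskCoeff_pos hα k, (isWeightedModel_disk hα).moment_eq (diskCoeff_pos hα k), ?_⟩) z
    z.mem_geomDomain
  · rw [← map_diskMeasure, he.memLp_map_measure_iff]
    exact (memLp_congr_ae (Filter.Eventually.of_forall fun z => hFz z)).2 hf2
  · rw [← map_diskMeasure, he.integral_map]
    simp only [hFz]
    exact h k

end Projection

/-! ## Invariance of the three families -/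

section Invariance

theorem IsWeightedModel.diag_pos {ε α : ℝ} {w : ℝ → ℝ} {B : ℕ → ℝ} {K : ℂ → ℂ → ℂ}
    (hM : IsWeightedModel ε α w B K) {z : ℂ} (hz : z ∈ geomDomain ε) : 0 < (K z z).re := by
  have hα := hM.pos
  have h1 : 0 < (K z z).re * w (‖z‖ ^ 2) := by
    have hz' : 0 < 1 + ε * ‖z‖ ^ 2 := hz
    rw [hM.diag z hz]
    positivity
  exact pos_of_mul_pos_left h1 (hM.weight_pos z hz).le

theorem map_withDensity_comp {Ω Ω' : Type*} [MeasurableSpace Ω] [MeasurableSpace Ω']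
    {μ : Measure Ω} {g : Ω → Ω'} (hg : Measurable g) {q : Ω' → ℝ≥0∞} (hq : Measurable q) :
    (μ.withDensity fun z => q (g z)).map g = (μ.map g).withDensity q := by
  ext D hD
  rw [Measure.map_apply hg hD, withDensity_apply _ (hg hD), withDensity_apply _ hD,
    setLIntegral_map hD hq hg]

/-- The weighted measure is a multiple of `σ / K z z`. On the diagonal the gauge relation says `‖u
z‖² = K z z / K (g z) (g z)`, so the factor `‖u‖²` turns it into the same multiple of `σ / K (g z)
(g z)`, which the `σ`-preserving map `g` sends to `σ / K z z`. -/
theorem IsWeightedModel.map_gauge {ε α : ℝ} {w : ℝ → ℝ} {B : ℕ → ℝ} {K : ℂ → ℂ → ℂ}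
    (hM : IsWeightedModel ε α w B K) (hK : Measurable fun z => (K z z).re) {g u : ℂ → ℂ}
    (hg : Measurable g) (hσ : (geomMeasure ε).map g = geomMeasure ε) (hu : Measurable u)
    (hgauge : ∀ᵐ z ∂(geomMeasure ε), K z z = u z * K (g z) (g z) * conj (u z)) :
    ((radialMeasure ε w).withDensity fun z => ENNReal.ofReal (‖u z‖ ^ 2)).map g =
      radialMeasure ε w := by
  have hinv : Measurable fun z => (ENNReal.ofReal (K z z).re)⁻¹ := hK.ennreal_ofReal.inv
  have hu2 : Measurable fun z => ENNReal.ofReal (‖u z‖ ^ 2) := (hu.norm.pow_const 2).ennreal_ofReal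
  have hae : ∀ {κ : ℝ≥0∞}, ∀ᵐ z ∂(κ • geomMeasure ε),
      ((fun z => (ENNReal.ofReal (K z z).re)⁻¹) * fun z => ENNReal.ofReal (‖u z‖ ^ 2)) z =
        (ENNReal.ofReal (K (g z) (g z)).re)⁻¹ := fun {κ} => by
    refine Measure.ae_smul_measure ?_ κ
    filter_upwards [hgauge, ae_mem_geomDomain ε] with z hz hzd
    have h1 : (K z z).re = ‖u z‖ ^ 2 * (K (g z) (g z)).re := by
      rw [mul_right_comm, Complex.mul_conj, Complex.normSq_eq_norm_sq] at hz
      rw [hz, Complex.re_ofReal_mul]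
    have h2 := hM.diag_pos hzd
    have h3 : 0 < ‖u z‖ ^ 2 := by
      refine (sq_nonneg _).lt_of_ne' fun h0 => ?_
      rw [h1, h0, zero_mul] at h2
      exact lt_irrefl _ h2
    have h5 : ENNReal.ofReal (‖u z‖ ^ 2) ≠ 0 := (ENNReal.ofReal_pos.2 h3).ne'
    rw [Pi.mul_apply, h1, ENNReal.ofReal_mul h3.le,
      ENNReal.mul_inv (Or.inl h5) (Or.inl ENNReal.ofReal_ne_top), mul_right_comm,
      ENNReal.inv_mul_cancel h5 ENNReal.ofReal_ne_top, one_mul]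
  rw [hM.radialMeasure_eq hK, ← withDensity_mul _ hinv hu2, withDensity_congr_ae hae,
    map_withDensity_comp hg hinv, Measure.map_smul, hσ]

theorem IsWeightedModel.isFiniteMeasure {ε α : ℝ} {w : ℝ → ℝ} {B : ℕ → ℝ} {K : ℂ → ℂ → ℂ}
    (hM : IsWeightedModel ε α w B K) : IsFiniteMeasure (radialMeasure ε w) := by
  have hα := hM.pos
  have h1 := hM.moment_eq (k := 0) (by rw [hM.coeff_zero]; positivity)
  simp only [mul_zero, pow_zero, lintegral_one] at h1
  exact ⟨h1 ▸ ENNReal.ofReal_lt_top⟩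

variable {S : Type*} [MeasurableSpace S] {P : Measure S} [IsProbabilityMeasure P]

/-! ### The plane -/

theorem isPSDKernel_planeKernel {α : ℝ} (hα : 0 < α) : IsPSDKernel (planeKernel α) :=
  IsPSDKernel.of_hasSum (planeBasis α) (hasSum_planeBasis hα)

theorem measurable_planeKernel (α : ℝ) : Measurable (Function.uncurry (planeKernel α)) := by
  simp only [Function.uncurry_def, planeKernel]
  fun_prop

theorem map_plane_geomMeasure {a : ℂ} (ha : ‖a‖ = 1) (b : ℂ) :
    (geomMeasure 0).map (fun z => a * z + b) = geomMeasure 0 := by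
  have h1 := map_rot_geomMeasure 0 ⟨a, mem_sphere_zero_iff_norm.2 ha⟩
  have h2 := map_geomTranslation (ε := 0) (w := b) (by simp [geomDomain_zero])
  have h3 : geomTranslation 0 b = fun z => z + b := by
    funext z
    simp [geomTranslation]
  rw [h3] at h2
  conv_rhs => rw [← h2]
  conv_rhs => rw [← h1]
  rw [Measure.map_map (by fun_prop) (by fun_prop)]
  rfl

/-- In `α (a x + b) conj (a y + b)` the terms other than `α x ȳ` split into a function of `x` and
the conjugate of the same function of `y`, half of `α|b|²` going to each. -/
theorem planeKernel_gauge {a : ℂ} (ha : ‖a‖ = 1) (b : ℂ) (α : ℝ) (x y : ℂ) :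
    planeKernel α x y =
      Complex.exp (-α * (a * conj b * x) - α * (b * conj b) / 2) *
        planeKernel α (a * x + b) (a * y + b) *
          conj (Complex.exp (-α * (a * conj b * y) - α * (b * conj b) / 2)) := by
  have haa : a * conj a = 1 := by
    rw [Complex.mul_conj, Complex.normSq_eq_norm_sq, ha]
    norm_num
  have hexp : Complex.exp (α * (x * conj y)) =
      Complex.exp (-α * (a * conj b * x) - α * (b * conj b) / 2) *
        Complex.exp (α * ((a * x + b) * conj (a * y + b))) *
          Complex.exp (conj (-α * (a * conj b * y) - α * (b * conj b) / 2)) := by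
    rw [← Complex.exp_add, ← Complex.exp_add]
    congr 1
    simp only [map_sub, map_mul, map_add, map_neg, map_div₀, Complex.conj_ofReal, Complex.conj_conj,
      map_ofNat]
    linear_combination -(α : ℂ) * x * conj y * haa
  rw [planeKernel, planeKernel, hexp, ← Complex.exp_conj]
  ring

theorem isFiniteMeasure_planeMeasure {α : ℝ} (hα : 0 < α) : IsFiniteMeasure (planeMeasure α) := by
  rw [planeMeasure_eq]
  exact (isWeightedModel_plane hα).isFiniteMeasure

theorem isInvariantInLaw_plane {X : S → Measure ℂ} {α : ℝ} (hα : 0 < α)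
    (h : IsDeterminantal P X (planeMeasure α) (planeKernel α)) :
    IsInvariantInLaw P X planeIsometries := by
  rintro g ⟨a, b, ha, rfl⟩
  have hM := isWeightedModel_plane hα
  have hfin := isFiniteMeasure_planeMeasure hα
  obtain ⟨u, hu, hgauge⟩ : ∃ u : ℂ → ℂ, Measurable u ∧ ∀ x y, planeKernel α x y =
      u x * planeKernel α (a * x + b) (a * y + b) * conj (u y) :=
    ⟨fun z => Complex.exp (-α * (a * conj b * z) - α * (b * conj b) / 2), by fun_prop,
      planeKernel_gauge ha b α⟩
  have hg : Measurable fun z : ℂ => a * z + b := by fun_prop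
  have hd : Measurable fun z => (planeKernel α z z).re := by
    simp only [planeKernel]
    fun_prop
  have hmap := hM.map_gauge (g := fun z => a * z + b) (u := u) hd hg (map_plane_geomMeasure ha b) hu
    (Filter.Eventually.of_forall fun z => hgauge z z)
  rw [← planeMeasure_eq] at hmap
  exact h.map_eq_of_gauge (g := fun z => a * z + b) (isPSDKernel_planeKernel hα)
    (measurable_planeKernel α) hg u hu hmap ∅ measure_empty fun x _ y _ => hgauge x y

/-! ### The sphere -/

theorem measurable_sphere {β : Type*} [MeasurableSpace β] {f : Sphere2 → β}
    (hf : Measurable fun z : ℂ => f z) : Measurable f := by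
  intro s hs
  have h1 : f ⁻¹' s = (fun z : ℂ => (z : Sphere2)) '' ((fun z : ℂ => f z) ⁻¹' s) ∪
      ({OnePoint.infty} ∩ f ⁻¹' s) := by
    ext z
    induction z using OnePoint.rec with
    | infty => simp
    | coe z => simp
  rw [h1]
  exact (measurableEmbedding_coe_sphere.measurableSet_image.2 (hf hs)).union
    (Set.Subsingleton.measurableSet (Set.subsingleton_singleton.anti Set.inter_subset_left))

theorem measurable_coe_sphere : Measurable fun z : ℂ => (z : Sphere2) :=
  measurableEmbedding_coe_sphere.measurable

theorem measurable_sphereMap (a b : ℂ) : Measurable (sphereMap a b) := by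
  classical
  refine measurable_sphere ?_
  have h1 : (fun z : ℂ => sphereMap a b (z : Sphere2)) = fun z : ℂ =>
      if -conj b * z + conj a = 0 then OnePoint.infty
      else (((a * z + b) / (-conj b * z + conj a) : ℂ) : Sphere2) := rfl
  rw [h1]
  refine Measurable.ite ?_ measurable_const (measurable_coe_sphere.comp (by fun_prop))
  exact measurableSet_eq_fun (by fun_prop) measurable_const

theorem sphereMap_coe {a b z : ℂ} (hz : -(((1 : ℝ) : ℂ) * conj b) * z + conj a ≠ 0) :
    sphereMap a b (z : Sphere2) = ((mobius 1 a b z : ℂ) : Sphere2) := by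
  rw [Complex.ofReal_one, one_mul] at hz
  have h1 : sphereMap a b (z : Sphere2) = if -conj b * z + conj a = 0 then OnePoint.infty
      else (((a * z + b) / (-conj b * z + conj a) : ℂ) : Sphere2) := rfl
  rw [h1, if_neg hz, mobius, Complex.ofReal_one, one_mul]

theorem measurable_sphereBasis (α : ℕ) (k : Fin α) : Measurable (sphereBasis α k) := by
  refine measurable_sphere ?_
  change Measurable fun z : ℂ =>
    (Real.sqrt (α / Real.pi * ((α - 1).choose k : ℝ)) : ℂ) * z ^ (k : ℕ)
  fun_prop

theorem measurable_sphereKernel {α : ℕ} (hα : 1 ≤ α) :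
    Measurable (Function.uncurry (sphereKernel α)) := by
  have h1 : Function.uncurry (sphereKernel α) = fun p : Sphere2 × Sphere2 =>
      ∑ k, sphereBasis α k p.1 * conj (sphereBasis α k p.2) := by
    funext p
    exact (sum_sphereBasis hα p.1 p.2).symm
  rw [h1]
  refine Finset.measurable_sum _ fun k _ => ?_
  exact ((measurable_sphereBasis α k).comp measurable_fst).mul
    (Complex.continuous_conj.measurable.comp ((measurable_sphereBasis α k).comp measurable_snd))

theorem isPSDKernel_sphereKernel {α : ℕ} (hα : 1 ≤ α) : IsPSDKernel (sphereKernel α) :=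
  IsPSDKernel.of_hasSum (sphereBasis α) fun z w => sum_sphereBasis hα z w ▸ hasSum_fintype _

/-- The polarized form of `one_add_norm_mobius`. It shows that powers of the denominator serve as
gauge for the sphere kernel. -/
theorem mobius_mul_conj_mobius {ε : ℝ} {a b z w : ℂ} (h : ‖a‖ ^ 2 + ε * ‖b‖ ^ 2 = 1)
    (hz : -(ε * conj b) * z + conj a ≠ 0) (hw : -(ε * conj b) * w + conj a ≠ 0) :
    1 + ε * (mobius ε a b z * conj (mobius ε a b w)) = (1 + ε * (z * conj w)) /
      ((-(ε * conj b) * z + conj a) * conj (-(ε * conj b) * w + conj a)) := by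
  have hw' : conj (-(ε * conj b) * w + conj a) ≠ 0 :=
    (map_ne_zero (starRingEnd ℂ)).2 hw
  have hab : a * conj a + ε * (b * conj b) = 1 := by
    rw [Complex.mul_conj, Complex.mul_conj, Complex.normSq_eq_norm_sq, Complex.normSq_eq_norm_sq]
    exact_mod_cast h
  rw [eq_div_iff (mul_ne_zero hz hw'), mobius, mobius, map_div₀, div_mul_div_comm, mul_div_assoc',
    add_mul, div_mul_cancel₀ _ (mul_ne_zero hz hw')]
  simp only [map_add, map_mul, map_neg, Complex.conj_conj, Complex.conj_ofReal]
  linear_combination (1 + ε * (z * conj w)) * hab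

theorem isFiniteMeasure_sphereMeasure {α : ℕ} (hα : 1 ≤ α) : IsFiniteMeasure (sphereMeasure α) := by
  have := (isWeightedModel_sphere hα).isFiniteMeasure
  rw [sphereMeasure_eq]
  infer_instance

theorem isInvariantInLaw_sphere {X : S → Measure Sphere2} {α : ℕ} (hα : 1 ≤ α)
    (h : IsDeterminantal P X (sphereMeasure α) (sphereKernel α)) :
    IsInvariantInLaw P X sphereIsometries := by
  rintro g ⟨a, b, hab, rfl⟩
  have hM := isWeightedModel_sphere hα
  have hab' : ‖a‖ ^ 2 + (1 : ℝ) * ‖b‖ ^ 2 = 1 := by rw [one_mul, hab]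
  have hfin := isFiniteMeasure_sphereMeasure hα
  set u : ℂ → ℂ := fun z => (-(((1 : ℝ) : ℂ) * conj b) * z + conj a) ^ (α - 1) with hu
  set U : Sphere2 → ℂ := fun z => OnePoint.elim z 0 u with hU
  have hUm : Measurable U := measurable_sphere (by
    change Measurable u
    fun_prop)
  have hgauge : ∀ x : ℂ, -(((1 : ℝ) : ℂ) * conj b) * x + conj a ≠ 0 →
      ∀ y : ℂ, -(((1 : ℝ) : ℂ) * conj b) * y + conj a ≠ 0 →
      sphereKernel α (x : Sphere2) (y : Sphere2) = u x * sphereKernel α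
        ((mobius 1 a b x : ℂ) : Sphere2) ((mobius 1 a b y : ℂ) : Sphere2) * conj (u y) := by
    intro x hx y hy
    have h1 := mobius_mul_conj_mobius hab' hx hy
    have hy' : conj (-(((1 : ℝ) : ℂ) * conj b) * y + conj a) ≠ 0 :=
      (map_ne_zero (starRingEnd ℂ)).2 hy
    change ((α / Real.pi : ℝ) : ℂ) * (1 + x * conj y) ^ (α - 1) =
      u x * (((α / Real.pi : ℝ) : ℂ) *
        (1 + mobius 1 a b x * conj (mobius 1 a b y)) ^ (α - 1)) * conj (u y)
    rw [Complex.ofReal_one, one_mul, one_mul] at h1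
    rw [Complex.ofReal_one] at hx hy'
    simp only [hu, Complex.ofReal_one]
    rw [h1, map_pow, div_pow, mul_pow]
    generalize conj (-(1 * conj b) * y + conj a) = q at hy'
    generalize -(1 * conj b) * x + conj a = p at hx
    field_simp
  have hpole : ∀ᵐ z ∂(radialMeasure 1 (sphereWeight α)),
      -(((1 : ℝ) : ℂ) * conj b) * z + conj a ≠ 0 := by
    have h1 : radialMeasure 1 (sphereWeight α) ≪ volume :=
      (withDensity_absolutelyContinuous _ _).trans Measure.restrict_le_self.absolutelyContinuous
    exact h1.ae_le (measure_eq_zero_iff_ae_notMem.1 (volume_mobius_pole hab'))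
  -- The gauge relation may fail at `∞`, where the kernel is zero by convention, and at the pole,
  -- which is sent to `∞`; together they form a null set.
  set N : Set Sphere2 := {OnePoint.infty} ∪ (fun z : ℂ => (z : Sphere2)) ''
    {z : ℂ | -(((1 : ℝ) : ℂ) * conj b) * z + conj a = 0} with hN
  refine h.map_eq_of_gauge (isPSDKernel_sphereKernel hα) (measurable_sphereKernel hα)
    (measurable_sphereMap a b) U hUm ?_ N ?_ ?_
  · have hmap := hM.map_gauge (g := mobius 1 a b) (u := u) (Complex.measurable_re.comp
      ((measurable_sphereKernel hα).comp (measurable_coe_sphere.prodMk measurable_coe_sphere)))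
      (measurable_mobius _ _ _) (map_mobius_geomMeasure hab') (by fun_prop) (by
        filter_upwards [ae_mobius_denom hab'] with z hz
        exact hgauge z hz z hz)
    have hUm2 : Measurable fun z => ENNReal.ofReal (‖U z‖ ^ 2) :=
      (hUm.norm.pow_const 2).ennreal_ofReal
    rw [sphereMeasure_eq, ← map_withDensity_comp measurable_coe_sphere hUm2,
      Measure.map_map (measurable_sphereMap a b) measurable_coe_sphere]
    conv_rhs => rw [← hmap]
    rw [Measure.map_map measurable_coe_sphere (measurable_mobius _ _ _)]
    refine Measure.map_congr ?_
    filter_upwards [(withDensity_absolutelyContinuous _ _).ae_le hpole] with z hz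
    exact sphereMap_coe hz
  · have hNm : MeasurableSet N := (measurableSet_singleton _).union
      (measurableEmbedding_coe_sphere.measurableSet_image.2
        (measurableSet_eq_fun (by fun_prop) measurable_const))
    rw [sphereMeasure_eq, Measure.map_apply measurable_coe_sphere hNm, measure_eq_zero_iff_ae_notMem]
    filter_upwards [hpole] with z hz
    simpa [hN] using hz
  · intro x hx y hy
    induction x using OnePoint.rec with
    | infty => simp [hN] at hx
    | coe x =>
      induction y using OnePoint.rec with
      | infty => simp [hN] at hy
      | coe y =>
        have hx' : -(((1 : ℝ) : ℂ) * conj b) * x + conj a ≠ 0 := by simpa [hN] using hx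
        have hy' : -(((1 : ℝ) : ℂ) * conj b) * y + conj a ≠ 0 := by simpa [hN] using hy
        rw [sphereMap_coe hx', sphereMap_coe hy']
        exact hgauge x hx' y hy'

/-! ### The disk -/

theorem isPSDKernel_diskKernel {α : ℝ} (hα : 0 < α) : IsPSDKernel (diskKernel α) :=
  IsPSDKernel.of_hasSum (diskBasis α) (hasSum_diskBasis hα)

theorem measurable_diskKernel (α : ℝ) : Measurable (Function.uncurry (diskKernel α)) := by
  simp only [Function.uncurry_def, diskKernel]
  fun_prop

/-- The two sides differ by `2πi n`. Four arguments of modulus less than `π / 2` give `|2πn| < 2π`,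
so `n = 0`. It keeps the noninteger powers in the disk kernel on their principal branch. -/
theorem Complex.log_mul_mul {x y q : ℂ} {r : ℝ} (hr : 0 < r) (hx : 0 < x.re) (hy : 0 < y.re)
    (hq : 0 < q.re) (h : 0 < (r * (x * y * q)).re) :
    Complex.log (r * (x * y * q)) =
      Real.log r + (Complex.log x + Complex.log y + Complex.log q) := by
  have hne : ∀ {v : ℂ}, 0 < v.re → v ≠ 0 := fun {v} hv h0 => by simp [h0] at hv
  have h1 : Complex.exp (Complex.log (r * (x * y * q))) =
      Complex.exp (Real.log r + (Complex.log x + Complex.log y + Complex.log q)) := by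
    rw [Complex.exp_log (hne h), Complex.exp_add, Complex.exp_add, Complex.exp_add,
      Complex.exp_log (hne hx), Complex.exp_log (hne hy), Complex.exp_log (hne hq),
      ← Complex.ofReal_exp, Real.exp_log hr]
  obtain ⟨n, hn⟩ := Complex.exp_eq_exp_iff_exists_int.1 h1
  have hzero : n = 0 := by
    have him := congrArg Complex.im hn
    simp only [Complex.add_im, Complex.log_im, Complex.ofReal_im, zero_add] at him
    have h2 : ((n : ℂ) * (2 * Real.pi * Complex.I)).im = n * (2 * Real.pi) := by simp
    rw [h2] at him
    have hlt : ∀ {v : ℂ}, 0 < v.re → |v.arg| < Real.pi / 2 := fun {v} hv =>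
      Complex.abs_arg_lt_pi_div_two_iff.2 (Or.inl hv)
    have ha := abs_lt.1 (hlt h)
    have hb := abs_lt.1 (hlt hx)
    have hc := abs_lt.1 (hlt hy)
    have hd := abs_lt.1 (hlt hq)
    have hπ := Real.pi_pos
    have h3 : (n : ℝ) < 1 := by nlinarith
    have h4 : (-1 : ℝ) < n := by nlinarith
    have h5 : n < 1 := by exact_mod_cast h3
    have h6 : -1 < n := by exact_mod_cast h4
    omega
  rw [hn, hzero]
  simp

theorem re_one_add_pos {x : ℂ} (hx : ‖x‖ < 1) : 0 < (1 + x).re := by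
  have h1 := Complex.abs_re_le_norm x
  have h2 := abs_le.1 h1
  rw [Complex.add_re, Complex.one_re]
  linarith

theorem Disk.norm_mul_conj_lt (z w : Disk) : ‖(z : ℂ) * conj (w : ℂ)‖ < 1 := by
  have hz := mem_ball_zero_iff.1 z.2
  have hw := mem_ball_zero_iff.1 w.2
  rw [norm_mul, RCLike.norm_conj]
  nlinarith [norm_nonneg (z : ℂ), norm_nonneg (w : ℂ)]

/-- The natural gauge is a power of the denominator `conj a (1 + c z)`, where `c = conj b / conj a`
and `|c| < 1`. The phase of `conj a` cancels between `u z` and `conj (u w)`, so `log ‖a‖ + log (1 +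
c z)` replaces the logarithm of the denominator, and all the factors have positive real part. -/
theorem diskKernel_gauge {a b : ℂ} (hab : ‖a‖ ^ 2 - ‖b‖ ^ 2 = 1) (α : ℝ) (z w : Disk) :
    diskKernel α z w =
      Complex.exp (-(α + 1) * (Real.log ‖a‖ + Complex.log (1 + conj b / conj a * z))) *
        diskKernel α (diskMap a b hab z) (diskMap a b hab w) *
        conj (Complex.exp (-(α + 1) * (Real.log ‖a‖ + Complex.log (1 + conj b / conj a * w)))) := by
  have ha1 : 1 ≤ ‖a‖ ^ 2 := by nlinarith [sq_nonneg ‖b‖]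
  have ha : 0 < ‖a‖ := by
    refine (norm_nonneg a).lt_of_ne' fun h => ?_
    rw [h] at ha1
    norm_num at ha1
  have ha0 : a ≠ 0 := norm_pos_iff.1 ha
  have hca : conj a ≠ 0 := by simpa using ha0
  have hc : ‖conj b / conj a‖ < 1 := by
    rw [norm_div, RCLike.norm_conj, RCLike.norm_conj, div_lt_one ha]
    nlinarith [norm_nonneg b]
  have hre : ∀ v : Disk, 0 < (1 + conj b / conj a * (v : ℂ)).re := fun v => by
    refine re_one_add_pos ?_
    rw [norm_mul]
    have hv := mem_ball_zero_iff.1 v.2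
    nlinarith [norm_nonneg (v : ℂ), norm_nonneg (conj b / conj a)]
  have hre' : 0 < (conj (1 + conj b / conj a * (w : ℂ))).re := by
    rw [Complex.conj_re]
    exact hre w
  set q : ℂ := 1 - (diskMap a b hab z : ℂ) * conj (diskMap a b hab w : ℂ) with hq
  have hqre : 0 < q.re := by
    rw [hq, sub_eq_add_neg]
    refine re_one_add_pos ?_
    rw [norm_neg]
    exact Disk.norm_mul_conj_lt _ _
  have hden : ∀ v : Disk, conj b * (v : ℂ) + conj a = conj a * (1 + conj b / conj a * v) :=
    fun v => by
      field_simp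
      ring
  have hne : ∀ v : Disk, conj b * (v : ℂ) + conj a ≠ 0 := fun v => by
    rw [hden v]
    refine mul_ne_zero hca fun h0 => ?_
    have := hre v
    rw [h0] at this
    simp at this
  have hprod : 1 - (z : ℂ) * conj (w : ℂ) =
      ((‖a‖ ^ 2 : ℝ) : ℂ) * ((1 + conj b / conj a * z) * conj (1 + conj b / conj a * (w : ℂ)) * q) := by
    have hab' : a * conj a - b * conj b = 1 := by
      rw [Complex.mul_conj, Complex.mul_conj, Complex.normSq_eq_norm_sq, Complex.normSq_eq_norm_sq]
      exact_mod_cast hab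
    have h1 : ((‖a‖ ^ 2 : ℝ) : ℂ) * ((1 + conj b / conj a * z) *
        conj (1 + conj b / conj a * (w : ℂ)) * q) =
        (conj b * (z : ℂ) + conj a) * conj (conj b * (w : ℂ) + conj a) * q := by
      rw [hden z, hden w, map_mul, Complex.conj_conj, ← Complex.normSq_eq_norm_sq,
        ← Complex.mul_conj]
      ring
    have hw' : conj (conj b * (w : ℂ) + conj a) ≠ 0 := (map_ne_zero (starRingEnd ℂ)).2 (hne w)
    have h2 : q = 1 - (a * z + b) / (conj b * z + conj a) *
        (conj (a * w + b) / conj (conj b * (w : ℂ) + conj a)) := by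
      rw [hq, ← map_div₀]
      rfl
    rw [h1, h2, div_mul_div_comm, mul_sub, mul_one, mul_div_cancel₀ _ (mul_ne_zero (hne z) hw')]
    simp only [map_add, map_mul, Complex.conj_conj]
    linear_combination -(1 - (z : ℂ) * conj (w : ℂ)) * hab'
  have hT : 0 < (1 - (z : ℂ) * conj (w : ℂ)).re := by
    rw [sub_eq_add_neg]
    refine re_one_add_pos ?_
    rw [norm_neg]
    exact Disk.norm_mul_conj_lt z w
  have hlog := Complex.log_mul_mul (pow_pos ha 2) (hre z) hre' hqre (hprod ▸ hT)
  rw [← hprod] at hlog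
  have hTne : 1 - (z : ℂ) * conj (w : ℂ) ≠ 0 := fun h0 => by simp [h0] at hT
  have hqne : q ≠ 0 := fun h0 => by simp [h0] at hqre
  have hconj : conj (Complex.log (1 + conj b / conj a * (w : ℂ))) =
      Complex.log (conj (1 + conj b / conj a * (w : ℂ))) := by
    refine (Complex.log_conj _ fun hπ => ?_).symm
    have := abs_lt.1 (Complex.abs_arg_lt_pi_div_two_iff.2 (Or.inl (hre w)))
    rw [hπ] at this
    linarith [Real.pi_pos, this.2]
  have hK : diskKernel α (diskMap a b hab z) (diskMap a b hab w) =
      ((α / Real.pi : ℝ) : ℂ) * Complex.exp (Complex.log q * (-((α : ℂ) + 1))) := by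
    rw [← Complex.cpow_def_of_ne_zero hqne]
    rfl
  have hexp : Complex.exp (Complex.log (1 - (z : ℂ) * conj (w : ℂ)) * (-((α : ℂ) + 1))) =
      Complex.exp (-(α + 1) * (Real.log ‖a‖ + Complex.log (1 + conj b / conj a * z))) *
        Complex.exp (Complex.log q * (-((α : ℂ) + 1))) *
        Complex.exp (conj (-(α + 1) *
          (Real.log ‖a‖ + Complex.log (1 + conj b / conj a * (w : ℂ))))) := by
    have h1 : conj (-((α : ℂ) + 1) *
        (Real.log ‖a‖ + Complex.log (1 + conj b / conj a * (w : ℂ)))) =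
        -((α : ℂ) + 1) *
          (Real.log ‖a‖ + Complex.log (conj (1 + conj b / conj a * (w : ℂ)))) := by
      rw [← hconj]
      simp only [map_mul, map_add, map_neg, map_one, Complex.conj_ofReal]
    rw [h1, ← Complex.exp_add, ← Complex.exp_add, hlog, Real.log_pow]
    congr 1
    push_cast
    ring
  rw [hK, diskKernel, Complex.cpow_def_of_ne_zero hTne, hexp, ← Complex.exp_conj]
  ring

theorem measurable_diskMap {a b : ℂ} (hab : ‖a‖ ^ 2 - ‖b‖ ^ 2 = 1) :
    Measurable (diskMap a b hab) :=
  Measurable.subtype_mk (by fun_prop)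

theorem coe_diskMap {a b : ℂ} (hab : ‖a‖ ^ 2 - ‖b‖ ^ 2 = 1) (z : Disk) :
    (diskMap a b hab z : ℂ) = mobius (-1) a b z := by
  rw [mobius, diskMap]
  simp

theorem isFiniteMeasure_diskMeasure {α : ℝ} (hα : 0 < α) : IsFiniteMeasure (diskMeasure α) := by
  have h1 := (isWeightedModel_disk hα).isFiniteMeasure
  rw [← map_diskMeasure] at h1
  constructor
  have h2 := h1.measure_univ_lt_top
  rwa [Measure.map_apply measurableEmbedding_coe_disk.measurable MeasurableSet.univ] at h2

theorem eq_of_map_coe_disk {μ₁ μ₂ : Measure Disk}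
    (h : μ₁.map (Subtype.val : Disk → ℂ) = μ₂.map Subtype.val) : μ₁ = μ₂ := by
  rw [← measurableEmbedding_coe_disk.comap_map μ₁, ← measurableEmbedding_coe_disk.comap_map μ₂, h]

theorem isInvariantInLaw_disk {X : S → Measure Disk} {α : ℝ} (hα : 0 < α)
    (h : IsDeterminantal P X (diskMeasure α) (diskKernel α)) :
    IsInvariantInLaw P X diskIsometries := by
  rintro g ⟨a, b, hab, rfl⟩
  have he := measurableEmbedding_coe_disk
  have hM := isWeightedModel_disk hα
  have hab' : ‖a‖ ^ 2 + (-1 : ℝ) * ‖b‖ ^ 2 = 1 := by linarith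
  have hfin := isFiniteMeasure_diskMeasure hα
  set u : ℂ → ℂ := fun z =>
    Complex.exp (-(α + 1) * (Real.log ‖a‖ + Complex.log (1 + conj b / conj a * z))) with hu
  have hum : Measurable u := by fun_prop
  refine h.map_eq_of_gauge (isPSDKernel_diskKernel hα) (measurable_diskKernel α)
    (measurable_diskMap hab) (fun z => u z) (hum.comp he.measurable) ?_ ∅ (by simp)
    fun x _ y _ => diskKernel_gauge hab α x y
  have hum2 : Measurable fun z => ENNReal.ofReal (‖u z‖ ^ 2) := (hum.norm.pow_const 2).ennreal_ofReal
  have hmap := hM.map_gauge (g := mobius (-1) a b) (u := u) (measurable_diskKernel_diag α)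
    (measurable_mobius _ _ _) (map_mobius_geomMeasure hab') hum (by
      filter_upwards [ae_mem_geomDomain (-1)] with z hz
      rw [geomDomain_neg_one] at hz
      have h1 := diskKernel_gauge hab α ⟨z, hz⟩ ⟨z, hz⟩
      simp only [diskKernel, coe_diskMap] at h1
      exact h1)
  refine eq_of_map_coe_disk ?_
  rw [Measure.map_map he.measurable (measurable_diskMap hab), map_diskMeasure]
  conv_rhs => rw [← hmap]
  rw [← map_diskMeasure, ← map_withDensity_comp he.measurable hum2,
    Measure.map_map (measurable_mobius _ _ _) he.measurable]
  congr 1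
  funext z
  exact coe_diskMap hab z

end Invariance

/-! ## Transfer between the carrier spaces and the plane -/

section Transfer

variable {S Ω ι : Type*} [MeasurableSpace S] [MeasurableSpace Ω]
  {P : Measure S} {X : S → Measure Ω} {μ : Measure Ω} {K : Ω → Ω → ℂ}

theorem sigmaFinite_kernelIntensity (μ : Measure Ω) [SigmaFinite μ] (K : Ω → Ω → ℂ) :
    SigmaFinite (kernelIntensity μ K) :=
  SigmaFinite.withDensity_ofReal _

theorem ae_of_kernelIntensity_eq_zero {N : Set Ω} (hKm : Measurable (Function.uncurry K))
    (hNm : MeasurableSet N) (hN : kernelIntensity μ K N = 0) :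
    ∀ᵐ x ∂μ, x ∈ N → (K x x).re ≤ 0 := by
  have hd : Measurable fun x => (K x x).re :=
    Complex.measurable_re.comp (hKm.comp (f := fun x => (x, x)) (by fun_prop))
  rw [kernelIntensity, withDensity_apply _ hNm, lintegral_eq_zero_iff hd.ennreal_ofReal,
    Filter.EventuallyEq, ae_restrict_iff' hNm] at hN
  filter_upwards [hN] with x hx hxN
  exact ENNReal.ofReal_eq_zero.1 (hx hxN)

theorem kernelIntensity_restrict_compl {N : Set Ω} (hNm : MeasurableSet N)
    (hN : kernelIntensity μ K N = 0) :
    kernelIntensity (μ.restrict Nᶜ) K = kernelIntensity μ K := by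
  rw [kernelIntensity, ← restrict_withDensity hNm.compl]
  refine Measure.restrict_eq_self_of_ae_mem ?_
  exact measure_eq_zero_iff_ae_notMem.1 hN

theorem map_kernelIntensity {p : Ω → ℂ} (hp : Measurable p) {N : Set Ω} (hNm : MeasurableSet N)
    {K' : ℂ → ℂ → ℂ} (hK' : Measurable (Function.uncurry K'))
    (hKK : ∀ x ∉ N, ∀ y ∉ N, K x y = K' (p x) (p y)) (hN : kernelIntensity μ K N = 0) :
    (kernelIntensity μ K).map p = kernelIntensity ((μ.restrict Nᶜ).map p) K' := by
  have hd : Measurable fun x => ENNReal.ofReal (K' x x).re := (Complex.measurable_re.comp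
    (hK'.comp (f := fun x => (x, x)) (by fun_prop))).ennreal_ofReal
  rw [← kernelIntensity_restrict_compl hNm hN, kernelIntensity, kernelIntensity,
    ← map_withDensity_comp hp hd]
  congr 1
  refine withDensity_congr_ae ?_
  filter_upwards [ae_restrict_mem hNm.compl] with x hx
  rw [hKK x hx x hx]

theorem eq_zero_of_seriesKernel_le {Ω ι : Type*} {φ : ι → Ω → ℂ} (hs : ∀ x, Summable fun k => ‖φ k x‖ ^ 2) {x : Ω}
    (hx : (seriesKernel φ x x).re ≤ 0) (k : ι) : φ k x = 0 := by
  rw [seriesKernel_self hs, Complex.ofReal_re] at hx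
  have h1 : ‖φ k x‖ ^ 2 ≤ ∑' j, ‖φ j x‖ ^ 2 := (hs x).le_tsum k fun j _ => by positivity
  have h2 : ‖φ k x‖ ^ 2 = 0 := le_antisymm (h1.trans hx) (by positivity)
  simpa using h2

/-- The set `N` may carry mass of `μ`, but the functions vanish almost everywhere on it, so removing
it changes no inner product. -/
theorem IsOrthonormalL2.map_restrict {φ : ι → Ω → ℂ} (h : IsOrthonormalL2 μ φ) {N : Set Ω}
    (hNm : MeasurableSet N) (hN : ∀ k, ∀ᵐ x ∂μ, x ∈ N → φ k x = 0) {p : Ω → ℂ} (hp : Measurable p)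
    {ψ : ι → ℂ → ℂ} (hψ : ∀ k, Measurable (ψ k)) (hφ : ∀ k, ∀ x ∉ N, ψ k (p x) = φ k x) :
    IsOrthonormalL2 ((μ.restrict Nᶜ).map p) ψ := by
  have hae : ∀ k, (fun x => ψ k (p x)) =ᵐ[μ.restrict Nᶜ] φ k := fun k => by
    filter_upwards [ae_restrict_mem hNm.compl] with x hx
    exact hφ k x hx
  have hc : Measurable (conj : ℂ → ℂ) := Complex.continuous_conj.measurable
  have hint : ∀ j k, ∫ z, ψ j z * conj (ψ k z) ∂((μ.restrict Nᶜ).map p) =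
      ∫ x, φ j x * conj (φ k x) ∂μ := fun j k => by
    have hjk : Measurable fun z => ψ j z * conj (ψ k z) := (hψ j).mul (hc.comp (hψ k))
    rw [integral_map hp.aemeasurable hjk.aestronglyMeasurable,
      ← setIntegral_eq_integral_of_ae_compl_eq_zero (s := Nᶜ) (f := fun x => φ j x * conj (φ k x))]
    · refine integral_congr_ae ?_
      filter_upwards [hae j, hae k] with x hj hk
      rw [hj, hk]
    · filter_upwards [hN j] with x hx hxN
      rw [hx (not_not.1 hxN), zero_mul]
  refine ⟨fun k => ?_, fun k => ?_, fun j k hjk => ?_⟩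
  · rw [memLp_map_measure_iff (hψ k).aestronglyMeasurable hp.aemeasurable]
    exact (memLp_congr_ae (hae k)).2 ((h.memLp k).mono_measure Measure.restrict_le_self)
  · rw [hint, h.norm_one k]
  · rw [hint, h.orthogonal j k hjk]

variable [TopologicalSpace Ω]

/-- The chart needs to intertwine `g` and `T` only almost everywhere for the intensity; on the
sphere it fails to do so at poles and at `∞`. -/
theorem IsDeterminantal.map_chart_invariant [SigmaFinite μ] (h : IsDeterminantal P X μ K)
    {p : Ω → ℂ} (hp : Measurable p) {g : Ω → Ω} (hg : Measurable g)
    (hinv : P.map (fun ω => (X ω).map g) = P.map X) {T : ℂ → ℂ} (hT : Measurable T)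
    (hpT : ∀ᵐ x ∂(kernelIntensity μ K), p (g x) = T (p x)) :
    ((kernelIntensity μ K).map p).map T = (kernelIntensity μ K).map p := by
  rw [Measure.map_map hT hp]
  conv_rhs => rw [← h.intensity_invariant hg hinv, Measure.map_map hp hg]
  refine Measure.map_congr ?_
  filter_upwards [hpT] with x hx
  exact hx.symm

theorem IsDeterminantal.two_point_chart_invariant [SigmaFinite μ] (h : IsDeterminantal P X μ K)
    (hK : IsPSDKernel K) (hKm : Measurable (Function.uncurry K)) {p : Ω → ℂ} (hp : Measurable p)
    {N : Set Ω} (hN : kernelIntensity μ K N = 0) {K' : ℂ → ℂ → ℂ}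
    (hK' : Measurable (Function.uncurry K'))
    (hKK : ∀ x ∉ N, ∀ y ∉ N, K x y = K' (p x) (p y))
    {g : Ω → Ω} (hg : Measurable g)
    (hinv : P.map (fun ω => (X ω).map g) = P.map X) {T : ℂ → ℂ} (hT : Measurable T)
    (hpT : ∀ᵐ x ∂(kernelIntensity μ K), p (g x) = T (p x))
    {D₀ D₁ : Set ℂ} (hD₀ : MeasurableSet D₀) (hD₁ : MeasurableSet D₁) (hd : Disjoint D₀ D₁) :
    ∫⁻ x in T ⁻¹' D₀, ∫⁻ y in T ⁻¹' D₁, ENNReal.ofReal (1 - normalizedKernel K' x y)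
        ∂((kernelIntensity μ K).map p) ∂((kernelIntensity μ K).map p) =
      ∫⁻ x in D₀, ∫⁻ y in D₁, ENNReal.ofReal (1 - normalizedKernel K' x y)
        ∂((kernelIntensity μ K).map p) ∂((kernelIntensity μ K).map p) := by
  have hσ := sigmaFinite_kernelIntensity μ K
  set ν := kernelIntensity μ K with hν
  have hF : Measurable fun q : ℂ × ℂ => ENNReal.ofReal (1 - normalizedKernel K' q.1 q.2) := by
    have h1 : Measurable fun q : ℂ × ℂ => K' q.1 q.2 := hK'
    have h2 : Measurable fun q : ℂ × ℂ => K' q.1 q.1 :=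
      hK'.comp (f := fun q : ℂ × ℂ => (q.1, q.1)) (by fun_prop)
    have h3 : Measurable fun q : ℂ × ℂ => K' q.2 q.2 :=
      hK'.comp (f := fun q : ℂ × ℂ => (q.2, q.2)) (by fun_prop)
    unfold normalizedKernel
    fun_prop
  have hFx : ∀ x, Measurable fun y => ENNReal.ofReal (1 - normalizedKernel K' x y) := fun x =>
    hF.comp (f := fun y => (x, y)) (by fun_prop)
  have hNae : ∀ᵐ x ∂ν, x ∉ N := measure_eq_zero_iff_ae_notMem.1 hN
  have key : ∀ A B : Set ℂ, MeasurableSet A → MeasurableSet B →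
      ∫⁻ x in A, ∫⁻ y in B, ENNReal.ofReal (1 - normalizedKernel K' x y) ∂(ν.map p) ∂(ν.map p) =
        ∫⁻ x in p ⁻¹' A, ∫⁻ y in p ⁻¹' B, ENNReal.ofReal (1 - normalizedKernel K x y) ∂ν ∂ν := by
    intro A B hA hB
    rw [setLIntegral_map hA (Measurable.lintegral_prod_right' hF) hp]
    refine lintegral_congr_ae (ae_restrict_of_ae ?_)
    filter_upwards [hNae] with x hx
    rw [setLIntegral_map hB (hFx _) hp]
    refine lintegral_congr_ae (ae_restrict_of_ae ?_)
    filter_upwards [hNae] with y hy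
    rw [normalizedKernel, normalizedKernel, hKK x hx y hy, hKK x hx x hx, hKK y hy y hy]
  rw [key _ _ (hT hD₀) (hT hD₁), key _ _ hD₀ hD₁,
    ← h.two_point_invariant hK hKm hg hinv (hp hD₀) (hp hD₁) (hd.preimage p)]
  have hset : ∀ D : Set ℂ, p ⁻¹' (T ⁻¹' D) =ᵐ[ν] g ⁻¹' (p ⁻¹' D) := fun D => by
    filter_upwards [hpT] with x hx
    refine propext ?_
    change T (p x) ∈ D ↔ p (g x) ∈ D
    rw [hx]
  rw [Measure.restrict_congr_set (hset D₀), Measure.restrict_congr_set (hset D₁)]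

/-- The passage to the common geometry on `ℂ`: the set `N` is empty for the plane and the disk, and
is `{∞}` for the sphere. -/
theorem IsDeterminantal.isInvariantEnsemble [Countable ι] [SigmaFinite μ] {φ : ι → Ω → ℂ}
    (h : IsDeterminantal P X μ (seriesKernel φ)) {G : Set (Ω → Ω)} (hG : IsInvariantInLaw P X G)
    (hGm : ∀ g ∈ G, Measurable g)
    (hm : ∀ k, Measurable (φ k)) (hs : ∀ x, Summable fun k => ‖φ k x‖ ^ 2)
    (ho : IsOrthonormalL2 μ φ) {ε : ℝ} {p : Ω → ℂ} (hp : Measurable p) {N : Set Ω}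
    (hNm : MeasurableSet N) (hN : kernelIntensity μ (seriesKernel φ) N = 0)
    (hmem : ∀ x ∉ N, p x ∈ geomDomain ε)
    {ψ : ι → ℂ → ℂ} (hψ : ∀ k, ∀ x ∉ N, ψ k (p x) = φ k x) (hψm : ∀ k, Measurable (ψ k))
    (hψd : ∀ k, DifferentiableOn ℂ (ψ k) (geomDomain ε))
    (hψs : ∀ z, Summable fun k => ‖ψ k z‖ ^ 2)
    (hrot : ∀ u : Circle, ((μ.restrict Nᶜ).map p).map (fun z : ℂ => u * z) = (μ.restrict Nᶜ).map p)
    (hfin : ∃ r > 0, (μ.restrict Nᶜ).map p (Metric.ball 0 r) ≠ ∞)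
    (hGrot : ∀ u : Circle, ∃ g ∈ G,
      ∀ᵐ x ∂(kernelIntensity μ (seriesKernel φ)), p (g x) = u * p x)
    (hGtr : ∀ w ∈ geomDomain ε, ∃ g ∈ G,
      ∀ᵐ x ∂(kernelIntensity μ (seriesKernel φ)), p (g x) = geomTranslation ε w (p x)) :
    IsInvariantEnsemble ε ((μ.restrict Nᶜ).map p) ψ := by
  have hKm := measurable_seriesKernel hm hs
  have hK'm := measurable_seriesKernel hψm hψs
  have hKK : ∀ x ∉ N, ∀ y ∉ N, seriesKernel φ x y = seriesKernel ψ (p x) (p y) := by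
    intro x hx y hy
    refine tsum_congr fun k => ?_
    rw [hψ k x hx, hψ k y hy]
  have hν := map_kernelIntensity hp hNm hK'm hKK hN
  have hN0 : ∀ k, ∀ᵐ x ∂μ, x ∈ N → φ k x = 0 := fun k => by
    filter_upwards [ae_of_kernelIntensity_eq_zero hKm hNm hN] with x hx hxN
    exact eq_zero_of_seriesKernel_le hs (hx hxN) k
  refine ⟨?_, hrot, hfin, hψd, hψm, hψs, ho.map_restrict hNm hN0 hp hψm hψ, ?_, ?_, ?_⟩
  · refine (ae_map_iff (p := fun z => z ∈ geomDomain ε) hp.aemeasurable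
      (measurableSet_geomDomain ε)).2 ?_
    filter_upwards [ae_restrict_mem hNm.compl] with x hx
    exact hmem x hx
  · intro u
    obtain ⟨g, hg, hpg⟩ := hGrot u
    rw [← hν]
    exact h.map_chart_invariant hp (hGm g hg) (hG g hg) (by fun_prop) hpg
  · intro w hw
    obtain ⟨g, hg, hpg⟩ := hGtr w hw
    rw [← hν]
    exact h.map_chart_invariant hp (hGm g hg) (hG g hg) (measurable_geomTranslation ε w) hpg
  · intro w hw D₀ D₁ hD₀ hD₁ hd
    obtain ⟨g, hg, hpg⟩ := hGtr w hw
    rw [← hν]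
    exact h.two_point_chart_invariant (isPSDKernel_seriesKernel hs) hKm hp hN hK'm hKK (hGm g hg)
      (hG g hg) (measurable_geomTranslation ε w) hpg hD₀ hD₁ hd

/-- Rescaling the kernel and the reference measure, off a set without points, does not change the
process. -/
theorem IsDeterminantal.of_eq_smul [SigmaFinite μ] (h : IsDeterminantal P X μ K)
    (hK : IsPSDKernel K) (hKm : Measurable (Function.uncurry K)) {N : Set Ω}
    (hNm : MeasurableSet N) (hN : kernelIntensity μ K N = 0) {μ' : Measure Ω} [SigmaFinite μ']
    {K' : Ω → Ω → ℂ} (hK' : IsPSDKernel K') (hK'm : Measurable (Function.uncurry K'))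
    {c : ℝ} (hc : 0 < c) (hKK : ∀ x ∉ N, ∀ y ∉ N, K x y = c * K' x y)
    (hμ : μ.restrict Nᶜ = ENNReal.ofReal c⁻¹ • μ') :
    IsDeterminantal P X μ' K' := by
  classical
  refine ⟨h.1, h.simple,
    fun n x => (Matrix.of fun i j => K' (x i) (x j)).det.re.toNNReal, ?_, fun n x => ?_⟩
  swap
  · have h1 := (hK' n x).det_nonneg
    rw [Complex.le_def] at h1
    rw [Real.coe_toNNReal _ h1.1]
    exact Complex.ext (by simp) (by simpa using h1.2)
  intro m D n hD hd hn
  rw [h.lintegral_factorial D n hD hd hn]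
  -- Thus `μ' = f μ`, and the product of the factors `f (x i)` compensates `det K = c ^ n det K'`
  -- off `N`.
  set f : Ω → ℝ≥0∞ := Nᶜ.indicator fun _ => ENNReal.ofReal c with hf
  have hfm : Measurable f := measurable_const.indicator hNm.compl
  have hμ' : μ' = μ.withDensity f := by
    rw [hf, withDensity_indicator hNm.compl, withDensity_const, hμ, smul_smul,
      ← ENNReal.ofReal_mul hc.le, mul_inv_cancel₀ hc.ne', ENNReal.ofReal_one, one_smul]
  have hσ : SigmaFinite (μ.withDensity f) := hμ' ▸ inferInstance
  have hdet : Measurable fun x : Fin (∑ i, n i) → Ω =>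
      ENNReal.ofReal (Matrix.of fun i j => K' (x i) (x j)).det.re := by
    refine (Complex.measurable_re.comp ?_).ennreal_ofReal
    simp only [Matrix.det_apply, Matrix.of_apply]
    refine Finset.measurable_sum _ fun σ _ => Measurable.const_smul ?_ _
    refine Finset.measurable_prod _ fun i _ => ?_
    exact hK'm.comp (f := fun x : Fin (∑ i, n i) → Ω => (x (σ i), x i))
      ((measurable_pi_apply _).prodMk (measurable_pi_apply _))
  have hT : MeasurableSet {x : Fin (∑ i, n i) → Ω |
      ∀ (i : Fin m) (j : Fin (n i)), x (finSigmaFinEquiv ⟨i, j⟩) ∈ D i} := by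
    have h1 : {x : Fin (∑ i, n i) → Ω |
        ∀ (i : Fin m) (j : Fin (n i)), x (finSigmaFinEquiv ⟨i, j⟩) ∈ D i} =
        ⋂ (i : Fin m) (j : Fin (n i)),
          (fun x : Fin (∑ i, n i) → Ω => x (finSigmaFinEquiv ⟨i, j⟩)) ⁻¹' D i := by
      ext x
      simp
    rw [h1]
    exact MeasurableSet.iInter fun i => MeasurableSet.iInter fun j => measurable_pi_apply _ (hD i)
  have hprod : Measurable fun x : Fin (∑ i, n i) → Ω => ∏ i, f (x i) :=
    Finset.measurable_prod _ fun i _ => hfm.comp (measurable_pi_apply i)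
  change _ = ∫⁻ x : Fin (∑ i, n i) → Ω in _, ENNReal.ofReal (Matrix.of fun i j => K' (x i) (x j)).det.re ∂_
  rw [hμ', pi_withDensity μ _ f hfm, restrict_withDensity hT,
    lintegral_withDensity_eq_lintegral_mul _ hprod hdet]
  refine lintegral_congr_ae (ae_restrict_of_ae ?_)
  have hae : ∀ᵐ x ∂(Measure.pi fun _ : Fin (∑ i, n i) => μ), ∀ i, x i ∈ N →
      (K (x i) (x i)).re ≤ 0 := by
    rw [ae_all_iff]
    intro i
    exact (Measure.quasiMeasurePreserving_eval (μ := fun _ : Fin (∑ i, n i) => μ) i).ae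
      (ae_of_kernelIntensity_eq_zero hKm hNm hN)
  filter_upwards [hae] with x hx
  rw [Pi.mul_apply]
  -- A coordinate in `N` has zero diagonal entry almost everywhere; by Cauchy–Schwarz its row
  -- vanishes, so neither side contributes.
  by_cases hxN : ∃ i, x i ∈ N
  · obtain ⟨i, hi⟩ := hxN
    have h0 : ∀ j, K (x i) (x j) = 0 := fun j => by
      have h1 := hK.norm_sq_le (x i) (x j)
      have h2 : (K (x i) (x i)).re = 0 :=
        le_antisymm (hx i hi) (hK.diag_nonneg (x i))
      rw [h2, zero_mul] at h1
      simpa using le_antisymm h1 (by positivity)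
    rw [Finset.prod_eq_zero (Finset.mem_univ i) (by simp [hf, hi]), zero_mul,
      Matrix.det_eq_zero_of_row_eq_zero i (by simpa using h0), Complex.zero_re, ENNReal.ofReal_zero]
  · push Not at hxN
    have h1 : (Matrix.of fun i j => K (x i) (x j)) =
        (c : ℂ) • Matrix.of fun i j => K' (x i) (x j) := by
      ext i j
      simp [hKK _ (hxN i) _ (hxN j)]
    have h2 : ∀ i, f (x i) = ENNReal.ofReal c := fun i => by simp [hf, hxN i]
    rw [h1, Matrix.det_smul, Fintype.card_fin, ← Complex.ofReal_pow, Complex.re_ofReal_mul,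
      ENNReal.ofReal_mul (by positivity), Finset.prod_congr rfl fun i _ => h2 i, Finset.prod_const,
      Finset.card_univ, Fintype.card_fin, ENNReal.ofReal_pow hc.le]

theorem IsDeterminantal.kernelIntensity_eq [SigmaFinite μ] (h : IsDeterminantal P X μ K)
    {μ' : Measure Ω} [SigmaFinite μ'] {K' : Ω → Ω → ℂ} (h' : IsDeterminantal P X μ' K') :
    kernelIntensity μ K = kernelIntensity μ' K' := by
  ext D hD
  rw [← h.lintegral_apply hD, h'.lintegral_apply hD]

/-- Both cardinalities are the expected total number of points. -/
theorem IsDeterminantal.card_eq [SigmaFinite μ] [Countable ι] {φ : ι → Ω → ℂ}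
    (h : IsDeterminantal P X μ (seriesKernel φ)) (hm : ∀ k, Measurable (φ k))
    (hs : ∀ x, Summable fun k => ‖φ k x‖ ^ 2) (ho : IsOrthonormalL2 μ φ)
    {κ : Type*} [Countable κ] {μ' : Measure Ω} [SigmaFinite μ'] {ψ : κ → Ω → ℂ}
    (h' : IsDeterminantal P X μ' K) (hK : ∀ x y, HasSum (fun k => ψ k x * conj (ψ k y)) (K x y))
    (hm' : ∀ k, Measurable (ψ k)) (ho' : IsOrthonormalL2 μ' ψ) :
    ENat.card ι = ENat.card κ := by
  have hK' : K = seriesKernel ψ := by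
    funext x y
    exact (hK x y).tsum_eq.symm
  have hs' : ∀ x, Summable fun k => ‖ψ k x‖ ^ 2 := fun x => by
    have h1 := (Complex.hasSum_re (hK x x)).summable
    refine h1.congr fun k => ?_
    rw [Complex.mul_conj, Complex.normSq_eq_norm_sq, Complex.ofReal_re]
  subst hK'
  have h1 := congrArg (fun ν : Measure Ω => ν Set.univ) (h.kernelIntensity_eq h')
  simp only [kernelIntensity_seriesKernel _ hs, kernelIntensity_seriesKernel _ hs',
    withDensity_apply _ MeasurableSet.univ, Measure.restrict_univ, lintegral_kernelDiag hm ho,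
    lintegral_kernelDiag hm' ho'] at h1
  exact_mod_cast h1

end Transfer

/-! ## Classification of the invariant processes -/

section Classification

variable {S ι : Type*} [MeasurableSpace S] [Countable ι] [Nonempty ι] {P : Measure S}

theorem sigmaFinite_of_isFiniteMeasureOnCompacts {Ω : Type*} [TopologicalSpace Ω]
    [MeasurableSpace Ω] [LocallyCompactSpace Ω] [SecondCountableTopology Ω] (μ : Measure Ω)
    [IsFiniteMeasureOnCompacts μ] : SigmaFinite μ := by
  have := isLocallyFiniteMeasure_of_isFiniteMeasureOnCompacts (μ := μ)
  infer_instance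

theorem eq_of_smul_geomMeasure {ε a b : ℝ} (ha : 0 < a) (hb : 0 < b)
    (h : ENNReal.ofReal a • geomMeasure ε = ENNReal.ofReal b • geomMeasure ε) : a = b := by
  obtain ⟨r, hr, hrU⟩ := exists_norm_lt_mem_geomDomain (zero_mem_geomDomain ε)
  have hr0 : 0 < |r| := by
    rw [norm_zero] at hr
    positivity
  have hsub : Metric.closedBall (0 : ℂ) |r| ⊆ geomDomain ε := fun z hz =>
    mem_geomDomain_of_norm_le hrU (by simpa using hz)
  have hpos := (geomMeasure_pos Metric.isOpen_ball (Metric.ball_subset_closedBall.trans hsub)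
    ⟨0, Metric.mem_ball_self hr0⟩).trans_le (measure_mono Metric.ball_subset_closedBall)
  have h1 := congrArg (fun ν : Measure ℂ => ν (Metric.closedBall 0 |r|)) h
  simp only [Measure.smul_apply, smul_eq_mul] at h1
  have h2 := (ENNReal.mul_left_inj hpos.ne' (geomMeasure_lt_top hrU).ne).1 h1
  exact (ENNReal.ofReal_eq_ofReal_iff ha.le hb.le).1 h2

theorem exists_sq_eq_circle (u : Circle) : ∃ a : ℂ, ‖a‖ = 1 ∧ a ^ 2 = u := by
  obtain ⟨a, ha⟩ := IsAlgClosed.exists_pow_nat_eq (u : ℂ) (n := 2) (by norm_num)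
  refine ⟨a, ?_, ha⟩
  have h1 : ‖a‖ ^ 2 = 1 := by rw [← norm_pow, ha, Circle.norm_coe]
  exact (pow_eq_one_iff_of_nonneg (norm_nonneg a) two_ne_zero).1 h1

theorem mobius_zero_right {a : ℂ} (ha : ‖a‖ = 1) (ε : ℝ) (z : ℂ) : mobius ε a 0 z = a ^ 2 * z := by
  have h1 : conj a ≠ 0 := (map_ne_zero (starRingEnd ℂ)).2 (by
    rintro rfl
    simp at ha)
  have h2 : a * conj a = 1 := by
    rw [Complex.mul_conj, Complex.normSq_eq_norm_sq, ha]
    norm_num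
  rw [mobius, map_zero, mul_zero, neg_zero, zero_mul, zero_add, add_zero, div_eq_iff h1]
  linear_combination (-a * z) * h2

/-! ### The plane -/

theorem IsDeterminantal.exists_eq_plane {μ : Measure ℂ} [IsFiniteMeasureOnCompacts μ]
    (hμ : ∀ u : Circle, μ.map (fun z : ℂ => u * z) = μ) {φ : ι → ℂ → ℂ}
    (hd : ∀ k, Differentiable ℂ (φ k)) (ho : IsOrthonormalL2 μ φ)
    (hs : ∀ z, Summable fun k => ‖φ k z‖ ^ 2) {X : S → Measure ℂ}
    (h : IsDeterminantal P X μ (seriesKernel φ)) (hinv : IsInvariantInLaw P X planeIsometries) :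
    ∃ α : ℝ, 0 < α ∧ IsDeterminantal P X (planeMeasure α) (planeKernel α) ∧
      ∃ c : ℝ, 0 < c ∧ μ = ENNReal.ofReal c⁻¹ • planeMeasure α ∧
        ∀ z w, seriesKernel φ z w = c * planeKernel α z w := by
  have hσ := sigmaFinite_of_isFiniteMeasureOnCompacts μ
  have hm : ∀ k, Measurable (φ k) := fun k => (hd k).continuous.measurable
  have hmap : (μ.restrict (∅ : Set ℂ)ᶜ).map (fun z => z) = μ := by
    rw [Set.compl_empty, Measure.restrict_univ, Measure.map_id']
  have hens := h.isInvariantEnsemble hinv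
    (by rintro g ⟨a, b, -, rfl⟩; fun_prop) hm hs ho (ε := 0) (p := fun z => z) measurable_id
    MeasurableSet.empty measure_empty (fun z _ => by simp [geomDomain_zero]) (ψ := φ)
    (fun k x _ => rfl) hm (fun k => (hd k).differentiableOn) hs (fun u => by rw [hmap, hμ u])
    ⟨1, one_pos, by
      rw [hmap]
      exact ((measure_mono Metric.ball_subset_closedBall).trans_lt
        (isCompact_closedBall (0 : ℂ) 1).measure_lt_top).ne⟩
    (fun u => ⟨fun z => u * z + 0, ⟨u, 0, Circle.norm_coe u, rfl⟩,
      Filter.Eventually.of_forall fun z => add_zero _⟩)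
    (fun w _ => ⟨fun z => 1 * z + w, ⟨1, w, norm_one, rfl⟩,
      Filter.Eventually.of_forall fun z => by simp [geomTranslation]⟩)
  rw [hmap] at hens
  obtain ⟨α, hα, c, hc, hK, hμα, -⟩ := hens.plane
  have := isFiniteMeasure_planeMeasure hα
  refine ⟨α, hα, ?_, c, hc, hμα, hK⟩
  exact h.of_eq_smul (isPSDKernel_seriesKernel hs) (measurable_seriesKernel hm hs)
    MeasurableSet.empty measure_empty (isPSDKernel_planeKernel hα) (measurable_planeKernel α) hc
    (fun z _ w _ => hK z w) (by rwa [Set.compl_empty, Measure.restrict_univ])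

/-- The intensity, which belongs to the process, is `α / π` times the invariant measure. -/
theorem IsDeterminantal.plane_parameter_unique {X : S → Measure ℂ} {α β : ℝ} (hα : 0 < α)
    (hβ : 0 < β) (h : IsDeterminantal P X (planeMeasure α) (planeKernel α))
    (h' : IsDeterminantal P X (planeMeasure β) (planeKernel β)) : α = β := by
  have := isFiniteMeasure_planeMeasure hα
  have := isFiniteMeasure_planeMeasure hβ
  have hd : ∀ γ, Measurable fun z => (planeKernel γ z z).re := fun γ => by
    simp only [planeKernel]
    fun_prop
  have h1 := h.kernelIntensity_eq h'
  rw [planeMeasure_eq, planeMeasure_eq, (isWeightedModel_plane hα).kernelIntensity_eq (hd α),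
    (isWeightedModel_plane hβ).kernelIntensity_eq (hd β)] at h1
  have h2 := eq_of_smul_geomMeasure (by positivity) (by positivity) h1
  rwa [div_left_inj' Real.pi_ne_zero] at h2

theorem plane_classification [IsProbabilityMeasure P] {μ : Measure ℂ} [IsFiniteMeasureOnCompacts μ]
    (hμ : ∀ u : Circle, μ.map (fun z : ℂ => u * z) = μ) {φ : ι → ℂ → ℂ}
    (hd : ∀ k, Differentiable ℂ (φ k)) (ho : IsOrthonormalL2 μ φ)
    (hs : ∀ z, Summable fun k => ‖φ k z‖ ^ 2) {X : S → Measure ℂ}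
    (h : IsDeterminantal P X μ (seriesKernel φ)) :
    (IsInvariantInLaw P X planeIsometries ↔
      ∃ α : ℝ, 0 < α ∧ IsDeterminantal P X (planeMeasure α) (planeKernel α)) ∧
    (∀ α : ℝ, 0 < α → IsDeterminantal P X (planeMeasure α) (planeKernel α) →
      ENat.card ι = ⊤ ∧
      ∃ c : ℝ, 0 < c ∧ μ = ENNReal.ofReal c⁻¹ • planeMeasure α ∧
        ∀ z w, seriesKernel φ z w = c * planeKernel α z w) := by
  refine ⟨⟨fun hinv => ?_, fun ⟨α, hα, hX⟩ => isInvariantInLaw_plane hα hX⟩, fun α hα hX => ?_⟩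
  · obtain ⟨α, hα, hX, -⟩ := h.exists_eq_plane hμ hd ho hs hinv
    exact ⟨α, hα, hX⟩
  · obtain ⟨β, hβ, hX', hc⟩ := h.exists_eq_plane hμ hd ho hs (isInvariantInLaw_plane hα hX)
    obtain rfl := hX.plane_parameter_unique hα hβ hX'
    have hσ := sigmaFinite_of_isFiniteMeasureOnCompacts μ
    have := isFiniteMeasure_planeMeasure hα
    refine ⟨?_, hc⟩
    rw [h.card_eq (fun k => (hd k).continuous.measurable) hs ho hX (hasSum_planeBasis hα)
      (fun k => by unfold planeBasis; fun_prop) (isOrthonormalL2_planeBasis hα),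
      ENat.card_eq_top_of_infinite]

/-! ### The disk -/

theorem IsDeterminantal.exists_eq_disk {μ : Measure Disk} [IsFiniteMeasureOnCompacts μ]
    (hμ : ∀ u : Circle, μ.map (diskRotation u) = μ) {φ : ι → ℂ → ℂ}
    (hd : ∀ k, DifferentiableOn ℂ (φ k) (Metric.ball 0 1))
    (ho : IsOrthonormalL2 μ fun k (z : Disk) => φ k z)
    (hs : ∀ z : Disk, Summable fun k => ‖φ k z‖ ^ 2) {X : S → Measure Disk}
    (h : IsDeterminantal P X μ (seriesKernel fun k (z : Disk) => φ k z))
    (hinv : IsInvariantInLaw P X diskIsometries) :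
    ∃ α : ℝ, 0 < α ∧ IsDeterminantal P X (diskMeasure α) (diskKernel α) ∧
      ∃ c : ℝ, 0 < c ∧ μ = ENNReal.ofReal c⁻¹ • diskMeasure α ∧
        ∀ z w : Disk, seriesKernel (fun k (z : Disk) => φ k z) z w = c * diskKernel α z w := by
  have : LocallyCompactSpace Disk := Metric.isOpen_ball.locallyCompactSpace
  have hσ := sigmaFinite_of_isFiniteMeasureOnCompacts μ
  have he := measurableEmbedding_coe_disk
  -- Nothing is known of `φ k` outside the disk; extension by zero makes it measurable and square
  -- summable on all of `ℂ`.
  set ψ : ι → ℂ → ℂ := fun k => (Metric.ball 0 1).indicator (φ k) with hψ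
  have hψφ : ∀ k (z : Disk), ψ k z = φ k z := fun k z => Set.indicator_of_mem z.2 _
  have hψm : ∀ k, Measurable (ψ k) := fun k =>
    measurable_indicator_of_differentiableOn Metric.isOpen_ball (hd k)
  have hm : ∀ k, Measurable fun z : Disk => φ k z := fun k => by
    have h1 := (hψm k).comp he.measurable
    have h2 : ψ k ∘ Subtype.val = fun z : Disk => φ k z := funext (hψφ k)
    rwa [h2] at h1
  have hψs : ∀ z, Summable fun k => ‖ψ k z‖ ^ 2 := fun z => by
    by_cases hz : z ∈ Metric.ball (0 : ℂ) 1
    · exact (hs ⟨z, hz⟩).congr fun k => by rw [← hψφ k ⟨z, hz⟩]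
    · have h0 : ∀ k, ψ k z = 0 := fun k => Set.indicator_of_notMem hz _
      simp [h0]
  have hmap : (μ.restrict (∅ : Set Disk)ᶜ).map (Subtype.val : Disk → ℂ) = μ.map Subtype.val := by
    rw [Set.compl_empty, Measure.restrict_univ]
  have hrot : ∀ u : Circle, (μ.map (Subtype.val : Disk → ℂ)).map (fun z : ℂ => u * z) =
      μ.map Subtype.val := fun u => by
    have hu : Measurable fun z : ℂ => (u : ℂ) * z := by fun_prop
    have hum : Measurable (diskRotation u) := Measurable.subtype_mk (by fun_prop)
    rw [Measure.map_map hu he.measurable]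
    conv_rhs => rw [← hμ u, Measure.map_map he.measurable hum]
    rfl
  have hens := h.isInvariantEnsemble hinv
    (by rintro g ⟨a, b, hab, rfl⟩; exact measurable_diskMap hab) hm hs ho (ε := -1)
    (p := Subtype.val) he.measurable
    MeasurableSet.empty measure_empty (fun z _ => Disk.mem_geomDomain z) (ψ := ψ)
    (fun k x _ => hψφ k x) hψm
    (fun k => by
      rw [geomDomain_neg_one]
      exact (hd k).congr fun z hz => Set.indicator_of_mem hz _)
    hψs (fun u => by rw [hmap, hrot u])
    ⟨1 / 2, by norm_num, by
      have hsub : (Metric.closedBall 0 (1 / 2) : Set ℂ) ⊆ Metric.ball 0 1 :=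
        Metric.closedBall_subset_ball (by norm_num)
      have hcpt : IsCompact ((Subtype.val : Disk → ℂ) ⁻¹' Metric.closedBall 0 (1 / 2)) := by
        rw [Subtype.isCompact_iff, Subtype.image_preimage_coe, Set.inter_eq_right.2 hsub]
        exact isCompact_closedBall _ _
      rw [hmap, Measure.map_apply he.measurable Metric.isOpen_ball.measurableSet]
      exact ((measure_mono (Set.preimage_mono Metric.ball_subset_closedBall)).trans_lt
        hcpt.measure_lt_top).ne⟩
    (fun u => by
      obtain ⟨a, ha, hau⟩ := exists_sq_eq_circle u
      have hab : ‖a‖ ^ 2 - ‖(0 : ℂ)‖ ^ 2 = 1 := by simp [ha]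
      refine ⟨diskMap a 0 hab, ⟨a, 0, hab, rfl⟩, Filter.Eventually.of_forall fun z => ?_⟩
      rw [coe_diskMap, mobius_zero_right ha, hau])
    (fun w hw => by
      obtain ⟨a, b, hab, -, hT⟩ := geomTranslation_eq_mobius hw
      have hab' : ‖a‖ ^ 2 - ‖b‖ ^ 2 = 1 := by linarith
      refine ⟨diskMap a b hab', ⟨a, b, hab', rfl⟩, Filter.Eventually.of_forall fun z => ?_⟩
      rw [coe_diskMap, hT])
  rw [hmap] at hens
  have hσ' : SigmaFinite (μ.map (Subtype.val : Disk → ℂ)) := he.sigmaFinite_map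
  obtain ⟨α, hα, c, hc, hK, hμα, -⟩ := hens.disk
  have hKd : ∀ z w : Disk, seriesKernel (fun k (z : Disk) => φ k z) z w = c * diskKernel α z w := by
    intro z w
    rw [diskKernel, ← hK z (Disk.mem_geomDomain z) w (Disk.mem_geomDomain w)]
    exact tsum_congr fun k => by rw [hψφ, hψφ]
  have hμd : μ = ENNReal.ofReal c⁻¹ • diskMeasure α := by
    refine eq_of_map_coe_disk ?_
    rw [Measure.map_smul, map_diskMeasure, hμα]
  have := isFiniteMeasure_diskMeasure hα
  refine ⟨α, hα, ?_, c, hc, hμd, hKd⟩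
  exact h.of_eq_smul (isPSDKernel_seriesKernel hs) (measurable_seriesKernel hm hs)
    MeasurableSet.empty measure_empty (isPSDKernel_diskKernel hα) (measurable_diskKernel α) hc
    (fun z _ w _ => hKd z w) (by rwa [Set.compl_empty, Measure.restrict_univ])

theorem map_kernelIntensity_diskMeasure {α : ℝ} (hα : 0 < α) :
    (kernelIntensity (diskMeasure α) (diskKernel α)).map Subtype.val =
      ENNReal.ofReal (α / Real.pi) • geomMeasure (-1) := by
  rw [← (isWeightedModel_disk hα).kernelIntensity_eq (measurable_diskKernel_diag α),
    ← map_diskMeasure]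
  simp only [kernelIntensity, diskKernel]
  exact map_withDensity_comp (g := (Subtype.val : Disk → ℂ))
    (q := fun z => ENNReal.ofReal
      (((α / Real.pi : ℝ) : ℂ) * (1 - z * conj z) ^ (-((α : ℂ) + 1))).re)
    measurableEmbedding_coe_disk.measurable (measurable_diskKernel_diag α).ennreal_ofReal

theorem IsDeterminantal.disk_parameter_unique {X : S → Measure Disk} {α β : ℝ} (hα : 0 < α)
    (hβ : 0 < β) (h : IsDeterminantal P X (diskMeasure α) (diskKernel α))
    (h' : IsDeterminantal P X (diskMeasure β) (diskKernel β)) : α = β := by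
  have := isFiniteMeasure_diskMeasure hα
  have := isFiniteMeasure_diskMeasure hβ
  have h1 := congrArg (Measure.map (Subtype.val : Disk → ℂ)) (h.kernelIntensity_eq h')
  rw [map_kernelIntensity_diskMeasure hα, map_kernelIntensity_diskMeasure hβ] at h1
  have h2 := eq_of_smul_geomMeasure (by positivity) (by positivity) h1
  rwa [div_left_inj' Real.pi_ne_zero] at h2

theorem disk_classification [IsProbabilityMeasure P] {μ : Measure Disk}
    [IsFiniteMeasureOnCompacts μ]
    (hμ : ∀ u : Circle, μ.map (diskRotation u) = μ) {φ : ι → ℂ → ℂ}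
    (hd : ∀ k, DifferentiableOn ℂ (φ k) (Metric.ball 0 1))
    (ho : IsOrthonormalL2 μ fun k (z : Disk) => φ k z)
    (hs : ∀ z : Disk, Summable fun k => ‖φ k z‖ ^ 2) {X : S → Measure Disk}
    (h : IsDeterminantal P X μ (seriesKernel fun k (z : Disk) => φ k z)) :
    (IsInvariantInLaw P X diskIsometries ↔
      ∃ α : ℝ, 0 < α ∧ IsDeterminantal P X (diskMeasure α) (diskKernel α)) ∧
    (∀ α : ℝ, 0 < α → IsDeterminantal P X (diskMeasure α) (diskKernel α) →
      ENat.card ι = ⊤ ∧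
      ∃ c : ℝ, 0 < c ∧ μ = ENNReal.ofReal c⁻¹ • diskMeasure α ∧
        ∀ z w : Disk, seriesKernel (fun k (z : Disk) => φ k z) z w = c * diskKernel α z w) := by
  refine ⟨⟨fun hinv => ?_, fun ⟨α, hα, hX⟩ => isInvariantInLaw_disk hα hX⟩, fun α hα hX => ?_⟩
  · obtain ⟨α, hα, hX, -⟩ := h.exists_eq_disk hμ hd ho hs hinv
    exact ⟨α, hα, hX⟩
  · obtain ⟨β, hβ, hX', hc⟩ := h.exists_eq_disk hμ hd ho hs (isInvariantInLaw_disk hα hX)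
    obtain rfl := hX.disk_parameter_unique hα hβ hX'
    have : LocallyCompactSpace Disk := Metric.isOpen_ball.locallyCompactSpace
    have hσ := sigmaFinite_of_isFiniteMeasureOnCompacts μ
    have := isFiniteMeasure_diskMeasure hα
    refine ⟨?_, hc⟩
    rw [h.card_eq (fun k => (hd k).continuousOn.domRestrict.measurable) hs ho hX
      (hasSum_diskBasis hα) (fun k => by unfold diskBasis; fun_prop) (isOrthonormalL2_diskBasis hα),
      ENat.card_eq_top_of_infinite]

end Classification

section SphereClassification

variable {S ι : Type*} [MeasurableSpace S] [Countable ι] [Nonempty ι] {P : Measure S}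

/-! ### The sphere -/

/-- The affine coordinate on the sphere (with value `0` at `∞`). -/
noncomputable def sphereCoord (z : Sphere2) : ℂ := OnePoint.elim z 0 id

theorem sphereCoord_coe (z : ℂ) : sphereCoord (z : Sphere2) = z := rfl

theorem measurable_sphereCoord : Measurable sphereCoord :=
  measurable_sphere (f := sphereCoord) measurable_id

theorem sphereMap_infty {a b : ℂ} (hb : b ≠ 0) :
    sphereMap a b OnePoint.infty = ((a / (-conj b) : ℂ) : Sphere2) := by
  classical
  have h1 : sphereMap a b OnePoint.infty =
    if b = 0 then OnePoint.infty else ((a / (-conj b) : ℂ) : Sphere2) := rfl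
  rw [h1, if_neg hb]

theorem exists_sphereMap_infty (z : ℂ) :
    ∃ g ∈ sphereIsometries, g OnePoint.infty = (z : Sphere2) := by
  have hz : 0 < 1 + ‖z‖ ^ 2 := by positivity
  set r : ℝ := (Real.sqrt (1 + ‖z‖ ^ 2))⁻¹ with hr
  have hr0 : 0 < r := by positivity
  have hr2 : r ^ 2 * (1 + ‖z‖ ^ 2) = 1 := by
    rw [hr, inv_pow, Real.sq_sqrt hz.le, inv_mul_cancel₀ hz.ne']
  have hrc : (r : ℂ) ≠ 0 := by exact_mod_cast hr0.ne'
  refine ⟨sphereMap (-(r * z)) r, ⟨_, _, ?_, rfl⟩, ?_⟩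
  · rw [norm_neg, norm_mul, Complex.norm_real, Real.norm_eq_abs, abs_of_pos hr0, mul_pow]
    linarith
  · rw [sphereMap_infty hrc, Complex.conj_ofReal]
    congr 1
    field_simp

/-- A `σ`-finite measure on the sphere which is invariant under the rotations has no mass at `∞`. -/
theorem measure_infty_eq_zero {ν : Measure Sphere2} [SigmaFinite ν]
    (h : ∀ g ∈ sphereIsometries, ν.map g = ν) : ν {OnePoint.infty} = 0 := by
  by_contra h0
  have hpos : ∀ z : ℂ, 0 < ν {(z : Sphere2)} := fun z => by
    obtain ⟨g, hg, hgz⟩ := exists_sphereMap_infty z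
    have hgm : Measurable g := by
      obtain ⟨a, b, -, rfl⟩ := hg
      exact measurable_sphereMap a b
    rw [← h g hg, Measure.map_apply hgm (measurableSet_singleton _)]
    exact (pos_iff_ne_zero.2 h0).trans_le (measure_mono (by simp [hgz]))
  -- By transitivity an atom at `∞` would give an atom at every point of `ℂ`, but a σ-finite measure
  -- has only countably many.
  have h1 := Measure.countable_meas_pos_of_disjoint_iUnion (μ := ν)
    (As := fun z : ℂ => {(z : Sphere2)}) (fun z => measurableSet_singleton _)
    fun z w hzw => by simpa using hzw
  refine not_countable_complex (h1.mono fun z _ => hpos z)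

theorem sphereCoord_sphereMap {a b : ℂ} {x : Sphere2} (hx : x ≠ OnePoint.infty)
    (hgx : sphereMap a b x ≠ OnePoint.infty) :
    sphereCoord (sphereMap a b x) = mobius 1 a b (sphereCoord x) := by
  classical
  induction x using OnePoint.rec with
  | infty => exact absurd rfl hx
  | coe z =>
    have h1 : sphereMap a b (z : Sphere2) = if -conj b * z + conj a = 0 then OnePoint.infty
      else (((a * z + b) / (-conj b * z + conj a) : ℂ) : Sphere2) := rfl
    have hz : -conj b * z + conj a ≠ 0 := fun h0 => hgx (by rw [h1, if_pos h0])
    rw [sphereMap_coe (by rwa [Complex.ofReal_one, one_mul]), sphereCoord_coe, sphereCoord_coe]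

theorem map_coe_map_sphereCoord (μ : Measure Sphere2) :
    ((μ.restrict {OnePoint.infty}ᶜ).map sphereCoord).map (fun z : ℂ => (z : Sphere2)) =
      μ.restrict {OnePoint.infty}ᶜ := by
  rw [Measure.map_map measurable_coe_sphere measurable_sphereCoord]
  conv_rhs => rw [← Measure.map_id (μ := μ.restrict {OnePoint.infty}ᶜ)]
  refine Measure.map_congr ?_
  filter_upwards [ae_restrict_mem (measurableSet_singleton _).compl] with x hx
  induction x using OnePoint.rec with
  | infty => exact absurd rfl hx
  | coe z => rfl

theorem map_rot_map_sphereCoord {μ : Measure Sphere2} {u : Circle}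
    (hμ : μ.map (OnePoint.map fun z : ℂ => u * z) = μ) :
    ((μ.restrict {OnePoint.infty}ᶜ).map sphereCoord).map (fun z : ℂ => u * z) =
      (μ.restrict {OnePoint.infty}ᶜ).map sphereCoord := by
  have hu : Measurable fun z : ℂ => (u : ℂ) * z := by fun_prop
  have hum : Measurable (OnePoint.map fun z : ℂ => (u : ℂ) * z) :=
    measurable_sphere (measurable_coe_sphere.comp hu)
  have hpre : (OnePoint.map fun z : ℂ => (u : ℂ) * z) ⁻¹' {OnePoint.infty}ᶜ =
      {OnePoint.infty}ᶜ := by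
    ext x
    induction x using OnePoint.rec with
    | infty => simp
    | coe z => simp
  have hNm : MeasurableSet ({OnePoint.infty}ᶜ : Set Sphere2) := (measurableSet_singleton _).compl
  rw [Measure.map_map hu measurable_sphereCoord]
  conv_rhs => rw [← hμ, Measure.restrict_map hum hNm, hpre,
    Measure.map_map measurable_sphereCoord hum]
  refine Measure.map_congr ?_
  filter_upwards [ae_restrict_mem hNm] with x hx
  induction x using OnePoint.rec with
  | infty => exact absurd rfl hx
  | coe z => rfl

theorem IsDeterminantal.exists_eq_sphere {μ : Measure Sphere2} [IsFiniteMeasure μ]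
    (hμ : ∀ u : Circle, μ.map (OnePoint.map fun z : ℂ => u * z) = μ) {φ : ι → Sphere2 → ℂ}
    (hd : ∀ k, Differentiable ℂ fun z : ℂ => φ k z) (ho : IsOrthonormalL2 μ φ)
    (hs : ∀ z, Summable fun k => ‖φ k z‖ ^ 2) {X : S → Measure Sphere2}
    (h : IsDeterminantal P X μ (seriesKernel φ)) (hinv : IsInvariantInLaw P X sphereIsometries) :
    ∃ α : ℕ, 1 ≤ α ∧ IsDeterminantal P X (sphereMeasure α) (sphereKernel α) ∧
      ∃ c : ℝ, 0 < c ∧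
        μ.restrict {OnePoint.infty}ᶜ = ENNReal.ofReal c⁻¹ • sphereMeasure α ∧
        ∀ z w : ℂ, seriesKernel φ z w = c * sphereKernel α z w := by
  have hGm : ∀ g ∈ sphereIsometries, Measurable g := by
    rintro g ⟨a, b, -, rfl⟩
    exact measurable_sphereMap a b
  have hm : ∀ k, Measurable (φ k) := fun k => measurable_sphere (hd k).continuous.measurable
  have hσ := sigmaFinite_kernelIntensity μ (seriesKernel φ)
  have hνG : ∀ g ∈ sphereIsometries,
      (kernelIntensity μ (seriesKernel φ)).map g = kernelIntensity μ (seriesKernel φ) :=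
    fun g hg => h.intensity_invariant (hGm g hg) (hinv g hg)
  -- The intensity has no atom at `∞`, although `μ` itself may have one.
  have hN := measure_infty_eq_zero hνG
  have hNm : MeasurableSet ({OnePoint.infty} : Set Sphere2) := measurableSet_singleton _
  have hchart : ∀ a b : ℂ, ‖a‖ ^ 2 + ‖b‖ ^ 2 = 1 →
      ∀ᵐ x ∂(kernelIntensity μ (seriesKernel φ)),
        sphereCoord (sphereMap a b x) = mobius 1 a b (sphereCoord x) := fun a b hab => by
    have hg : sphereMap a b ∈ sphereIsometries := ⟨a, b, hab, rfl⟩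
    have h2 : kernelIntensity μ (seriesKernel φ) (sphereMap a b ⁻¹' {OnePoint.infty}) = 0 := by
      rw [← Measure.map_apply (hGm _ hg) hNm, hνG _ hg, hN]
    filter_upwards [measure_eq_zero_iff_ae_notMem.1 hN, measure_eq_zero_iff_ae_notMem.1 h2]
      with x hx hgx
    exact sphereCoord_sphereMap hx hgx
  have hens := h.isInvariantEnsemble hinv hGm hm hs ho (ε := 1) (p := sphereCoord)
    measurable_sphereCoord hNm hN (fun z _ => by simp [geomDomain_one])
    (ψ := fun k (z : ℂ) => φ k z) (fun k x hx => by
      induction x using OnePoint.rec with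
      | infty => exact absurd rfl hx
      | coe z => rfl)
    (fun k => (hd k).continuous.measurable) (fun k => (hd k).differentiableOn) (fun z => hs z)
    (fun u => map_rot_map_sphereCoord (hμ u)) ⟨1, one_pos, measure_ne_top _ _⟩
    (fun u => by
      obtain ⟨a, ha, hau⟩ := exists_sq_eq_circle u
      have hab : ‖a‖ ^ 2 + ‖(0 : ℂ)‖ ^ 2 = 1 := by simp [ha]
      refine ⟨sphereMap a 0, ⟨a, 0, hab, rfl⟩, ?_⟩
      filter_upwards [hchart a 0 hab] with x hx
      rw [hx, mobius_zero_right ha, hau])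
    (fun w hw => by
      obtain ⟨a, b, hab, -, hT⟩ := geomTranslation_eq_mobius hw
      rw [one_mul] at hab
      refine ⟨sphereMap a b, ⟨a, b, hab, rfl⟩, ?_⟩
      filter_upwards [hchart a b hab] with x hx
      rw [hx, hT])
  obtain ⟨α, hα, c, hc, hK, hμα, -⟩ := hens.sphere
  have hKd : ∀ z w : ℂ, seriesKernel φ z w = c * sphereKernel α z w := hK
  have hμd : μ.restrict {OnePoint.infty}ᶜ = ENNReal.ofReal c⁻¹ • sphereMeasure α := by
    rw [← map_coe_map_sphereCoord, hμα, Measure.map_smul, sphereMeasure_eq]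
  have := isFiniteMeasure_sphereMeasure hα
  refine ⟨α, hα, ?_, c, hc, hμd, hKd⟩
  refine h.of_eq_smul (isPSDKernel_seriesKernel hs) (measurable_seriesKernel hm hs)
    hNm hN (isPSDKernel_sphereKernel hα) (measurable_sphereKernel hα) hc
    (fun z hz w hw => ?_) hμd
  induction z using OnePoint.rec with
  | infty => exact absurd rfl hz
  | coe z =>
    induction w using OnePoint.rec with
    | infty => exact absurd rfl hw
    | coe w => exact hKd z w

theorem sphere_classification [IsProbabilityMeasure P] {μ : Measure Sphere2} [IsFiniteMeasure μ]
    (hμ : ∀ u : Circle, μ.map (OnePoint.map fun z : ℂ => u * z) = μ) {φ : ι → Sphere2 → ℂ}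
    (hd : ∀ k, Differentiable ℂ fun z : ℂ => φ k z) (ho : IsOrthonormalL2 μ φ)
    (hs : ∀ z, Summable fun k => ‖φ k z‖ ^ 2) {X : S → Measure Sphere2}
    (h : IsDeterminantal P X μ (seriesKernel φ)) :
    (IsInvariantInLaw P X sphereIsometries ↔
      ∃ α : ℕ, 1 ≤ α ∧ IsDeterminantal P X (sphereMeasure α) (sphereKernel α)) ∧
    (∀ α : ℕ, 1 ≤ α → IsDeterminantal P X (sphereMeasure α) (sphereKernel α) →
      ENat.card ι = α ∧
      ∃ c : ℝ, 0 < c ∧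
        μ.restrict {OnePoint.infty}ᶜ = ENNReal.ofReal c⁻¹ • sphereMeasure α ∧
        ∀ z w : ℂ, seriesKernel φ z w = c * sphereKernel α z w) := by
  -- On the sphere the number of functions is finite and equals the parameter, so counting points
  -- also proves uniqueness of `α`.
  have hcard : ∀ α : ℕ, 1 ≤ α → IsDeterminantal P X (sphereMeasure α) (sphereKernel α) →
      ENat.card ι = α := fun α hα hX => by
    have := isFiniteMeasure_sphereMeasure hα
    rw [h.card_eq (fun k => measurable_sphere (hd k).continuous.measurable) hs ho hX
      (ψ := sphereBasis α) (fun z w => sum_sphereBasis hα z w ▸ hasSum_fintype _)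
      (measurable_sphereBasis α) (isOrthonormalL2_sphereBasis hα)]
    simp
  refine ⟨⟨fun hinv => ?_, fun ⟨α, hα, hX⟩ => isInvariantInLaw_sphere hα hX⟩, fun α hα hX => ?_⟩
  · obtain ⟨α, hα, hX, -⟩ := h.exists_eq_sphere hμ hd ho hs hinv
    exact ⟨α, hα, hX⟩
  · obtain ⟨β, hβ, hX', hc⟩ := h.exists_eq_sphere hμ hd ho hs (isInvariantInLaw_sphere hα hX)
    have hαβ : β = α := by exact_mod_cast (hcard β hβ hX').symm.trans (hcard α hα hX)
    subst hαβ
    exact ⟨hcard β hβ hX', hc⟩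

end SphereClassification

/-! ### The three families and their classification -/

theorem theorem3p1 {S ι : Type*} [MeasurableSpace S] (P : Measure S) [IsProbabilityMeasure P]
    [Countable ι] [Nonempty ι] :
    -- the three families: `K` is the projection kernel of the analytic functions in `L²`
    ((∀ α : ℝ, 0 < α →
        IsOrthonormalL2 (planeMeasure α) (planeBasis α) ∧
        (∀ z w : ℂ, HasSum (fun k => planeBasis α k z * conj (planeBasis α k w))
          (planeKernel α z w)) ∧
        (∀ f : ℂ → ℂ, Differentiable ℂ f → MemLp f 2 (planeMeasure α) →
          (∀ k, ∫ z, f z * conj (planeBasis α k z) ∂(planeMeasure α) = 0) → ∀ z, f z = 0)) ∧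
      (∀ α : ℕ, 1 ≤ α →
        IsOrthonormalL2 (sphereMeasure α) (sphereBasis α) ∧
        (∀ z w : Sphere2, ∑ k, sphereBasis α k z * conj (sphereBasis α k w) =
          sphereKernel α z w) ∧
        (∀ f : Sphere2 → ℂ, Differentiable ℂ (fun z : ℂ => f z) →
          MemLp f 2 (sphereMeasure α) →
          (∀ k, ∫ z, f z * conj (sphereBasis α k z) ∂(sphereMeasure α) = 0) →
          ∀ z : ℂ, f z = 0)) ∧
      (∀ α : ℝ, 0 < α →
        IsOrthonormalL2 (diskMeasure α) (diskBasis α) ∧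
        (∀ z w : Disk, HasSum (fun k => diskBasis α k z * conj (diskBasis α k w))
          (diskKernel α z w)) ∧
        (∀ f : ℂ → ℂ, DifferentiableOn ℂ f (Metric.ball 0 1) →
          MemLp (fun z : Disk => f z) 2 (diskMeasure α) →
          (∀ k, ∫ z : Disk, f z * conj (diskBasis α k z) ∂(diskMeasure α) = 0) →
          ∀ z : Disk, f z = 0))) ∧
    -- the classification
    -- the plane
    ((∀ (μ : Measure ℂ) [IsFiniteMeasureOnCompacts μ],
        (∀ u : Circle, μ.map (fun z : ℂ => u * z) = μ) →
        ∀ φ : ι → ℂ → ℂ, (∀ k, Differentiable ℂ (φ k)) → IsOrthonormalL2 μ φ →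
        (∀ z, Summable fun k => ‖φ k z‖ ^ 2) →
        ∀ X : S → Measure ℂ, IsDeterminantal P X μ (seriesKernel φ) →
          (IsInvariantInLaw P X planeIsometries ↔
            ∃ α : ℝ, 0 < α ∧ IsDeterminantal P X (planeMeasure α) (planeKernel α)) ∧
          (∀ α : ℝ, 0 < α → IsDeterminantal P X (planeMeasure α) (planeKernel α) →
            ENat.card ι = ⊤ ∧
            ∃ c : ℝ, 0 < c ∧ μ = ENNReal.ofReal c⁻¹ • planeMeasure α ∧
              ∀ z w, seriesKernel φ z w = c * planeKernel α z w)) ∧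
      -- the sphere
      (∀ (μ : Measure Sphere2) [IsFiniteMeasure μ],
        (∀ u : Circle, μ.map (OnePoint.map fun z : ℂ => u * z) = μ) →
        ∀ φ : ι → Sphere2 → ℂ, (∀ k, Differentiable ℂ fun z : ℂ => φ k z) →
        IsOrthonormalL2 μ φ →
        (∀ z, Summable fun k => ‖φ k z‖ ^ 2) →
        ∀ X : S → Measure Sphere2, IsDeterminantal P X μ (seriesKernel φ) →
          (IsInvariantInLaw P X sphereIsometries ↔
            ∃ α : ℕ, 1 ≤ α ∧ IsDeterminantal P X (sphereMeasure α) (sphereKernel α)) ∧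
          (∀ α : ℕ, 1 ≤ α → IsDeterminantal P X (sphereMeasure α) (sphereKernel α) →
            ENat.card ι = α ∧
            ∃ c : ℝ, 0 < c ∧
              μ.restrict {OnePoint.infty}ᶜ = ENNReal.ofReal c⁻¹ • sphereMeasure α ∧
              ∀ z w : ℂ, seriesKernel φ z w = c * sphereKernel α z w)) ∧
      -- the disk
      (∀ (μ : Measure Disk) [IsFiniteMeasureOnCompacts μ],
        (∀ u : Circle, μ.map (diskRotation u) = μ) →
        ∀ φ : ι → ℂ → ℂ, (∀ k, DifferentiableOn ℂ (φ k) (Metric.ball 0 1)) →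
        IsOrthonormalL2 μ (fun k (z : Disk) => φ k z) →
        (∀ z : Disk, Summable fun k => ‖φ k z‖ ^ 2) →
        ∀ X : S → Measure Disk,
          IsDeterminantal P X μ (seriesKernel fun k (z : Disk) => φ k z) →
          (IsInvariantInLaw P X diskIsometries ↔
            ∃ α : ℝ, 0 < α ∧ IsDeterminantal P X (diskMeasure α) (diskKernel α)) ∧
          (∀ α : ℝ, 0 < α → IsDeterminantal P X (diskMeasure α) (diskKernel α) →
            ENat.card ι = ⊤ ∧
            ∃ c : ℝ, 0 < c ∧ μ = ENNReal.ofReal c⁻¹ • diskMeasure α ∧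
              ∀ z w : Disk, seriesKernel (fun k (z : Disk) => φ k z) z w =
                c * diskKernel α z w))) := by
  refine ⟨⟨fun α hα => ⟨isOrthonormalL2_planeBasis hα, hasSum_planeBasis hα,
      fun f hf hf2 h => eq_zero_of_orthogonal_planeBasis hα hf hf2 h⟩,
    fun α hα => ⟨isOrthonormalL2_sphereBasis hα, sum_sphereBasis hα,
      fun f hf hf2 h => eq_zero_of_orthogonal_sphereBasis hα hf hf2 h⟩,
    fun α hα => ⟨isOrthonormalL2_diskBasis hα, hasSum_diskBasis hα,
      fun f hf hf2 h => eq_zero_of_orthogonal_diskBasis hα hf hf2 h⟩⟩, ?_, ?_, ?_⟩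
  · intro μ _ hμ φ hd ho hs X h
    exact plane_classification hμ hd ho hs h
  · intro μ _ hμ φ hd ho hs X h
    exact sphere_classification hμ hd ho hs h
  · intro μ _ hμ φ hd ho hs X h
    exact disk_classification hμ hd ho hs h
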